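/- Let $k$ be a field, $Q$ a quiver (possibly infinite), $kQ$ its path algebra (in a product $pq$ of paths, $q$ is traversed first), $\rho$ a set of paths of length $\ge 2$ in $Q$, and $\Lambda=kQ/(\rho)$, where $(\rho)$ is the two-sided ideal generated by $\rho$. Assume that $\Lambda$ is a string algebra, that is: (a) every vertex of $Q$ is the head of at most two arrows and the tail of at most two arrows; (b) for every arrow $y$ there is at most one path $xy$ of length $2$ with $xy\notin\rho$ and at most one path $yz$ of length $2$ with $yz\notin\rho$. No finiteness condition is imposed, so $\Lambda$ need not have a one. A left $\Lambda$-module $M$ (a $k$-vector space with a $k$-linear action of $\Lambda$) is unital if $\Lambda M=M$; it is finitely generated if $M=\Lambda m_1+\dots+\Lambda m_n$ for some $m_1,\dots,m_n\in M$, and finitely controlled if for every $a\in\Lambda$ the set $aM$ is contained in a finitely generated submodule of $M$ (for example, if $M$ is finitely generated). A letter is an arrow $x$ of $Q$ or a formal inverse $x^{-1}$; the head (tail) of $x^{-1}$ is the tail (head) of $x$, and $(x^{-1})^{-1}=x$. Let $I$ be one of $\{0,\dots,n\}$ $(n\ge 0)$, $\mathbb N$, $-\mathbb N$, $\mathbb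 Z$. An $I$-word $C$ consists of a letter $C_i$ for each $i\in I$ with $i-1\in I$, such that for consecutive letters the tail of $C_i$ is the head of $C_{i+1}$ and $C_i^{-1}\ne C_{i+1}$, and such that no $x_1\cdots x_m\in\rho$, nor its inverse $x_m^{-1}\cdots x_1^{-1}$, occurs as a sequence of consecutive letters in $C$; for $I=\{0\}$ there is instead a trivial word for each vertex $v$ of $Q$. For $i\in I$ let $v_i(C)$ be the tail of $C_i$ or the head of $C_{i+1}$, or $v$ for the trivial word at $v$. The string module $M(C)$ is the $\Lambda$-module with $k$-basis $(b_i)_{i\in I}$ in which the trivial path $e_v$ acts by $e_vb_i=b_i$ if $v_i(C)=v$ and $e_vb_i=0$ otherwise, and an arrow $x$ acts by $xb_i=b_{i-1}$ if $i-1\in I$ and $C_i=x$, by $xb_i=b_{i+1}$ if $i+1\in I$ and $C_{i+1}=x^{-1}$, and by $xb_i=0$ otherwise. A $\mathbb Z$-word $C$ is periodic if there is an $n>0$ with $C_{i+n}=C_i$ for all $i$; the least such $n$ is its period. Then $M(C)$ is a $\Lambda$-$k[T,T^{-1}]$-bimodule with $T$ acting by $b_i\mapsto b_{i-n}$, and the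 band modules are the modules $M(C)\otimes_{k[T,T^{-1}]}V$ with $C$ a periodic $\mathbb Z$-word and $V$ a finite-dimensional indecomposable $k[T,T^{-1}]$-module. Then every finitely controlled unital $\Lambda$-module is isomorphic to a direct sum (of a possibly infinite family) of string modules and band modules. -/

import Mathlib

open scoped TensorProduct LaurentPolynomial DirectSum

universe u v w x y

noncomputable section

namespace StringAlg

/-! ### The path algebra of a quiver -/

/-- A path of the quiver `V`, of any length, together with its tail and its head. -/
@[ext] structure QPath (V : Type v) [Quiver.{w} V] where
  tail : V
  head : V
  path : Quiver.Path tail head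

/-- The vector space underlying the path algebra: it has the paths as a basis. -/
def PathAlgebra (k : Type u) [Field k] (V : Type v) [Quiver.{w} V] : Type (max u v w) :=
  QPath V →₀ k

section PathAlgebra

variable (k : Type u) [Field k] (V : Type v) [Quiver.{w} V]

instance : AddCommGroup (PathAlgebra k V) := inferInstanceAs (AddCommGroup (QPath V →₀ k))
instance : Module k (PathAlgebra k V) := inferInstanceAs (Module k (QPath V →₀ k))

variable {V}

/-- The basis element of the path algebra given by a path. -/
def ofPath (p : QPath V) : PathAlgebra k V := Finsupp.single p (1 : k)

variable {k} in
theorem PathAlgebra.hom_ext {N : Type x} [AddCommGroup N] [Module k N]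
    {f g : PathAlgebra k V →ₗ[k] N} (h : ∀ p, f (ofPath k p) = g (ofPath k p)) : f = g :=
  Finsupp.lhom_ext' fun p => LinearMap.ext_ring (h p)

/-- The linear map out of the path algebra with given values on paths. -/
def PathAlgebra.extend {N : Type x} [AddCommGroup N] [Module k N] (F : QPath V → N) :
    PathAlgebra k V →ₗ[k] N :=
  (Finsupp.linearCombination k F : (QPath V →₀ k) →ₗ[k] N)

@[simp] theorem PathAlgebra.extend_ofPath {N : Type x} [AddCommGroup N] [Module k N]
    (F : QPath V → N) (p : QPath V) : PathAlgebra.extend k F (ofPath k p) = F p :=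
  (Finsupp.linearCombination_single k (1 : k) p).trans (one_smul k _)

open Classical in
/-- The product `p q` of two paths: first traverse `q`, then `p`. It is the concatenated path if
the tail of `p` is the head of `q`, and zero otherwise. -/
def pathMul (p q : QPath V) : PathAlgebra k V :=
  if h : q.head = p.tail then ofPath k ⟨q.tail, p.head, q.path.comp (p.path.cast h.symm rfl)⟩
  else 0

theorem pathMul_comp {a b c : V} (q : Quiver.Path a b) (p : Quiver.Path b c) :
    pathMul k ⟨b, c, p⟩ ⟨a, b, q⟩ = ofPath k ⟨a, c, q.comp p⟩ := by
  simp [pathMul]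

theorem pathMul_ne {p q : QPath V} (h : q.head ≠ p.tail) : pathMul k p q = 0 := by
  simp [pathMul, h]

/-- The multiplication of the path algebra as a bilinear map. -/
def mulBilin : PathAlgebra k V →ₗ[k] PathAlgebra k V →ₗ[k] PathAlgebra k V :=
  PathAlgebra.extend k fun p => PathAlgebra.extend k fun q => pathMul k p q

instance : Mul (PathAlgebra k V) := ⟨fun f g => mulBilin k f g⟩

theorem mul_eq_mulBilin (f g : PathAlgebra k V) : f * g = mulBilin k f g := rfl

theorem ofPath_mul_ofPath (p q : QPath V) : ofPath k p * ofPath k q = pathMul k p q := by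
  simp [mul_eq_mulBilin, mulBilin]

theorem ofPath_mul_assoc (p q r : QPath V) :
    ofPath k p * ofPath k q * ofPath k r = ofPath k p * (ofPath k q * ofPath k r) := by
  obtain ⟨c, d, p⟩ := p
  obtain ⟨b, c', q⟩ := q
  obtain ⟨a, b', r⟩ := r
  have z1 : ∀ f : PathAlgebra k V, 0 * f = 0 := fun f => by simp [mul_eq_mulBilin]
  have z2 : ∀ f : PathAlgebra k V, f * 0 = 0 := fun f => by simp [mul_eq_mulBilin]
  by_cases h1 : c' = c
  · subst h1
    by_cases h2 : b' = b
    · subst h2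
      simp only [ofPath_mul_ofPath, pathMul_comp, Quiver.Path.comp_assoc]
    · simp only [ofPath_mul_ofPath, pathMul_comp]
      rw [pathMul_ne k h2, pathMul_ne k h2, z2]
  · by_cases h2 : b' = b
    · subst h2
      simp only [ofPath_mul_ofPath, pathMul_comp]
      rw [pathMul_ne k h1, pathMul_ne k h1, z1]
    · simp only [ofPath_mul_ofPath]
      rw [pathMul_ne k h1, pathMul_ne k h2, z1, z2]

instance : NonUnitalRing (PathAlgebra k V) where
  left_distrib f g h := by simp [mul_eq_mulBilin]
  right_distrib f g h := by simp [mul_eq_mulBilin]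
  zero_mul f := by simp [mul_eq_mulBilin]
  mul_zero f := by simp [mul_eq_mulBilin]
  mul_assoc f g h := by
    let L : PathAlgebra k V →ₗ[k] PathAlgebra k V →ₗ[k] PathAlgebra k V →ₗ[k] PathAlgebra k V :=
      (mulBilin k).compr₂ (mulBilin k)
    let R : PathAlgebra k V →ₗ[k] PathAlgebra k V →ₗ[k] PathAlgebra k V →ₗ[k] PathAlgebra k V :=
      LinearMap.mk₂ k (fun f g => (mulBilin k f).comp (mulBilin k g))
        (by intros; ext1; simp) (by intros; ext1; simp)
        (by intros; ext1; simp) (by intros; ext1; simp)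
    have : L = R := PathAlgebra.hom_ext fun p => PathAlgebra.hom_ext fun q =>
      PathAlgebra.hom_ext fun r => ofPath_mul_assoc k p q r
    exact congrArg (fun F => F f g h) this

instance : IsScalarTower k (PathAlgebra k V) (PathAlgebra k V) :=
  ⟨fun c f g => by simp [mul_eq_mulBilin]⟩

instance : SMulCommClass k (PathAlgebra k V) (PathAlgebra k V) :=
  ⟨fun c f g => by simp [mul_eq_mulBilin]⟩

end PathAlgebra

/-! ### The quotient by the ideal generated by a set of paths -/

section Quotient

variable (k : Type u) [Field k] {V : Type v} [Quiver.{w} V]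

/-- A two-sided ideal of the path algebra, viewed as a `k`-algebra. -/
def IsIdeal (I : Submodule k (PathAlgebra k V)) : Prop :=
  ∀ a, ∀ f ∈ I, a * f ∈ I ∧ f * a ∈ I

/-- The ideal `(ρ)` generated by a set `ρ` of paths. -/
def relIdeal (ρ : Set (QPath V)) : Submodule k (PathAlgebra k V) :=
  sInf {I | IsIdeal k I ∧ ∀ r ∈ ρ, ofPath k r ∈ I}

theorem relIdeal_isIdeal (ρ : Set (QPath V)) : IsIdeal k (relIdeal k ρ) := by
  intro a f hf
  simp only [relIdeal, Submodule.mem_sInf] at hf ⊢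
  exact ⟨fun I hI => (hI.1 a f (hf I hI)).1, fun I hI => (hI.1 a f (hf I hI)).2⟩

/-- The algebra `Λ = kQ/(ρ)`. -/
def QuotAlgebra (ρ : Set (QPath V)) : Type (max u v w) := PathAlgebra k V ⧸ relIdeal k ρ

variable (ρ : Set (QPath V))

instance : AddCommGroup (QuotAlgebra k ρ) :=
  inferInstanceAs (AddCommGroup (PathAlgebra k V ⧸ relIdeal k ρ))
instance : Module k (QuotAlgebra k ρ) :=
  inferInstanceAs (Module k (PathAlgebra k V ⧸ relIdeal k ρ))

/-- The projection `kQ → Λ`. -/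
def proj : PathAlgebra k V →ₗ[k] QuotAlgebra k ρ := (relIdeal k ρ).mkQ

theorem proj_surjective : Function.Surjective (proj k ρ) := (relIdeal k ρ).mkQ_surjective

/-- The multiplication of `Λ`, induced by that of the path algebra. -/
instance : Mul (QuotAlgebra k ρ) :=
  ⟨Quotient.map₂ (· * ·) fun a b hab c d hcd => by
    have hab : a - b ∈ relIdeal k ρ := (Submodule.quotientRel_def _).1 hab
    have hcd : c - d ∈ relIdeal k ρ := (Submodule.quotientRel_def _).1 hcd
    refine (Submodule.quotientRel_def _).2 ?_
    have h : a * c - b * d = (a - b) * c + b * (c - d) := by noncomm_ring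
    rw [h]
    exact add_mem (relIdeal_isIdeal k ρ c _ hab).2 (relIdeal_isIdeal k ρ b _ hcd).1⟩

theorem proj_mul (f g : PathAlgebra k V) : proj k ρ (f * g) = proj k ρ f * proj k ρ g := rfl

instance : NonUnitalRing (QuotAlgebra k ρ) where
  left_distrib a b c := by
    obtain ⟨a, rfl⟩ := proj_surjective k ρ a
    obtain ⟨b, rfl⟩ := proj_surjective k ρ b
    obtain ⟨c, rfl⟩ := proj_surjective k ρ c
    simp only [← map_add, ← proj_mul, mul_add]
  right_distrib a b c := by
    obtain ⟨a, rfl⟩ := proj_surjective k ρ a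
    obtain ⟨b, rfl⟩ := proj_surjective k ρ b
    obtain ⟨c, rfl⟩ := proj_surjective k ρ c
    simp only [← map_add, ← proj_mul, add_mul]
  zero_mul a := by
    obtain ⟨a, rfl⟩ := proj_surjective k ρ a
    rw [← map_zero (proj k ρ), ← proj_mul, zero_mul]
  mul_zero a := by
    obtain ⟨a, rfl⟩ := proj_surjective k ρ a
    rw [← map_zero (proj k ρ), ← proj_mul, mul_zero]
  mul_assoc a b c := by
    obtain ⟨a, rfl⟩ := proj_surjective k ρ a
    obtain ⟨b, rfl⟩ := proj_surjective k ρ b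
    obtain ⟨c, rfl⟩ := proj_surjective k ρ c
    simp only [← proj_mul, mul_assoc]

instance : IsScalarTower k (QuotAlgebra k ρ) (QuotAlgebra k ρ) :=
  ⟨fun c a b => by
    obtain ⟨a, rfl⟩ := proj_surjective k ρ a
    obtain ⟨b, rfl⟩ := proj_surjective k ρ b
    simp only [smul_eq_mul, ← map_smul, ← proj_mul, smul_mul_assoc]⟩

instance : SMulCommClass k (QuotAlgebra k ρ) (QuotAlgebra k ρ) :=
  ⟨fun c a b => by
    obtain ⟨a, rfl⟩ := proj_surjective k ρ a
    obtain ⟨b, rfl⟩ := proj_surjective k ρ b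
    simp only [smul_eq_mul, ← map_smul, ← proj_mul, mul_smul_comm]⟩

end Quotient

/-! ### String algebras -/

/-- The conditions on `ρ` under which `kQ/(ρ)` is a string algebra. In the last two conditions the
path written `x y` is the one that traverses `y` first. -/
structure IsStringAlgebra {V : Type v} [Quiver.{w} V] (ρ : Set (QPath V)) : Prop where
  two_le_length : ∀ r ∈ ρ, 2 ≤ r.path.length
  head_le_two : ∀ v : V, {x : Quiver.Total V | x.right = v}.encard ≤ 2
  tail_le_two : ∀ v : V, {x : Quiver.Total V | x.left = v}.encard ≤ 2
  /-- for each arrow `y` there is at most one path `x y` of length two not in `ρ` -/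
  left_unique : ∀ {a b : V} (y : a ⟶ b),
    {x : Σ c : V, (b ⟶ c) | (⟨a, x.1, y.toPath.cons x.2⟩ : QPath V) ∉ ρ}.Subsingleton
  /-- for each arrow `y` there is at most one path `y z` of length two not in `ρ` -/
  right_unique : ∀ {b c : V} (y : b ⟶ c),
    {z : Σ a : V, (a ⟶ b) | (⟨z.1, c, z.2.toPath.cons y⟩ : QPath V) ∉ ρ}.Subsingleton

/-! ### Modules over a possibly non-unital algebra -/

/-- A left module over a `k`-algebra `A` that need not have a one: a vector space on which `A` acts
by endomorphisms, linearly and multiplicatively. -/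
structure AlgModule (k : Type u) [Field k] (A : Type v) [NonUnitalRing A] [Module k A] where
  carrier : Type x
  [addCommGroup : AddCommGroup carrier]
  [module : Module k carrier]
  act : A →ₙₐ[k] Module.End k carrier

attribute [instance] AlgModule.addCommGroup AlgModule.module

namespace AlgModule

variable {k : Type u} [Field k] {A : Type v} [NonUnitalRing A] [Module k A]

/-- `M` is unital if `A M = M`, that is, every element is a finite sum of elements `a m`. -/
def IsUnital (M : AlgModule.{u, v, x} k A) : Prop :=
  Submodule.span k {m : M.carrier | ∃ a m', m = M.act a m'} = ⊤

/-- The subspace `A m₁ + ⋯ + A mₙ` for a set `s = {m₁, …, mₙ}`. -/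
def generated (M : AlgModule.{u, v, x} k A) (s : Set M.carrier) : Submodule k M.carrier :=
  Submodule.span k {m | ∃ a, ∃ m' ∈ s, m = M.act a m'}

/-- `N` is a finitely generated submodule of `M`: it is `A m₁ + ⋯ + A mₙ` for finitely many
elements `m₁, …, mₙ` of `N`. Such an `N` is stable under `A`. -/
def IsFGSubmodule (M : AlgModule.{u, v, x} k A) (N : Submodule k M.carrier) : Prop :=
  ∃ s : Finset M.carrier, (∀ m ∈ s, m ∈ N) ∧ N = M.generated s

/-- `M` is a finitely generated module. -/
def IsFinitelyGenerated (M : AlgModule.{u, v, x} k A) : Prop := M.IsFGSubmodule ⊤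

/-- `M` is finitely controlled: for each `a`, the set `a M` lies in a finitely generated
submodule. -/
def IsFinitelyControlled (M : AlgModule.{u, v, x} k A) : Prop :=
  ∀ a : A, ∃ N, M.IsFGSubmodule N ∧ ∀ m, M.act a m ∈ N

theorem IsFinitelyGenerated.isFinitelyControlled {M : AlgModule.{u, v, x} k A}
    (h : M.IsFinitelyGenerated) : M.IsFinitelyControlled :=
  fun _ => ⟨⊤, h, fun _ => trivial⟩

/-- Two modules are isomorphic. -/
def Isomorphic (M : AlgModule.{u, v, x} k A) (N : AlgModule.{u, v, y} k A) : Prop :=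
  ∃ f : M.carrier ≃ₗ[k] N.carrier, ∀ a m, f (M.act a m) = N.act a (f m)

/-- The direct sum of a family of modules. -/
def directSum {J : Type y} (N : J → AlgModule.{u, v, x} k A) :
    AlgModule.{u, v, max x y} k A where
  carrier := ⨁ j, (N j).carrier
  act :=
    { toFun := fun a => DirectSum.lmap fun j => (N j).act a
      map_smul' := fun c a => by
        refine LinearMap.ext fun m => DFinsupp.ext fun j => ?_
        exact congrArg (fun F : Module.End k (N j).carrier => F (m j)) (map_smul (N j).act c a)
      map_zero' := by
        refine LinearMap.ext fun m => DFinsupp.ext fun j => ?_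
        simp
      map_add' := fun a b => by
        refine LinearMap.ext fun m => DFinsupp.ext fun j => ?_
        simp
      map_mul' := fun a b => by
        refine LinearMap.ext fun m => DFinsupp.ext fun j => ?_
        simp }

end AlgModule

/-! ### Modules over `kQ/(ρ)` from representations of the quiver -/

/-- Operators on a vector space `M` for the vertices and the arrows of the quiver, such that the
vertices act as orthogonal idempotents and an arrow maps from its tail to its head. -/
structure QuiverOps (k : Type u) [Field k] (V : Type v) [Quiver.{w} V]
    (M : Type x) [AddCommGroup M] [Module k M] where
  vert : V → Module.End k M
  arrow : Quiver.Total V → Module.End k M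
  vert_idem : ∀ v, vert v * vert v = vert v
  vert_orth : ∀ v w, v ≠ w → vert v * vert w = 0
  head_arrow : ∀ x, vert x.right * arrow x = arrow x
  arrow_tail : ∀ x, arrow x * vert x.left = arrow x

namespace QuiverOps

variable {k : Type u} [Field k] {V : Type v} [Quiver.{w} V]
  {M : Type x} [AddCommGroup M] [Module k M] (R : QuiverOps k V M)

/-- The operator of a path: that of the vertex for a trivial path, and the composition of the
operators of the arrows otherwise. -/
def path {a : V} : ∀ {b : V}, Quiver.Path a b → Module.End k M
  | _, .nil => R.vert a
  | _, .cons p x => R.arrow ⟨_, _, x⟩ * path p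

theorem head_path {a b : V} (p : Quiver.Path a b) : R.vert b * R.path p = R.path p := by
  cases p with
  | nil => exact R.vert_idem a
  | cons p x => rw [path, ← mul_assoc, R.head_arrow ⟨_, _, x⟩]

theorem path_tail {a b : V} (p : Quiver.Path a b) : R.path p * R.vert a = R.path p := by
  induction p with
  | nil => exact R.vert_idem a
  | cons p x ih => rw [path, mul_assoc, ih]

theorem path_comp {a b c : V} (q : Quiver.Path a b) (p : Quiver.Path b c) :
    R.path (q.comp p) = R.path p * R.path q := by
  induction p with
  | nil => exact (R.head_path q).symm
  | cons p x ih => rw [Quiver.Path.comp_cons, path, path, ih, mul_assoc]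

/-- The action of the path algebra, as a linear map. -/
def pathAlgLin : PathAlgebra k V →ₗ[k] Module.End k M :=
  PathAlgebra.extend k fun p => R.path p.path

theorem pathAlgLin_mul (f g : PathAlgebra k V) :
    R.pathAlgLin (f * g) = R.pathAlgLin f * R.pathAlgLin g := by
  have : (mulBilin k (V := V)).compr₂ R.pathAlgLin =
      (LinearMap.mul k (Module.End k M)).compl₁₂ R.pathAlgLin R.pathAlgLin := by
    refine PathAlgebra.hom_ext fun p => PathAlgebra.hom_ext fun q => ?_
    change R.pathAlgLin (ofPath k p * ofPath k q) =
      R.pathAlgLin (ofPath k p) * R.pathAlgLin (ofPath k q)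
    obtain ⟨b, c, p⟩ := p
    obtain ⟨a, b', q⟩ := q
    rw [ofPath_mul_ofPath]
    by_cases h : b' = b
    · subst h
      simp [pathMul_comp, pathAlgLin, path_comp]
    · rw [pathMul_ne k h]
      simp only [pathAlgLin, PathAlgebra.extend_ofPath, map_zero]
      rw [← R.path_tail p, ← R.head_path q, mul_assoc, ← mul_assoc (R.vert b),
        R.vert_orth b b' (Ne.symm h), zero_mul, mul_zero]
  exact congrArg (fun F => F f g) this

variable (ρ : Set (QPath V))

theorem relIdeal_le_ker (h : ∀ r ∈ ρ, R.path r.path = 0) :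
    relIdeal k ρ ≤ LinearMap.ker R.pathAlgLin := by
  refine sInf_le ⟨fun a f hf => ?_, fun r hr => ?_⟩
  · rw [LinearMap.mem_ker] at hf
    simp [LinearMap.mem_ker, pathAlgLin_mul, hf]
  · simp [LinearMap.mem_ker, pathAlgLin, h r hr]

/-- The action of `kQ/(ρ)` on `M` when the paths in `ρ` act as zero. -/
def act (h : ∀ r ∈ ρ, R.path r.path = 0) : QuotAlgebra k ρ →ₙₐ[k] Module.End k M :=
  let L : QuotAlgebra k ρ →ₗ[k] Module.End k M :=
    (relIdeal k ρ).liftQ R.pathAlgLin (R.relIdeal_le_ker ρ h)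
  { L with
    map_zero' := L.map_zero
    map_mul' := fun a b => by
      obtain ⟨a, rfl⟩ := proj_surjective k ρ a
      obtain ⟨b, rfl⟩ := proj_surjective k ρ b
      exact R.pathAlgLin_mul a b }

theorem act_proj (h : ∀ r ∈ ρ, R.path r.path = 0) (f : PathAlgebra k V) :
    R.act ρ h (proj k ρ f) = R.pathAlgLin f := rfl

end QuiverOps

/-! ### Words -/

/-- A letter: an arrow or the formal inverse of an arrow. -/
inductive Letter (V : Type v) [Quiver.{w} V] where
  | direct (x : Quiver.Total V)
  | inverse (x : Quiver.Total V)

namespace Letter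

variable {V : Type v} [Quiver.{w} V]

def inv : Letter V → Letter V
  | direct x => inverse x
  | inverse x => direct x

def head : Letter V → V
  | direct x => x.right
  | inverse x => x.left

def tail : Letter V → V
  | direct x => x.left
  | inverse x => x.right

end Letter

/-- The arrows `x₁, …, xₘ` of the path `x₁ ⋯ xₘ`; the arrow traversed last comes first. -/
def arrowList {V : Type v} [Quiver.{w} V] {a : V} :
    ∀ {b : V}, Quiver.Path a b → List (Quiver.Total V)
  | _, .nil => []
  | _, .cons p x => ⟨_, _, x⟩ :: arrowList p

/-- The possible index sets of words. -/
inductive Shape where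
  | fin (n : ℕ)
  | nat
  | negNat
  | int

/-- The index set: `{0, …, n}`, or `ℕ`, or `-ℕ`, or `ℤ`. -/
def Shape.idx : Shape → Set ℤ
  | fin n => {i | 0 ≤ i ∧ i ≤ n}
  | nat => {i | 0 ≤ i}
  | negNat => {i | i ≤ 0}
  | int => Set.univ

/-- The list `L` occurs as a sequence of consecutive letters of the sequence `C`. -/
def Occurs {V : Type v} [Quiver.{w} V] (C : ℤ → Option (Letter V)) (L : List (Letter V)) : Prop :=
  ∃ j : ℤ, ∀ (t : ℕ) (ht : t < L.length), C (j + t) = some L[t]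

/-- An `I`-word, where `I` is the index set of `shape`. There is a letter `C i` for all `i` with
`i ∈ I` and `i - 1 ∈ I`, and a vertex for all `i ∈ I`, which is the tail of `C i` and the head
of `C (i + 1)` if there are such letters. Thus the vertices are determined by the letters, unless
`I = {0}`: in that case there are no letters and the word is the trivial word at its only vertex. -/
structure Word {V : Type v} [Quiver.{w} V] (ρ : Set (QPath V)) where
  shape : Shape
  letter : ℤ → Option (Letter V)
  vertex : ℤ → Option V
  letter_isSome : ∀ i, (letter i).isSome ↔ i ∈ shape.idx ∧ i - 1 ∈ shape.idx
  vertex_isSome : ∀ i, (vertex i).isSome ↔ i ∈ shape.idx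
  head_letter : ∀ i l, letter i = some l → vertex (i - 1) = some l.head
  tail_letter : ∀ i l, letter i = some l → vertex i = some l.tail
  reduced : ∀ i l l', letter i = some l → letter (i + 1) = some l' → l.inv ≠ l'
  /-- no zero relation occurs in the word -/
  no_rel : ∀ r ∈ ρ, ¬ Occurs letter ((arrowList r.path).map .direct)
  /-- no inverse of a zero relation occurs in the word -/
  no_rel_inv : ∀ r ∈ ρ, ¬ Occurs letter ((arrowList r.path).reverse.map .inverse)

/-! ### String modules -/

namespace Word

variable {V : Type v} [Quiver.{w} V] {ρ : Set (QPath V)} (C : Word ρ)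
variable (k : Type u) [Field k]

/-- The vector space with basis the symbols `b i`, for `i` in the index set. -/
abbrev Space : Type u := C.shape.idx →₀ k

open Classical in
/-- The basis vector `b i`, read as zero if `i` is not in the index set. -/
def b (i : ℤ) : C.Space k := if h : i ∈ C.shape.idx then Finsupp.single ⟨i, h⟩ 1 else 0

variable {k} in
theorem hom_ext {N : Type x} [AddCommGroup N] [Module k N] {f g : C.Space k →ₗ[k] N}
    (h : ∀ i ∈ C.shape.idx, f (C.b k i) = g (C.b k i)) : f = g := by
  refine Finsupp.lhom_ext' fun i => LinearMap.ext_ring ?_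
  simpa [b, i.2] using h i i.2

/-- The linear map with given values on the basis vectors `b i`. -/
def extend {N : Type x} [AddCommGroup N] [Module k N] (F : ℤ → N) : C.Space k →ₗ[k] N :=
  Finsupp.linearCombination k fun i : C.shape.idx => F i

theorem extend_b {N : Type x} [AddCommGroup N] [Module k N] (F : ℤ → N) {i : ℤ}
    (hi : i ∈ C.shape.idx) : C.extend k F (C.b k i) = F i := by
  simp [extend, b, hi]

open Classical in
/-- The action of the trivial path at `v`. -/
def vertOp (v : V) : Module.End k (C.Space k) :=
  C.extend k fun i => if C.vertex i = some v then C.b k i else 0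

open Classical in
/-- The action of an arrow `x`. -/
def arrowOp (x : Quiver.Total V) : Module.End k (C.Space k) :=
  C.extend k fun i =>
    if C.letter i = some (.direct x) then C.b k (i - 1)
    else if C.letter (i + 1) = some (.inverse x) then C.b k (i + 1)
    else 0

variable {C} in
theorem mem_of_letter {i : ℤ} {l : Letter V} (h : C.letter i = some l) :
    i ∈ C.shape.idx ∧ i - 1 ∈ C.shape.idx := (C.letter_isSome i).1 (by simp [h])

open Classical in
theorem vertOp_b (v : V) (i : ℤ) :
    C.vertOp k v (C.b k i) = if C.vertex i = some v then C.b k i else 0 := by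
  by_cases hi : i ∈ C.shape.idx
  · exact C.extend_b k _ hi
  · simp [b, hi]

open Classical in
theorem arrowOp_b (x : Quiver.Total V) (i : ℤ) :
    C.arrowOp k x (C.b k i) =
      if C.letter i = some (.direct x) then C.b k (i - 1)
      else if C.letter (i + 1) = some (.inverse x) then C.b k (i + 1)
      else 0 := by
  by_cases hi : i ∈ C.shape.idx
  · exact C.extend_b k _ hi
  · rw [if_neg fun h => hi (mem_of_letter h).1, if_neg fun h => hi ?_]
    · simp [b, hi]
    · simpa using (mem_of_letter h).2

/-- The operators of vertices and arrows on the string module. -/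
def ops : QuiverOps k V (C.Space k) where
  vert := C.vertOp k
  arrow := C.arrowOp k
  vert_idem v := C.hom_ext fun i _ => by
    by_cases h : C.vertex i = some v <;> simp [vertOp_b, h]
  vert_orth v w hvw := C.hom_ext fun i _ => by
    by_cases h : C.vertex i = some w
    · simp [vertOp_b, h, hvw.symm]
    · simp [vertOp_b, h]
  head_arrow x := C.hom_ext fun i _ => by
    rw [Module.End.mul_apply, arrowOp_b]
    split_ifs with h1 h2
    · rw [vertOp_b]
      exact if_pos (C.head_letter _ _ h1)
    · rw [vertOp_b]
      exact if_pos (C.tail_letter _ _ h2)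
    · simp
  arrow_tail x := C.hom_ext fun i _ => by
    rw [Module.End.mul_apply, vertOp_b]
    split_ifs with h
    · rfl
    · rw [map_zero, arrowOp_b, if_neg fun h1 => h (C.tail_letter _ _ h1), if_neg fun h2 => h ?_]
      have := C.head_letter _ _ h2
      rwa [add_sub_cancel_right] at this

theorem length_arrowList {a c : V} (p : Quiver.Path a c) : (arrowList p).length = p.length := by
  induction p with
  | nil => rfl
  | cons p x ih => simp [arrowList, ih]

/-- If a path acts on `b i` as nonzero, then the path or its inverse stands next to the
position `i` in the word. -/
theorem path_b {a c : V} (p : Quiver.Path a c) (i : ℤ) :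
    (C.ops k).path p (C.b k i) = 0 ∨
    ((C.ops k).path p (C.b k i) = C.b k (i - p.length) ∧
      ∀ (t : ℕ) (ht : t < (arrowList p).length),
        C.letter (i - p.length + 1 + t) = some (.direct (arrowList p)[t])) ∨
    ((C.ops k).path p (C.b k i) = C.b k (i + p.length) ∧
      ∀ (t : ℕ) (ht : t < (arrowList p).length),
        C.letter (i + p.length - t) = some (.inverse (arrowList p)[t])) := by
  induction p with
  | nil =>
    have h : (C.ops k).path (.nil : Quiver.Path a a) (C.b k i) = C.vertOp k a (C.b k i) := rfl
    rw [h, vertOp_b]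
    split_ifs
    · exact Or.inr (Or.inl ⟨by simp, fun t ht => by simp [arrowList] at ht⟩)
    · exact Or.inl rfl
  | @cons d e p x ih =>
    have hstep : (C.ops k).path (p.cons x) (C.b k i) =
        C.arrowOp k ⟨d, e, x⟩ ((C.ops k).path p (C.b k i)) := rfl
    have hlen := length_arrowList p
    rw [hstep]
    rcases ih with h | ⟨h, hl⟩ | ⟨h, hl⟩
    · exact Or.inl (by rw [h, map_zero])
    · rw [h, arrowOp_b]
      split_ifs with h1 h2
      · refine Or.inr (Or.inl ⟨by rw [Quiver.Path.length_cons]; congr 1; push_cast; ring, ?_⟩)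
        rintro (_ | t) ht
        · rw [Quiver.Path.length_cons]
          simp only [arrowList, List.getElem_cons_zero, ← h1]
          congr 1; push_cast; ring
        · have := hl t (by simpa [arrowList] using ht)
          simp only [arrowList, List.getElem_cons_succ, ← this, Quiver.Path.length_cons]
          congr 1; push_cast; ring
      · rcases Nat.eq_zero_or_pos p.length with h0 | h0
        · refine Or.inr (Or.inr ⟨by rw [Quiver.Path.length_cons, h0]; simp, ?_⟩)
          rintro (_ | t) ht
          · simpa [arrowList, h0] using h2
          · simp [arrowList] at ht; omega
        · have := hl 0 (by omega)
          simp [h2] at this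
      · exact Or.inl rfl
    · rw [h, arrowOp_b]
      split_ifs with h1 h2
      · rcases Nat.eq_zero_or_pos p.length with h0 | h0
        · refine Or.inr (Or.inl ⟨by rw [Quiver.Path.length_cons, h0]; simp, ?_⟩)
          rintro (_ | t) ht
          · simpa [arrowList, h0] using h1
          · simp [arrowList] at ht; omega
        · have := hl 0 (by omega)
          simp [h1] at this
      · refine Or.inr (Or.inr ⟨by rw [Quiver.Path.length_cons]; congr 1; push_cast; ring, ?_⟩)
        rintro (_ | t) ht
        · simpa [arrowList, add_assoc] using h2
        · have := hl t (by simpa [arrowList] using ht)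
          simp only [arrowList, List.getElem_cons_succ, ← this, Quiver.Path.length_cons]
          congr 1; push_cast; ring
      · exact Or.inl rfl

/-- The relations act as zero on a string module. -/
theorem ops_rel (r : QPath V) (hr : r ∈ ρ) : (C.ops k).path r.path = 0 := by
  refine C.hom_ext fun i _ => ?_
  rw [LinearMap.zero_apply]
  rcases C.path_b k r.path i with h | ⟨-, h⟩ | ⟨-, h⟩
  · exact h
  · refine absurd ⟨i - r.path.length + 1, fun t ht => ?_⟩ (C.no_rel r hr)
    rw [h t (by simpa using ht)]; simp
  · refine absurd ⟨i + 1, fun t ht => ?_⟩ (C.no_rel_inv r hr)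
    have hlen := length_arrowList r.path
    have ht' : t < (arrowList r.path).length := by simpa using ht
    have := h ((arrowList r.path).length - 1 - t) (by omega)
    simp only [List.getElem_map, List.getElem_reverse]
    rw [← this]
    congr 1
    omega

/-- The string module `M(C)`. -/
def stringModule : AlgModule.{u, max u v w, u} k (QuotAlgebra k ρ) where
  carrier := C.Space k
  act := (C.ops k).act ρ (C.ops_rel k)

end Word

/-! ### Band modules -/

namespace Word

variable {V : Type v} [Quiver.{w} V] {ρ : Set (QPath V)}

/-- `C` is a periodic `ℤ`-word of period `n`: the number `n` is the least positive integer such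
that the shift `C[n]`, with letters `C[n] i = C (i + n)`, equals `C`. -/
structure IsPeriodic (C : Word ρ) (n : ℕ) : Prop where
  shape_eq : C.shape = .int
  isLeast : IsLeast {m : ℕ | 0 < m ∧ ∀ i, C.letter (i + m) = C.letter i} n

namespace IsPeriodic

variable {C : Word ρ} {n : ℕ} (hC : C.IsPeriodic n) (k : Type u) [Field k]

theorem mem_idx (hC : C.IsPeriodic n) (i : ℤ) : i ∈ C.shape.idx := by
  rw [hC.shape_eq]; trivial

theorem letter_sub (hC : C.IsPeriodic n) (i : ℤ) : C.letter (i - n) = C.letter i := by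
  have := hC.isLeast.1.2 (i - n)
  rwa [sub_add_cancel, eq_comm] at this

theorem vertex_sub (hC : C.IsPeriodic n) (i : ℤ) : C.vertex (i - n) = C.vertex i := by
  obtain ⟨l, hl⟩ := Option.isSome_iff_exists.1
    ((C.letter_isSome i).2 ⟨hC.mem_idx i, hC.mem_idx (i - 1)⟩)
  rw [C.tail_letter i l hl, C.tail_letter (i - n) l (by rw [hC.letter_sub, hl])]

/-- The bijection `i ↦ i - n` of the index set. -/
def shiftIdx : C.shape.idx ≃ C.shape.idx where
  toFun i := ⟨i - n, hC.mem_idx _⟩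
  invFun i := ⟨i + n, hC.mem_idx _⟩
  left_inv i := by simp
  right_inv i := by simp

/-- The automorphism of the vector space of `M(C)` with `b i ↦ b (i - n)`. -/
def shift : C.Space k ≃ₗ[k] C.Space k := Finsupp.domLCongr hC.shiftIdx

theorem shift_b (i : ℤ) : hC.shift k (C.b k i) = C.b k (i - n) := by
  simp [shift, b, hC.mem_idx, shiftIdx]

/-- The shift as an invertible operator. -/
def shiftUnit : (Module.End k (C.Space k))ˣ where
  val := hC.shift k
  inv := (hC.shift k).symm
  val_inv := LinearMap.ext fun m => (hC.shift k).apply_symm_apply m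
  inv_val := LinearMap.ext fun m => (hC.shift k).symm_apply_apply m

/-- The homomorphism from Laurent polynomials to operators that sends `T` to the shift. -/
def laurentHom : k[T;T⁻¹] →ₐ[k] Module.End k (C.Space k) :=
  AddMonoidAlgebra.lift k (Module.End k (C.Space k)) ℤ
    ((Units.coeHom _).comp (zpowersHom _ (hC.shiftUnit k)))

theorem laurentHom_T (m : ℤ) :
    hC.laurentHom k (LaurentPolynomial.T m) = ((hC.shiftUnit k ^ m : (Module.End k _)ˣ) : _) := by
  rw [laurentHom, LaurentPolynomial.T, AddMonoidAlgebra.lift_single, one_smul]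
  rfl

theorem commute_laurentHom {f : Module.End k (C.Space k)}
    (hf : Commute f (hC.shift k : Module.End k (C.Space k))) (g : k[T;T⁻¹]) :
    Commute f (hC.laurentHom k g) := by
  induction g using LaurentPolynomial.induction_on' with
  | add p q hp hq => rw [map_add]; exact hp.add_right hq
  | C_mul_T m c =>
    have hu : Commute f (hC.shiftUnit k : Module.End k (C.Space k)) := hf
    rw [← LaurentPolynomial.smul_eq_C_mul, map_smul, laurentHom_T]
    exact (hu.units_zpow_right m).smul_right c

theorem path_commute {a c : V} (p : Quiver.Path a c) :
    Commute ((C.ops k).path p) (hC.shift k : Module.End k (C.Space k)) := by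
  induction p with
  | nil =>
    refine C.hom_ext fun i _ => ?_
    change C.vertOp k a (hC.shift k (C.b k i)) = hC.shift k (C.vertOp k a (C.b k i))
    rw [shift_b, vertOp_b, vertOp_b, hC.vertex_sub]
    split_ifs
    · rw [shift_b]
    · rw [map_zero]
  | @cons d e p x ih =>
    refine Commute.mul_left (C.hom_ext fun i _ => ?_) ih
    change C.arrowOp k ⟨d, e, x⟩ (hC.shift k (C.b k i)) =
      hC.shift k (C.arrowOp k ⟨d, e, x⟩ (C.b k i))
    rw [shift_b, arrowOp_b, arrowOp_b, hC.letter_sub, sub_add_eq_add_sub, hC.letter_sub]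
    split_ifs
    · rw [shift_b, sub_right_comm]
    · rw [shift_b]
    · rw [map_zero]

/-- The action of the algebra on `M(C)` commutes with the shift. -/
theorem act_commute (a : QuotAlgebra k ρ) :
    Commute ((C.stringModule k).act a) (hC.shift k : Module.End k (C.Space k)) := by
  obtain ⟨f, rfl⟩ := proj_surjective k ρ a
  let L : PathAlgebra k V →ₗ[k] Module.End k (C.Space k) :=
    (LinearMap.mulRight k (hC.shift k : Module.End k (C.Space k))).comp (C.ops k).pathAlgLin
  let R : PathAlgebra k V →ₗ[k] Module.End k (C.Space k) :=
    (LinearMap.mulLeft k (hC.shift k : Module.End k (C.Space k))).comp (C.ops k).pathAlgLin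
  have : L = R := by
    refine PathAlgebra.hom_ext (k := k) (N := Module.End k (C.Space k)) (f := L) (g := R)
      fun p => ?_
    simpa [L, R, QuiverOps.pathAlgLin] using (hC.path_commute k p.path).eq
  exact congrArg (fun F => F f) this

/-- `M(C)` as a module over `k[T, T⁻¹]`, where `T` acts by `b i ↦ b (i - n)`. -/
def Bimodule (_ : C.IsPeriodic n) (k : Type u) [Field k] : Type u := C.Space k

instance : AddCommGroup (hC.Bimodule k) := inferInstanceAs (AddCommGroup (C.Space k))
instance : Module k (hC.Bimodule k) := inferInstanceAs (Module k (C.Space k))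

instance : Module k[T;T⁻¹] (hC.Bimodule k) :=
  Module.compHom (C.Space k) (hC.laurentHom k).toRingHom

theorem laurent_smul_def (g : k[T;T⁻¹]) (m : hC.Bimodule k) :
    g • m = (hC.laurentHom k g : Module.End k (C.Space k)) m := rfl

instance : IsScalarTower k k[T;T⁻¹] (hC.Bimodule k) :=
  ⟨fun c g m => by rw [laurent_smul_def, map_smul]; rfl⟩

instance : SMulCommClass k[T;T⁻¹] k (hC.Bimodule k) :=
  ⟨fun g c m => (hC.laurentHom k g : Module.End k (C.Space k)).map_smul c m⟩

/-- The action of an element of the algebra on `M(C)` as a `k[T, T⁻¹]`-linear map. -/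
def actLaurent (a : QuotAlgebra k ρ) : hC.Bimodule k →ₗ[k[T;T⁻¹]] hC.Bimodule k where
  toFun m := ((C.stringModule k).act a : Module.End k (C.Space k)) m
  map_add' m m' := ((C.stringModule k).act a : Module.End k (C.Space k)).map_add m m'
  map_smul' g m := congrArg (fun F : Module.End k (C.Space k) => F m)
    (hC.commute_laurentHom k (hC.act_commute k a) g).eq

variable (W : Type u) [AddCommGroup W] [Module k[T;T⁻¹] W]

/-- The module `M(C, W) = M(C) ⊗ W` over `k[T, T⁻¹]`, with the algebra acting on the left factor. -/
def tensorModule : AlgModule.{u, max u v w, u} k (QuotAlgebra k ρ) where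
  carrier := hC.Bimodule k ⊗[k[T;T⁻¹]] W
  act :=
    { toFun := fun a => ((hC.actLaurent k a).rTensor W).restrictScalars k
      map_smul' := fun c a => LinearMap.ext fun z => by
        induction z with
        | zero => simp only [map_zero]
        | add z z' h h' => simp only [map_add, h, h']
        | tmul m w =>
          change hC.actLaurent k (c • a) m ⊗ₜ w = (c • hC.actLaurent k a m) ⊗ₜ[k[T;T⁻¹]] w
          rw [show hC.actLaurent k (c • a) m = c • hC.actLaurent k a m from
            congrArg (fun F : Module.End k (C.Space k) => F m) (map_smul (C.stringModule k).act c a)]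
      map_zero' := LinearMap.ext fun z => by
        induction z with
        | zero => simp only [map_zero]
        | add z z' h h' => simp only [map_add, h, h']
        | tmul m w =>
          change hC.actLaurent k 0 m ⊗ₜ[k[T;T⁻¹]] w = 0
          rw [show hC.actLaurent k 0 m = 0 from
            congrArg (fun F : Module.End k (C.Space k) => F m) (map_zero (C.stringModule k).act),
            TensorProduct.zero_tmul]
      map_add' := fun a a' => LinearMap.ext fun z => by
        induction z with
        | zero => simp only [map_zero]
        | add z z' h h' => simp only [map_add, h, h']
        | tmul m w =>
          change hC.actLaurent k (a + a') m ⊗ₜ[k[T;T⁻¹]] w =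
            hC.actLaurent k a m ⊗ₜ[k[T;T⁻¹]] w + hC.actLaurent k a' m ⊗ₜ[k[T;T⁻¹]] w
          rw [← TensorProduct.add_tmul,
            show hC.actLaurent k (a + a') m = hC.actLaurent k a m + hC.actLaurent k a' m from
            congrArg (fun F : Module.End k (C.Space k) => F m) (map_add (C.stringModule k).act a a')]
      map_mul' := fun a a' => LinearMap.ext fun z => by
        induction z with
        | zero => simp only [map_zero]
        | add z z' h h' => simp only [map_add, h, h']
        | tmul m w =>
          change hC.actLaurent k (a * a') m ⊗ₜ[k[T;T⁻¹]] w =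
            hC.actLaurent k a (hC.actLaurent k a' m) ⊗ₜ[k[T;T⁻¹]] w
          rw [show hC.actLaurent k (a * a') m = hC.actLaurent k a (hC.actLaurent k a' m) from
            congrArg (fun F : Module.End k (C.Space k) => F m)
              (map_mul (C.stringModule k).act a a')] }

end IsPeriodic

end Word

/-- A module is indecomposable if it is nonzero and not a direct sum of two nonzero submodules. -/
def IsIndecomposable (R : Type u) [Ring R] (W : Type x) [AddCommGroup W] [Module R W] : Prop :=
  Nontrivial W ∧ ∀ p q : Submodule R W, IsCompl p q → p = ⊥ ∨ q = ⊥

/-- The string modules `M(C)`, for arbitrary words `C`, and the band modules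
`M(C) ⊗ W` over `k[T, T⁻¹]`, for a periodic `ℤ`-word `C` and a finite-dimensional indecomposable
`k[T, T⁻¹]`-module `W`. -/
inductive IsStringOrBand {k : Type u} [Field k] {V : Type v} [Quiver.{w} V] {ρ : Set (QPath V)} :
    AlgModule.{u, max u v w, u} k (QuotAlgebra k ρ) → Prop
  | string (C : Word ρ) : IsStringOrBand (C.stringModule k)
  | band (C : Word ρ) (n : ℕ) (hC : C.IsPeriodic n) (W : Type u) [AddCommGroup W]
      [Module k[T;T⁻¹] W] [Module k W] [IsScalarTower k k[T;T⁻¹] W] [FiniteDimensional k W]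
      (hW : IsIndecomposable k[T;T⁻¹] W) : IsStringOrBand (hC.tensorModule k W)

end StringAlg

end

/-! The method is that of functorial filtrations (Gelfand–Ponomarev, Ringel), extended to
infinite-dimensional modules. Signs divide the letters that depart from a vertex into two sides. A
one-sided word `w` on a side defines subspaces w⁻ ⊆ w⁺ of the space at the vertex: the elements that
start a sequence following the relations of the letters, eventually zero for w⁻. The intervals of
different words on the same side do not overlap (`plus_le_minus_or`). A vertex with a word on each
of its sides is a position of a two-sided word and has a subquotient F⁺/F⁻. Passing along a letter
identifies the subquotients of consecutive positions (`mem_Fminus_succ_iff`), so a basis at one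
position lifts to families along the whole word (`IsStr`, `LiftFamily`), which are the homomorphisms
from a string module. As the intervals do not overlap, the lifts for all classes of words together
are linearly independent (`LiftFamily.linearIndependent`). Zero relations inside words need not be
excluded in advance: a family along a word that contains one vanishes somewhere, so such words have
zero subquotients.

The hard point is that the lifts span. Let `Z` be the sum of all primitive cycles. It commutes with
the arrows (`Z_arrow_eq`), and finite control makes the image of every arrow a finitely generated
module over the polynomials in `Z` (`exists_range_le_span_Z`). Chains of subspaces along infinite
words then become stationary, except along direct powers of a primitive cycle, where Krull's
intersection theorem replaces this (`sat_bot_of_cyc`). So words cover the space at a vertex up to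
denominators, that is, polynomials in `Z` with constant term one (`exists_word`, `sat_of_tplus_le`):
for the span `H` of any lift and `m` at a vertex, some f(Z) m lies in `H` with f(0) = 1. As f is
coprime to the powers of the variable, Z^n m ∈ H then suffices for m ∈ H (`Stable.mem_of_sat`), and
only the images of arrows on primitive cycles remain to be treated.

There the lift has to be chosen with care. For a loop `x` without relations and M = k[x], the
element 1 + x is a possible lift for the word x⁻¹x⁻¹⋯, but it generates a proper submodule. The
tails of nonperiodic words that run around inverse cycles are therefore changed by multiples of `Z`,
so that the vectors on the tails generate submodules that are saturated up to torsion
(`exists_saturated`, `exists_adjusted`). The torsion lies in the ray of the cycle, where `Z` is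
invertible, and the ray is the subquotient of the periodic word of the cycle (`ray_le_span`).

For a periodic word the subquotient is finite dimensional (`finite_of_isPer`), and telescoping
corrections give a lift on which the shift by the period is an automorphism of the coefficients
(`exists_automorphism`). Splitting the resulting k[T,T⁻¹]-module into indecomposables gives the band
modules; each basis vector of a nonperiodic word gives a string module. -/

noncomputable section

namespace StringAlg

/-! ### Composable arrows and signs -/

/-- A vertex together with a sign. -/
abbrev Side (V : Type v) := V × Bool

/-- The opposite side of the same vertex. -/
def Side.flip {V : Type v} (s : Side V) : Side V := (s.1, !s.2)

@[simp] theorem Side.flip_flip {V : Type v} (s : Side V) : s.flip.flip = s := by simp [Side.flip]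
theorem Side.flip_ne {V : Type v} (s : Side V) : s.flip ≠ s := by
  intro h
  have := congrArg Prod.snd h
  simp [Side.flip] at this

section Combinatorics

variable {V : Type v} [Quiver.{w} V]

/-- The path `x y` of length two exists and is not in `ρ`. -/
inductive Foll (ρ : Set (QPath V)) : Quiver.Total V → Quiver.Total V → Prop
  | mk {a b c : V} (y : a ⟶ b) (x : b ⟶ c)
      (h : (⟨a, c, y.toPath.cons x⟩ : QPath V) ∉ ρ) : Foll ρ ⟨b, c, x⟩ ⟨a, b, y⟩

variable {ρ : Set (QPath V)}

theorem Foll.right_eq_left {x y : Quiver.Total V} (h : Foll ρ x y) : y.right = x.left := by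
  cases h; rfl

theorem Foll.left_unique (hρ : IsStringAlgebra ρ) {x x' y : Quiver.Total V}
    (h : Foll ρ x y) (h' : Foll ρ x' y) : x = x' := by
  cases h with
  | mk y x h =>
    cases h' with
    | mk _ x' h' =>
      have hs := hρ.left_unique y
      have := @hs ⟨_, x⟩ h ⟨_, x'⟩ h'
      cases this
      rfl

theorem Foll.right_unique (hρ : IsStringAlgebra ρ) {x y y' : Quiver.Total V}
    (h : Foll ρ x y) (h' : Foll ρ x y') : y = y' := by
  cases h with
  | mk y x h =>
    cases h' with
    | mk y' _ h' =>
      have hs := hρ.right_unique x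
      have := @hs ⟨_, y⟩ h ⟨_, y'⟩ h'
      cases this
      rfl

variable (ρ) in
/-- Signs for the letters, such that the letters with a given head and a given sign are at most
one direct letter `y` and one inverse letter `x⁻¹`, with `x y ∈ ρ` if there are both. -/
structure Signs where
  sgn : Letter V → Bool
  direct_ne : ∀ x y, x ≠ y → x.right = y.right → sgn (.direct x) ≠ sgn (.direct y)
  inverse_ne : ∀ x y, x ≠ y → x.left = y.left → sgn (.inverse x) ≠ sgn (.inverse y)
  foll_ne : ∀ x y, Foll ρ x y → sgn (.inverse x) ≠ sgn (.direct y)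

/-- The extension step in the choice of signs. Of two elements, prescribed values are already
different, so an element without a prescription can take the value that remains. -/
theorem exists_injOn_bool {α : Type*} {S : Set α} (hS : S.encard ≤ 2) (φ : α → Option Bool)
    (h : ∀ a ∈ S, ∀ b ∈ S, ∀ t, φ a = some t → φ b = some t → a = b) :
    ∃ g : α → Bool, S.InjOn g ∧ ∀ a ∈ S, ∀ t, φ a = some t → g a = t := by
  classical
  rcases hS.lt_or_eq with h1 | h2
  · have h1 : S.encard ≤ 1 := by
      rw [← one_add_one_eq_two] at h1
      exact Order.le_of_lt_add_one h1
    rw [Set.encard_le_one_iff] at h1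
    exact ⟨fun a => (φ a).getD true, fun a ha b hb _ => h1 a b ha hb,
      fun a _ t ht => by simp [ht]⟩
  · obtain ⟨a, b, hab, rfl⟩ := Set.encard_eq_two.1 h2
    have key : ∀ t, (∀ s, φ a = some s → s = t) → (∀ s, φ b = some s → s = !t) →
        ∃ g : α → Bool, Set.InjOn g {a, b} ∧ ∀ c ∈ ({a, b} : Set α), ∀ s, φ c = some s → g c = s := by
      intro t h1 h2
      refine ⟨fun c => if c = a then t else !t, ?_, ?_⟩
      · rintro c (rfl | rfl) d (rfl | rfl) <;> simp [hab.symm]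
      · rintro c (rfl | rfl) s hs
        · simp [h1 s hs]
        · simp [hab.symm, h2 s hs]
    rcases ha : φ a with _ | t
    · rcases hb : φ b with _ | s
      · exact key true (by simp [ha]) (by simp [hb])
      · exact key (!s) (by simp [ha]) (by simp [hb])
    · refine key t (by simp [ha]) fun s hs => ?_
      by_contra hst
      have : s = t := by revert hst; cases s <;> cases t <;> simp
      exact hab (h a (by simp) b (by simp) t ha (this ▸ hs))

/-- The incoming arrows at a vertex receive arbitrary different signs `g`. An outgoing `x` with `x y
∉ ρ` is then forced to have the sign opposite to that of `y`; by uniqueness of `x` for given `y`,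
the forced signs of different outgoing arrows differ, so they extend to all outgoing arrows. -/
theorem exists_signs (hρ : IsStringAlgebra ρ) : Nonempty (Signs ρ) := by
  classical
  have hin := fun v : V => exists_injOn_bool (hρ.head_le_two v) (fun _ => none) (by simp)
  choose g hg _ using hin
  let φ : Quiver.Total V → Option Bool := fun x =>
    if h : ∃ y, Foll ρ x y then some (!g x.left h.choose) else none
  have hφ : ∀ x y, Foll ρ x y → φ x = some (!g x.left y) := by
    intro x y h
    have h' : ∃ y, Foll ρ x y := ⟨y, h⟩
    simp only [φ, dif_pos h', h'.choose_spec.right_unique hρ h]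
  have hout := fun v : V => exists_injOn_bool (hρ.tail_le_two v) φ (by
    intro a ha b hb t hat hbt
    have : ∀ c t, φ c = some t → ∃ y, Foll ρ c y := by
      intro c t hc
      by_contra hn
      simp [φ, hn] at hc
    obtain ⟨y, hy⟩ := this a t hat
    obtain ⟨y', hy'⟩ := this b t hbt
    rw [hφ a y hy] at hat
    rw [hφ b y' hy', ← hat] at hbt
    rw [ha, hb] at hbt
    have : y' = y := hg v (by rw [Set.mem_ofPred, hy'.right_eq_left, hb])
      (by rw [Set.mem_ofPred, hy.right_eq_left, ha]) (by simpa using hbt)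
    subst this
    exact hy.left_unique hρ hy')
  choose f hf hf' using hout
  refine ⟨⟨fun l => match l with
    | .direct y => g y.right y
    | .inverse x => f x.left x, ?_, ?_, ?_⟩⟩
  · intro x y hne h heq
    refine hne (hg x.right rfl h.symm ?_)
    simpa [h] using heq
  · intro x y hne h heq
    refine hne (hf x.left rfl h.symm ?_)
    simpa [h] using heq
  · intro x y h
    simp only
    rw [hf' x.left x rfl _ (hφ x y h), h.right_eq_left]
    simp

/-! ### One-sided words -/

@[simp] theorem Letter.inv_inv (l : Letter V) : l.inv.inv = l := by cases l <;> rfl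
@[simp] theorem Letter.head_inv (l : Letter V) : l.inv.head = l.tail := by cases l <;> rfl
@[simp] theorem Letter.tail_inv (l : Letter V) : l.inv.tail = l.head := by cases l <;> rfl
theorem Letter.inv_ne (l : Letter V) : l.inv ≠ l := by cases l <;> simp [Letter.inv]

namespace Signs

variable (σ : Signs ρ)

/-- The side from which a letter departs. -/
def src (l : Letter V) : Side V := (l.head, σ.sgn l)

/-- The side from which a word continues after a letter. -/
def dst (l : Letter V) : Side V := (l.tail, !σ.sgn l.inv)

theorem src_inv (l : Letter V) : σ.src l.inv = (σ.dst l).flip := by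
  simp [src, dst, Side.flip]

theorem dst_inv (l : Letter V) : σ.dst l.inv = (σ.src l).flip := by
  simp [src, dst, Side.flip]

theorem direct_eq {x y : Quiver.Total V} (h : σ.src (.direct x) = σ.src (.direct y)) : x = y := by
  by_contra hne
  exact σ.direct_ne x y hne (congrArg Prod.fst h) (congrArg Prod.snd h)

theorem inverse_eq {x y : Quiver.Total V} (h : σ.src (.inverse x) = σ.src (.inverse y)) :
    x = y := by
  by_contra hne
  exact σ.inverse_ne x y hne (congrArg Prod.fst h) (congrArg Prod.snd h)

theorem not_foll {x y : Quiver.Total V} (h : σ.src (.inverse x) = σ.src (.direct y)) :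
    ¬ Foll ρ x y :=
  fun hf => σ.foll_ne x y hf (congrArg Prod.snd h)

/-- Two letters `x` and `y` with `x y ∉ ρ` meet on opposite sides. -/
theorem src_of_foll {x y : Quiver.Total V} (h : Foll ρ x y) :
    σ.src (.direct y) = (σ.src (.inverse x)).flip := by
  have h1 := σ.foll_ne x y h
  refine Prod.ext h.right_eq_left ?_
  change σ.sgn (.direct y) = !σ.sgn (.inverse x)
  revert h1
  cases σ.sgn (.direct y) <;> cases σ.sgn (.inverse x) <;> simp

/-- The side reached after `n` letters; it does not change after the end of the word. -/
def st (s : Side V) (w : ℕ → Option (Letter V)) : ℕ → Side V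
  | 0 => s
  | n + 1 => match w n with
    | some l => σ.dst l
    | none => st s w n

@[simp] theorem st_zero (s : Side V) (w : ℕ → Option (Letter V)) : σ.st s w 0 = s := rfl

theorem st_succ_some {s : Side V} {w : ℕ → Option (Letter V)} {n : ℕ} {l : Letter V}
    (h : w n = some l) : σ.st s w (n + 1) = σ.dst l := by simp [st, h]

theorem st_succ_none {s : Side V} {w : ℕ → Option (Letter V)} {n : ℕ}
    (h : w n = none) : σ.st s w (n + 1) = σ.st s w n := by simp [st, h]

theorem st_shift (s : Side V) (w : ℕ → Option (Letter V)) (n : ℕ) :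
    σ.st (σ.st s w 1) (fun i => w (i + 1)) n = σ.st s w (n + 1) := by
  induction n with
  | zero => rfl
  | succ n ih =>
    rcases h : w (n + 1) with _ | l
    · rw [st_succ_none σ (w := fun i => w (i + 1)) h, ih, st_succ_none σ h]
    · rw [st_succ_some σ (w := fun i => w (i + 1)) h, st_succ_some σ h]

theorem st_shift_some {s : Side V} {w : ℕ → Option (Letter V)} {l : Letter V} (h : w 0 = some l)
    (n : ℕ) : σ.st (σ.dst l) (fun i => w (i + 1)) n = σ.st s w (n + 1) := by
  rw [← σ.st_succ_some (s := s) h, st_shift]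

theorem st_congr {s : Side V} {w w' : ℕ → Option (Letter V)} {n : ℕ} (h : ∀ i < n, w i = w' i) :
    σ.st s w n = σ.st s w' n := by
  induction n with
  | zero => rfl
  | succ n ih =>
    have h1 := ih fun i hi => h i (by omega)
    have h2 := h n (by omega)
    simp only [st, h1, h2]

/-- One-sided words that depart from the side `s`; a finite word is continued by `none`. -/
structure IsWord (s : Side V) (w : ℕ → Option (Letter V)) : Prop where
  src_eq : ∀ n l, w n = some l → σ.src l = σ.st s w n
  none_succ : ∀ n, w n = none → w (n + 1) = none

end Signs

end Combinatorics

/-! ### Linear relations -/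

section Relations

variable {k : Type u} [Field k] {M : Type x} [AddCommGroup M] [Module k M]

/-- The elements related to some element of `Y`. -/
def relAct (r : Submodule k (M × M)) (Y : Submodule k M) : Submodule k M :=
  (r ⊓ Y.comap (LinearMap.snd k M M)).map (LinearMap.fst k M M)

theorem mem_relAct {r : Submodule k (M × M)} {Y : Submodule k M} {a : M} :
    a ∈ relAct r Y ↔ ∃ b ∈ Y, (a, b) ∈ r := by
  simp only [relAct, Submodule.mem_map, Submodule.mem_inf, Submodule.mem_comap,
    LinearMap.snd_apply, LinearMap.fst_apply, Prod.exists, exists_and_right, exists_eq_right]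
  exact exists_congr fun b => and_comm

theorem relAct_mono (r : Submodule k (M × M)) {Y Y' : Submodule k M} (h : Y ≤ Y') :
    relAct r Y ≤ relAct r Y' := by
  intro a ha
  obtain ⟨b, hb, hr⟩ := mem_relAct.1 ha
  exact mem_relAct.2 ⟨b, h hb, hr⟩

/-- A linear relation `r` maps `(B⁺ ∩ r D⁻) + (B⁻ ∩ r D⁺)` to `(r⁻¹ B⁺ ∩ D⁻) + (r⁻¹ B⁻ ∩ D⁺)`. -/
theorem rel_mem_minus {r r' : Submodule k (M × M)} (hr : ∀ a b, (a, b) ∈ r ↔ (b, a) ∈ r')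
    {Bp Bm Dp Dm : Submodule k M} (hD : Dm ≤ Dp) {a b : M}
    (ha : a ∈ (Bp ⊓ relAct r Dm) ⊔ (Bm ⊓ relAct r Dp)) (hab : (a, b) ∈ r) (hb : b ∈ Dp) :
    b ∈ (relAct r' Bp ⊓ Dm) ⊔ (relAct r' Bm ⊓ Dp) := by
  obtain ⟨a₁, ⟨h1, h1'⟩, a₂, ⟨h2, h2'⟩, rfl⟩ := Submodule.mem_sup.1 ha
  obtain ⟨b₁, hb1, hr1⟩ := mem_relAct.1 h1'
  obtain ⟨b₂, hb2, hr2⟩ := mem_relAct.1 h2'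
  -- `a` determines `b` only up to elements related to `0`. These lie in `r'` applied to `Bm`, so
  -- they can be put into the second summand.
  have h0 : ((0 : M), b - b₁ - b₂) ∈ r := by
    have := r.sub_mem (r.sub_mem hab hr1) hr2
    simpa using this
  have hb' : b = b₁ + (b₂ + (b - b₁ - b₂)) := by abel
  rw [hb']
  refine Submodule.add_mem_sup ⟨mem_relAct.2 ⟨a₁, h1, (hr _ _).1 hr1⟩, hb1⟩ (add_mem ?_ ?_)
  · exact ⟨mem_relAct.2 ⟨a₂, h2, (hr _ _).1 hr2⟩, hb2⟩
  · exact ⟨mem_relAct.2 ⟨0, zero_mem _, (hr _ _).1 h0⟩,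
      sub_mem (sub_mem hb (hD hb1)) hb2⟩

/-- Sequences that are eventually zero. -/
def eventuallyZero (k : Type u) [Field k] (M : Type x) [AddCommGroup M] [Module k M] :
    Submodule k (ℕ → M) where
  carrier := {f | ∃ N, ∀ n ≥ N, f n = 0}
  add_mem' := by
    rintro f g ⟨N, hN⟩ ⟨N', hN'⟩
    exact ⟨max N N', fun n hn => by
      simp [hN n (le_trans (le_max_left _ _) hn), hN' n (le_trans (le_max_right _ _) hn)]⟩
  zero_mem' := ⟨0, fun _ _ => rfl⟩
  smul_mem' := by
    rintro c f ⟨N, hN⟩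
    exact ⟨N, fun n hn => by simp [hN n hn]⟩

end Relations

/-! ### The subspaces defined by one-sided words -/

namespace QuiverOps

variable {k : Type u} [Field k] {V : Type v} [Quiver.{w} V] {ρ : Set (QPath V)}
  {M : Type x} [AddCommGroup M] [Module k M] (R : QuiverOps k V M) (σ : Signs ρ)

/-- The space at a vertex. -/
def E (v : V) : Submodule k M := LinearMap.range (R.vert v)

theorem vert_apply_vert (v : V) (m : M) : R.vert v (R.vert v m) = R.vert v m :=
  congrArg (fun f => f m) (R.vert_idem v)

theorem mem_E {v : V} {m : M} : m ∈ R.E v ↔ R.vert v m = m := by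
  constructor
  · rintro ⟨m', rfl⟩
    exact R.vert_apply_vert v m'
  · exact fun h => ⟨m, h⟩

theorem vert_apply_of_ne {v v' : V} (h : v ≠ v') {m : M} (hm : m ∈ R.E v') : R.vert v m = 0 := by
  rw [← R.mem_E.1 hm]
  exact congrArg (fun f => f m) (R.vert_orth v v' h)

theorem vert_mem_E (v : V) (m : M) : R.vert v m ∈ R.E v := ⟨m, rfl⟩

theorem arrow_mem_E (x : Quiver.Total V) (m : M) : R.arrow x m ∈ R.E x.right :=
  R.mem_E.2 (congrArg (fun f => f m) (R.head_arrow x))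

theorem arrow_vert (x : Quiver.Total V) (m : M) : R.arrow x (R.vert x.left m) = R.arrow x m :=
  congrArg (fun f => f m) (R.arrow_tail x)

theorem arrow_apply_of_ne {x : Quiver.Total V} {v : V} (h : x.left ≠ v) {m : M} (hm : m ∈ R.E v) :
    R.arrow x m = 0 := by
  rw [← R.arrow_vert, R.vert_apply_of_ne h hm, map_zero]

theorem range_arrow_le (x : Quiver.Total V) : LinearMap.range (R.arrow x) ≤ R.E x.right := by
  rintro _ ⟨m, rfl⟩
  exact R.arrow_mem_E x m

theorem arrow_arrow_eq_zero (hR : ∀ r ∈ ρ, R.path r.path = 0) {x y : Quiver.Total V}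
    (h : ¬ Foll ρ x y) (m : M) : R.arrow x (R.arrow y m) = 0 := by
  by_cases hxy : y.right = x.left
  · obtain ⟨a, b, y⟩ := y
    obtain ⟨b', c, x⟩ := x
    obtain rfl : b = b' := hxy
    have h1 : (⟨a, c, y.toPath.cons x⟩ : QPath V) ∈ ρ := by
      by_contra h2
      exact h (.mk y x h2)
    have h2 := congrArg (fun f => f m) (hR _ h1)
    have h3 : R.arrow ⟨a, b, y⟩ (R.vert a m) = R.arrow ⟨a, b, y⟩ m := R.arrow_vert ⟨a, b, y⟩ m
    simpa [path, Quiver.Hom.toPath, h3] using h2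
  · exact R.arrow_apply_of_ne (Ne.symm hxy) (R.arrow_mem_E y m)

/-- The linear relation of a letter. -/
def lrel : Letter V → Submodule k (M × M)
  | .direct x => LinearMap.ker (LinearMap.fst k M M - R.arrow x ∘ₗ LinearMap.snd k M M) ⊓
      (R.E x.left).comap (LinearMap.snd k M M)
  | .inverse x => LinearMap.ker (LinearMap.snd k M M - R.arrow x ∘ₗ LinearMap.fst k M M) ⊓
      (R.E x.left).comap (LinearMap.fst k M M)

theorem mem_lrel_direct {x : Quiver.Total V} {a b : M} :
    (a, b) ∈ R.lrel (.direct x) ↔ a = R.arrow x b ∧ b ∈ R.E x.left := by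
  simp [lrel, sub_eq_zero]

theorem mem_lrel_inverse {x : Quiver.Total V} {a b : M} :
    (a, b) ∈ R.lrel (.inverse x) ↔ b = R.arrow x a ∧ a ∈ R.E x.left := by
  simp [lrel, sub_eq_zero]

theorem mem_lrel_inv {l : Letter V} {a b : M} : (a, b) ∈ R.lrel l.inv ↔ (b, a) ∈ R.lrel l := by
  cases l with
  | direct x => rw [Letter.inv, mem_lrel_inverse, mem_lrel_direct]
  | inverse x => rw [Letter.inv, mem_lrel_inverse, mem_lrel_direct]

theorem tail_mem_E {l : Letter V} {a b : M} (h : (a, b) ∈ R.lrel l) : b ∈ R.E l.tail := by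
  cases l with
  | direct x => exact (R.mem_lrel_direct.1 h).2
  | inverse x => rw [(R.mem_lrel_inverse.1 h).1]; exact R.arrow_mem_E x a

theorem head_mem_E {l : Letter V} {a b : M} (h : (a, b) ∈ R.lrel l) : a ∈ R.E l.head := by
  have := R.tail_mem_E (R.mem_lrel_inv.2 h)
  simpa using this

/-- The largest of the subspaces of the trivial word on a side. -/
def kerSide (s : Side V) : Submodule k M :=
  R.E s.1 ⊓ ⨅ (x : Quiver.Total V) (_ : σ.src (.inverse x) = s), LinearMap.ker (R.arrow x)

/-- The smallest of the subspaces of the trivial word on a side. -/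
def imSide (s : Side V) : Submodule k M :=
  ⨆ (y : Quiver.Total V) (_ : σ.src (.direct y) = s), LinearMap.range (R.arrow y)

theorem mem_kerSide {s : Side V} {m : M} :
    m ∈ R.kerSide σ s ↔ m ∈ R.E s.1 ∧ ∀ x, σ.src (.inverse x) = s → R.arrow x m = 0 := by
  simp [kerSide, Submodule.mem_iInf]

theorem range_le_imSide {s : Side V} {y : Quiver.Total V} (h : σ.src (.direct y) = s) :
    LinearMap.range (R.arrow y) ≤ R.imSide σ s :=
  le_iSup₂_of_le y h le_rfl

/-- A direct and an inverse letter that share a side compose to zero, by the choice of signs. -/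
theorem imSide_le_kerSide (hR : ∀ r ∈ ρ, R.path r.path = 0) (s : Side V) :
    R.imSide σ s ≤ R.kerSide σ s := by
  refine iSup₂_le fun y hy => ?_
  rintro _ ⟨m, rfl⟩
  rw [mem_kerSide]
  refine ⟨?_, fun x hx => R.arrow_arrow_eq_zero hR (σ.not_foll (hx.trans hy.symm)) m⟩
  rw [← hy]
  exact R.arrow_mem_E y m

/-- The relation for passing from one position to the next one in a one-sided word. -/
def step (s : Side V) : Option (Letter V) → Submodule k (M × M)
  | some l => R.lrel l
  -- Past the end of the word a sequence stays in `kerSide` and moves only by elements of `imSide`;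
  -- hence the sequences that become zero there start in `imSide`.
  | none => (R.kerSide σ s).comap (LinearMap.fst k M M) ⊓
      (R.kerSide σ s).comap (LinearMap.snd k M M) ⊓
      (R.imSide σ s).comap (LinearMap.fst k M M - LinearMap.snd k M M)

theorem step_some (s : Side V) (l : Letter V) : R.step σ s (some l) = R.lrel l := rfl

theorem mem_step_none {s : Side V} {a b : M} : (a, b) ∈ R.step σ s none ↔
    a ∈ R.kerSide σ s ∧ b ∈ R.kerSide σ s ∧ a - b ∈ R.imSide σ s := by
  simp [step, and_assoc]

/-- The sequences of elements along a one-sided word. -/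
def seqs (s : Side V) (w : ℕ → Option (Letter V)) : Submodule k (ℕ → M) :=
  ⨅ n, (R.step σ (σ.st s w n) (w n)).comap
    ((LinearMap.proj n : (ℕ → M) →ₗ[k] M).prod (LinearMap.proj (n + 1)))

theorem mem_seqs {s : Side V} {w : ℕ → Option (Letter V)} {f : ℕ → M} :
    f ∈ R.seqs σ s w ↔ ∀ n, (f n, f (n + 1)) ∈ R.step σ (σ.st s w n) (w n) := by
  simp [seqs, Submodule.mem_iInf]

/-- The subspace `w⁺`. -/
def plus (s : Side V) (w : ℕ → Option (Letter V)) : Submodule k M :=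
  (R.seqs σ s w).map (LinearMap.proj 0)

/-- The subspace `w⁻`. -/
def minus (s : Side V) (w : ℕ → Option (Letter V)) : Submodule k M :=
  (R.seqs σ s w ⊓ eventuallyZero k M).map (LinearMap.proj 0)

theorem mem_plus {s : Side V} {w : ℕ → Option (Letter V)} {m : M} :
    m ∈ R.plus σ s w ↔ ∃ f ∈ R.seqs σ s w, f 0 = m := by
  simp [plus]

theorem mem_minus {s : Side V} {w : ℕ → Option (Letter V)} {m : M} :
    m ∈ R.minus σ s w ↔ ∃ f ∈ R.seqs σ s w, (∃ N, ∀ n ≥ N, f n = 0) ∧ f 0 = m := by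
  simp [minus, eventuallyZero, and_assoc]

theorem minus_le_plus (s : Side V) (w : ℕ → Option (Letter V)) :
    R.minus σ s w ≤ R.plus σ s w :=
  Submodule.map_mono inf_le_left

theorem seqs_tail {s : Side V} {w : ℕ → Option (Letter V)} {l : Letter V} (hl : w 0 = some l)
    {f : ℕ → M} : f ∈ R.seqs σ s w ↔
      (f 0, f 1) ∈ R.lrel l ∧ (fun n => f (n + 1)) ∈ R.seqs σ (σ.dst l) fun n => w (n + 1) := by
  simp only [mem_seqs]
  constructor
  · intro h
    refine ⟨?_, fun n => ?_⟩
    · have := h 0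
      rwa [hl] at this
    · rw [σ.st_shift_some hl]
      exact h (n + 1)
  · rintro ⟨h0, h⟩ (_ | n)
    · rw [hl]
      exact h0
    · have := h n
      rwa [σ.st_shift_some hl] at this

theorem plus_cons {s : Side V} {w : ℕ → Option (Letter V)} {l : Letter V} (hl : w 0 = some l) :
    R.plus σ s w = relAct (R.lrel l) (R.plus σ (σ.dst l) fun n => w (n + 1)) := by
  ext m
  rw [mem_plus, mem_relAct]
  constructor
  · rintro ⟨f, hf, rfl⟩
    obtain ⟨h0, h⟩ := (R.seqs_tail σ hl).1 hf
    exact ⟨f 1, (R.mem_plus σ).2 ⟨_, h, rfl⟩, h0⟩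
  · rintro ⟨b, hb, hm⟩
    obtain ⟨f, hf, rfl⟩ := (R.mem_plus σ).1 hb
    exact ⟨fun n => n.casesOn m f, (R.seqs_tail σ hl).2 ⟨hm, hf⟩, rfl⟩

theorem minus_cons {s : Side V} {w : ℕ → Option (Letter V)} {l : Letter V} (hl : w 0 = some l) :
    R.minus σ s w = relAct (R.lrel l) (R.minus σ (σ.dst l) fun n => w (n + 1)) := by
  ext m
  rw [mem_minus, mem_relAct]
  constructor
  · rintro ⟨f, hf, ⟨N, hN⟩, rfl⟩
    obtain ⟨h0, h⟩ := (R.seqs_tail σ hl).1 hf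
    exact ⟨f 1, (R.mem_minus σ).2 ⟨_, h, ⟨N, fun n hn => hN _ (by omega)⟩, rfl⟩, h0⟩
  · rintro ⟨b, hb, hm⟩
    obtain ⟨f, hf, ⟨N, hN⟩, rfl⟩ := (R.mem_minus σ).1 hb
    refine ⟨fun n => n.casesOn m f, (R.seqs_tail σ hl).2 ⟨hm, hf⟩, ⟨N + 1, ?_⟩, rfl⟩
    rintro (_ | n) hn
    · omega
    · exact hN n (by omega)

theorem plus_le_E {s : Side V} {w : ℕ → Option (Letter V)} (hw : σ.IsWord s w) :
    R.plus σ s w ≤ R.E s.1 := by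
  intro m hm
  obtain ⟨f, hf, rfl⟩ := (R.mem_plus σ).1 hm
  have h0 := (R.mem_seqs σ).1 hf 0
  rcases h : w 0 with _ | l
  · rw [h, mem_step_none, mem_kerSide] at h0
    exact h0.1.1
  · rw [h] at h0
    have h1 := R.head_mem_E h0
    have h2 := hw.src_eq 0 l h
    rwa [← show l.head = s.1 from congrArg Prod.fst h2]

/-- A sequence that follows a word up to a position where it can be continued by zero. -/
theorem mem_minus_of_truncate {s : Side V} {w : ℕ → Option (Letter V)} {f : ℕ → M} {n : ℕ}
    (h : ∀ i < n, (f i, f (i + 1)) ∈ R.step σ (σ.st s w i) (w i))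
    (hn : (f n, 0) ∈ R.step σ (σ.st s w n) (w n)) : f 0 ∈ R.minus σ s w := by
  refine (R.mem_minus σ).2 ⟨fun i => if i ≤ n then f i else 0, (R.mem_seqs σ).2 fun i => ?_,
    ⟨n + 1, fun i hi => if_neg (by omega)⟩, by simp⟩
  rcases lt_trichotomy i n with hi | rfl | hi
  · simpa [hi.le, Nat.succ_le_of_lt hi] using h i hi
  · simpa using hn
  · have h1 : ¬ i ≤ n := by omega
    have h2 : ¬ i + 1 ≤ n := by omega
    simp only [h1, h2, if_false]
    exact zero_mem _

/-- At the first difference the possible continuations on the common side are ordered: direct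
letter, end of the word, inverse letter. The image of the direct letter lies in `imSide`, which lies
in `kerSide`, which the inverse letter kills. So a sequence along the smaller word can be cut off by
zero at this place along the greater one. -/
theorem plus_le_minus_of_first_diff (hR : ∀ r ∈ ρ, R.path r.path = 0) {s : Side V}
    {w w' : ℕ → Option (Letter V)} (hw : σ.IsWord s w) (hw' : σ.IsWord s w') {n : ℕ}
    (h : ∀ i < n, w i = w' i) (hn : w n ≠ w' n) :
    R.plus σ s w ≤ R.minus σ s w' ∨ R.plus σ s w' ≤ R.minus σ s w := by
  have hst : ∀ i ≤ n, σ.st s w i = σ.st s w' i := fun i hi =>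
    σ.st_congr fun j hj => h j (by omega)
  have key : ∀ {w₁ w₂ : ℕ → Option (Letter V)}, (∀ i < n, w₁ i = w₂ i) →
      (∀ i ≤ n, σ.st s w₁ i = σ.st s w₂ i) →
      (∀ a b, (a, b) ∈ R.step σ (σ.st s w₁ n) (w₁ n) →
        (a, 0) ∈ R.step σ (σ.st s w₁ n) (w₂ n)) → R.plus σ s w₁ ≤ R.minus σ s w₂ := by
    intro w₁ w₂ h hst H m hm
    obtain ⟨f, hf, rfl⟩ := (R.mem_plus σ).1 hm
    rw [mem_seqs] at hf
    refine R.mem_minus_of_truncate σ (n := n) (fun i hi => ?_) ?_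
    · rw [← h i hi, ← hst i hi.le]
      exact hf i
    · rw [← hst n le_rfl]
      exact H _ _ (hf n)
  have kx : ∀ {w₁ : ℕ → Option (Letter V)} {x : Quiver.Total V}, w₁ n = none →
      σ.src (.inverse x) = σ.st s w₁ n →
      ∀ a b, (a, b) ∈ R.step σ (σ.st s w₁ n) none →
        (a, 0) ∈ R.step σ (σ.st s w₁ n) (some (.inverse x)) := by
    intro w₁ x _ hs a b hab
    rw [mem_step_none] at hab
    have := (R.mem_kerSide σ).1 hab.1
    rw [step_some, mem_lrel_inverse]
    refine ⟨(this.2 x hs).symm, ?_⟩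
    rw [← hs] at this
    exact this.1
  have ky : ∀ {w₁ : ℕ → Option (Letter V)} {y : Quiver.Total V},
      σ.src (.direct y) = σ.st s w₁ n →
      ∀ a b, (a, b) ∈ R.step σ (σ.st s w₁ n) (some (.direct y)) →
        (a, 0) ∈ R.step σ (σ.st s w₁ n) none := by
    intro w₁ y hs a b hab
    rw [step_some, mem_lrel_direct] at hab
    have ha : a ∈ R.imSide σ (σ.st s w₁ n) :=
      R.range_le_imSide σ hs (by rw [hab.1]; exact ⟨b, rfl⟩)
    rw [mem_step_none]
    exact ⟨R.imSide_le_kerSide σ hR _ ha, zero_mem _, by simpa using ha⟩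
  have kxy : ∀ {w₁ : ℕ → Option (Letter V)} {x y : Quiver.Total V},
      σ.src (.direct y) = σ.st s w₁ n → σ.src (.inverse x) = σ.st s w₁ n →
      ∀ a b, (a, b) ∈ R.step σ (σ.st s w₁ n) (some (.direct y)) →
        (a, 0) ∈ R.step σ (σ.st s w₁ n) (some (.inverse x)) := by
    intro w₁ x y hy hx a b hab
    rw [step_some, mem_lrel_direct] at hab
    rw [step_some, mem_lrel_inverse]
    have h3 : y.right = x.left := congrArg Prod.fst (hy.trans hx.symm)
    refine ⟨?_, ?_⟩
    · rw [hab.1, R.arrow_arrow_eq_zero hR (σ.not_foll (hx.trans hy.symm))]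
    · rw [hab.1, ← h3]
      exact R.arrow_mem_E y b
  have h' : ∀ i < n, w' i = w i := fun i hi => (h i hi).symm
  have hst' : ∀ i ≤ n, σ.st s w' i = σ.st s w i := fun i hi => (hst i hi).symm
  have hs := hst n le_rfl
  rcases hwn : w n with _ | (y | x)
  · rcases hwn' : w' n with _ | (y' | x')
    · exact absurd (hwn.trans hwn'.symm) hn
    · refine Or.inr (key h' hst' ?_)
      rw [hwn, hwn']
      exact ky (hw'.src_eq n _ hwn')
    · refine Or.inl (key h hst ?_)
      rw [hwn, hwn']
      exact kx hwn (by rw [hs]; exact hw'.src_eq n _ hwn')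
  · have e1 := hw.src_eq n _ hwn
    rcases hwn' : w' n with _ | (y' | x')
    · refine Or.inl (key h hst ?_)
      rw [hwn, hwn']
      exact ky e1
    · have e2 := hw'.src_eq n _ hwn'
      have := σ.direct_eq (e1.trans (hs.trans e2.symm))
      subst this
      exact absurd (hwn.trans hwn'.symm) hn
    · refine Or.inl (key h hst ?_)
      rw [hwn, hwn']
      exact kxy e1 (by rw [hs]; exact hw'.src_eq n _ hwn')
  · have e1 := hw.src_eq n _ hwn
    rcases hwn' : w' n with _ | (y' | x')
    · refine Or.inr (key h' hst' ?_)
      rw [hwn, hwn']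
      exact kx hwn' (by rw [← hs]; exact e1)
    · refine Or.inr (key h' hst' ?_)
      rw [hwn, hwn']
      exact kxy (hw'.src_eq n _ hwn') (by rw [← hs]; exact e1)
    · have e2 := hw'.src_eq n _ hwn'
      have := σ.inverse_eq (e1.trans (hs.trans e2.symm))
      subst this
      exact absurd (hwn.trans hwn'.symm) hn

/-- The filtrations given by different words on the same side do not overlap. -/
theorem plus_le_minus_or (hR : ∀ r ∈ ρ, R.path r.path = 0) {s : Side V}
    {w w' : ℕ → Option (Letter V)} (hw : σ.IsWord s w) (hw' : σ.IsWord s w') (hne : w ≠ w') :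
    R.plus σ s w ≤ R.minus σ s w' ∨ R.plus σ s w' ≤ R.minus σ s w := by
  classical
  have h : ∃ n, w n ≠ w' n := by
    by_contra h
    push Not at h
    exact hne (funext h)
  refine R.plus_le_minus_of_first_diff σ hR hw hw' (n := Nat.find h) (fun i hi => ?_)
    (Nat.find_spec h)
  by_contra hi'
  exact Nat.find_min h hi hi'

end QuiverOps

/-! ### Two-sided words and their positions -/

namespace Signs

variable {V : Type v} [Quiver.{w} V] {ρ : Set (QPath V)} (σ : Signs ρ)

theorem IsWord.ne_none_of_le {σ : Signs ρ} {s : Side V} {w : ℕ → Option (Letter V)}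
    (h : σ.IsWord s w) {m n : ℕ} (hmn : m ≤ n) (hn : w n ≠ none) : w m ≠ none := by
  induction n, hmn using Nat.le_induction with
  | base => exact hn
  | succ n _ ih => exact ih fun h' => hn (h.none_succ n h')

/-- A two-sided word whose letters meet on opposite sides, with index set an interval `I`. -/
structure BiWord where
  letter : ℤ → Option (Letter V)
  side : ℤ → Side V
  I : Set ℤ
  conv : ∀ i j t, i ∈ I → j ∈ I → i ≤ t → t ≤ j → t ∈ I
  isSome : ∀ i, (letter i).isSome ↔ i ∈ I ∧ i - 1 ∈ I
  src_eq : ∀ i l, letter i = some l → σ.src l = side (i - 1)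
  dst_eq : ∀ i l, letter i = some l → σ.dst l = side i

/-- A vertex `v`, a word that departs from its positive side, and one that departs from its
negative side. -/
abbrev Triple (V : Type v) [Quiver.{w} V] :=
  V × (ℕ → Option (Letter V)) × (ℕ → Option (Letter V))

/-- The two words of the triple are words on the two sides of the vertex. -/
def IsTriple (t : Triple V) : Prop :=
  σ.IsWord (t.1, true) t.2.1 ∧ σ.IsWord (t.1, false) t.2.2

namespace BiWord

variable {σ} (c : σ.BiWord)

theorem mem_of_letter {i : ℤ} {l : Letter V} (h : c.letter i = some l) : i ∈ c.I ∧ i - 1 ∈ c.I :=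
  (c.isSome i).1 (by simp [h])

theorem exists_letter {i : ℤ} (h : i ∈ c.I) (h' : i - 1 ∈ c.I) : ∃ l, c.letter i = some l :=
  Option.isSome_iff_exists.1 ((c.isSome i).2 ⟨h, h'⟩)

/-- The word read to the right from position `i`. -/
def right (i : ℤ) : ℕ → Option (Letter V) := fun n => c.letter (i + 1 + n)

/-- The word read to the left from position `i`. -/
def left (i : ℤ) : ℕ → Option (Letter V) := fun n => (c.letter (i - n)).map Letter.inv

/-- The inverse word. -/
def rev : σ.BiWord where
  letter i := (c.letter (1 - i)).map Letter.inv
  side i := (c.side (-i)).flip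
  I := {i | -i ∈ c.I}
  conv i j t hi hj h1 h2 := c.conv (-j) (-i) (-t) hj hi (by omega) (by omega)
  isSome i := by
    rw [Option.isSome_map, c.isSome, and_comm]
    simp only [Set.mem_ofPred]
    rw [show 1 - i - 1 = -i by ring, show 1 - i = -(i - 1) by ring]
  src_eq i l h := by
    obtain ⟨l', h', rfl⟩ := Option.map_eq_some_iff.1 h
    rw [σ.src_inv, c.dst_eq _ _ h', show 1 - i = -(i - 1) by ring]
  dst_eq i l h := by
    obtain ⟨l', h', rfl⟩ := Option.map_eq_some_iff.1 h
    rw [σ.dst_inv, c.src_eq _ _ h', show 1 - i - 1 = -i by ring]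

theorem rev_right (i : ℤ) : c.rev.right (-i) = c.left i := by
  funext n
  simp only [right, rev, left]
  congr 2
  ring

theorem rev_left (i : ℤ) : c.rev.left (-i) = c.right i := by
  funext n
  simp only [right, rev, left, Option.map_map]
  rw [show Letter.inv ∘ Letter.inv = id from funext fun l : Letter V => l.inv_inv,
    Option.map_id, id]
  congr 1
  ring

theorem st_right {i : ℤ} {n : ℕ} (hi : i ∈ c.I) (h : i + n ∈ c.I) :
    σ.st (c.side i) (c.right i) n = c.side (i + n) := by
  induction n with
  | zero => simp
  | succ n ih =>
    have h1 : i + n ∈ c.I := c.conv i _ _ hi h (by omega) (by omega)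
    obtain ⟨l, hl⟩ := c.exists_letter h (by rwa [show i + (n + 1 : ℕ) - 1 = i + n by push_cast; ring])
    rw [σ.st_succ_some (l := l), c.dst_eq _ _ hl]
    simp only [right, ← hl]
    congr 1
    push_cast
    ring

theorem right_isWord {i : ℤ} (hi : i ∈ c.I) : σ.IsWord (c.side i) (c.right i) where
  src_eq n l h := by
    have h1 := (c.mem_of_letter h).2
    rw [show i + 1 + n - 1 = i + n by ring] at h1
    rw [c.st_right hi h1, c.src_eq _ _ h, show i + 1 + n - 1 = i + n by ring]
  none_succ n h := by
    by_contra h'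
    obtain ⟨l, hl⟩ := Option.ne_none_iff_exists'.1 h'
    have h1 := c.mem_of_letter hl
    have h2 : i + 1 + n ∈ c.I := c.conv i _ _ hi h1.1 (by omega) (by push_cast; omega)
    have h3 : i + n ∈ c.I := c.conv i _ _ hi h1.1 (by omega) (by push_cast; omega)
    obtain ⟨l', hl'⟩ := c.exists_letter h2 (by rwa [show i + 1 + n - 1 = i + n by ring])
    simp [right, hl'] at h

theorem mem_rev {i : ℤ} : i ∈ c.rev.I ↔ -i ∈ c.I := Iff.rfl

theorem left_isWord {i : ℤ} (hi : i ∈ c.I) : σ.IsWord (c.side i).flip (c.left i) := by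
  have := c.rev.right_isWord (i := -i) (by rwa [mem_rev, neg_neg])
  rw [rev_right] at this
  simpa [rev] using this

theorem right_zero {i : ℤ} : c.right i 0 = c.letter (i + 1) := by simp [right]

theorem right_succ (i : ℤ) : (fun n => c.right i (n + 1)) = c.right (i + 1) := by
  funext n
  simp only [right]
  congr 1
  push_cast
  ring

theorem left_zero {i : ℤ} : c.left i 0 = (c.letter i).map Letter.inv := by simp [left]

theorem left_succ (i : ℤ) : (fun n => c.left (i + 1) (n + 1)) = c.left i := by
  funext n
  simp only [left]
  congr 2
  push_cast
  ring

/-- The triple of a position of a two-sided word. -/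
def triple (i : ℤ) : Triple V :=
  ((c.side i).1, if (c.side i).2 then (c.right i, c.left i) else (c.left i, c.right i))

theorem triple_isTriple {i : ℤ} (hi : i ∈ c.I) : σ.IsTriple (c.triple i) := by
  have h1 := c.right_isWord hi
  have h2 := c.left_isWord hi
  unfold IsTriple triple
  rcases h : c.side i with ⟨v, _ | _⟩ <;> simp only [h, Side.flip] at h1 h2 ⊢
  · exact ⟨h2, h1⟩
  · exact ⟨h1, h2⟩

theorem rev_triple (i : ℤ) : c.rev.triple (-i) = c.triple i := by
  unfold triple
  rw [rev_right, rev_left]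
  have : c.rev.side (-i) = (c.side i).flip := by simp [rev]
  rw [this]
  rcases h : c.side i with ⟨v, _ | _⟩ <;> simp [Side.flip]

theorem letter_eq_none_of_right {i : ℤ} {n : ℕ} (hi : i ∈ c.I) :
    c.right i n ≠ none ↔ i + 1 + n ∈ c.I := by
  rw [← Option.isSome_iff_ne_none]
  unfold right
  rw [c.isSome]
  exact ⟨fun h => h.1, fun h => ⟨h, c.conv i _ _ hi h (by omega) (by omega)⟩⟩

end BiWord

variable {σ}

/-- The two-sided word with a given triple at position zero. -/
def ofTriple (t : Triple V) (ht : σ.IsTriple t) : σ.BiWord where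
  -- The word on the negative side is read to the right from position `0`; the word on the positive
  -- side, inverted, fills the positions up to `0`.
  letter i := if 0 < i then t.2.2 (i - 1).toNat else (t.2.1 (-i).toNat).map Letter.inv
  side i := if 0 ≤ i then σ.st (t.1, false) t.2.2 i.toNat
    else (σ.st (t.1, true) t.2.1 (-i).toNat).flip
  I := {i | (0 < i → t.2.2 (i - 1).toNat ≠ none) ∧ (i < 0 → t.2.1 (-i - 1).toNat ≠ none)}
  conv i j s hi hj h1 h2 :=
    ⟨fun h => ht.2.ne_none_of_le (by omega) (hj.1 (by omega)),
      fun h => ht.1.ne_none_of_le (by omega) (hi.2 (by omega))⟩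
  isSome i := by
    simp only [Set.mem_ofPred]
    split_ifs with h
    · rw [Option.isSome_iff_ne_none]
      exact ⟨fun h' => ⟨⟨fun _ => h', fun _ => by omega⟩,
        ⟨fun _ => ht.2.ne_none_of_le (by omega) h', fun _ => by omega⟩⟩, fun h' => h'.1.1 h⟩
    · rw [Option.isSome_map, Option.isSome_iff_ne_none, show -(i - 1) - 1 = -i by ring]
      exact ⟨fun h' => ⟨⟨fun _ => by omega, fun _ => ht.1.ne_none_of_le (by omega) h'⟩,
        ⟨fun _ => by omega, fun _ => h'⟩⟩, fun h' => h'.2.2 (by omega)⟩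
  src_eq i l h := by
    split_ifs at h with h0
    · rw [if_pos (by omega), ht.2.src_eq _ _ h]
    · obtain ⟨l', h', rfl⟩ := Option.map_eq_some_iff.1 h
      rw [if_neg (by omega), σ.src_inv, show (-(i - 1)).toNat = (-i).toNat + 1 by omega,
        σ.st_succ_some h']
  dst_eq i l h := by
    split_ifs at h with h0
    · rw [if_pos (by omega), show i.toNat = (i - 1).toNat + 1 by omega, σ.st_succ_some h]
    · obtain ⟨l', h', rfl⟩ := Option.map_eq_some_iff.1 h
      rw [σ.dst_inv, ht.1.src_eq _ _ h']
      split_ifs with h1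
      · obtain rfl : i = 0 := by omega
        rfl
      · rfl

theorem zero_mem_ofTriple (t : Triple V) (ht : σ.IsTriple t) : (0 : ℤ) ∈ (ofTriple t ht).I :=
  ⟨fun h => by omega, fun h => by omega⟩

theorem ofTriple_triple_zero (t : Triple V) (ht : σ.IsTriple t) :
    (ofTriple t ht).triple 0 = t := by
  obtain ⟨v, B, D⟩ := t
  have h1 : (ofTriple (v, B, D) ht).right 0 = D := by
    funext n
    simp only [BiWord.right, ofTriple]
    rw [if_pos (by omega)]
    congr 1
    omega
  have h2 : (ofTriple (v, B, D) ht).left 0 = B := by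
    funext n
    simp only [BiWord.left, ofTriple]
    rw [if_neg (by omega), Option.map_map,
      show Letter.inv ∘ Letter.inv = id from funext fun l : Letter V => l.inv_inv, Option.map_id, id]
    congr 1
    omega
  have h3 : (ofTriple (v, B, D) ht).side 0 = (v, false) := by simp [ofTriple]
  simp [BiWord.triple, h1, h2, h3]

namespace BiWord

variable (c : σ.BiWord)

/-- `ofTriple` puts the negative side of the vertex to the right, so for a negative side at `i` the
rebuilt word is the given one translated by `i`. A positive side is treated through the inverse
word. -/
theorem ofTriple_triple_of_false {i : ℤ} (hi : i ∈ c.I) (hs : (c.side i).2 = false) :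
    ∃ ht : σ.IsTriple (c.triple i), (∀ j, j ∈ (ofTriple _ ht).I ↔ i + j ∈ c.I) ∧
      ∀ j ∈ (ofTriple _ ht).I, (ofTriple _ ht).triple j = c.triple (i + j) := by
  suffices H : ∀ t (hT : σ.IsTriple t), t = ((c.side i).1, c.left i, c.right i) →
      (∀ j, j ∈ (ofTriple t hT).I ↔ i + j ∈ c.I) ∧
      ∀ j ∈ (ofTriple t hT).I, (ofTriple t hT).triple j = c.triple (i + j) from
    ⟨c.triple_isTriple hi, H _ _ (by simp [triple, hs])⟩
  have hside : c.side i = ((c.side i).1, false) := by rw [← hs]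
  have hside' : (c.side i).flip = ((c.side i).1, true) := by simp [Side.flip, hs]
  rintro _ hT rfl
  have hlet : ∀ j, (ofTriple _ hT).letter j = c.letter (i + j) := by
    intro j
    simp only [ofTriple, right, left]
    split_ifs with h
    · congr 1; omega
    · rw [Option.map_map, show Letter.inv ∘ Letter.inv = id from
        funext fun l : Letter V => l.inv_inv, Option.map_id, id]
      congr 1; omega
  have hI : ∀ j, j ∈ (ofTriple _ hT).I ↔ i + j ∈ c.I := by
    intro j
    have h1 : c.right i (j - 1).toNat ≠ none ↔ i + 1 + (j - 1).toNat ∈ c.I :=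
      c.letter_eq_none_of_right hi
    have h2 : c.left i (-j - 1).toNat ≠ none ↔ -(-i + 1 + (-j - 1).toNat) ∈ c.I := by
      rw [← rev_right]
      exact c.rev.letter_eq_none_of_right (by rwa [mem_rev, neg_neg])
    simp only [ofTriple, Set.mem_ofPred, h1, h2]
    rcases lt_trichotomy j 0 with h | rfl | h
    · rw [show -(-i + 1 + ((-j - 1).toNat : ℤ)) = i + j by omega]
      exact ⟨fun h' => h'.2 h, fun h' => ⟨fun _ => by omega, fun _ => h'⟩⟩
    · simp [hi]
    · rw [show i + 1 + ((j - 1).toNat : ℤ) = i + j by omega]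
      exact ⟨fun h' => h'.1 h, fun h' => ⟨fun _ => h', fun _ => by omega⟩⟩
  refine ⟨hI, fun j hj => ?_⟩
  have hj' := (hI j).1 hj
  have h1 : (ofTriple _ hT).right j = c.right (i + j) := by
    funext n
    simp only [right, hlet]
    congr 1; ring
  have h2 : (ofTriple _ hT).left j = c.left (i + j) := by
    funext n
    simp only [left, hlet]
    congr 2; ring
  have h3 : (ofTriple _ hT).side j = c.side (i + j) := by
    simp only [ofTriple]
    split_ifs with h
    · rw [← hside, c.st_right hi (by rwa [Int.toNat_of_nonneg h]), Int.toNat_of_nonneg h]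
    · have := c.rev.st_right (i := -i) (n := (-j).toNat) (by rwa [mem_rev, neg_neg])
        (by rw [mem_rev]; convert hj' using 1; omega)
      rw [rev_right] at this
      simp only [rev, neg_neg] at this
      rw [hside'] at this
      rw [this, Side.flip_flip]
      congr 1; omega
  unfold triple
  rw [h1, h2, h3]

theorem ofTriple_triple {i : ℤ} (hi : i ∈ c.I) :
    ∃ ht : σ.IsTriple (c.triple i),
      (∀ j ∈ c.I, ∃ j' ∈ (ofTriple _ ht).I, (ofTriple _ ht).triple j' = c.triple j) ∧
      ∀ j' ∈ (ofTriple _ ht).I, ∃ j ∈ c.I, (ofTriple _ ht).triple j' = c.triple j := by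
  rcases hs : (c.side i).2
  · obtain ⟨ht, h1, h2⟩ := c.ofTriple_triple_of_false hi hs
    refine ⟨ht, fun j hj => ?_, fun j' hj' => ⟨i + j', (h1 j').1 hj', h2 j' hj'⟩⟩
    have : j - i ∈ (ofTriple _ ht).I := (h1 _).2 (by rwa [add_sub_cancel])
    exact ⟨j - i, this, by rw [h2 _ this, add_sub_cancel]⟩
  · have hi' : -i ∈ c.rev.I := by rwa [mem_rev, neg_neg]
    have hx := c.rev.ofTriple_triple_of_false hi' (by simp [rev, Side.flip, hs])
    rw [rev_triple] at hx
    obtain ⟨ht, h1, h2⟩ := hx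
    refine ⟨ht, fun j hj => ?_, fun j' hj' => ⟨-(-i + j'), (h1 j').1 hj', ?_⟩⟩
    · have : -j + i ∈ (ofTriple _ ht).I := (h1 _).2 (by rw [mem_rev]; convert hj using 1; ring)
      refine ⟨-j + i, this, ?_⟩
      rw [h2 _ this, ← c.rev_triple j]
      congr 1; ring
    · rw [h2 _ hj', ← c.rev_triple (-(-i + j')), neg_neg]

/-- Two positions of a two-sided word with the same triple differ by a period. -/
theorem period_of_triple_eq {i j : ℤ} (hi : i ∈ c.I) (hj : j ∈ c.I) (hij : i < j)
    (h : c.triple i = c.triple j) : (∀ t, c.letter (t + (j - i)) = c.letter t) ∧ c.I = Set.univ := by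
  have hletter : ∀ t, i < t → t ≤ j → ∃ l, c.letter t = some l := fun t h1 h2 =>
    c.exists_letter (c.conv i j t hi hj h1.le h2) (c.conv i j _ hi hj (by omega) (by omega))
  have hcase : (c.right i = c.right j ∧ c.left i = c.left j) ∨
      (c.right i = c.left j ∧ c.left i = c.right j) := by
    unfold triple at h
    have h2 := congrArg Prod.snd h
    split_ifs at h2 <;> simp at h2 <;> tauto
  rcases hcase with ⟨h1, h2⟩ | ⟨h1, h2⟩
  · have hper : ∀ t, c.letter (t + (j - i)) = c.letter t := by
      intro t
      by_cases ht : i < t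
      · have := congrFun h1 (t - i - 1).toNat
        simp only [right] at this
        rw [show i + 1 + ((t - i - 1).toNat : ℤ) = t by omega,
          show j + 1 + ((t - i - 1).toNat : ℤ) = t + (j - i) by omega] at this
        exact this.symm
      · have := congrFun h2 (i - t).toNat
        simp only [left] at this
        rw [show i - ((i - t).toNat : ℤ) = t by omega,
          show j - ((i - t).toNat : ℤ) = t + (j - i) by omega] at this
        refine (Option.map_injective (fun a b hab => ?_) this).symm
        rw [← a.inv_inv, hab, b.inv_inv]
    refine ⟨hper, Set.eq_univ_of_forall ?_⟩
    -- There are letters at all positions after `i` up to `j`, which make up a full period, hence at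
    -- all positions.
    have key : ∀ n : ℕ, ∀ t, c.letter (t + n * (j - i)) = c.letter t := by
      intro n
      induction n with
      | zero => intro t; simp
      | succ n ih => intro t; rw [← ih t, ← hper (t + n * (j - i))]; congr 1; push_cast; ring
    have key' : ∀ n : ℤ, ∀ t, c.letter (t + n * (j - i)) = c.letter t := by
      intro n t
      rcases Int.eq_nat_or_neg n with ⟨m, rfl | rfl⟩
      · exact key m t
      · rw [← key m]; congr 1; ring
    intro t
    have hpos : 0 < j - i := by omega
    have hd := Int.emod_add_mul_ediv (t - i - 1) (j - i)
    have hr := Int.emod_nonneg (t - i - 1) hpos.ne'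
    have hr' := Int.emod_lt_of_pos (t - i - 1) hpos
    obtain ⟨l, hl⟩ := hletter (i + 1 + (t - i - 1) % (j - i)) (by omega) (by omega)
    rw [← key' ((t - i - 1) / (j - i))] at hl
    have : i + 1 + (t - i - 1) % (j - i) + (t - i - 1) / (j - i) * (j - i) = t := by
      linear_combination hd
    rw [this] at hl
    exact (c.mem_of_letter hl).1
  -- Now the word coincides with its own reflection about the middle between `i` and `j`. If the
  -- middle is a position, a letter is followed by its inverse, against the signs; otherwise a
  -- letter is its own inverse.
  · exfalso
    have hrefl : ∀ t, i < t → t ≤ j → c.letter t = (c.letter (i + j + 1 - t)).map Letter.inv := by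
      intro t h3 h4
      have := congrFun h1 (t - i - 1).toNat
      simp only [right, left] at this
      rwa [show i + 1 + ((t - i - 1).toNat : ℤ) = t by omega,
        show j - ((t - i - 1).toNat : ℤ) = i + j + 1 - t by omega] at this
    rcases Int.even_or_odd' (i + j) with ⟨m, hm | hm⟩
    · obtain ⟨l, hl⟩ := hletter m (by omega) (by omega)
      have h3 := hrefl (m + 1) (by omega) (by omega)
      rw [show i + j + 1 - (m + 1) = m by omega, hl] at h3
      have h4 := c.src_eq _ _ h3
      rw [σ.src_inv, c.dst_eq _ _ hl, add_sub_cancel_right] at h4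
      exact Side.flip_ne _ h4
    · obtain ⟨l, hl⟩ := hletter (m + 1) (by omega) (by omega)
      have h3 := hrefl (m + 1) (by omega) (by omega)
      rw [show i + j + 1 - (m + 1) = m + 1 by omega, hl] at h3
      simp only [Option.map_some, Option.some.injEq] at h3
      exact l.inv_ne h3.symm

/-- A two-sided word that is infinite in both directions and periodic. -/
def IsPer : Prop := c.I = Set.univ ∧ ∃ n : ℕ, 0 < n ∧ ∀ t, c.letter (t + n) = c.letter t

open Classical in
/-- The period of a periodic word. -/
def per : ℕ := if h : c.IsPer then Nat.find h.2 else 0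

variable {c}

theorem IsPer.per_pos (h : c.IsPer) : 0 < c.per := by
  classical
  rw [per, dif_pos h]
  exact (Nat.find_spec h.2).1

theorem IsPer.letter_add (h : c.IsPer) (t : ℤ) : c.letter (t + c.per) = c.letter t := by
  classical
  rw [per, dif_pos h]
  exact (Nat.find_spec h.2).2 t

theorem IsPer.per_le (h : c.IsPer) {n : ℕ} (hn : 0 < n)
    (h' : ∀ t, c.letter (t + n) = c.letter t) : c.per ≤ n := by
  classical
  rw [per, dif_pos h]
  exact Nat.find_min' h.2 ⟨hn, h'⟩

theorem IsPer.mem (h : c.IsPer) (i : ℤ) : i ∈ c.I := by rw [h.1]; trivial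

theorem IsPer.letter_add_mul (h : c.IsPer) (t n : ℤ) :
    c.letter (t + n * c.per) = c.letter t := by
  induction n using Int.induction_on generalizing t with
  | zero => simp
  | succ n ih => rw [← ih t, ← h.letter_add (t + n * c.per)]; congr 1; ring
  | pred n ih =>
    rw [← ih t, ← h.letter_add (t + (-n - 1) * c.per)]; congr 1; ring

theorem IsPer.side_add_mul (h : c.IsPer) (t n : ℤ) : c.side (t + n * c.per) = c.side t := by
  obtain ⟨l, hl⟩ := c.exists_letter (h.mem t) (h.mem _)
  rw [← c.dst_eq _ _ hl, ← c.dst_eq (t + n * c.per) l (by rw [h.letter_add_mul, hl])]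

theorem IsPer.right_add_mul (h : c.IsPer) (t n : ℤ) : c.right (t + n * c.per) = c.right t := by
  funext m
  simp only [right]
  rw [← h.letter_add_mul (t + 1 + m) n]
  congr 1; ring

theorem IsPer.left_add_mul (h : c.IsPer) (t n : ℤ) : c.left (t + n * c.per) = c.left t := by
  funext m
  simp only [left]
  rw [← h.letter_add_mul (t - m) n]
  congr 2; ring

theorem IsPer.triple_add_mul (h : c.IsPer) (t n : ℤ) :
    c.triple (t + n * c.per) = c.triple t := by
  unfold triple
  rw [h.right_add_mul, h.left_add_mul, h.side_add_mul]

variable (c)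

open Classical in
/-- A set of positions at which every triple of the word occurs exactly once. -/
def J : Set ℤ := if c.IsPer then Set.Ico 0 (c.per : ℤ) else c.I

theorem J_subset : c.J ⊆ c.I := by
  unfold J
  split_ifs with h
  · intro i _
    exact h.mem i
  · exact subset_rfl

theorem exists_mem_J {i : ℤ} (hi : i ∈ c.I) : ∃ j ∈ c.J, c.triple j = c.triple i := by
  unfold J
  split_ifs with h
  · have hp : (0 : ℤ) < c.per := by exact_mod_cast h.per_pos
    refine ⟨i % c.per, ⟨Int.emod_nonneg _ hp.ne', Int.emod_lt_of_pos _ hp⟩, ?_⟩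
    rw [← h.triple_add_mul (i % c.per) (i / c.per), Int.emod_add_ediv_mul]
  · exact ⟨i, hi, rfl⟩

/-- Two positions with equal triples differ by a period, and two positions in `[0, per)` differ by
less than the least one. -/
theorem triple_injOn : c.J.InjOn c.triple := by
  have key : ∀ i ∈ c.J, ∀ j ∈ c.J, i < j → c.triple i ≠ c.triple j := by
    intro i hi j hj hij h
    obtain ⟨h1, h2⟩ := c.period_of_triple_eq (c.J_subset hi) (c.J_subset hj) hij h
    have h1' : ∀ t, c.letter (t + (j - i).toNat) = c.letter t := by
      intro t
      rw [Int.toNat_of_nonneg (by omega)]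
      exact h1 t
    have hp : c.IsPer := ⟨h2, (j - i).toNat, by omega, h1'⟩
    have := hp.per_le (by omega) h1'
    rw [J, if_pos hp] at hi hj
    have h3 := hi.1
    have h4 := hj.2
    omega
  intro i hi j hj h
  rcases lt_trichotomy i j with h' | h' | h'
  · exact absurd h (key i hi j hj h')
  · exact h'
  · exact absurd h.symm (key j hj i hi h')

end BiWord

variable (σ)

/-- Triples are equivalent if they are triples of positions of the same two-sided word. -/
def tripleSetoid : Setoid {t : Triple V // σ.IsTriple t} where
  r t t' := ∃ i ∈ (ofTriple t.1 t.2).I, (ofTriple t.1 t.2).triple i = t'.1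
  iseqv :=
    { refl := fun t => ⟨0, zero_mem_ofTriple _ _, ofTriple_triple_zero _ _⟩
      symm := by
        rintro ⟨t, ht⟩ ⟨t', ht'⟩ ⟨i, hi, h⟩
        obtain ⟨h1, h2, -⟩ := (ofTriple t ht).ofTriple_triple hi
        obtain ⟨j, hj, hj'⟩ := h2 0 (zero_mem_ofTriple _ _)
        rw [ofTriple_triple_zero] at hj'
        simp only at h
        subst h
        exact ⟨j, hj, hj'⟩
      trans := by
        rintro ⟨t, ht⟩ ⟨t', ht'⟩ ⟨t'', ht''⟩ ⟨i, hi, h⟩ ⟨j, hj, h'⟩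
        obtain ⟨h1, -, h2⟩ := (ofTriple t ht).ofTriple_triple hi
        simp only at h h'
        subst h
        obtain ⟨j', hj', hj''⟩ := h2 j hj
        exact ⟨j', hj', hj''.symm.trans h'⟩ }

/-- The equivalence classes of triples, which correspond to the two-sided words up to shift and
inversion. -/
def Class : Type (max v w) := Quotient σ.tripleSetoid

variable {σ}

/-- A two-sided word in a given class. -/
def Class.word (p : σ.Class) : σ.BiWord := ofTriple (Quotient.out p).1 (Quotient.out p).2

theorem Class.zero_mem (p : σ.Class) : (0 : ℤ) ∈ p.word.I := zero_mem_ofTriple _ _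

theorem Class.exists_triple_eq {t : Triple V} (ht : σ.IsTriple t) :
    ∃ p : σ.Class, ∃ i ∈ p.word.J, p.word.triple i = t := by
  let p : σ.Class := Quotient.mk σ.tripleSetoid ⟨t, ht⟩
  have h : σ.tripleSetoid.r (Quotient.out p) ⟨t, ht⟩ := Quotient.mk_out (s := σ.tripleSetoid) _
  obtain ⟨i, hi, h⟩ := h
  obtain ⟨j, hj, h'⟩ := p.word.exists_mem_J hi
  exact ⟨p, j, hj, h'.trans h⟩

theorem Class.eq_of_triple_eq {p q : σ.Class} {i j : ℤ} (hi : i ∈ p.word.J) (hj : j ∈ q.word.J)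
    (h : p.word.triple i = q.word.triple j) : p = q ∧ i = j := by
  have ht := p.word.triple_isTriple (p.word.J_subset hi)
  have h1 : σ.tripleSetoid.r (Quotient.out p) ⟨_, ht⟩ := ⟨i, p.word.J_subset hi, rfl⟩
  have h2 : σ.tripleSetoid.r (Quotient.out q) ⟨_, ht⟩ := ⟨j, q.word.J_subset hj, h.symm⟩
  have h3 : p = q := by
    have := Quotient.sound (s := σ.tripleSetoid) (a := Quotient.out p) (b := ⟨_, ht⟩) h1
    have h' := Quotient.sound (s := σ.tripleSetoid) (a := Quotient.out q) (b := ⟨_, ht⟩) h2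
    exact (Quotient.out_eq p).symm.trans ((this.trans h'.symm).trans (Quotient.out_eq q))
  subst h3
  exact ⟨rfl, p.word.triple_injOn hi hj h⟩

end Signs

/-! ### Bases of subquotients -/

section BasisMod

variable {k : Type u} [Field k] {M : Type x} [AddCommGroup M] [Module k M]

theorem linearCombination_mem {ι : Type*} {x : ι → M} {a : ι →₀ k} {N : Submodule k M}
    (h : ∀ i ∈ a.support, x i ∈ N) : Finsupp.linearCombination k x a ∈ N := by
  rw [Finsupp.linearCombination_apply]
  exact N.sum_mem fun i hi => N.smul_mem _ (h i hi)

/-- The family `x` of elements of `P` induces a basis of the subquotient `P / (P ∩ Q)`. -/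
structure IsBasisMod (P Q : Submodule k M) {β : Type*} (x : β → M) : Prop where
  mem : ∀ u, x u ∈ P
  indep : ∀ a : β →₀ k, Finsupp.linearCombination k x a ∈ Q → a = 0
  span : P ≤ Submodule.span k (Set.range x) ⊔ Q

theorem exists_isBasisMod (P Q : Submodule k M) :
    ∃ (β : Type x) (x : β → M), IsBasisMod P Q x := by
  let P' := P.map Q.mkQ
  let b := Module.Basis.ofVectorSpace k P'
  have hb : ∀ u, ∃ m ∈ P, Q.mkQ m = b u := fun u => Submodule.mem_map.1 (b u).2
  choose x hx hx' using hb
  refine ⟨_, x, hx, fun a ha => ?_, fun m hm => ?_⟩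
  · have h1 : Q.mkQ (Finsupp.linearCombination k x a) = 0 := (Submodule.Quotient.mk_eq_zero Q).2 ha
    have h2 : (Finsupp.linearCombination k b a : P') = 0 := by
      apply Subtype.ext
      rw [← Submodule.subtype_apply, Finsupp.apply_linearCombination]
      rw [Finsupp.apply_linearCombination] at h1
      rw [ZeroMemClass.coe_zero, ← h1]
      congr 2
      funext u
      exact (hx' u).symm
    exact linearIndependent_iff.1 b.linearIndependent a h2
  · let a := b.repr ⟨Q.mkQ m, Submodule.mem_map_of_mem hm⟩
    have h2 : (Finsupp.linearCombination k b a : P') = ⟨Q.mkQ m, Submodule.mem_map_of_mem hm⟩ :=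
      b.linearCombination_repr _
    have h3 := congrArg P'.subtype h2
    rw [Finsupp.apply_linearCombination] at h3
    have h4 : Q.mkQ (Finsupp.linearCombination k x a) = Q.mkQ m := by
      rw [Finsupp.apply_linearCombination]
      refine Eq.trans ?_ h3
      congr 2
      funext u
      exact hx' u
    have h5 : m - Finsupp.linearCombination k x a ∈ Q := by
      rw [← Submodule.Quotient.mk_eq_zero, ← Submodule.mkQ_apply, map_sub, h4, sub_self]
    rw [← add_sub_cancel (Finsupp.linearCombination k x a) m]
    exact Submodule.add_mem_sup (linearCombination_mem fun u _ =>
      Submodule.subset_span ⟨u, rfl⟩) h5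

theorem linearCombination_mem_rel {β : Type*} {x y : β → M} {r : Submodule k (M × M)}
    (h : ∀ u, (x u, y u) ∈ r) (a : β →₀ k) :
    (Finsupp.linearCombination k x a, Finsupp.linearCombination k y a) ∈ r := by
  have := linearCombination_mem (x := fun u => (x u, y u)) (a := a) (N := r) fun u _ => h u
  convert this using 1
  refine Prod.ext ?_ ?_
  · exact (Finsupp.apply_linearCombination k (LinearMap.fst k M M) (fun u => (x u, y u)) a).symm
  · exact (Finsupp.apply_linearCombination k (LinearMap.snd k M M) (fun u => (x u, y u)) a).symm

/-- Transport of a basis of a subquotient along a linear relation that induces a bijection. -/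
theorem IsBasisMod.transport {P Q P' Q' : Submodule k M} {r : Submodule k (M × M)} {β : Type*}
    {x y : β → M} (hx : IsBasisMod P Q x) (hy : ∀ u, y u ∈ P') (hxy : ∀ u, (x u, y u) ∈ r)
    (h2 : ∀ b ∈ P', ∃ a ∈ P, (a, b) ∈ r)
    (h3 : ∀ a b, (a, b) ∈ r → a ∈ P → b ∈ P' → (a ∈ Q ↔ b ∈ Q')) : IsBasisMod P' Q' y where
  mem := hy
  indep a ha := hx.indep a ((h3 _ _ (linearCombination_mem_rel hxy a)
    (linearCombination_mem fun u _ => hx.mem u) (linearCombination_mem fun u _ => hy u)).2 ha)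
  span b hb := by
    obtain ⟨a, ha, hab⟩ := h2 b hb
    obtain ⟨s, hs, q, hq, rfl⟩ := Submodule.mem_sup.1 (hx.span ha)
    obtain ⟨f, rfl⟩ := (Finsupp.mem_span_range_iff_exists_finsupp (R := k)).1 hs
    have e1 : (f.sum fun i c => c • x i) = Finsupp.linearCombination k x f := rfl
    rw [e1] at ha hab
    have h4 := r.sub_mem hab (linearCombination_mem_rel hxy f)
    simp only [Prod.mk_sub_mk, add_sub_cancel_left] at h4
    have hy' : Finsupp.linearCombination k y f ∈ P' := linearCombination_mem fun u _ => hy u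
    have h5 : q ∈ P := by
      have := P.sub_mem ha (linearCombination_mem (x := x) (a := f) fun u _ => hx.mem u)
      simpa using this
    have h6 := (h3 _ _ h4 h5 (sub_mem hb hy')).1 hq
    rw [← add_sub_cancel (Finsupp.linearCombination k y f) b]
    exact Submodule.add_mem_sup (linearCombination_mem fun u _ =>
      Submodule.subset_span ⟨u, rfl⟩) h6

/-- Lifts may be changed by elements of `Q`. This is the freedom used to straighten the families of
periodic words and to correct the tails of the others. -/
theorem IsBasisMod.congr {P Q : Submodule k M} {β : Type*} {x y : β → M} (hx : IsBasisMod P Q x)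
    (hQ : Q ≤ P) (h : ∀ u, y u - x u ∈ Q) : IsBasisMod P Q y where
  mem u := by
    rw [← sub_add_cancel (y u) (x u)]
    exact add_mem (hQ (h u)) (hx.mem u)
  indep a ha := by
    refine hx.indep a ?_
    have h1 : Finsupp.linearCombination k (fun u => y u - x u) a ∈ Q :=
      linearCombination_mem fun u _ => h u
    have h2 : Finsupp.linearCombination k (fun u => y u - x u) a =
        Finsupp.linearCombination k y a - Finsupp.linearCombination k x a := by
      simp only [Finsupp.linearCombination_apply, Finsupp.sum, smul_sub, Finset.sum_sub_distrib]
    rw [h2] at h1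
    simpa using sub_mem ha h1
  span := hx.span.trans (sup_le (Submodule.span_le.2 (by
    rintro _ ⟨u, rfl⟩
    have h1 : y u - (y u - x u) ∈ Submodule.span k (Set.range y) ⊔ Q := sub_mem
      (Submodule.mem_sup_left (Submodule.subset_span ⟨u, rfl⟩)) (Submodule.mem_sup_right (h u))
    rwa [sub_sub_cancel] at h1)) le_sup_right)

theorem exists_max_of_total {α : Type*} (r : α → α → Prop) (htrans : ∀ a b c, r a b → r b c → r a c)
    (S : Finset α) (hS : S.Nonempty) (htot : ∀ a ∈ S, ∀ b ∈ S, a ≠ b → r a b ∨ r b a) :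
    ∃ a ∈ S, ∀ b ∈ S, b ≠ a → r b a := by
  classical
  induction hS using Finset.Nonempty.cons_induction with
  | singleton a => exact ⟨a, by simp, fun b hb hne => absurd (by simpa using hb) hne⟩
  | cons a S ha hS ih =>
    obtain ⟨m, hm, hmax⟩ := ih fun a ha b hb => htot a (by simp [ha]) b (by simp [hb])
    rcases htot a (by simp) m (by simp [hm]) (fun h => ha (h ▸ hm)) with h | h
    · refine ⟨m, by simp [hm], fun b hb hne => ?_⟩
      rcases Finset.mem_cons.1 hb with rfl | hb
      · exact h
      · exact hmax b hb hne
    · refine ⟨a, by simp, fun b hb hne => ?_⟩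
      rcases Finset.mem_cons.1 hb with rfl | hb
      · exact absurd rfl hne
      · by_cases hbm : b = m
        · rw [hbm]; exact h
        · exact htrans _ _ _ (hmax b hb hbm) h

end BasisMod

namespace QuiverOps

variable {k : Type u} [Field k] {V : Type v} [Quiver.{w} V] {ρ : Set (QPath V)}
  {M : Type x} [AddCommGroup M] [Module k M] (R : QuiverOps k V M) (σ : Signs ρ)

/-! ### The subspaces defined by positions of two-sided words -/

/-- The subspace `F⁺` of a triple. -/
def tplus (t : Signs.Triple V) : Submodule k M :=
  R.plus σ (t.1, true) t.2.1 ⊓ R.plus σ (t.1, false) t.2.2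

/-- The subspace `F⁻` of a triple. -/
def tminus (t : Signs.Triple V) : Submodule k M :=
  (R.plus σ (t.1, true) t.2.1 ⊓ R.minus σ (t.1, false) t.2.2) ⊔
    (R.minus σ (t.1, true) t.2.1 ⊓ R.plus σ (t.1, false) t.2.2)

theorem tminus_le_tplus (t : Signs.Triple V) : R.tminus σ t ≤ R.tplus σ t :=
  sup_le (inf_le_inf le_rfl (R.minus_le_plus σ _ _)) (inf_le_inf (R.minus_le_plus σ _ _) le_rfl)

theorem tplus_le_E {t : Signs.Triple V} (ht : σ.IsTriple t) : R.tplus σ t ≤ R.E t.1 :=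
  inf_le_left.trans (R.plus_le_E σ ht.1)

/-- In a vanishing combination the terms at one vertex already sum to zero. Among their words on the
positive side let `B` be the greatest; all terms with other words lie in B⁻, so the terms with `B`
also sum to an element of B⁻. Among those terms take the greatest word `D` on the negative side. The
terms with triple `(v, B, D)` then sum to an element of F⁻, against `hind`. -/
theorem linearIndependent_of_triples (hR : ∀ r ∈ ρ, R.path r.path = 0) {ι : Type*} (x : ι → M)
    (t : ι → Signs.Triple V) (ht : ∀ i, σ.IsTriple (t i)) (hx : ∀ i, x i ∈ R.tplus σ (t i))
    (hind : ∀ t₀ (a : ι →₀ k), (∀ i ∈ a.support, t i = t₀) →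
      Finsupp.linearCombination k x a ∈ R.tminus σ t₀ → a = 0) : LinearIndependent k x := by
  classical
  rw [linearIndependent_iff]
  intro a ha
  by_contra hne
  obtain ⟨i₀, hi₀⟩ := Finsupp.support_nonempty_iff.2 hne
  let v := (t i₀).1
  have split : ∀ (a : ι →₀ k) (p : ι → Prop), Finsupp.linearCombination k x (a.filter p) +
      Finsupp.linearCombination k x (a.filter fun i => ¬ p i) = Finsupp.linearCombination k x a := by
    intro a p
    rw [← map_add, Finsupp.filter_add_filter_not]
  let a₁ := a.filter fun i => (t i).1 = v
  have ha₁ : Finsupp.linearCombination k x a₁ = 0 := by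
    have h0 := split a fun i => (t i).1 = v
    have h1 : Finsupp.linearCombination k x a₁ ∈ R.E v := linearCombination_mem fun i hi => by
      have hi' := (Finsupp.mem_support_iff.1 hi)
      have : (t i).1 = v := by
        by_contra h
        exact hi' (Finsupp.filter_apply_neg _ _ h)
      rw [← this]
      exact R.tplus_le_E σ (ht i) (hx i)
    have h2 : Finsupp.linearCombination k x (a.filter fun i => ¬ (t i).1 = v) ∈
        LinearMap.ker (R.vert v) := linearCombination_mem fun i hi => by
      have hi' := (Finsupp.mem_support_iff.1 hi)
      have : (t i).1 ≠ v := by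
        intro h
        exact hi' (Finsupp.filter_apply_neg _ _ (by simpa using h))
      exact R.vert_apply_of_ne this.symm (R.tplus_le_E σ (ht i) (hx i))
    have h3 := congrArg (R.vert v) h0
    rw [ha, map_add, LinearMap.mem_ker.1 h2, add_zero, map_zero, R.mem_E.1 h1] at h3
    exact h3
  have hv : ∀ i ∈ a₁.support, (t i).1 = v := fun i hi => by
    by_contra h
    exact (Finsupp.mem_support_iff.1 hi) (Finsupp.filter_apply_neg _ _ h)
  have hi₁ : i₀ ∈ a₁.support := by
    rw [Finsupp.support_filter, Finset.mem_filter]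
    exact ⟨hi₀, rfl⟩
  have hB : ∀ i ∈ a₁.support, σ.IsWord (v, true) (t i).2.1 := fun i hi => by
    rw [← hv i hi]; exact (ht i).1
  have hD : ∀ i ∈ a₁.support, σ.IsWord (v, false) (t i).2.2 := fun i hi => by
    rw [← hv i hi]; exact (ht i).2
  have htrans : ∀ (s : Side V) (b c d : ℕ → Option (Letter V)), R.plus σ s b ≤ R.minus σ s c →
      R.plus σ s c ≤ R.minus σ s d → R.plus σ s b ≤ R.minus σ s d := fun s b c d h1 h2 =>
    h1.trans ((R.minus_le_plus σ s c).trans h2)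
  obtain ⟨B, hBS, hBmax⟩ := exists_max_of_total
    (fun B B' => R.plus σ (v, true) B ≤ R.minus σ (v, true) B') (htrans _)
    (a₁.support.image fun i => (t i).2.1) ⟨_, Finset.mem_image_of_mem _ hi₁⟩ (by
      intro B hB1 B' hB' hne
      obtain ⟨i, hi, rfl⟩ := Finset.mem_image.1 hB1
      obtain ⟨j, hj, rfl⟩ := Finset.mem_image.1 hB'
      exact R.plus_le_minus_or σ hR (hB i hi) (hB j hj) hne)
  obtain ⟨i₂, hi₂, hi₂B⟩ := Finset.mem_image.1 hBS
  let a₂ := a₁.filter fun i => (t i).2.1 = B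
  have hs₂ : ∀ i ∈ a₂.support, i ∈ a₁.support ∧ (t i).2.1 = B := fun i hi => by
    rw [Finsupp.support_filter, Finset.mem_filter] at hi
    exact hi
  have hi₂' : i₂ ∈ a₂.support := by
    rw [Finsupp.support_filter, Finset.mem_filter]
    exact ⟨hi₂, hi₂B⟩
  have hx' : ∀ i ∈ a₁.support, x i ∈ R.plus σ (v, true) (t i).2.1 ∧
      x i ∈ R.plus σ (v, false) (t i).2.2 := fun i hi => by
    rw [← hv i hi]
    exact hx i
  have ha₂ : Finsupp.linearCombination k x a₂ ∈ R.minus σ (v, true) B := by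
    have h0 := split a₁ fun i => (t i).2.1 = B
    rw [ha₁, add_eq_zero_iff_eq_neg] at h0
    rw [h0]
    refine neg_mem (linearCombination_mem fun i hi => ?_)
    rw [Finsupp.support_filter, Finset.mem_filter] at hi
    exact hBmax _ (Finset.mem_image_of_mem _ hi.1) hi.2 (hx' i hi.1).1
  obtain ⟨D, hDS, hDmax⟩ := exists_max_of_total
    (fun D D' => R.plus σ (v, false) D ≤ R.minus σ (v, false) D') (htrans _)
    (a₂.support.image fun i => (t i).2.2) ⟨_, Finset.mem_image_of_mem _ hi₂'⟩ (by
      intro D hD1 D' hD' hne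
      obtain ⟨i, hi, rfl⟩ := Finset.mem_image.1 hD1
      obtain ⟨j, hj, rfl⟩ := Finset.mem_image.1 hD'
      exact R.plus_le_minus_or σ hR (hD i (hs₂ i hi).1) (hD j (hs₂ j hj).1) hne)
  obtain ⟨i₃, hi₃, hi₃D⟩ := Finset.mem_image.1 hDS
  let a₃ := a₂.filter fun i => (t i).2.2 = D
  have hs₃ : ∀ i ∈ a₃.support, i ∈ a₂.support ∧ (t i).2.2 = D := fun i hi => by
    rw [Finsupp.support_filter, Finset.mem_filter] at hi
    exact hi
  have hi₃' : i₃ ∈ a₃.support := by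
    rw [Finsupp.support_filter, Finset.mem_filter]
    exact ⟨hi₃, hi₃D⟩
  have hrest : Finsupp.linearCombination k x (a₂.filter fun i => ¬ (t i).2.2 = D) ∈
      R.plus σ (v, true) B ⊓ R.minus σ (v, false) D := linearCombination_mem fun i hi => by
    rw [Finsupp.support_filter, Finset.mem_filter] at hi
    obtain ⟨h1, h2⟩ := hs₂ i hi.1
    refine ⟨?_, hDmax _ (Finset.mem_image_of_mem _ hi.1) hi.2 (hx' i h1).2⟩
    rw [← h2]
    exact (hx' i h1).1
  have h3p : Finsupp.linearCombination k x a₃ ∈ R.plus σ (v, false) D :=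
    linearCombination_mem fun i hi => by
      obtain ⟨h1, h2⟩ := hs₃ i hi
      rw [← h2]
      exact (hx' i (hs₂ i h1).1).2
  have h0 := split a₂ fun i => (t i).2.2 = D
  -- The sum over `a₂` lies in B⁻ ∩ D⁺, and the part of it without the word `D` lies in B⁺ ∩ D⁻.
  have h4 : Finsupp.linearCombination k x a₃ ∈ R.tminus σ (v, B, D) := by
    have h5 : Finsupp.linearCombination k x a₃ =
        -Finsupp.linearCombination k x (a₂.filter fun i => ¬ (t i).2.2 = D) +
        Finsupp.linearCombination k x a₂ := by
      rw [← h0]; simp [a₃]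
    rw [h5]
    refine Submodule.add_mem_sup (neg_mem hrest) ⟨ha₂, ?_⟩
    change Finsupp.linearCombination k x a₂ ∈ R.plus σ (v, false) D
    rw [← h0]
    exact add_mem h3p (R.minus_le_plus σ _ _ hrest.2)
  have h5 := hind (v, B, D) a₃ (fun i hi => by
    obtain ⟨h1, h2⟩ := hs₃ i hi
    obtain ⟨h6, h7⟩ := hs₂ i h1
    rw [← hv i h6, ← h7, ← h2]) h4
  rw [h5] at hi₃'
  simp at hi₃'

variable {σ} (c : σ.BiWord)

/-- The subspace `F⁺` of a position of a two-sided word. -/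
def Fplus (i : ℤ) : Submodule k M := R.tplus σ (c.triple i)

/-- The subspace `F⁻` of a position of a two-sided word. -/
def Fminus (i : ℤ) : Submodule k M := R.tminus σ (c.triple i)

theorem Fplus_eq (i : ℤ) : R.Fplus c i =
    R.plus σ (c.side i).flip (c.left i) ⊓ R.plus σ (c.side i) (c.right i) := by
  unfold Fplus tplus Signs.BiWord.triple
  rcases h : c.side i with ⟨v, _ | _⟩ <;> simp [Side.flip]
  exact inf_comm _ _

theorem Fminus_eq (i : ℤ) : R.Fminus c i =
    (R.plus σ (c.side i).flip (c.left i) ⊓ R.minus σ (c.side i) (c.right i)) ⊔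
    (R.minus σ (c.side i).flip (c.left i) ⊓ R.plus σ (c.side i) (c.right i)) := by
  unfold Fminus tminus Signs.BiWord.triple
  rcases h : c.side i with ⟨v, _ | _⟩ <;> simp [Side.flip]
  exact (sup_comm _ _).trans (congrArg₂ (· ⊔ ·) (inf_comm _ _) (inf_comm _ _))

theorem Fminus_le_Fplus (i : ℤ) : R.Fminus c i ≤ R.Fplus c i := R.tminus_le_tplus σ _

theorem Fplus_rev (i : ℤ) : R.Fplus c.rev (-i) = R.Fplus c i := by
  unfold Fplus; rw [c.rev_triple]

theorem Fminus_rev (i : ℤ) : R.Fminus c.rev (-i) = R.Fminus c i := by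
  unfold Fminus; rw [c.rev_triple]

theorem plus_right_eq {i : ℤ} {l : Letter V} (hl : c.letter (i + 1) = some l) :
    R.plus σ (c.side i) (c.right i) =
      relAct (R.lrel l) (R.plus σ (c.side (i + 1)) (c.right (i + 1))) := by
  rw [R.plus_cons σ (l := l) (by rw [c.right_zero, hl]), c.right_succ, c.dst_eq _ _ hl]

theorem minus_right_eq {i : ℤ} {l : Letter V} (hl : c.letter (i + 1) = some l) :
    R.minus σ (c.side i) (c.right i) =
      relAct (R.lrel l) (R.minus σ (c.side (i + 1)) (c.right (i + 1))) := by
  rw [R.minus_cons σ (l := l) (by rw [c.right_zero, hl]), c.right_succ, c.dst_eq _ _ hl]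

theorem plus_left_eq {i : ℤ} {l : Letter V} (hl : c.letter (i + 1) = some l) :
    R.plus σ (c.side (i + 1)).flip (c.left (i + 1)) =
      relAct (R.lrel l.inv) (R.plus σ (c.side i).flip (c.left i)) := by
  rw [R.plus_cons σ (l := l.inv) (by rw [c.left_zero, hl]; rfl), c.left_succ, σ.dst_inv,
    c.src_eq _ _ hl, add_sub_cancel_right]

theorem minus_left_eq {i : ℤ} {l : Letter V} (hl : c.letter (i + 1) = some l) :
    R.minus σ (c.side (i + 1)).flip (c.left (i + 1)) =
      relAct (R.lrel l.inv) (R.minus σ (c.side i).flip (c.left i)) := by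
  rw [R.minus_cons σ (l := l.inv) (by rw [c.left_zero, hl]; rfl), c.left_succ, σ.dst_inv,
    c.src_eq _ _ hl, add_sub_cancel_right]

theorem exists_Fplus_succ {i : ℤ} {l : Letter V} (hl : c.letter (i + 1) = some l) {a : M}
    (ha : a ∈ R.Fplus c i) : ∃ b ∈ R.Fplus c (i + 1), (a, b) ∈ R.lrel l := by
  rw [Fplus_eq, R.plus_right_eq c hl] at ha
  obtain ⟨h1, h2⟩ := ha
  obtain ⟨b, hb, hab⟩ := mem_relAct.1 h2
  refine ⟨b, ?_, hab⟩
  rw [Fplus_eq, R.plus_left_eq c hl]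
  exact ⟨mem_relAct.2 ⟨a, h1, R.mem_lrel_inv.2 hab⟩, hb⟩

theorem exists_Fplus_pred {i : ℤ} {l : Letter V} (hl : c.letter (i + 1) = some l) {b : M}
    (hb : b ∈ R.Fplus c (i + 1)) : ∃ a ∈ R.Fplus c i, (a, b) ∈ R.lrel l := by
  rw [Fplus_eq, R.plus_left_eq c hl] at hb
  obtain ⟨h1, h2⟩ := hb
  obtain ⟨a, ha, hab⟩ := mem_relAct.1 h1
  refine ⟨a, ?_, R.mem_lrel_inv.1 hab⟩
  rw [Fplus_eq, R.plus_right_eq c hl]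
  exact ⟨ha, mem_relAct.2 ⟨b, h2, R.mem_lrel_inv.1 hab⟩⟩

/-- With `exists_Fplus_succ` and `exists_Fplus_pred` this says that a letter induces an isomorphism
of the subquotients at its two ends. Both implications are `rel_mem_minus`, applied to the relation
of the letter and to its inverse. -/
theorem mem_Fminus_succ_iff {i : ℤ} {l : Letter V} (hl : c.letter (i + 1) = some l) {a b : M}
    (hab : (a, b) ∈ R.lrel l) (ha : a ∈ R.Fplus c i) (hb : b ∈ R.Fplus c (i + 1)) :
    a ∈ R.Fminus c i ↔ b ∈ R.Fminus c (i + 1) := by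
  rw [Fplus_eq] at ha hb
  constructor
  · intro h
    rw [Fminus_eq, R.plus_right_eq c hl, R.minus_right_eq c hl] at h
    rw [Fminus_eq, R.plus_left_eq c hl, R.minus_left_eq c hl]
    exact rel_mem_minus (fun a b => R.mem_lrel_inv.symm) (R.minus_le_plus σ _ _) h hab hb.2
  · intro h
    rw [Fminus_eq, R.plus_left_eq c hl, R.minus_left_eq c hl, sup_comm, inf_comm,
      inf_comm (relAct _ _)] at h
    rw [Fminus_eq, R.plus_right_eq c hl, R.minus_right_eq c hl, sup_comm, inf_comm,
      inf_comm (R.plus _ _ _)]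
    exact rel_mem_minus (fun a b => R.mem_lrel_inv) (R.minus_le_plus σ _ _) h
      (R.mem_lrel_inv.2 hab) ha.1

/-! ### Sequences along a two-sided word -/

/-- The families of elements indexed by the positions of a two-sided word that define a
homomorphism from the string module. -/
structure IsStr (m : ℤ → M) : Prop where
  rel : ∀ i l, c.letter (i + 1) = some l → (m i, m (i + 1)) ∈ R.lrel l
  right_end : ∀ i ∈ c.I, c.letter (i + 1) = none → m i ∈ R.kerSide σ (c.side i)
  left_end : ∀ i ∈ c.I, c.letter i = none → m i ∈ R.kerSide σ (c.side i).flip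

variable {R c}

theorem IsStr.add {m m' : ℤ → M} (h : R.IsStr c m) (h' : R.IsStr c m') :
    R.IsStr c fun i => m i + m' i where
  rel i l hl := add_mem (h.rel i l hl) (h'.rel i l hl)
  right_end i hi hl := add_mem (h.right_end i hi hl) (h'.right_end i hi hl)
  left_end i hi hl := add_mem (h.left_end i hi hl) (h'.left_end i hi hl)

theorem IsStr.rev {m : ℤ → M} (h : R.IsStr c m) : R.IsStr c.rev fun i => m (-i) where
  rel i l hl := by
    obtain ⟨l', hl', rfl⟩ := Option.map_eq_some_iff.1 hl
    have h1 := h.rel (-(i + 1)) l' (by rw [← hl']; congr 1; ring)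
    rw [mem_lrel_inv]
    convert h1 using 3
    ring
  right_end i hi hl := by
    have h1 : c.letter (-i) = none := by
      have := Option.map_eq_none_iff.1 hl
      rwa [show 1 - (i + 1) = -i by ring] at this
    exact h.left_end (-i) hi h1
  left_end i hi hl := by
    have h1 : c.letter (-i + 1) = none := by
      have := Option.map_eq_none_iff.1 hl
      rwa [show 1 - i = -i + 1 by ring] at this
    have := h.right_end (-i) hi h1
    simpa [Signs.BiWord.rev] using this

theorem rev_rev : c.rev.rev = c := by
  obtain ⟨l, s, I, _, _, _, _⟩ := c
  simp only [Signs.BiWord.rev, Option.map_map, neg_neg, Side.flip_flip, Signs.BiWord.mk.injEq]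
  refine ⟨?_, trivial, ?_⟩
  · funext i
    rw [show Letter.inv ∘ Letter.inv = id from funext fun l : Letter V => l.inv_inv,
      Option.map_id, id]
    congr 1; ring
  · ext i
    simp

theorem IsStr.of_rev {m : ℤ → M} (h : R.IsStr c.rev m) : R.IsStr c fun i => m (-i) := by
  have := h.rev
  rwa [rev_rev] at this

theorem IsStr.mem_plus_right {m : ℤ → M} (h : R.IsStr c m) {i : ℤ} (hi : i ∈ c.I) :
    m i ∈ R.plus σ (c.side i) (c.right i) := by
  classical
  -- Beyond the end of the word the last vector is repeated; the membership in `kerSide` at the end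
  -- makes this a sequence along the word.
  let f : ℕ → M := fun n => Nat.rec (m i) (fun n a => if i + (n + 1 : ℕ) ∈ c.I
    then m (i + (n + 1 : ℕ)) else a) n
  have hf : ∀ n, f (n + 1) = if i + (n + 1 : ℕ) ∈ c.I then m (i + (n + 1 : ℕ)) else f n :=
    fun n => rfl
  have hf1 : ∀ n : ℕ, i + n ∈ c.I → f n = m (i + n) := by
    rintro (_ | n) hn
    · simp [f]
    · rw [hf, if_pos hn]
  have hf2 : ∀ n, c.right i n = none → f n ∈ R.kerSide σ (σ.st (c.side i) (c.right i) n) ∧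
      f (n + 1) = f n := by
    intro n hn
    have h1 : i + (n + 1 : ℕ) ∉ c.I := by
      have := (not_congr (c.letter_eq_none_of_right (n := n) hi)).1 (not_not.2 hn)
      rwa [show i + (n + 1 : ℕ) = i + 1 + n by push_cast; ring]
    refine ⟨?_, by rw [hf, if_neg h1]⟩
    induction n with
    | zero =>
      have := h.right_end i hi (by rw [← c.right_zero, hn])
      simpa [f] using this
    | succ n ih =>
      by_cases h2 : i + (n + 1 : ℕ) ∈ c.I
      · rw [hf1 _ h2, c.st_right hi h2]
        refine h.right_end _ h2 ?_
        rw [← hn, Signs.BiWord.right]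
        congr 1; ring
      · have h3 : c.right i n = none := by
          by_contra h3
          have := (c.letter_eq_none_of_right hi).1 h3
          exact h2 (by rwa [show i + (n + 1 : ℕ) = i + 1 + n by push_cast; ring])
        rw [σ.st_succ_none h3, hf, if_neg h2]
        exact ih h3 h2
  refine (R.mem_plus σ).2 ⟨f, (R.mem_seqs σ).2 fun n => ?_, rfl⟩
  rcases hn : c.right i n with _ | l
  · obtain ⟨h1, h2⟩ := hf2 n hn
    rw [mem_step_none, h2, sub_self]
    exact ⟨h1, h1, zero_mem _⟩
  · have h1 : c.letter (i + n + 1) = some l := by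
      rw [← hn, Signs.BiWord.right]; congr 1; ring
    have h2 := c.mem_of_letter h1
    rw [add_sub_cancel_right] at h2
    rw [hf1 n h2.2, hf1 (n + 1) (by convert h2.1 using 1; push_cast; ring)]
    have := h.rel _ _ h1
    rwa [show i + (n + 1 : ℕ) = i + n + 1 by push_cast; ring]

theorem IsStr.mem_Fplus {m : ℤ → M} (h : R.IsStr c m) {i : ℤ} (hi : i ∈ c.I) :
    m i ∈ R.Fplus c i := by
  rw [Fplus_eq]
  refine ⟨?_, h.mem_plus_right hi⟩
  have := h.rev.mem_plus_right (i := -i) (by rwa [c.mem_rev, neg_neg])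
  rw [c.rev_right] at this
  simpa [Signs.BiWord.rev] using this

variable (R c)

theorem exists_isStr_of_seqs (h0 : (0 : ℤ) ∈ c.I) {g f : ℕ → M}
    (hg : g ∈ R.seqs σ (c.side 0).flip (c.left 0)) (hf : f ∈ R.seqs σ (c.side 0) (c.right 0))
    (hgf : g 0 = f 0) : ∃ m, R.IsStr c m ∧ ∀ n : ℕ, m n = f n ∧ m (-n) = g n := by
  rw [mem_seqs] at hf hg
  let m : ℤ → M := fun i => if 0 ≤ i then f i.toNat else g (-i).toNat
  have hm1 : ∀ i : ℤ, 0 ≤ i → m i = f i.toNat := fun i hi => if_pos hi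
  have hm2 : ∀ i : ℤ, i ≤ 0 → m i = g (-i).toNat := by
    intro i hi
    rcases hi.lt_or_eq with h | rfl
    · exact if_neg (by omega)
    · rw [hm1 0 le_rfl]
      simp [hgf]
  refine ⟨m, ⟨fun i l hl => ?_, fun i hi hl => ?_, fun i hi hl => ?_⟩, fun n => ⟨?_, ?_⟩⟩
  · by_cases hi : 0 ≤ i
    · have h1 : c.right 0 i.toNat = some l := by
        rw [← hl, Signs.BiWord.right]; congr 1; omega
      have := hf i.toNat
      rw [h1] at this
      rw [hm1 i hi, hm1 (i + 1) (by omega), show (i + 1).toNat = i.toNat + 1 by omega]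
      exact this
    · have h1 : c.left 0 (-(i + 1)).toNat = some l.inv := by
        rw [Signs.BiWord.left, show (0 : ℤ) - ((-(i + 1)).toNat : ℤ) = i + 1 by omega, hl]; rfl
      have := hg (-(i + 1)).toNat
      rw [h1] at this
      rw [hm2 i (by omega), hm2 (i + 1) (by omega),
        show (-i).toNat = (-(i + 1)).toNat + 1 by omega]
      exact R.mem_lrel_inv.1 this
  · have hi0 : 0 ≤ i := by
      by_contra hi0
      obtain ⟨l, hl'⟩ := c.exists_letter (i := i + 1) (c.conv i 0 _ hi h0 (by omega) (by omega))
        (by rwa [add_sub_cancel_right])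
      simp [hl] at hl'
    have h1 : c.right 0 i.toNat = none := by
      rw [← hl, Signs.BiWord.right]; congr 1; omega
    have := hf i.toNat
    rw [h1, mem_step_none, c.st_right h0 (by simpa [hi0] using hi)] at this
    rw [hm1 i hi0]
    simpa [hi0] using this.1
  · have hi0 : i ≤ 0 := by
      by_contra hi0
      obtain ⟨l, hl'⟩ := c.exists_letter hi (c.conv 0 i _ h0 hi (by omega) (by omega))
      simp [hl] at hl'
    have h1 : c.left 0 (-i).toNat = none := by
      rw [Signs.BiWord.left, show (0 : ℤ) - ((-i).toNat : ℤ) = i by omega, hl]; rfl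
    have := hg (-i).toNat
    have h2 := c.rev.st_right (i := -0) (n := (-i).toNat) (by simpa [c.mem_rev] using h0)
      (by rw [c.mem_rev]; convert hi using 1; omega)
    rw [c.rev_right] at h2
    simp only [Signs.BiWord.rev, neg_zero, zero_add] at h2
    rw [h1, mem_step_none, h2, show -((-i).toNat : ℤ) = i by omega] at this
    rw [hm2 i hi0]
    exact this.1
  · rw [hm1 n (by omega), Int.toNat_natCast]
  · rw [hm2 (-n) (by omega), neg_neg, Int.toNat_natCast]

theorem exists_isStr (h0 : (0 : ℤ) ∈ c.I) {a : M} (ha : a ∈ R.Fplus c 0) :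
    ∃ m, R.IsStr c m ∧ m 0 = a := by
  rw [Fplus_eq] at ha
  obtain ⟨g, hg, hg0⟩ := (R.mem_plus σ).1 ha.1
  obtain ⟨f, hf, hf0⟩ := (R.mem_plus σ).1 ha.2
  obtain ⟨m, hm, h⟩ := R.exists_isStr_of_seqs c h0 hg hf (hg0.trans hf0.symm)
  exact ⟨m, hm, (h 0).1.trans hf0⟩

variable {R c}

/-- A basis of a subquotient at one position is transported to all positions. -/
theorem IsBasisMod.of_isStr {β : Type*} {m : β → ℤ → M} (hm : ∀ u, R.IsStr c (m u)) {i j : ℤ}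
    (hi : i ∈ c.I) (hj : j ∈ c.I)
    (h : IsBasisMod (R.Fplus c i) (R.Fminus c i) fun u => m u i) :
    IsBasisMod (R.Fplus c j) (R.Fminus c j) fun u => m u j := by
  rcases le_total i j with hij | hij
  · induction j, hij using Int.leInduction with
    | base => exact h
    | succ j hij ih =>
      have hj' : j ∈ c.I := c.conv i _ _ hi hj hij (by omega)
      obtain ⟨l, hl⟩ := c.exists_letter hj (by rwa [add_sub_cancel_right])
      exact (ih hj').transport (r := R.lrel l) (fun u => (hm u).mem_Fplus hj)
        (fun u => (hm u).rel _ _ hl) (fun b hb => R.exists_Fplus_pred c hl hb)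
        fun a b hab ha hb => R.mem_Fminus_succ_iff c hl hab ha hb
  · induction j, hij using Int.leInductionDown with
    | base => exact h
    | pred j hij ih =>
      have hj' : j ∈ c.I := c.conv _ i _ hj hi (by omega) hij
      obtain ⟨l, hl⟩ := c.exists_letter hj' hj
      rw [← sub_add_cancel j 1] at hl
      have h1 := ih hj'
      rw [show R.Fplus c j = R.Fplus c (j - 1 + 1) by rw [sub_add_cancel],
        show R.Fminus c j = R.Fminus c (j - 1 + 1) by rw [sub_add_cancel]] at h1
      refine h1.transport (r := R.lrel l.inv) (fun u => (hm u).mem_Fplus hj)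
        (fun u => ?_) (fun b hb => ?_) fun a b hab ha hb => ?_
      · have := (hm u).rel _ _ hl
        rw [sub_add_cancel] at this
        exact R.mem_lrel_inv.2 this
      · obtain ⟨a, ha, hab⟩ := R.exists_Fplus_succ c hl hb
        exact ⟨a, ha, R.mem_lrel_inv.2 hab⟩
      · exact (R.mem_Fminus_succ_iff c hl (R.mem_lrel_inv.1 hab) hb ha).symm

/-- Whether a sequence lies in `F⁻` does not depend on the position. -/
theorem IsStr.mem_Fminus {m : ℤ → M} (hm : R.IsStr c m) {i j : ℤ} (hi : i ∈ c.I) (hj : j ∈ c.I)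
    (h : m i ∈ R.Fminus c i) : m j ∈ R.Fminus c j := by
  rcases le_total i j with hij | hij
  · induction j, hij using Int.leInduction with
    | base => exact h
    | succ j hij ih =>
      have hj' : j ∈ c.I := c.conv i _ _ hi hj hij (by omega)
      obtain ⟨l, hl⟩ := c.exists_letter hj (by rwa [add_sub_cancel_right])
      exact (R.mem_Fminus_succ_iff c hl (hm.rel _ _ hl) (hm.mem_Fplus hj')
        (hm.mem_Fplus hj)).1 (ih hj')
  · induction j, hij using Int.leInductionDown with
    | base => exact h
    | pred j hij ih =>
      have hj' : j ∈ c.I := c.conv _ i _ hj hi (by omega) hij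
      obtain ⟨l, hl⟩ := c.exists_letter hj' hj
      rw [← sub_add_cancel j 1] at hl
      have h1 := ih hj'
      have h2 := hm.mem_Fplus hj'
      rw [← sub_add_cancel j 1] at h1 h2
      exact (R.mem_Fminus_succ_iff c hl (hm.rel _ _ hl) (hm.mem_Fplus hj) h2).2 h1

end QuiverOps

/-! ### Modules over a polynomial ring, up to polynomials with constant term one -/

section Saturation

open Polynomial

variable {k : Type u} [Field k]

theorem isCoprime_X_pow {f : k[X]} (hf : f.coeff 0 = 1) (n : ℕ) : IsCoprime f (X ^ n) := by
  refine IsCoprime.pow_right ⟨1, -f.divX, ?_⟩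
  have := f.divX_mul_X_add
  rw [hf, C_1] at this
  linear_combination -this

variable {N : Type x} [AddCommGroup N] [Module k[X] N]

/-- The elements that are moved into `S` by a polynomial with constant term one. -/
def satur (S : Submodule k[X] N) : Submodule k[X] N where
  carrier := {y | ∃ f : k[X], f.coeff 0 = 1 ∧ f • y ∈ S}
  add_mem' := by
    rintro y y' ⟨f, hf, h⟩ ⟨f', hf', h'⟩
    refine ⟨f * f', by rw [mul_coeff_zero, hf, hf', one_mul], ?_⟩
    rw [smul_add]
    refine add_mem ?_ ?_
    · rw [mul_comm, mul_smul]; exact S.smul_mem _ h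
    · rw [mul_smul]; exact S.smul_mem _ h'
  zero_mem' := ⟨1, by simp, by simp⟩
  smul_mem' := by
    rintro c y ⟨f, hf, h⟩
    exact ⟨f, hf, by rw [smul_comm]; exact S.smul_mem _ h⟩

theorem mem_satur {S : Submodule k[X] N} {y : N} :
    y ∈ satur S ↔ ∃ f : k[X], f.coeff 0 = 1 ∧ f • y ∈ S := Iff.rfl

theorem le_satur (S : Submodule k[X] N) : S ≤ satur S := fun y hy => ⟨1, by simp, by simpa using hy⟩

theorem satur_mono {S S' : Submodule k[X] N} (h : S ≤ S') : satur S ≤ satur S' :=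
  fun _ ⟨f, hf, hy⟩ => ⟨f, hf, h hy⟩

theorem satur_satur (S : Submodule k[X] N) : satur (satur S) ≤ satur S := by
  rintro y ⟨f, hf, g, hg, h⟩
  exact ⟨g * f, by rw [mul_coeff_zero, hf, hg, one_mul], by rwa [mul_smul]⟩

theorem satur_sup_bot (S : Submodule k[X] N) : satur (S ⊔ satur ⊥) ≤ satur S :=
  (satur_mono (sup_le (le_satur S) (satur_mono bot_le))).trans (satur_satur S)

/-- From f = X · divX f + 1 and f • y = 0 it follows that the variable acts on `y` with inverse
-divX f. -/
theorem eq_X_smul_of_mem_satur_bot {y : N} (h : y ∈ satur (⊥ : Submodule k[X] N)) :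
    ∃ n ∈ satur (⊥ : Submodule k[X] N), y = (X : k[X]) • n := by
  obtain ⟨f, hf, h0⟩ := h
  refine ⟨-f.divX • y, Submodule.smul_mem _ _ ⟨f, hf, h0⟩, ?_⟩
  have h1 : f = X * f.divX + 1 := by
    have := f.divX_mul_X_add
    rw [hf, C_1] at this
    rw [mul_comm]; exact this.symm
  have h2 := (Submodule.mem_bot k[X]).1 h0
  rw [h1, add_smul, one_smul, mul_smul] at h2
  rw [neg_smul, smul_neg]
  exact eq_neg_of_add_eq_zero_right h2

/-- The product of the denominators of finitely many generators serves as a common denominator. -/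
theorem exists_uniform_satur [IsNoetherian k[X] N] (S : Submodule k[X] N) :
    ∃ f : k[X], f.coeff 0 = 1 ∧ ∀ y ∈ satur S, f • y ∈ S := by
  classical
  obtain ⟨G, hG⟩ := IsNoetherian.noetherian (satur S)
  have hG' : ∀ g : G, ∃ f : k[X], f.coeff 0 = 1 ∧ f • (g : N) ∈ S := fun g =>
    mem_satur.1 (hG ▸ Submodule.subset_span g.2)
  choose f hf hfS using hG'
  refine ⟨∏ g : G, f g, ?_, fun y hy => ?_⟩
  · have : (∏ g : G, f g).coeff 0 = ∏ g : G, (f g).coeff 0 := by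
      simp only [coeff_zero_eq_eval_zero, eval_prod]
    rw [this]
    exact Finset.prod_eq_one fun g _ => hf g
  · rw [← hG] at hy
    induction hy using Submodule.span_induction with
    | mem g hg =>
      have h1 : (∏ g : G, f g) = (∏ g' ∈ Finset.univ.erase (⟨g, hg⟩ : G), f g') * f ⟨g, hg⟩ :=
        (Finset.prod_erase_mul _ _ (Finset.mem_univ _)).symm
      rw [h1, mul_smul]
      exact S.smul_mem _ (hfS ⟨g, hg⟩)
    | zero => simp
    | add y y' _ _ h h' => rw [smul_add]; exact add_mem h h'
    | smul c y _ h => rw [smul_comm]; exact S.smul_mem _ h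

/-- Let `f` be a common denominator, so that `f • S` lies in the span of `w`. The coefficients of
`w` that occur form an ideal of a principal ideal domain, and an element `y₀` that belongs to a
generator of it generates `S` up to torsion. It remains to compare `y₀` with `w` modulo the
variable: w = c • y₀ up to torsion, and the two cases depend on c(0). -/
theorem exists_generator_satur [IsNoetherian k[X] N] (w : N) :
    ∃ g ∈ satur (Submodule.span k[X] {w}), satur (Submodule.span k[X] {w}) ≤
      Submodule.span k[X] {g} ⊔ satur ⊥ ∧ ∃ n : N, g - w = (X : k[X]) • n := by
  set S := satur (Submodule.span k[X] {w}) with hS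
  obtain ⟨f, hf, hfS⟩ := exists_uniform_satur (Submodule.span k[X] {w})
  let I : Ideal k[X] :=
    { carrier := {a | ∃ y ∈ S, f • y = a • w}
      add_mem' := by
        rintro a b ⟨y, hy, h⟩ ⟨y', hy', h'⟩
        exact ⟨y + y', add_mem hy hy', by rw [smul_add, h, h', add_smul]⟩
      zero_mem' := ⟨0, zero_mem _, by simp⟩
      smul_mem' := by
        rintro c a ⟨y, hy, h⟩
        exact ⟨c • y, S.smul_mem _ hy, by rw [smul_comm, h, smul_eq_mul, mul_smul]⟩ }
  obtain ⟨a₀, ha₀⟩ := (IsPrincipalIdealRing.principal I).1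
  obtain ⟨y₀, hy₀, hfy₀⟩ : a₀ ∈ I := by rw [ha₀]; exact Ideal.mem_span_singleton_self a₀
  have key : ∀ y ∈ S, ∃ b : k[X], y - b • y₀ ∈ satur (⊥ : Submodule k[X] N) := by
    intro y hy
    obtain ⟨a, ha⟩ := Submodule.mem_span_singleton.1 (hfS y hy)
    have hI : a ∈ I := ⟨y, hy, ha.symm⟩
    rw [ha₀] at hI
    obtain ⟨b, rfl⟩ := Ideal.mem_span_singleton'.1 hI
    refine ⟨b, f, hf, ?_⟩
    rw [Submodule.mem_bot, smul_sub, ← ha, smul_comm f b, hfy₀, mul_smul, sub_self]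
  have hw : w ∈ S := le_satur _ (Submodule.mem_span_singleton_self w)
  obtain ⟨c, hc⟩ := key w hw
  by_cases hc0 : c.coeff 0 = 0
  -- `f - a₀ c` has constant term one and moves `y₀` into the torsion. So all of `S` is torsion, and
  -- `w` can be kept.
  · have hy : y₀ ∈ satur (⊥ : Submodule k[X] N) := by
      obtain ⟨g, hg, h⟩ := hc
      refine ⟨g * (f - a₀ * c), ?_, ?_⟩
      · simp [mul_coeff_zero, hg, hf, hc0]
      · rw [Submodule.mem_bot] at h ⊢
        rw [mul_smul, sub_smul, hfy₀, mul_smul, ← smul_sub, smul_comm, h, smul_zero]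
    refine ⟨w, hw, fun y hy' => ?_, 0, by simp⟩
    obtain ⟨b, hb⟩ := key y hy'
    refine Submodule.mem_sup_right ?_
    rw [← sub_add_cancel y (b • y₀)]
    exact add_mem hb (Submodule.smul_mem _ _ hy)
  -- Rescaling by the unit c(0) makes the generator congruent to `w`, because torsion elements are
  -- multiples of the variable.
  · refine ⟨C (c.coeff 0) • y₀, S.smul_mem _ hy₀, fun y hy' => ?_, ?_⟩
    · obtain ⟨b, hb⟩ := key y hy'
      rw [← sub_add_cancel y (b • y₀), add_comm]
      refine Submodule.add_mem_sup (Submodule.mem_span_singleton.2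
        ⟨b * C (c.coeff 0)⁻¹, ?_⟩) hb
      rw [smul_smul, mul_assoc, ← C_mul, inv_mul_cancel₀ hc0, C_1, mul_one]
    · obtain ⟨n, -, hn⟩ := eq_X_smul_of_mem_satur_bot hc
      refine ⟨-(c.divX • y₀) - n, ?_⟩
      have h1 : c = X * c.divX + C (c.coeff 0) := by
        rw [mul_comm]; exact c.divX_mul_X_add.symm
      rw [smul_sub, ← hn, smul_neg, smul_smul]
      have h2 : c • y₀ = (X * c.divX) • y₀ + C (c.coeff 0) • y₀ := by
        rw [← add_smul, ← h1]
      rw [h2]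
      abel

/-- By induction on the number of elements: `w 0` is replaced by a generator of the saturation `S`
of its span, and the other elements are treated in `N ⧸ S`. The changes made in the quotient are
multiples of the variable, so they lift. -/
theorem exists_saturated_fin (n : ℕ) : ∀ (N : Type x) [AddCommGroup N] [Module k[X] N]
    [IsNoetherian k[X] N] (w : Fin n → N), ∃ w' : Fin n → N,
      (∀ i, ∃ m : N, w' i - w i = (X : k[X]) • m) ∧
      (∀ i, w i ∈ Submodule.span k[X] (Set.range w') ⊔ satur ⊥) ∧
      satur (Submodule.span k[X] (Set.range w')) ≤
        Submodule.span k[X] (Set.range w') ⊔ satur ⊥ := by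
  induction n with
  | zero =>
    intro N _ _ _ w
    refine ⟨w, fun i => i.elim0, fun i => i.elim0, ?_⟩
    simp [Set.range_eq_empty]
  | succ n ih =>
    intro N _ _ _ w
    obtain ⟨g, hgS, hg, m₀, hm₀⟩ := exists_generator_satur (k := k) (w 0)
    set S := satur (Submodule.span k[X] {w 0}) with hS
    obtain ⟨wb, h1, h2, h3⟩ := ih (N ⧸ S) fun i => S.mkQ (w i.succ)
    have h1' : ∀ i, ∃ m : N, wb i = S.mkQ (w i.succ + (X : k[X]) • m) := by
      intro i
      obtain ⟨m, hm⟩ := h1 i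
      obtain ⟨m, rfl⟩ := S.mkQ_surjective m
      refine ⟨m, ?_⟩
      rw [map_add, map_smul, ← hm]
      abel
    choose m hm using h1'
    let w' : Fin (n + 1) → N := Fin.cons g fun i => w i.succ + (X : k[X]) • m i
    have hspan : ∀ z ∈ Submodule.span k[X] (Set.range wb),
        ∃ z' ∈ Submodule.span k[X] (Set.range w'), S.mkQ z' = z := by
      intro z hz
      have : Submodule.span k[X] (Set.range wb) ≤
          (Submodule.span k[X] (Set.range w')).map S.mkQ := by
        rw [Submodule.span_le]
        rintro _ ⟨i, rfl⟩
        exact ⟨w' i.succ, Submodule.subset_span ⟨i.succ, rfl⟩, by simp [w', hm]⟩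
      exact Submodule.mem_map.1 (this hz)
    have hgw : Submodule.span k[X] {g} ≤ Submodule.span k[X] (Set.range w') := by
      rw [Submodule.span_singleton_le_iff_mem]
      exact Submodule.subset_span ⟨0, rfl⟩
    have lift : ∀ y : N, S.mkQ y ∈ Submodule.span k[X] (Set.range wb) ⊔ satur ⊥ →
        y ∈ Submodule.span k[X] (Set.range w') ⊔ satur ⊥ := by
      intro y hy
      obtain ⟨z, hz, e, he, hze⟩ := Submodule.mem_sup.1 hy
      obtain ⟨z', hz', rfl⟩ := hspan z hz
      obtain ⟨f, hf, hfe⟩ := he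
      have h4 : f • (y - z') ∈ S := by
        have : S.mkQ (f • (y - z')) = 0 := by
          rw [map_smul, map_sub, ← hze, add_sub_cancel_left]
          exact (Submodule.mem_bot _).1 hfe
        exact (Submodule.Quotient.mk_eq_zero S).1 this
      have h5 : y - z' ∈ S := satur_satur _ ⟨f, hf, h4⟩
      rw [← add_sub_cancel z' y]
      exact add_mem (Submodule.mem_sup_left hz') (sup_le_sup_right hgw _ (hg h5))
    refine ⟨w', ?_, ?_, ?_⟩
    · intro i
      refine Fin.cases ⟨m₀, hm₀⟩ (fun i => ⟨m i, ?_⟩) i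
      simp [w']
    · intro i
      refine Fin.cases ?_ (fun i => lift _ (h2 i)) i
      exact sup_le_sup_right hgw _ (hg (le_satur _ (Submodule.mem_span_singleton_self _)))
    · rintro y ⟨f, hf, hfy⟩
      refine lift y (h3 ⟨f, hf, ?_⟩)
      have h4 : Submodule.span k[X] (Set.range w') ≤
          (Submodule.span k[X] (Set.range wb)).comap S.mkQ := by
        rw [Submodule.span_le]
        rintro _ ⟨i, rfl⟩
        refine Fin.cases ?_ (fun i => ?_) i
        · have : S.mkQ g = 0 := (Submodule.Quotient.mk_eq_zero S).2 hgS
          change S.mkQ g ∈ Submodule.span k[X] (Set.range wb)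
          rw [this]
          exact zero_mem _
        · change S.mkQ (w i.succ + (X : k[X]) • m i) ∈ Submodule.span k[X] (Set.range wb)
          rw [← hm]
          exact Submodule.subset_span ⟨i, rfl⟩
      have := h4 hfy
      rwa [Submodule.mem_comap, map_smul] at this

/-- A family of elements of a finitely generated module can be changed by multiples of the
variable, so that it generates a submodule that is saturated up to torsion. -/
theorem exists_saturated [IsNoetherian k[X] N] {T : Type*} (w : T → N) : ∃ w' : T → N,
    (∀ t, ∃ m : N, w' t - w t = (X : k[X]) • m) ∧
    satur (Submodule.span k[X] (Set.range w')) ≤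
      Submodule.span k[X] (Set.range w') ⊔ satur ⊥ := by
  classical
  obtain ⟨G, hGs, hG⟩ := (Submodule.fg_span_iff_fg_span_finset_subset (Set.range w)).1
    (IsNoetherian.noetherian (Submodule.span k[X] (Set.range w)))
  have hpre : ∀ g : G, ∃ t, w t = g := fun g => hGs g.2
  choose τ hτ using hpre
  let e := G.equivFin
  obtain ⟨w₀, h1, h2, h3⟩ := exists_saturated_fin (k := k) G.card N fun i => (e.symm i : N)
  have hτinj : Function.Injective τ := fun g g' h => Subtype.ext (by rw [← hτ, ← hτ, h])
  -- Only the members of a finite subfamily with the same span are changed; the others then lie in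
  -- the new span up to torsion.
  let w' : T → N := fun t => if h : ∃ g, τ g = t then w₀ (e h.choose) else w t
  have hw' : ∀ g, w' (τ g) = w₀ (e g) := by
    intro g
    have h : ∃ g', τ g' = τ g := ⟨g, rfl⟩
    simp only [w', dif_pos h]
    rw [hτinj h.choose_spec]
  have hle : Submodule.span k[X] (Set.range w₀) ≤ Submodule.span k[X] (Set.range w') :=
    Submodule.span_mono (by
      rintro _ ⟨i, rfl⟩
      exact ⟨τ (e.symm i), by rw [hw', e.apply_symm_apply]⟩)
  have hge : Submodule.span k[X] (Set.range w') ≤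
      Submodule.span k[X] (Set.range w₀) ⊔ satur ⊥ := by
    rw [Submodule.span_le]
    rintro _ ⟨t, rfl⟩
    by_cases h : ∃ g, τ g = t
    · obtain ⟨g, rfl⟩ := h
      rw [hw']
      exact Submodule.mem_sup_left (Submodule.subset_span ⟨_, rfl⟩)
    · have ht : w' t = w t := dif_neg h
      rw [ht]
      have h4 : w t ∈ Submodule.span k[X] (Set.range w) := Submodule.subset_span ⟨t, rfl⟩
      rw [hG] at h4
      refine (Submodule.span_le.2 ?_ : Submodule.span k[X] (G : Set N) ≤ _) h4
      intro g hg
      have := h2 (e ⟨g, hg⟩)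
      rwa [e.symm_apply_apply] at this
  refine ⟨w', fun t => ?_, ?_⟩
  · by_cases h : ∃ g, τ g = t
    · obtain ⟨g, rfl⟩ := h
      obtain ⟨m, hm⟩ := h1 (e g)
      refine ⟨m, ?_⟩
      rw [hw', hτ, ← hm, e.symm_apply_apply]
    · have ht : w' t = w t := dif_neg h
      exact ⟨0, by rw [ht, sub_self, smul_zero]⟩
  · exact ((satur_mono hge).trans ((satur_sup_bot _).trans h3)).trans (sup_le_sup_right hle _)

/-- A divisible submodule of a finitely generated module is torsion. -/
theorem le_satur_bot_of_divisible [IsNoetherian k[X] N] {D : Submodule k[X] N}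
    (hD : ∀ d ∈ D, ∃ d' ∈ D, d = (X : k[X]) • d') :
    ∃ f : k[X], f.coeff 0 = 1 ∧ ∀ d ∈ D, f • d = 0 := by
  -- Nakayama's lemma for the ideal generated by the variable: `D` is killed by an element congruent
  -- to one.
  obtain ⟨r, hr, h⟩ := Submodule.exists_sub_one_mem_and_smul_eq_zero_of_fg_of_le_smul
    (Ideal.span {(X : k[X])}) D (IsNoetherian.noetherian D) fun d hd => by
      obtain ⟨d', hd', rfl⟩ := hD d hd
      exact Submodule.smul_mem_smul (Ideal.mem_span_singleton_self _) hd'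
  refine ⟨r, ?_, h⟩
  have := X_dvd_iff.1 (Ideal.mem_span_singleton.1 hr)
  rw [coeff_sub, coeff_one_zero, sub_eq_zero] at this
  exact this

/-- Krull's intersection theorem, up to polynomials with constant term one. -/
theorem mem_satur_of_forall_pow [IsNoetherian k[X] N] (S : Submodule k[X] N) {y : N}
    (h : ∀ a : ℕ, ∃ f : k[X], f.coeff 0 = 1 ∧ ∃ n : N, f • y - (X : k[X]) ^ a • n ∈ S) :
    y ∈ satur S := by
  -- A denominator is coprime to `X ^ a`, so the class of `y` itself is divisible by `X ^ a`;
  -- Krull's theorem is then applied in `N ⧸ S`.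
  have h1 : S.mkQ y ∈ (⨅ i : ℕ, Ideal.span {(X : k[X])} ^ i • ⊤ : Submodule k[X] (N ⧸ S)) := by
    rw [Submodule.mem_iInf]
    intro a
    obtain ⟨f, hf, n, hn⟩ := h a
    obtain ⟨p, q, hpq⟩ := isCoprime_X_pow hf a
    have h2 : f • S.mkQ y = (X : k[X]) ^ a • S.mkQ n := by
      rw [← map_smul, ← map_smul, ← sub_eq_zero, ← map_sub]
      exact (Submodule.Quotient.mk_eq_zero S).2 hn
    have h3 : S.mkQ y = (X : k[X]) ^ a • (p • S.mkQ n + q • S.mkQ y) := by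
      calc S.mkQ y = (p * f + q * X ^ a) • S.mkQ y := by rw [hpq, one_smul]
        _ = _ := by rw [add_smul, mul_smul, h2, smul_add, smul_smul, smul_smul, smul_smul,
            mul_comm p, mul_comm q]
    rw [h3, Ideal.span_singleton_pow]
    exact Submodule.smul_mem_smul (Ideal.mem_span_singleton_self _) trivial
  obtain ⟨⟨r, hr⟩, hrx⟩ := (Ideal.mem_iInf_smul_pow_eq_bot_iff _ _).1 h1
  have hr0 := X_dvd_iff.1 (Ideal.mem_span_singleton.1 hr)
  refine ⟨1 - r, by simp [hr0], ?_⟩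
  rw [← Submodule.Quotient.mk_eq_zero, ← Submodule.mkQ_apply, map_smul, sub_smul, one_smul]
  simp only at hrx
  rw [hrx, sub_self]

/-- A finitely generated torsion module is finite-dimensional. -/
theorem finiteDimensional_of_torsion [Module k N] [IsScalarTower k k[X] N] {S : Submodule k[X] N}
    (hS : S.FG) {f : k[X]} (hf : f ≠ 0) (h : ∀ s ∈ S, f • s = 0) :
    FiniteDimensional k (S.restrictScalars k) := by
  classical
  obtain ⟨G, rfl⟩ := hS
  let B : Finset N := Finset.image₂ (fun a g => (X : k[X]) ^ a • g) (Finset.range f.natDegree) G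
  refine Submodule.finiteDimensional_of_le (S₂ := Submodule.span k (B : Set N)) ?_
  intro s hs
  rw [Submodule.restrictScalars_mem] at hs
  rw [← Set.image_id (G : Set N)] at hs
  obtain ⟨p, hp, rfl⟩ := (Finsupp.mem_span_image_iff_linearCombination k[X]).1 hs
  rw [Finsupp.linearCombination_apply]
  refine Submodule.sum_mem _ fun g hg => ?_
  have hg : g ∈ G := hp hg
  have key : ∀ p : k[X], p • g ∈ Submodule.span k (B : Set N) := by
    intro p
    have h1 : p • g = (p % f) • g := by
      have : p = f * (p / f) + p % f := (EuclideanDomain.div_add_mod p f).symm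
      conv_lhs => rw [this]
      rw [add_smul, mul_comm, mul_smul, h g (Submodule.subset_span hg), smul_zero, zero_add]
    rw [h1]
    by_cases hz : p % f = 0
    · rw [hz, zero_smul]; exact zero_mem _
    have hdeg : (p % f).natDegree < f.natDegree := by
      have := EuclideanDomain.mod_lt p hf
      exact natDegree_lt_natDegree hz this
    rw [(p % f).as_sum_range' f.natDegree hdeg, Finset.sum_smul]
    refine Submodule.sum_mem _ fun a ha => ?_
    rw [← C_mul_X_pow_eq_monomial, mul_smul, ← Polynomial.algebraMap_eq, algebraMap_smul]
    exact Submodule.smul_mem _ _ (Submodule.subset_span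
      (Finset.mem_coe.2 (Finset.mem_image₂_of_mem ha hg)))
  exact key (p g)

end Saturation

/-! ### Primitive cycles -/

section Cycles

variable {V : Type v} [Quiver.{w} V] (ρ : Set (QPath V))

open Classical in
/-- The arrow `y` with `x y ∉ ρ`, if there is one. -/
def next (x : Quiver.Total V) : Quiver.Total V := if h : ∃ y, Foll ρ x y then h.choose else x

variable {ρ}

theorem Foll.next_eq (hρ : IsStringAlgebra ρ) {x y : Quiver.Total V} (h : Foll ρ x y) :
    next ρ x = y := by
  have h' : ∃ y, Foll ρ x y := ⟨y, h⟩
  rw [next, dif_pos h']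
  exact h'.choose_spec.right_unique hρ h

variable (ρ) in
/-- The arrow `x` is the last arrow of a cycle all of whose powers avoid relations of length
two. -/
structure Cyc (x : Quiver.Total V) : Prop where
  periodic : x ∈ Function.periodicPts (next ρ)
  -- Periodicity alone would not suffice, because `next` returns its argument when no arrow follows.
  foll : ∀ i : ℕ, Foll ρ ((next ρ)^[i] x) ((next ρ)^[i + 1] x)

variable (ρ) in
/-- The length of the cycle. -/
def cycLen (x : Quiver.Total V) : ℕ := Function.minimalPeriod (next ρ) x

variable {x : Quiver.Total V}

theorem Cyc.cycLen_pos (h : Cyc ρ x) : 0 < cycLen ρ x :=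
  Function.minimalPeriod_pos_of_mem_periodicPts h.periodic

theorem Cyc.iterate_cycLen (_h : Cyc ρ x) : (next ρ)^[cycLen ρ x] x = x :=
  Function.iterate_minimalPeriod

theorem Cyc.next (h : Cyc ρ x) : Cyc ρ (next ρ x) where
  periodic := by
    obtain ⟨n, hn, hx⟩ := h.periodic
    exact ⟨n, hn, hx.apply⟩
  foll i := by
    have := h.foll (i + 1)
    rwa [Function.iterate_succ_apply, Function.iterate_succ_apply] at this

theorem Cyc.iterate (h : Cyc ρ x) (n : ℕ) : Cyc ρ ((StringAlg.next ρ)^[n] x) := by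
  induction n with
  | zero => exact h
  | succ n ih => rw [Function.iterate_succ_apply']; exact ih.next

theorem Cyc.cycLen_next (h : Cyc ρ x) : cycLen ρ (StringAlg.next ρ x) = cycLen ρ x :=
  Function.minimalPeriod_apply h.periodic

theorem Cyc.foll_next (h : Cyc ρ x) : Foll ρ x (StringAlg.next ρ x) := h.foll 0

theorem Cyc.foll_last (h : Cyc ρ x) : Foll ρ ((StringAlg.next ρ)^[cycLen ρ x - 1] x) x := by
  have := h.foll (cycLen ρ x - 1)
  rwa [Nat.sub_add_cancel h.cycLen_pos, h.iterate_cycLen] at this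

/-- By uniqueness on the left, `a` must be the arrow that already precedes `x` on the cycle. -/
theorem Cyc.of_foll (hρ : IsStringAlgebra ρ) (h : Cyc ρ x) {a : Quiver.Total V}
    (ha : Foll ρ a x) : Cyc ρ a := by
  rw [ha.left_unique hρ h.foll_last]
  exact h.iterate _

end Cycles

/-! ### Operators of primitive cycles and their sum `Z` -/

namespace QuiverOps

variable {k : Type u} [Field k] {V : Type v} [Quiver.{w} V] {ρ : Set (QPath V)}
  {M : Type x} [AddCommGroup M] [Module k M] (R : QuiverOps k V M)

variable (ρ) in
/-- The operator of the path with `n` arrows that ends with the arrow `x` and avoids `ρ`. -/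
def opRay : Quiver.Total V → ℕ → Module.End k M
  | _, 0 => 1
  | x, n + 1 => R.arrow x * opRay (next ρ x) n

theorem opRay_succ (x : Quiver.Total V) (n : ℕ) :
    R.opRay ρ x (n + 1) = R.arrow x * R.opRay ρ (next ρ x) n := rfl

theorem opRay_add (x : Quiver.Total V) (m n : ℕ) :
    R.opRay ρ x (m + n) = R.opRay ρ x m * R.opRay ρ ((next ρ)^[m] x) n := by
  induction m generalizing x with
  | zero => simp [opRay]
  | succ m ih =>
    rw [show m + 1 + n = m + n + 1 by ring, opRay_succ, ih, opRay_succ, mul_assoc]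
    rfl

theorem opRay_one (x : Quiver.Total V) : R.opRay ρ x 1 = R.arrow x := by simp [opRay]

theorem opRay_succ' (x : Quiver.Total V) (n : ℕ) :
    R.opRay ρ x (n + 1) = R.opRay ρ x n * R.arrow ((next ρ)^[n] x) := by
  rw [opRay_add, opRay_one]

open Classical in
variable (ρ) in
/-- The operator of the primitive cycle that ends with the arrow `x`, or zero. -/
def cycOp (x : Quiver.Total V) : Module.End k M :=
  if Cyc ρ x then R.opRay ρ x (cycLen ρ x) else 0

theorem cycOp_eq {x : Quiver.Total V} (h : Cyc ρ x) :
    R.cycOp ρ x = R.opRay ρ x (cycLen ρ x) := if_pos h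

theorem cycOp_eq_zero {x : Quiver.Total V} (h : ¬ Cyc ρ x) : R.cycOp ρ x = 0 := if_neg h

theorem cycOp_eq_left {x : Quiver.Total V} (h : Cyc ρ x) : R.cycOp ρ x =
    R.opRay ρ x (cycLen ρ x - 1) * R.arrow ((next ρ)^[cycLen ρ x - 1] x) := by
  rw [← opRay_succ', Nat.sub_add_cancel h.cycLen_pos, R.cycOp_eq h]

theorem opRay_mem_range {x : Quiver.Total V} {n : ℕ} (hn : 0 < n) (m : M) :
    R.opRay ρ x n m ∈ LinearMap.range (R.arrow x) := by
  obtain ⟨n, rfl⟩ := Nat.exists_eq_succ_of_ne_zero hn.ne'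
  exact ⟨_, rfl⟩

theorem cycOp_mem_range (x : Quiver.Total V) (m : M) :
    R.cycOp ρ x m ∈ LinearMap.range (R.arrow x) := by
  by_cases h : Cyc ρ x
  · rw [R.cycOp_eq h]
    exact R.opRay_mem_range h.cycLen_pos m
  · rw [R.cycOp_eq_zero h]
    exact zero_mem _

theorem cycOp_apply_of_ne {x : Quiver.Total V} {v : V} (h : x.right ≠ v) {m : M} (hm : m ∈ R.E v) :
    R.cycOp ρ x m = 0 := by
  by_cases hx : Cyc ρ x
  · rw [R.cycOp_eq_left hx, Module.End.mul_apply,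
      R.arrow_apply_of_ne (by rwa [← hx.foll_last.right_eq_left]) hm, map_zero]
  · rw [R.cycOp_eq_zero hx]; rfl

theorem cycOp_vert (x : Quiver.Total V) (m : M) :
    R.cycOp ρ x (R.vert x.right m) = R.cycOp ρ x m := by
  by_cases hx : Cyc ρ x
  · rw [R.cycOp_eq_left hx, Module.End.mul_apply, Module.End.mul_apply,
      hx.foll_last.right_eq_left, R.arrow_vert]
  · rw [R.cycOp_eq_zero hx]; rfl

/-- The arrow of the cycle that is traversed first can follow no arrow but `x`, so it kills the
images of all others. -/
theorem cycOp_arrow_of_ne (hρ : IsStringAlgebra ρ) (hR : ∀ r ∈ ρ, R.path r.path = 0)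
    {x y : Quiver.Total V} (h : x ≠ y) (m : M) : R.cycOp ρ x (R.arrow y m) = 0 := by
  by_cases hx : Cyc ρ x
  · rw [R.cycOp_eq_left hx, Module.End.mul_apply,
      R.arrow_arrow_eq_zero hR (fun h' => h (hx.foll_last.right_unique hρ h')), map_zero]
  · rw [R.cycOp_eq_zero hx]; rfl

theorem arrow_cycOp_next {x : Quiver.Total V} (h : Cyc ρ x) (m : M) :
    R.arrow x (R.cycOp ρ (next ρ x) m) = R.cycOp ρ x (R.arrow x m) := by
  rw [R.cycOp_eq h, R.cycOp_eq h.next, h.cycLen_next]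
  have h1 : R.arrow x * R.opRay ρ (next ρ x) (cycLen ρ x) =
      R.opRay ρ x (cycLen ρ x) * R.arrow x := by
    rw [← opRay_succ, opRay_succ', h.iterate_cycLen]
  exact congrArg (fun f => f m) h1

/-- A module in which the paths in `ρ` act as zero, that is the sum of the spaces at the
vertices, and in which each of these spaces lies in a finitely generated submodule. -/
structure IsControlled (ρ : Set (QPath V)) : Prop where
  string : IsStringAlgebra ρ
  rel : ∀ r ∈ ρ, R.path r.path = 0
  iSup_E : ⨆ v, R.E v = ⊤
  fg : ∀ v, ∃ G : Finset M, R.E v ≤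
    Submodule.span k {m | ∃ p : QPath V, ∃ g ∈ G, m = R.path p.path g}

namespace IsControlled

variable {R}

theorem finite_vert (hc : R.IsControlled ρ) (m : M) : {v | R.vert v m ≠ 0}.Finite := by
  have hm : m ∈ ⨆ v, R.E v := by rw [hc.iSup_E]; trivial
  induction hm using Submodule.iSup_induction' with
  | mem v m hm =>
    refine (Set.finite_singleton v).subset fun v' hv' => ?_
    by_contra hne
    exact hv' (R.vert_apply_of_ne hne hm)
  | zero => simp
  | add m m' _ _ h h' =>
    refine (h.union h').subset fun v hv => ?_
    by_contra hn
    simp only [Set.mem_union, Set.mem_ofPred, not_or, not_not] at hn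
    exact hv (by rw [map_add, hn.1, hn.2, add_zero])

theorem finite_cycOp (hc : R.IsControlled ρ) (m : M) : {x | R.cycOp ρ x m ≠ 0}.Finite := by
  refine ((hc.finite_vert m).biUnion fun v _ =>
    Set.finite_of_encard_le_coe (hc.string.head_le_two v)).subset fun x hx => ?_
  simp only [Set.mem_iUnion]
  refine ⟨x.right, fun h => hx ?_, rfl⟩
  rw [← R.cycOp_vert, h, map_zero]

end IsControlled

variable (ρ) in
open Classical in
/-- The sum of all operators of primitive cycles. -/
def Z : Module.End k M :=
  if hc : ∀ m : M, {x | R.cycOp ρ x m ≠ 0}.Finite then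
    { toFun := fun m => ∑ᶠ x, R.cycOp ρ x m
      map_add' := fun m m' => by
        simp only [map_add]
        exact finsum_add_distrib (hc m) (hc m')
      map_smul' := fun c m => by
        simp only [map_smul, RingHom.id_apply]
        exact (smul_finsum' c (hc m)).symm }
  else 0

namespace IsControlled

variable {R}

theorem Z_apply (hc : R.IsControlled ρ) (m : M) : R.Z ρ m = ∑ᶠ x, R.cycOp ρ x m := by
  rw [Z, dif_pos hc.finite_cycOp]; rfl

theorem Z_arrow (hc : R.IsControlled ρ) (x : Quiver.Total V) (m : M) :
    R.Z ρ (R.arrow x m) = R.cycOp ρ x (R.arrow x m) := by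
  rw [hc.Z_apply]
  exact finsum_eq_single _ x fun y hy => R.cycOp_arrow_of_ne hc.string hc.rel hy m

/-- On the image of `x` only the cycle that ends with `x` acts, and moving `x` past it rotates it to
the cycle that ends with the next arrow. If `x` lies on no cycle, neither does the next arrow, and
both sides vanish. -/
theorem Z_arrow_eq (hc : R.IsControlled ρ) (x : Quiver.Total V) (m : M) :
    R.Z ρ (R.arrow x m) = R.arrow x (R.Z ρ m) := by
  rw [hc.Z_arrow, hc.Z_apply, map_finsum _ (hc.finite_cycOp m)]
  have h0 : ∀ y, ¬ Foll ρ x y → R.arrow x (R.cycOp ρ y m) = 0 := by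
    intro y hy
    obtain ⟨m', hm'⟩ := R.cycOp_mem_range (ρ := ρ) y m
    rw [← hm', R.arrow_arrow_eq_zero hc.rel hy]
  by_cases hx : ∃ y, Foll ρ x y
  · obtain ⟨y, hy⟩ := hx
    rw [finsum_eq_single _ y fun y' hy' => h0 y' fun h => hy' (h.right_unique hc.string hy)]
    rw [← hy.next_eq hc.string]
    by_cases hcx : Cyc ρ x
    · rw [R.arrow_cycOp_next hcx]
    · have : ¬ Cyc ρ (next ρ x) := fun h => hcx (h.of_foll hc.string
        (by rw [hy.next_eq hc.string]; exact hy))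
      rw [R.cycOp_eq_zero hcx, R.cycOp_eq_zero this]
      simp
  · rw [R.cycOp_eq_zero fun h => hx ⟨_, h.foll_next⟩, finsum_eq_zero_of_forall_eq_zero]
    · rfl
    · exact fun y => h0 y fun h => hx ⟨y, h⟩

theorem Z_vert (hc : R.IsControlled ρ) (v : V) (m : M) : R.Z ρ (R.vert v m) = R.vert v (R.Z ρ m) := by
  rw [hc.Z_apply, hc.Z_apply, map_finsum _ (hc.finite_cycOp m)]
  refine finsum_congr fun x => ?_
  have h1 := R.range_arrow_le x (R.cycOp_mem_range (ρ := ρ) x m)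
  by_cases h : x.right = v
  · subst h
    rw [R.cycOp_vert, R.mem_E.1 h1]
  · rw [R.cycOp_apply_of_ne h (R.vert_mem_E v m), R.vert_apply_of_ne (Ne.symm h) h1]

theorem Z_mem_E (hc : R.IsControlled ρ) {v : V} {m : M} (hm : m ∈ R.E v) : R.Z ρ m ∈ R.E v := by
  rw [R.mem_E, ← hc.Z_vert, R.mem_E.1 hm]

theorem Z_mem_range (hc : R.IsControlled ρ) {x : Quiver.Total V} {m : M} (hm : m ∈ LinearMap.range (R.arrow x)) :
    R.Z ρ m ∈ LinearMap.range (R.arrow x) := by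
  obtain ⟨m', rfl⟩ := hm
  exact ⟨_, (hc.Z_arrow_eq x m').symm⟩

theorem Z_eq_cycOp (hc : R.IsControlled ρ) {x : Quiver.Total V} {m : M} (hm : m ∈ LinearMap.range (R.arrow x)) :
    R.Z ρ m = R.cycOp ρ x m := by
  obtain ⟨m', rfl⟩ := hm
  exact hc.Z_arrow x m'

theorem Z_pow_eq_cycOp_pow (hc : R.IsControlled ρ) {x : Quiver.Total V} {m : M} (hm : m ∈ LinearMap.range (R.arrow x))
    (n : ℕ) : (R.Z ρ ^ n) m = (R.cycOp ρ x ^ n) m ∧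
      (R.Z ρ ^ n) m ∈ LinearMap.range (R.arrow x) := by
  induction n with
  | zero => exact ⟨rfl, hm⟩
  | succ n ih =>
    rw [pow_succ', pow_succ', Module.End.mul_apply, Module.End.mul_apply, ← ih.1]
    exact ⟨hc.Z_eq_cycOp ih.2, hc.Z_mem_range ih.2⟩

theorem opRay_Z (hc : R.IsControlled ρ) (x : Quiver.Total V) (n : ℕ) (m : M) :
    R.opRay ρ x n (R.Z ρ m) = R.Z ρ (R.opRay ρ x n m) := by
  induction n generalizing x with
  | zero => rfl
  | succ n ih => rw [opRay_succ, Module.End.mul_apply, Module.End.mul_apply, ih, hc.Z_arrow_eq]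

/-! ### The images of arrows are finitely generated over polynomials in `Z` -/

/-- There is at most one way to prolong an arrow without a relation of length two, so a path on
which `x` does not vanish for this reason is the ray that ends with `x`. -/
theorem arrow_path_eq (hc : R.IsControlled ρ) (x : Quiver.Total V) {a b : V} (p : Quiver.Path a b) (m : M) :
    R.arrow x (R.path p m) = 0 ∨ R.arrow x (R.path p m) = R.opRay ρ x (p.length + 1) m := by
  induction p generalizing x with
  | nil =>
    by_cases h : x.left = a
    · subst h
      right
      rw [Quiver.Path.length_nil, opRay_one]
      exact R.arrow_vert x m
    · left
      exact R.arrow_apply_of_ne h (R.vert_mem_E a m)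
  | @cons d e p y ih =>
    have h1 : R.path (p.cons y) m = R.arrow ⟨d, e, y⟩ (R.path p m) := rfl
    rw [h1]
    by_cases h : Foll ρ x ⟨d, e, y⟩
    · rw [Quiver.Path.length_cons, opRay_succ, Module.End.mul_apply, h.next_eq hc.string]
      rcases ih ⟨d, e, y⟩ with h2 | h2
      · left
        rw [h2, map_zero]
      · right
        rw [h2]
    · left
      exact R.arrow_arrow_eq_zero hc.rel h _

theorem exists_range_le_span_opRay (hc : R.IsControlled ρ) (x : Quiver.Total V) : ∃ G : Finset M,
    LinearMap.range (R.arrow x) ≤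
      Submodule.span k {m | ∃ n : ℕ, ∃ g ∈ G, m = R.opRay ρ x (n + 1) g} := by
  obtain ⟨G, hG⟩ := hc.fg x.left
  refine ⟨G, ?_⟩
  rintro _ ⟨m, rfl⟩
  rw [← R.arrow_vert]
  have h1 := hG (R.vert_mem_E x.left m)
  revert h1
  generalize R.vert x.left m = m'
  intro h1
  induction h1 using Submodule.span_induction with
  | mem m hm =>
    obtain ⟨p, g, hg, rfl⟩ := hm
    rcases hc.arrow_path_eq x p.path g with h | h
    · rw [h]; exact zero_mem _
    · rw [h]; exact Submodule.subset_span ⟨_, g, hg, rfl⟩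
  | zero => rw [map_zero]; exact zero_mem _
  | add m m' _ _ h h' => rw [map_add]; exact add_mem h h'
  | smul a m _ h => rw [map_smul]; exact Submodule.smul_mem _ _ h

/-- Either the ray meets a relation of length two, and all longer paths vanish, or its arrows are
pairwise different, since a repetition could be traced back to `x` by uniqueness on the left and
would make `x` cyclic. In the second case only finitely many of the arrows start at a vertex where
`g` has a nonzero component. -/
theorem finite_opRay (hc : R.IsControlled ρ) {x : Quiver.Total V} (hx : ¬ Cyc ρ x) (g : M) :
    {n : ℕ | R.opRay ρ x (n + 1) g ≠ 0}.Finite := by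
  by_cases hf : ∀ i : ℕ, Foll ρ ((next ρ)^[i] x) ((next ρ)^[i + 1] x)
  · have hinj : Function.Injective fun i : ℕ => (next ρ)^[i] x := by
      have key : ∀ i j : ℕ, (next ρ)^[i] x = (next ρ)^[i + (j + 1)] x → False := by
        intro i
        induction i with
        | zero =>
          intro j h
          refine hx ⟨⟨j + 1, by omega, ?_⟩, hf⟩
          rw [Nat.zero_add] at h
          exact h.symm
        | succ i ih =>
          intro j h
          refine ih j ((hf i).left_unique hc.string ?_)
          rw [h, show i + 1 + (j + 1) = i + (j + 1) + 1 by ring]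
          exact hf _
      intro i j hij
      rcases lt_trichotomy i j with h | h | h
      · obtain ⟨d, rfl⟩ := Nat.exists_eq_add_of_lt h
        exact (key i d hij).elim
      · exact h
      · obtain ⟨d, rfl⟩ := Nat.exists_eq_add_of_lt h
        exact (key j d hij.symm).elim
    have hfin := (hc.finite_vert g).biUnion fun v _ =>
      Set.finite_of_encard_le_coe (hc.string.tail_le_two v)
    refine (hfin.preimage hinj.injOn).subset fun n hn => ?_
    simp only [Set.mem_preimage, Set.mem_iUnion]
    refine ⟨((next ρ)^[n] x).left, fun h => hn ?_, rfl⟩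
    rw [opRay_succ', Module.End.mul_apply, ← R.arrow_vert, h, map_zero, map_zero]
  · push Not at hf
    obtain ⟨i, hi⟩ := hf
    refine (Set.finite_le_nat i).subset fun n hn => ?_
    by_contra hni
    refine hn ?_
    obtain ⟨d, rfl⟩ := Nat.exists_eq_add_of_lt (not_le.1 hni)
    rw [show i + d + 1 + 1 = i + (2 + d) by ring, opRay_add, opRay_add, Module.End.mul_apply,
      Module.End.mul_apply]
    have h2 : ∀ m, R.opRay ρ ((next ρ)^[i] x) 2 m = 0 := by
      intro m
      rw [show (2 : ℕ) = 1 + 1 from rfl, opRay_succ, opRay_one, Module.End.mul_apply,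
        R.arrow_arrow_eq_zero hc.rel]
      rwa [Function.iterate_succ_apply'] at hi
    rw [h2, map_zero]

theorem finiteDimensional_range (hc : R.IsControlled ρ) {x : Quiver.Total V} (hx : ¬ Cyc ρ x) :
    FiniteDimensional k (LinearMap.range (R.arrow x)) := by
  classical
  obtain ⟨G, hG⟩ := hc.exists_range_le_span_opRay x
  have hfin : {m | ∃ n : ℕ, ∃ g ∈ G, m = R.opRay ρ x (n + 1) g}.Finite := by
    refine ((G.finite_toSet.biUnion fun g _ =>
      (hc.finite_opRay hx g).image fun n => R.opRay ρ x (n + 1) g).union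
      (Set.finite_singleton 0)).subset ?_
    rintro _ ⟨n, g, hg, rfl⟩
    by_cases h : R.opRay ρ x (n + 1) g = 0
    · right; simp [h]
    · left
      simp only [Set.mem_iUnion]
      exact ⟨g, hg, n, h, rfl⟩
  have := FiniteDimensional.span_of_finite k hfin
  exact Submodule.finiteDimensional_of_le hG

/-- On a cycle of length `L` a ray is a number of full turns, on which `Z` acts as the cycle, after
one of `L` short rays. Off the cycles the image is even finite dimensional. -/
theorem exists_range_le_span_Z (hc : R.IsControlled ρ) (x : Quiver.Total V) : ∃ G : Finset M,
    (∀ g ∈ G, g ∈ LinearMap.range (R.arrow x)) ∧ LinearMap.range (R.arrow x) ≤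
      Submodule.span k {m | ∃ n : ℕ, ∃ g ∈ G, m = (R.Z ρ ^ n) g} := by
  classical
  by_cases hx : Cyc ρ x
  · obtain ⟨G, hG⟩ := hc.exists_range_le_span_opRay x
    refine ⟨Finset.image₂ (fun r g => R.opRay ρ x (r + 1) g) (Finset.range (cycLen ρ x)) G,
      fun g hg => ?_, hG.trans (Submodule.span_mono ?_)⟩
    · obtain ⟨r, -, g, -, rfl⟩ := Finset.mem_image₂.1 hg
      exact R.opRay_mem_range (by omega) g
    · rintro _ ⟨n, g, hg, rfl⟩
      refine ⟨n / cycLen ρ x, R.opRay ρ x (n % cycLen ρ x + 1) g,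
        Finset.mem_image₂_of_mem (Finset.mem_range.2 (Nat.mod_lt _ hx.cycLen_pos)) hg, ?_⟩
      rw [(hc.Z_pow_eq_cycOp_pow (R.opRay_mem_range (by omega) g) _).1, R.cycOp_eq hx]
      have key : ∀ q s : ℕ, R.opRay ρ x (cycLen ρ x * q + s) =
          R.opRay ρ x (cycLen ρ x) ^ q * R.opRay ρ x s := by
        intro q s
        induction q with
        | zero => simp
        | succ q ih =>
          rw [show cycLen ρ x * (q + 1) + s = cycLen ρ x + (cycLen ρ x * q + s) by ring,
            opRay_add, hx.iterate_cycLen, ih, pow_succ', mul_assoc]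
      have := key (n / cycLen ρ x) (n % cycLen ρ x + 1)
      rw [← add_assoc, Nat.div_add_mod] at this
      rw [this]
      rfl
  · have := hc.finiteDimensional_range hx
    obtain ⟨G, hG⟩ := (Submodule.fg_top (LinearMap.range (R.arrow x))).1 (Module.Finite.fg_top)
    refine ⟨G, fun g hg => by rw [← hG]; exact Submodule.subset_span hg, ?_⟩
    rw [← hG]
    exact Submodule.span_mono fun g hg => ⟨0, g, hg, rfl⟩

end IsControlled

end QuiverOps

/-! ### Subspaces stable under an operator -/

section Stable

open Polynomial

variable {k : Type u} [Field k] {M : Type x} [AddCommGroup M] [Module k M] (φ : Module.End k M)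

/-- The subspace `S` is mapped to itself by `φ`. -/
def Stable (S : Submodule k M) : Prop := ∀ m ∈ S, φ m ∈ S

variable {φ}

theorem Stable.aeval {S : Submodule k M} (hS : Stable φ S) (f : k[X]) {m : M} (hm : m ∈ S) :
    aeval φ f m ∈ S := by
  induction f using Polynomial.induction_on' with
  | add p q hp hq => rw [map_add]; exact add_mem hp hq
  | monomial n a =>
    rw [aeval_monomial, Module.End.mul_apply, Module.algebraMap_end_apply]
    refine S.smul_mem _ ?_
    induction n with
    | zero => exact hm
    | succ n ih => rw [pow_succ', Module.End.mul_apply]; exact hS _ ih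

theorem Stable.pow {S : Submodule k M} (hS : Stable φ S) (n : ℕ) {m : M} (hm : m ∈ S) :
    (φ ^ n) m ∈ S := by
  have := hS.aeval (X ^ n) hm
  rwa [map_pow, aeval_X] at this

theorem Stable.bot : Stable φ (⊥ : Submodule k M) := fun m hm => by
  rw [(Submodule.mem_bot k).1 hm, map_zero]; exact zero_mem _

theorem Stable.sup {S S' : Submodule k M} (h : Stable φ S) (h' : Stable φ S') :
    Stable φ (S ⊔ S') := by
  intro m hm
  obtain ⟨a, ha, b, hb, rfl⟩ := Submodule.mem_sup.1 hm
  rw [map_add]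
  exact Submodule.add_mem_sup (h a ha) (h' b hb)

theorem Stable.inf {S S' : Submodule k M} (h : Stable φ S) (h' : Stable φ S') :
    Stable φ (S ⊓ S') := fun m hm => ⟨h m hm.1, h' m hm.2⟩

theorem Stable.span {s : Set M} (h : ∀ m ∈ s, φ m ∈ Submodule.span k s) :
    Stable φ (Submodule.span k s) := by
  intro m hm
  induction hm using Submodule.span_induction with
  | mem m hm => exact h m hm
  | zero => rw [map_zero]; exact zero_mem _
  | add a b _ _ ha hb => rw [map_add]; exact add_mem ha hb
  | smul c a _ ha => rw [map_smul]; exact Submodule.smul_mem _ _ ha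

/-- A relation that is stable under `φ`, in the sense that it relates `φ a` and `φ b` if it relates
`a` and `b`, is compatible with polynomials in `φ`. -/
theorem aeval_prod_mem {r : Submodule k (M × M)} (hr : ∀ a b, (a, b) ∈ r → (φ a, φ b) ∈ r)
    (f : k[X]) {a b : M} (h : (a, b) ∈ r) : (aeval φ f a, aeval φ f b) ∈ r := by
  induction f using Polynomial.induction_on' with
  | add p q hp hq =>
    rw [map_add]
    exact add_mem hp hq
  | monomial n c =>
    rw [aeval_monomial, Module.End.mul_apply, Module.algebraMap_end_apply, Module.End.mul_apply,
      Module.algebraMap_end_apply]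
    refine r.smul_mem c (x := ((φ ^ n) a, (φ ^ n) b)) ?_
    induction n with
    | zero => exact h
    | succ n ih =>
      rw [pow_succ', Module.End.mul_apply, Module.End.mul_apply]
      exact hr _ _ ih

variable (φ) in
/-- Some polynomial in `φ` with constant term one moves `m` into `S`. -/
def Sat (S : Submodule k M) (m : M) : Prop := ∃ f : k[X], f.coeff 0 = 1 ∧ aeval φ f m ∈ S

theorem Sat.of_mem {S : Submodule k M} {m : M} (h : m ∈ S) : Sat φ S m := ⟨1, by simp, by simpa⟩

theorem Sat.mono {S S' : Submodule k M} (h : S ≤ S') {m : M} (hm : Sat φ S m) : Sat φ S' m :=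
  let ⟨f, hf, hfm⟩ := hm
  ⟨f, hf, h hfm⟩

theorem Sat.of_aeval {S : Submodule k M} {m : M} {f : k[X]} (hf : f.coeff 0 = 1)
    (h : Sat φ S (aeval φ f m)) : Sat φ S m := by
  obtain ⟨g, hg, h⟩ := h
  exact ⟨g * f, by rw [mul_coeff_zero, hg, hf, one_mul], by rwa [map_mul, Module.End.mul_apply]⟩

theorem Sat.aeval {S : Submodule k M} (hS : Stable φ S) {m : M} (h : Sat φ S m) (g : k[X]) :
    Sat φ S (aeval φ g m) := by
  obtain ⟨f, hf, h⟩ := h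
  refine ⟨f, hf, ?_⟩
  rw [← Module.End.mul_apply, ← map_mul, mul_comm, map_mul, Module.End.mul_apply]
  exact hS.aeval g h

theorem Sat.add {S : Submodule k M} (hS : Stable φ S) {m m' : M} (h : Sat φ S m)
    (h' : Sat φ S m') : Sat φ S (m + m') := by
  obtain ⟨f, hf, h⟩ := h
  refine Sat.of_aeval hf ?_
  obtain ⟨g, hg, h'⟩ := h'.aeval hS f
  exact ⟨g, hg, by rw [map_add, map_add]; exact add_mem (hS.aeval g h) h'⟩

/-- `N` is generated by finitely many elements over the polynomials in `φ`. -/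
structure StableFG (φ : Module.End k M) (N : Submodule k M) : Prop where
  stable : Stable φ N
  fg : ∃ G : Finset M, (∀ g ∈ G, g ∈ N) ∧ N ≤ Submodule.span k {m | ∃ n : ℕ, ∃ g ∈ G, m = (φ ^ n) g}

variable (φ) in
/-- The module over the polynomial ring on which the variable acts by `φ`. -/
@[reducible] def polyModule : Module k[X] M := Module.compHom M (Polynomial.aeval φ).toRingHom

/-- A stable subspace as a module over the polynomial ring. -/
@[reducible] def Stable.polySubmodule {S : Submodule k M} (hS : Stable φ S) :
    letI := polyModule φ
    Submodule k[X] M :=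
  letI := polyModule φ
  { S with smul_mem' := fun f _ hm => hS.aeval f hm }

theorem StableFG.isNoetherian {N : Submodule k M} (h : StableFG φ N) :
    letI := polyModule φ
    IsNoetherian k[X] h.stable.polySubmodule := by
  let := polyModule φ
  refine isNoetherian_of_fg_of_noetherian _ ?_
  obtain ⟨G, hG, hN⟩ := h.fg
  refine ⟨G, le_antisymm (Submodule.span_le.2 hG) fun m hm => ?_⟩
  have hm' : m ∈ Submodule.span k {m | ∃ n : ℕ, ∃ g ∈ G, m = (φ ^ n) g} := hN hm
  clear hm
  induction hm' using Submodule.span_induction with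
  | mem m hm =>
    obtain ⟨n, g, hg, rfl⟩ := hm
    have : (φ ^ n) g = (X ^ n : k[X]) • g := by
      change _ = aeval φ (X ^ n : k[X]) g
      rw [map_pow, aeval_X]
    rw [this]
    exact Submodule.smul_mem _ _ (Submodule.subset_span hg)
  | zero => exact zero_mem _
  | add a b _ _ ha hb => exact add_mem ha hb
  | smul c a _ ha =>
    have : c • a = (C c : k[X]) • a := by
      change _ = aeval φ (C c : k[X]) a
      rw [aeval_C, Module.algebraMap_end_apply]
    rw [this]
    exact Submodule.smul_mem _ _ ha

/-- A subspace on which `φ` is surjective is finite dimensional and killed by a polynomial with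
constant term one. -/
theorem StableFG.exists_aeval_eq_zero {N D : Submodule k M} (h : StableFG φ N) (hDN : D ≤ N)
    (hD : ∀ d ∈ D, ∃ d' ∈ D, d = φ d') (hDs : Stable φ D) :
    ∃ f : k[X], f.coeff 0 = 1 ∧ ∀ d ∈ D, Polynomial.aeval φ f d = 0 := by
  let _ := polyModule φ
  have := h.isNoetherian
  obtain ⟨f, hf, hd⟩ := le_satur_bot_of_divisible
    (D := hDs.polySubmodule.comap h.stable.polySubmodule.subtype) (by
      rintro ⟨d, hd⟩ hd'
      obtain ⟨d', hd', e⟩ := hD d hd'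
      refine ⟨⟨d', hDN hd'⟩, hd', Subtype.ext ?_⟩
      change d = Polynomial.aeval φ X d'
      rw [e, aeval_X])
  exact ⟨f, hf, fun d hd' => congrArg Subtype.val (hd ⟨d, hDN hd'⟩ hd')⟩

theorem StableFG.finiteDimensional {N D : Submodule k M} (h : StableFG φ N) (hDN : D ≤ N)
    (hDs : Stable φ D) {f : k[X]} (hf : f ≠ 0) (hD : ∀ d ∈ D, Polynomial.aeval φ f d = 0) :
    FiniteDimensional k D := by
  let _ := polyModule φ
  have := h.isNoetherian
  have : IsScalarTower k k[X] M := ⟨fun c g m => by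
    change Polynomial.aeval φ (c • g) m = c • Polynomial.aeval φ g m
    rw [map_smul]; rfl⟩
  have hfg : hDs.polySubmodule.FG := by
    have h1 := IsNoetherian.noetherian (hDs.polySubmodule.comap h.stable.polySubmodule.subtype)
    have h2 := h1.map h.stable.polySubmodule.subtype
    rwa [Submodule.map_comap_subtype, inf_eq_right.2] at h2
    exact hDN
  exact finiteDimensional_of_torsion (S := hDs.polySubmodule) hfg hf hD

theorem StableFG.finiteDimensional_of_divisible {N D : Submodule k M} (h : StableFG φ N)
    (hDN : D ≤ N) (hD : ∀ d ∈ D, ∃ d' ∈ D, d = φ d') (hDs : Stable φ D) :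
    FiniteDimensional k D := by
  obtain ⟨f, hf, hd⟩ := h.exists_aeval_eq_zero hDN hD hDs
  exact h.finiteDimensional hDN hDs (f := f) (by rintro rfl; simp at hf) hd

/-- Krull's intersection theorem. -/
theorem StableFG.sat_of_forall_pow {N S : Submodule k M} (h : StableFG φ N) (hS : Stable φ S)
    {y : M} (hy : y ∈ N) (hyS : ∀ a : ℕ, ∃ f : k[X], f.coeff 0 = 1 ∧ ∃ n ∈ N,
      Polynomial.aeval φ f y - (φ ^ a) n ∈ S) : Sat φ S y := by
  let _ := polyModule φ
  have := h.isNoetherian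
  obtain ⟨f, hf, hd⟩ := mem_satur_of_forall_pow
    (hS.polySubmodule.comap h.stable.polySubmodule.subtype) (y := ⟨y, hy⟩) (fun a => by
      obtain ⟨f, hf, n, hn, h1⟩ := hyS a
      refine ⟨f, hf, ⟨n, hn⟩, ?_⟩
      change Polynomial.aeval φ f y - Polynomial.aeval φ (X ^ a) n ∈ S
      rwa [map_pow, aeval_X])
  exact ⟨f, hf, hd⟩

theorem StableFG.exists_saturated {N : Submodule k M} (h : StableFG φ N) {T : Type*} (w : T → M)
    (hw : ∀ t, w t ∈ N) : ∃ w' : T → M, (∀ t, ∃ m ∈ N, w' t - w t = φ m) ∧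
      ∀ y ∈ N, Sat φ (Submodule.span k {m | ∃ (a : ℕ) (t : T), m = (φ ^ a) (w' t)}) y →
        ∃ z ∈ Submodule.span k {m | ∃ (a : ℕ) (t : T), m = (φ ^ a) (w' t)},
          Sat φ ⊥ (y - z) := by
  let _ := polyModule φ
  have := h.isNoetherian
  obtain ⟨w', h1, h2⟩ := StringAlg.exists_saturated (k := k)
    (fun t => (⟨w t, hw t⟩ : h.stable.polySubmodule))
  set L := Submodule.span k {m | ∃ (a : ℕ) (t : T), m = (φ ^ a) (w' t : M)} with hL
  have hLs : Stable φ L := Stable.span fun m hm => by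
    obtain ⟨a, t, rfl⟩ := hm
    refine Submodule.subset_span ⟨a + 1, t, ?_⟩
    rw [pow_succ', Module.End.mul_apply]
  have key : ∀ z : h.stable.polySubmodule, z ∈ Submodule.span k[X] (Set.range w') ↔
      (z : M) ∈ L := by
    intro z
    constructor
    · intro hz
      induction hz using Submodule.span_induction with
      | mem m hm =>
        obtain ⟨t, rfl⟩ := hm
        exact Submodule.subset_span ⟨0, t, rfl⟩
      | zero => exact zero_mem _
      | add a b _ _ ha hb => exact add_mem ha hb
      | smul c a _ ha => exact hLs.aeval c ha
    · intro hz
      have : L ≤ {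
          carrier := {m | ∃ hm : m ∈ N, (⟨m, hm⟩ : h.stable.polySubmodule) ∈
            Submodule.span k[X] (Set.range w')}
          add_mem' := by
            rintro a b ⟨ha, ha'⟩ ⟨hb, hb'⟩
            exact ⟨add_mem ha hb, add_mem ha' hb'⟩
          zero_mem' := ⟨zero_mem _, zero_mem _⟩
          smul_mem' := by
            rintro c a ⟨ha, ha'⟩
            refine ⟨N.smul_mem c ha, ?_⟩
            convert Submodule.smul_mem _ (C c : k[X]) ha' using 1
            refine Subtype.ext ?_
            change c • a = Polynomial.aeval φ (C c : k[X]) a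
            rw [aeval_C, Module.algebraMap_end_apply] : Submodule k M } := by
        refine Submodule.span_le.2 ?_
        rintro _ ⟨a, t, rfl⟩
        refine ⟨h.stable.pow a (w' t).2, ?_⟩
        convert Submodule.smul_mem _ (X ^ a : k[X])
          (Submodule.subset_span (Set.mem_range_self (f := w') t)) using 1
        refine Subtype.ext ?_
        change _ = Polynomial.aeval φ (X ^ a : k[X]) (w' t : M)
        rw [map_pow, aeval_X]
      exact (this hz).2
  refine ⟨fun t => w' t, fun t => ?_, fun y hy hs => ?_⟩
  · obtain ⟨m, hm⟩ := h1 t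
    refine ⟨m, m.2, ?_⟩
    have : ((w' t : M) - w t) = Polynomial.aeval φ (X : k[X]) (m : M) := congrArg Subtype.val hm
    rwa [aeval_X] at this
  · obtain ⟨f, hf, hs⟩ := hs
    have hy' : (⟨y, hy⟩ : h.stable.polySubmodule) ∈ satur (Submodule.span k[X] (Set.range w')) :=
      ⟨f, hf, (key _).2 hs⟩
    obtain ⟨z, hz, b, ⟨g, hg, hb⟩, hzb⟩ := Submodule.mem_sup.1 (h2 hy')
    refine ⟨z, (key z).1 hz, g, hg, (Submodule.mem_bot k).2 ?_⟩
    have e : y - z = b := by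
      rw [sub_eq_iff_eq_add, add_comm]
      exact (congrArg Subtype.val hzb).symm
    rw [e]
    exact congrArg Subtype.val ((Submodule.mem_bot k[X]).1 hb)

end Stable

/-! ### Stability under the sum of the primitive cycles -/

namespace QuiverOps.IsControlled

variable {k : Type u} [Field k] {V : Type v} [Quiver.{w} V] {ρ : Set (QPath V)}
  {M : Type x} [AddCommGroup M] [Module k M] {R : QuiverOps k V M} (σ : Signs ρ)

theorem stable_range (hc : R.IsControlled ρ) (x : Quiver.Total V) :
    Stable (R.Z ρ) (LinearMap.range (R.arrow x)) := fun _ hm => hc.Z_mem_range hm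

theorem stableFG_range (hc : R.IsControlled ρ) (x : Quiver.Total V) :
    StableFG (R.Z ρ) (LinearMap.range (R.arrow x)) :=
  ⟨hc.stable_range x, hc.exists_range_le_span_Z x⟩

theorem lrel_Z (hc : R.IsControlled ρ) (l : Letter V) (a b : M) (h : (a, b) ∈ R.lrel l) :
    (R.Z ρ a, R.Z ρ b) ∈ R.lrel l := by
  cases l with
  | direct x =>
    rw [mem_lrel_direct] at h ⊢
    exact ⟨by rw [h.1, hc.Z_arrow_eq], hc.Z_mem_E h.2⟩
  | inverse x =>
    rw [mem_lrel_inverse] at h ⊢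
    exact ⟨by rw [h.1, hc.Z_arrow_eq], hc.Z_mem_E h.2⟩

theorem stable_kerSide (hc : R.IsControlled ρ) (s : Side V) :
    Stable (R.Z ρ) (R.kerSide σ s) := by
  intro m hm
  rw [mem_kerSide] at hm ⊢
  exact ⟨hc.Z_mem_E hm.1, fun x hx => by rw [← hc.Z_arrow_eq, hm.2 x hx, map_zero]⟩

theorem stable_imSide (hc : R.IsControlled ρ) (s : Side V) :
    Stable (R.Z ρ) (R.imSide σ s) := by
  intro m hm
  have : R.imSide σ s ≤ (R.imSide σ s).comap (R.Z ρ) := by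
    refine iSup₂_le fun y hy a ha => ?_
    exact R.range_le_imSide σ hy (hc.Z_mem_range ha)
  exact this hm

theorem step_Z (hc : R.IsControlled ρ) (s : Side V) (o : Option (Letter V)) (a b : M)
    (h : (a, b) ∈ R.step σ s o) : (R.Z ρ a, R.Z ρ b) ∈ R.step σ s o := by
  cases o with
  | none =>
    rw [mem_step_none] at h ⊢
    refine ⟨hc.stable_kerSide σ s a h.1, hc.stable_kerSide σ s b h.2.1, ?_⟩
    rw [← map_sub]
    exact hc.stable_imSide σ s _ h.2.2
  | some l => exact hc.lrel_Z l a b h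

theorem seqs_Z (hc : R.IsControlled ρ) {s : Side V} {w : ℕ → Option (Letter V)} {f : ℕ → M}
    (h : f ∈ R.seqs σ s w) : (fun n => R.Z ρ (f n)) ∈ R.seqs σ s w := by
  rw [mem_seqs] at h ⊢
  exact fun n => hc.step_Z σ _ _ _ _ (h n)

theorem stable_plus (hc : R.IsControlled ρ) (s : Side V) (w : ℕ → Option (Letter V)) :
    Stable (R.Z ρ) (R.plus σ s w) := by
  intro m hm
  obtain ⟨f, hf, rfl⟩ := (R.mem_plus σ).1 hm
  exact (R.mem_plus σ).2 ⟨_, hc.seqs_Z σ hf, rfl⟩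

theorem stable_minus (hc : R.IsControlled ρ) (s : Side V) (w : ℕ → Option (Letter V)) :
    Stable (R.Z ρ) (R.minus σ s w) := by
  intro m hm
  obtain ⟨f, hf, ⟨N, hN⟩, rfl⟩ := (R.mem_minus σ).1 hm
  exact (R.mem_minus σ).2 ⟨_, hc.seqs_Z σ hf, ⟨N, fun n hn => by
    simp only [hN n hn, map_zero]⟩, rfl⟩

/-- On the image of `x`, `Z` acts as the cycle that ends with `x`, and this kills the image of `y`.
So the intersection is a finitely generated module over the polynomials in `Z` on which `Z` is zero.
-/
theorem finiteDimensional_range_inf (hc : R.IsControlled ρ) {x y : Quiver.Total V} (h : x ≠ y) :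
    FiniteDimensional k ↥(LinearMap.range (R.arrow x) ⊓ LinearMap.range (R.arrow y)) := by
  refine (hc.stableFG_range x).finiteDimensional (f := Polynomial.X) inf_le_left
    ((hc.stable_range x).inf (hc.stable_range y)) Polynomial.X_ne_zero ?_
  rintro d ⟨hd, m, rfl⟩
  rw [Polynomial.aeval_X, hc.Z_eq_cycOp hd, R.cycOp_arrow_of_ne hc.string hc.rel h]

end QuiverOps.IsControlled

/-! ### Infinite sequences of letters -/

theorem exists_stable_of_antitone {k : Type u} [Field k] {M : Type x} [AddCommGroup M] [Module k M]
    {A : ℕ → Submodule k M} (hA : Antitone A) {F : Submodule k M} [FiniteDimensional k F] {n : ℕ}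
    (hF : A n ≤ F) : ∃ J, ∀ j ≥ J, A J ≤ A j := by
  obtain ⟨J, hJ⟩ := IsArtinian.monotone_stabilizes (R := k) (M := F)
    ⟨fun j => OrderDual.toDual ((A (n + j)).comap F.subtype), fun i j hij =>
      OrderDual.toDual_le_toDual.2 (Submodule.comap_mono (hA (by omega)))⟩
  refine ⟨n + J, fun j hj a ha => ?_⟩
  obtain ⟨d, rfl⟩ := Nat.exists_eq_add_of_le hj
  have h1 := hJ (J + d) (by omega)
  have h2 : (A (n + J)).comap F.subtype = (A (n + (J + d))).comap F.subtype := h1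
  have h3 : (⟨a, hF (hA (by omega) ha)⟩ : F) ∈ (A (n + J)).comap F.subtype := ha
  rw [h2] at h3
  rw [add_assoc]
  exact h3

namespace QuiverOps

variable {k : Type u} [Field k] {V : Type v} [Quiver.{w} V] {ρ : Set (QPath V)}
  {M : Type x} [AddCommGroup M] [Module k M] (R : QuiverOps k V M)

/-- The elements from which one can follow the first `n` letters of a sequence. -/
def pre : ℕ → (ℕ → Letter V) → Submodule k M
  | 0, l => R.E (l 0).head
  | n + 1, l => relAct (R.lrel (l 0)) (pre n fun i => l (i + 1))

theorem pre_succ_le (n : ℕ) (l : ℕ → Letter V) : R.pre (n + 1) l ≤ R.pre n l := by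
  induction n generalizing l with
  | zero =>
    intro a ha
    obtain ⟨b, -, h⟩ := mem_relAct.1 ha
    exact R.head_mem_E h
  | succ n ih => exact relAct_mono _ (ih _)

theorem pre_antitone (l : ℕ → Letter V) : Antitone fun n => R.pre n l :=
  antitone_nat_of_succ_le fun n => R.pre_succ_le n l

/-- The elements from which one can follow arbitrarily many letters are those from which one can
follow a certain number of letters. -/
def Stabilizes (l : ℕ → Letter V) : Prop := ∃ J, ∀ j ≥ J, R.pre J l ≤ R.pre j l

variable {R}

theorem Stabilizes.of_succ {l : ℕ → Letter V} (h : R.Stabilizes fun i => l (i + 1)) :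
    R.Stabilizes l := by
  obtain ⟨J, hJ⟩ := h
  refine ⟨J + 1, fun j hj => ?_⟩
  obtain ⟨j, rfl⟩ := Nat.exists_eq_add_of_le' (show 1 ≤ j by omega)
  exact relAct_mono _ (hJ j (by omega))

theorem Stabilizes.of_add {l : ℕ → Letter V} (n : ℕ) (h : R.Stabilizes fun i => l (i + n)) :
    R.Stabilizes l := by
  induction n with
  | zero => exact h
  | succ n ih =>
    refine ih (Stabilizes.of_succ ?_)
    convert h using 3
    ring

/-- If all tails of a sequence stabilize, then the elements from which one can follow sufficiently
many letters are those from which one can follow all letters. -/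
theorem exists_seq_of_stabilizes {l : ℕ → Letter V}
    (h : ∀ n, R.Stabilizes fun i => l (i + n)) :
    ∃ J, ∀ a ∈ R.pre J l, ∃ f : ℕ → M, f 0 = a ∧ ∀ n, (f n, f (n + 1)) ∈ R.lrel (l n) := by
  choose J hJ using h
  have key : ∀ n, ∀ a ∈ R.pre (J n) (fun i => l (i + n)),
      ∃ b ∈ R.pre (J (n + 1)) (fun i => l (i + (n + 1))), (a, b) ∈ R.lrel (l n) := by
    intro n a ha
    -- The length exceeds both `J n` and, after one letter, `J (n + 1)`.
    have h1 := hJ n (J n + J (n + 1) + 1) (by omega) ha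
    obtain ⟨b, hb, hab⟩ := mem_relAct.1 h1
    refine ⟨b, ?_, by simpa using hab⟩
    have h2 := R.pre_antitone _ (show J (n + 1) ≤ J n + J (n + 1) by omega) hb
    convert h2 using 4
    ring
  choose! g hg hr using key
  refine ⟨J 0, fun a ha => ?_⟩
  let f : ℕ → M := fun n => Nat.rec a (fun n b => g n b) n
  have hf : ∀ n, f n ∈ R.pre (J n) (fun i => l (i + n)) := by
    intro n
    induction n with
    | zero => exact ha
    | succ n ih => exact hg n _ ih
  exact ⟨f, rfl, fun n => hr n _ (hf n)⟩

namespace IsControlled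

/-- Following an inverse letter means applying an arrow, which is always possible. -/
theorem stabilizes_of_inverse {l : ℕ → Letter V} (hl : ∀ i, ∃ x, l i = .inverse x)
    (hs : ∀ i, (l (i + 1)).head = (l i).tail) : R.Stabilizes l := by
  have key : ∀ (n : ℕ) (l : ℕ → Letter V), (∀ i, ∃ x, l i = .inverse x) →
      (∀ i, (l (i + 1)).head = (l i).tail) → R.E (l 0).head ≤ R.pre n l := by
    intro n
    induction n with
    | zero => exact fun l _ _ => le_rfl
    | succ n ih =>
      intro l hl hs a ha
      obtain ⟨x, hx⟩ := hl 0
      refine mem_relAct.2 ⟨R.arrow x a, ih _ (fun i => hl (i + 1)) (fun i => hs (i + 1)) ?_, ?_⟩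
      · rw [hs 0, hx]
        exact R.arrow_mem_E x a
      · rw [hx] at ha ⊢
        exact R.mem_lrel_inverse.2 ⟨rfl, ha⟩
  exact ⟨0, fun j _ => key j l hl hs⟩

/-- After the first letter the chain runs inside the intersection of the images of two different
arrows, which is finite dimensional. -/
theorem stabilizes_of_inverse_direct (hc : R.IsControlled ρ) {l : ℕ → Letter V}
    {x y : Quiver.Total V} (hx : l 0 = .inverse x) (hy : l 1 = .direct y) (hxy : x ≠ y) :
    R.Stabilizes l := by
  have := hc.finiteDimensional_range_inf hxy
  obtain ⟨J, hJ⟩ := exists_stable_of_antitone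
    (A := fun n => LinearMap.range (R.arrow x) ⊓ R.pre n fun i => l (i + 1))
    (fun i j hij => inf_le_inf le_rfl (R.pre_antitone _ hij)) (n := 1)
    (F := LinearMap.range (R.arrow x) ⊓ LinearMap.range (R.arrow y))
    (inf_le_inf le_rfl fun a ha => by
      obtain ⟨b, -, hb⟩ := mem_relAct.1 ha
      change (a, b) ∈ R.lrel (l 1) at hb
      rw [hy, mem_lrel_direct] at hb
      exact ⟨b, hb.1.symm⟩)
  refine ⟨J + 1, fun j hj a ha => ?_⟩
  obtain ⟨j, rfl⟩ := Nat.exists_eq_add_of_le' (show 1 ≤ j by omega)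
  obtain ⟨b, hb, hab⟩ := mem_relAct.1 ha
  refine mem_relAct.2 ⟨b, (hJ j (by omega) ⟨?_, hb⟩).2, hab⟩
  rw [hx, mem_lrel_inverse] at hab
  exact ⟨a, hab.1.symm⟩

theorem stabilizes_of_direct (hc : R.IsControlled ρ) {l : ℕ → Letter V} {y : Quiver.Total V}
    (hy : l 0 = .direct y) (h : ¬ Cyc ρ y) : R.Stabilizes l := by
  have := hc.finiteDimensional_range h
  refine exists_stable_of_antitone (R.pre_antitone l) (n := 1)
    (F := LinearMap.range (R.arrow y)) fun a ha => ?_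
  obtain ⟨b, -, hb⟩ := mem_relAct.1 ha
  rw [hy, mem_lrel_direct] at hb
  exact ⟨b, hb.1.symm⟩

theorem stabilizes_of_not_foll (hc : R.IsControlled ρ) {l : ℕ → Letter V}
    {x y : Quiver.Total V} (hx : l 0 = .direct x) (hy : l 1 = .direct y) (hxy : ¬ Foll ρ x y) :
    R.Stabilizes l := by
  refine ⟨2, fun j _ a ha => ?_⟩
  obtain ⟨b, hb, hab⟩ := mem_relAct.1 ha
  obtain ⟨d, -, hbd⟩ := mem_relAct.1 hb
  rw [hx, mem_lrel_direct] at hab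
  change (b, d) ∈ R.lrel (l 1) at hbd
  rw [hy, mem_lrel_direct] at hbd
  rw [hab.1, hbd.1, R.arrow_arrow_eq_zero hc.rel hxy]
  exact zero_mem _

/-- The tails of a sequence of letters stabilize unless it ends with powers of a primitive
cycle. -/
theorem stabilizes_of_not_cyc (hc : R.IsControlled ρ) (σ : Signs ρ) {l : ℕ → Letter V}
    (hs : ∀ i, σ.src (l (i + 1)) = σ.dst (l i))
    (hcyc : ¬ ∃ N y, Cyc ρ y ∧ ∀ i, l (i + N) = .direct ((next ρ)^[i] y)) (N : ℕ) :
    R.Stabilizes fun i => l (i + N) := by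
  have hs' : ∀ i, (l (i + 1)).head = (l i).tail := fun i => congrArg Prod.fst (hs i)
  suffices h : ∃ n, R.Stabilizes fun i => l (i + (n + N)) by
    obtain ⟨n, hn⟩ := h
    refine Stabilizes.of_add n ?_
    simpa only [add_assoc] using hn
  -- Three cases: all letters are inverse from some place on; an inverse letter is followed by a
  -- direct one; all letters are direct.
  by_cases h1 : ∃ n, ∀ i, ∃ x, l (i + (n + N)) = .inverse x
  · obtain ⟨n, hn⟩ := h1
    refine ⟨n, stabilizes_of_inverse hn fun i => ?_⟩
    rw [← hs']
    congr 2
    ring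
  · push Not at h1
    by_cases h2 : ∃ n x, l (n + N) = .inverse x
    · obtain ⟨n, x, hx⟩ := h2
      by_contra hne
      push Not at hne
      obtain ⟨i, hi⟩ := h1 n
      have : ∀ i, ∃ x, l (i + (n + N)) = .inverse x := by
        intro i
        induction i with
        | zero => exact ⟨x, by simpa using hx⟩
        | succ i ih =>
          obtain ⟨x, hx⟩ := ih
          rcases hy : l (i + 1 + (n + N)) with y | y
          · refine (hne (i + n) (hc.stabilizes_of_inverse_direct (x := x) (y := y) ?_ ?_ ?_)).elim
            · rw [← hx]; congr 1; ring
            · rw [← hy]; congr 1; ring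
            · rintro rfl
              have h3 := hs (i + (n + N))
              rw [show i + (n + N) + 1 = i + 1 + (n + N) by ring, hx, hy] at h3
              exact Side.flip_ne _ (h3.trans (σ.dst_inv (.direct x))).symm
          · exact ⟨y, rfl⟩
      obtain ⟨x, hx⟩ := this i
      exact hi x hx
    · have h3 : ∀ n, ∃ y, l (n + N) = .direct y := by
        intro n
        rcases hy : l (n + N) with y | y
        · exact ⟨y, rfl⟩
        · exact (h2 ⟨n, y, hy⟩).elim
      choose y hy using h3
      -- Direct letters without relations of length two form the ray that ends with `y 0`, and
      -- `hcyc` says that `y 0` is not cyclic.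
      by_cases h4 : ∀ i, Foll ρ (y i) (y (i + 1))
      · have h5 : ∀ i, y i = (next ρ)^[i] (y 0) := by
          intro i
          induction i with
          | zero => rfl
          | succ i ih => rw [Function.iterate_succ_apply', ← ih, (h4 i).next_eq hc.string]
        refine ⟨0, hc.stabilizes_of_direct (y := y 0) (by simpa using hy 0) fun h => hcyc
          ⟨N, y 0, h, fun i => by rw [hy, h5]⟩⟩
      · push Not at h4
        obtain ⟨i, hi⟩ := h4
        refine ⟨i, hc.stabilizes_of_not_foll ?_ ?_ hi⟩
        · rw [← hy]; congr 1; ring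
        · rw [← hy]; congr 1; ring

end IsControlled

theorem mem_plus_of_seq (σ : Signs ρ) {s : Side V} {l : ℕ → Letter V} {f : ℕ → M}
    (h : ∀ n, (f n, f (n + 1)) ∈ R.lrel (l n)) : f 0 ∈ R.plus σ s fun n => some (l n) :=
  (R.mem_plus σ).2 ⟨f, (R.mem_seqs σ).2 h, rfl⟩

theorem plus_none (σ : Signs ρ) (s : Side V) : R.plus σ s (fun _ => none) = R.kerSide σ s := by
  ext m
  rw [mem_plus]
  constructor
  · rintro ⟨f, hf, rfl⟩
    exact ((R.mem_step_none σ).1 ((R.mem_seqs σ).1 hf 0)).1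
  · intro hm
    refine ⟨fun _ => m, (R.mem_seqs σ).2 fun n => ?_, rfl⟩
    have : σ.st s (fun _ => none) n = s := by
      induction n with
      | zero => rfl
      | succ n ih => rw [σ.st_succ_none rfl, ih]
    rw [this, mem_step_none, sub_self]
    exact ⟨hm, hm, zero_mem _⟩

theorem minus_none_le (σ : Signs ρ) (s : Side V) :
    R.minus σ s (fun _ => none) ≤ R.imSide σ s := by
  intro m hm
  obtain ⟨f, hf, ⟨N, hN⟩, rfl⟩ := (R.mem_minus σ).1 hm
  have hst : ∀ n, σ.st s (fun _ => none) n = s := by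
    intro n
    induction n with
    | zero => rfl
    | succ n ih => rw [σ.st_succ_none rfl, ih]
  have key : ∀ n, f 0 - f n ∈ R.imSide σ s := by
    intro n
    induction n with
    | zero => rw [sub_self]; exact zero_mem _
    | succ n ih =>
      have h1 := (R.mem_seqs σ).1 hf n
      rw [hst, mem_step_none] at h1
      have := add_mem ih h1.2.2
      rwa [sub_add_sub_cancel] at this
  have := key N
  rwa [hN N le_rfl, sub_zero] at this

/-- The composition of two linear relations. -/
def relComp (r r' : Submodule k (M × M)) : Submodule k (M × M) where
  carrier := {p | ∃ b, (p.1, b) ∈ r ∧ (b, p.2) ∈ r'}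
  add_mem' := by
    rintro p q ⟨b, h1, h2⟩ ⟨b', h1', h2'⟩
    exact ⟨b + b', r.add_mem h1 h1', r'.add_mem h2 h2'⟩
  zero_mem' := ⟨0, r.zero_mem, r'.zero_mem⟩
  smul_mem' := by
    rintro c p ⟨b, h1, h2⟩
    exact ⟨c • b, r.smul_mem c h1, r'.smul_mem c h2⟩

theorem relAct_relComp (r r' : Submodule k (M × M)) (Y : Submodule k M) :
    relAct (relComp r r') Y = relAct r (relAct r' Y) := by
  ext a
  simp only [mem_relAct]
  constructor
  · rintro ⟨b, hb, d, h1, h2⟩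
    exact ⟨d, ⟨b, hb, h2⟩, h1⟩
  · rintro ⟨d, ⟨b, hb, h2⟩, h1⟩
    exact ⟨b, hb, d, h1, h2⟩

theorem opRay_cycLen_mul (R : QuiverOps k V M) {x : Quiver.Total V} (hx : Cyc ρ x) (q n : ℕ) :
    R.opRay ρ x (cycLen ρ x * q + n) = R.cycOp ρ x ^ q * R.opRay ρ x n := by
  induction q with
  | zero => simp
  | succ q ih =>
    rw [show cycLen ρ x * (q + 1) + n = cycLen ρ x + (cycLen ρ x * q + n) by ring,
      opRay_add, hx.iterate_cycLen, ih, pow_succ', mul_assoc, R.cycOp_eq hx]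

theorem pre_le_range_opRay (y : Quiver.Total V) (n : ℕ) :
    R.pre n (fun i => .direct ((next ρ)^[i] y)) ≤ LinearMap.range (R.opRay ρ y n) := by
  induction n generalizing y with
  | zero => exact fun a _ => ⟨a, rfl⟩
  | succ n ih =>
    intro a ha
    obtain ⟨b, hb, hab⟩ := mem_relAct.1 ha
    obtain ⟨e, rfl⟩ := ih (next ρ y) hb
    exact ⟨e, (R.mem_lrel_direct.1 hab).1.symm⟩

/-! ### The covering property of one-sided words -/

namespace IsControlled

theorem stable_relAct {φ : Module.End k M} {r : Submodule k (M × M)} {Y : Submodule k M}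
    (hr : ∀ a b, (a, b) ∈ r → (φ a, φ b) ∈ r) (hY : Stable φ Y) : Stable φ (relAct r Y) := by
  intro m hm
  obtain ⟨b, hb, h⟩ := mem_relAct.1 hm
  exact mem_relAct.2 ⟨φ b, hY b hb, hr _ _ h⟩

/-- Krull's intersection theorem for powers of a primitive cycle. -/
theorem sat_bot_of_cyc (hc : R.IsControlled ρ) {X : Submodule k M} (hX : Stable (R.Z ρ) X)
    {r : Submodule k (M × M)} (hr : ∀ a b, (a, b) ∈ r → (R.Z ρ a, R.Z ρ b) ∈ r) {m : M}
    {y : Quiver.Total V} (hy : Cyc ρ y)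
    (h : ∀ n, Sat (R.Z ρ) (X ⊔ relAct r (LinearMap.range (R.opRay ρ y n))) m) :
    Sat (R.Z ρ) (X ⊔ relAct r ⊥) m := by
  set Y := LinearMap.range (R.arrow y)
  -- A path of `a + 1` turns is used: the additional turn leads into the image of `y`, where `Z`
  -- acts as the cycle and the other turns become `Z ^ a`.
  have h' : ∀ a : ℕ, ∃ f : Polynomial k, f.coeff 0 = 1 ∧ ∃ x' ∈ X, ∃ b, ∃ n ∈ Y,
      Polynomial.aeval (R.Z ρ) f m = x' + b ∧ (b, (R.Z ρ ^ a) n) ∈ r := by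
    intro a
    obtain ⟨f, hf, hs⟩ := h (cycLen ρ y * a + cycLen ρ y)
    obtain ⟨x', hx', b, hb, e⟩ := Submodule.mem_sup.1 hs
    obtain ⟨_, ⟨n, rfl⟩, hbn⟩ := mem_relAct.1 hb
    refine ⟨f, hf, x', hx', b, R.opRay ρ y (cycLen ρ y) n,
      R.opRay_mem_range hy.cycLen_pos n, e.symm, ?_⟩
    rw [(hc.Z_pow_eq_cycOp_pow (R.opRay_mem_range hy.cycLen_pos n) a).1]
    rwa [R.opRay_cycLen_mul hy] at hbn
  obtain ⟨f₀, hf₀, x₀, hx₀, a₀, b₀, hb₀, e₀, h₀⟩ := h' 0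
  change (a₀, b₀) ∈ r at h₀
  have hr' : ∀ a b, (a, b) ∈ r.map (LinearEquiv.prodComm k M M).toLinearMap ↔ (b, a) ∈ r := by
    intro a b
    simp
  set S := relAct (r.map (LinearEquiv.prodComm k M M).toLinearMap) X with hSdef
  have hS : Stable (R.Z ρ) S := stable_relAct (fun a b hab => by
    rw [hr'] at hab ⊢
    exact hr _ _ hab) hX
  -- `S` consists of the elements to which `r` relates elements of `X`. Comparing the decompositions
  -- of `m` for `a` and for `0`, each multiplied by the denominator of the other, shows that `b₀`
  -- lies in `S` up to a denominator and an element of `Z ^ a` applied to the image of `y`. As `a`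
  -- is arbitrary, Krull's theorem applies.
  have hb : Sat (R.Z ρ) S b₀ := by
    refine (hc.stableFG_range y).sat_of_forall_pow hS hb₀ fun a => ?_
    obtain ⟨f₁, hf₁, x₁, hx₁, a₁, n₁, hn₁, e₁, h₁⟩ := h' a
    refine ⟨f₁, hf₁, Polynomial.aeval (R.Z ρ) f₀ n₁, (hc.stable_range y).aeval f₀ hn₁, ?_⟩
    refine mem_relAct.2 ⟨Polynomial.aeval (R.Z ρ) f₁ a₀ - Polynomial.aeval (R.Z ρ) f₀ a₁,
      ?_, (hr' _ _).2 ?_⟩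
    · have e2 : Polynomial.aeval (R.Z ρ) f₁ (x₀ + a₀) = Polynomial.aeval (R.Z ρ) f₀ (x₁ + a₁) := by
        rw [← e₀, ← e₁, ← Module.End.mul_apply, ← Module.End.mul_apply, ← map_mul, ← map_mul,
          mul_comm]
      rw [map_add, map_add] at e2
      have e3 : Polynomial.aeval (R.Z ρ) f₁ a₀ - Polynomial.aeval (R.Z ρ) f₀ a₁ =
          Polynomial.aeval (R.Z ρ) f₀ x₁ - Polynomial.aeval (R.Z ρ) f₁ x₀ := by
        rw [sub_eq_sub_iff_add_eq_add, add_comm, e2]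
      rw [e3]
      exact sub_mem (hX.aeval _ hx₁) (hX.aeval _ hx₀)
    · have e4 : (R.Z ρ ^ a) (Polynomial.aeval (R.Z ρ) f₀ n₁) =
          Polynomial.aeval (R.Z ρ) f₀ ((R.Z ρ ^ a) n₁) := by
        have : R.Z ρ ^ a = Polynomial.aeval (R.Z ρ) (Polynomial.X ^ a : Polynomial k) := by
          rw [map_pow, Polynomial.aeval_X]
        rw [this, ← Module.End.mul_apply, ← map_mul, mul_comm, map_mul, Module.End.mul_apply]
      rw [e4]
      exact r.sub_mem (aeval_prod_mem hr f₁ h₀) (aeval_prod_mem hr f₀ h₁)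
  obtain ⟨g, hg, hgb⟩ := hb
  obtain ⟨x', hx', hx''⟩ := mem_relAct.1 hgb
  rw [hr'] at hx''
  refine Sat.of_aeval hf₀ ⟨g, hg, ?_⟩
  rw [e₀, map_add]
  have e5 : Polynomial.aeval (R.Z ρ) g x₀ + Polynomial.aeval (R.Z ρ) g a₀ =
      (Polynomial.aeval (R.Z ρ) g x₀ + x') + (Polynomial.aeval (R.Z ρ) g a₀ - x') := by abel
  rw [e5]
  refine Submodule.add_mem_sup (add_mem (hX.aeval g hx₀) hx') (mem_relAct.2 ⟨0, zero_mem _, ?_⟩)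
  have := r.sub_mem (aeval_prod_mem hr g h₀) hx''
  simpa using this

end IsControlled

/-- The composition of a relation with the relations of the first `n` letters of a sequence. -/
def relIter (R : QuiverOps k V M) (r : Submodule k (M × M)) (l : ℕ → Letter V) :
    ℕ → Submodule k (M × M)
  | 0 => r
  | n + 1 => relComp (relIter R r l n) (R.lrel (l n))

theorem relAct_relIter_pre (r : Submodule k (M × M)) (l : ℕ → Letter V) (n j : ℕ) :
    relAct (R.relIter r l n) (R.pre j fun i => l (i + n)) = relAct r (R.pre (j + n) l) := by
  induction n generalizing j with
  | zero => rfl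
  | succ n ih =>
    have h1 : relAct (R.relIter r l (n + 1)) (R.pre j fun i => l (i + (n + 1))) =
        relAct (R.relIter r l n) (R.pre (j + 1) fun i => l (i + n)) := by
      rw [relIter, relAct_relComp, pre, Nat.zero_add]
      simp only [add_assoc, add_comm 1 n]
    rw [h1, ih, add_assoc, add_comm 1 n]

namespace IsControlled

theorem relIter_Z (hc : R.IsControlled ρ) {r : Submodule k (M × M)}
    (hr : ∀ a b, (a, b) ∈ r → (R.Z ρ a, R.Z ρ b) ∈ r) (l : ℕ → Letter V) (n : ℕ) (a b : M)
    (h : (a, b) ∈ R.relIter r l n) : (R.Z ρ a, R.Z ρ b) ∈ R.relIter r l n := by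
  induction n generalizing b with
  | zero => exact hr a b h
  | succ n ih =>
    obtain ⟨d, h1, h2⟩ := h
    exact ⟨R.Z ρ d, ih d h1, hc.lrel_Z _ _ _ h2⟩

/-- Following every finite part of an infinite word is weaker than following all of it. The two
agree when the tails stabilize; they can fail to do so only if the word ends with direct powers of a
cycle, and then `sat_bot_of_cyc` turns `h1` into a contradiction to `h2`. An eventually zero
sequence, on the other hand, would contradict `h2` at the place where it becomes zero. -/
theorem exists_word_of_seq (hc : R.IsControlled ρ) (σ : Signs ρ) {X : Submodule k M}
    (hX : Stable (R.Z ρ) X) {r : Submodule k (M × M)}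
    (hr : ∀ a b, (a, b) ∈ r → (R.Z ρ a, R.Z ρ b) ∈ r) {m : M} {l : ℕ → Letter V}
    (hs : ∀ i, σ.src (l (i + 1)) = σ.dst (l i))
    (h1 : ∀ n, Sat (R.Z ρ) (X ⊔ relAct (R.relIter r l n) (R.E (l n).head)) m)
    (h2 : ∀ n, ¬ Sat (R.Z ρ) (X ⊔ relAct (R.relIter r l n) ⊥) m) :
    ∃ w, σ.IsWord (σ.src (l 0)) w ∧
      Sat (R.Z ρ) (X ⊔ relAct r (R.plus σ (σ.src (l 0)) w)) m ∧
      ¬ Sat (R.Z ρ) (X ⊔ relAct r (R.minus σ (σ.src (l 0)) w)) m := by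
  have h1' : ∀ n, Sat (R.Z ρ) (X ⊔ relAct r (R.pre n l)) m := by
    intro n
    have := h1 n
    have h3 := relAct_relIter_pre (R := R) r l n 0
    rw [Nat.zero_add] at h3
    rw [← h3, pre, Nat.zero_add]
    exact this
  have hst : ∀ n, σ.st (σ.src (l 0)) (fun n => some (l n)) n = σ.src (l n) := by
    intro n
    induction n with
    | zero => rfl
    | succ n ih => rw [σ.st_succ_some rfl, hs]
  refine ⟨fun n => some (l n), ⟨fun n l' hl => ?_, fun n hn => by simp at hn⟩, ?_, ?_⟩
  · obtain rfl : l n = l' := by simpa using hl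
    exact (hst n).symm
  · have hcyc : ¬ ∃ N y, Cyc ρ y ∧ ∀ i, l (i + N) = .direct ((next ρ)^[i] y) := by
      rintro ⟨N, y, hy, hl⟩
      refine h2 N (hc.sat_bot_of_cyc hX (hc.relIter_Z hr l N) hy fun n => ?_)
      refine (h1' (n + N)).mono (sup_le_sup le_rfl ?_)
      rw [← relAct_relIter_pre]
      refine relAct_mono _ ?_
      simp only [hl]
      exact pre_le_range_opRay y n
    obtain ⟨J, hJ⟩ := exists_seq_of_stabilizes (hc.stabilizes_of_not_cyc σ hs hcyc)
    refine (h1' J).mono (sup_le_sup le_rfl (relAct_mono _ fun a ha => ?_))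
    obtain ⟨f, rfl, hf⟩ := hJ a ha
    exact mem_plus_of_seq σ hf
  · rintro ⟨f, hf, hfm⟩
    obtain ⟨x', hx', a, ha, e⟩ := Submodule.mem_sup.1 hfm
    obtain ⟨b, hb, hab⟩ := mem_relAct.1 ha
    obtain ⟨g, hg, ⟨N, hN⟩, rfl⟩ := (R.mem_minus σ).1 hb
    have hg' : ∀ n, (a, g n) ∈ R.relIter r l n := by
      intro n
      induction n with
      | zero => exact hab
      | succ n ih => exact ⟨g n, ih, (R.mem_seqs σ).1 hg n⟩
    refine h2 N ⟨f, hf, ?_⟩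
    rw [← e]
    refine Submodule.add_mem_sup hx' (mem_relAct.2 ⟨0, zero_mem _, ?_⟩)
    have := hg' N
    rwa [hN N le_rfl] at this

/-- The subspaces of the words on one side cover the space at a vertex. -/
theorem exists_word (hc : R.IsControlled ρ) (σ : Signs ρ) {X : Submodule k M}
    (hX : Stable (R.Z ρ) X) {s : Side V} {m : M} (hm : m ∈ R.E s.1) (hn : ¬ Sat (R.Z ρ) X m) :
    ∃ w, σ.IsWord s w ∧ Sat (R.Z ρ) (X ⊔ R.plus σ s w) m ∧
      ¬ Sat (R.Z ρ) (X ⊔ R.minus σ s w) m := by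
  -- A state consists of the side reached and the relation composed so far. The invariant places `m`
  -- inside the interval of the part of the word that has been read; `Good` says that this part can
  -- be completed.
  let Inv : Side V × Submodule k (M × M) → Prop := fun p =>
    (∀ a b, (a, b) ∈ p.2 → (R.Z ρ a, R.Z ρ b) ∈ p.2) ∧
      Sat (R.Z ρ) (X ⊔ relAct p.2 (R.E p.1.1)) m ∧ ¬ Sat (R.Z ρ) (X ⊔ relAct p.2 ⊥) m
  let Good : Side V × Submodule k (M × M) → Prop := fun p =>
    ∃ w, σ.IsWord p.1 w ∧ Sat (R.Z ρ) (X ⊔ relAct p.2 (R.plus σ p.1 w)) m ∧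
      ¬ Sat (R.Z ρ) (X ⊔ relAct p.2 (R.minus σ p.1 w)) m
  have hcons : ∀ s r l, σ.src l = s → Good (σ.dst l, relComp r (R.lrel l)) → Good (s, r) := by
    rintro s r l rfl ⟨w, hw, h1, h2⟩
    have hl : (fun n => Nat.casesOn n (some l) w : ℕ → Option (Letter V)) 0 = some l := rfl
    refine ⟨fun n => Nat.casesOn n (some l) w, ⟨?_, ?_⟩, ?_, ?_⟩
    · rintro (_ | n) l' h
      · obtain rfl : l = l' := by simpa using h
        rfl
      · rw [← σ.st_shift_some hl]
        exact hw.src_eq n l' h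
    · rintro (_ | n) h
      · simp at h
      · exact hw.none_succ n h
    · rw [relAct_relComp] at h1
      rw [R.plus_cons σ hl]
      exact h1
    · rw [relAct_relComp] at h2
      rw [R.minus_cons σ hl]
      exact h2
  -- A state that cannot be completed can be prolonged by a letter. Otherwise `m` is not reached by
  -- the direct letter and is killed by the inverse letter, up to denominators, which places it
  -- between `imSide` and `kerSide`: the word could end here.
  have hnext : ∀ p, Inv p → ¬ Good p → ∃ l, σ.src l = p.1 ∧
      Inv (σ.dst l, relComp p.2 (R.lrel l)) ∧ ¬ Good (σ.dst l, relComp p.2 (R.lrel l)) := by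
    rintro ⟨s, r⟩ ⟨hr, h1, h2⟩ hg
    suffices h : ∃ l, σ.src l = s ∧ Inv (σ.dst l, relComp r (R.lrel l)) by
      obtain ⟨l, hl, hI⟩ := h
      exact ⟨l, hl, hI, fun h => hg (hcons s r l hl h)⟩
    have hr' : ∀ l a b, (a, b) ∈ relComp r (R.lrel l) →
        (R.Z ρ a, R.Z ρ b) ∈ relComp r (R.lrel l) := by
      rintro l a b ⟨d, h3, h4⟩
      exact ⟨R.Z ρ d, hr _ _ h3, hc.lrel_Z _ _ _ h4⟩
    by_contra hne
    push Not at hne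
    have hdir : ∀ y, σ.src (.direct y) = s →
        ¬ Sat (R.Z ρ) (X ⊔ relAct r (LinearMap.range (R.arrow y))) m := by
      intro y hy hs
      refine hne (.direct y) hy ⟨hr' _, hs.mono (sup_le_sup le_rfl ?_), fun h => h2 (h.mono
        (sup_le_sup le_rfl ?_))⟩
      · rw [relAct_relComp]
        refine relAct_mono _ ?_
        rintro _ ⟨a, rfl⟩
        exact mem_relAct.2 ⟨R.vert y.left a, R.vert_mem_E _ _,
          R.mem_lrel_direct.2 ⟨(R.arrow_vert y a).symm, R.vert_mem_E _ _⟩⟩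
      · rw [relAct_relComp]
        refine relAct_mono _ fun a ha => ?_
        obtain ⟨b, hb, hab⟩ := mem_relAct.1 ha
        rw [mem_lrel_direct, (Submodule.mem_bot k).1 hb, map_zero] at hab
        exact hab.1
    have hinv : ∀ x, σ.src (.inverse x) = s →
        Sat (R.Z ρ) (X ⊔ relAct r (R.E s.1 ⊓ LinearMap.ker (R.arrow x))) m := by
      intro x hx
      by_contra hs
      have hx1 : x.left = s.1 := congrArg Prod.fst hx
      refine hne (.inverse x) hx ⟨hr' _, h1.mono (sup_le_sup le_rfl ?_), fun h => hs (h.mono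
        (sup_le_sup le_rfl ?_))⟩
      · rw [relAct_relComp]
        refine relAct_mono _ fun a ha => mem_relAct.2 ⟨R.arrow x a, R.arrow_mem_E x a,
          R.mem_lrel_inverse.2 ⟨rfl, ?_⟩⟩
        rw [hx1]
        exact ha
      · rw [relAct_relComp]
        refine relAct_mono _ fun a ha => ?_
        obtain ⟨b, hb, hab⟩ := mem_relAct.1 ha
        rw [mem_lrel_inverse, (Submodule.mem_bot k).1 hb, hx1] at hab
        exact ⟨hab.2, hab.1.symm⟩
    refine hg ⟨fun _ => none, ⟨fun n l h => by simp at h, fun _ _ => rfl⟩, ?_, ?_⟩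
    · rw [plus_none]
      by_cases hx : ∃ x, σ.src (.inverse x) = s
      · obtain ⟨x, hx⟩ := hx
        refine (hinv x hx).mono (sup_le_sup le_rfl (relAct_mono _ ?_))
        rintro a ⟨ha, hxa⟩
        refine (R.mem_kerSide σ).2 ⟨ha, fun x' hx' => ?_⟩
        rw [σ.inverse_eq (hx'.trans hx.symm)]
        exact hxa
      · refine h1.mono (sup_le_sup le_rfl (relAct_mono _ fun a ha => ?_))
        exact (R.mem_kerSide σ).2 ⟨ha, fun x hx' => (hx ⟨x, hx'⟩).elim⟩
    · intro hs
      replace hs := hs.mono (sup_le_sup le_rfl (relAct_mono _ (minus_none_le σ s)))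
      by_cases hy : ∃ y, σ.src (.direct y) = s
      · obtain ⟨y, hy⟩ := hy
        refine hdir y hy (hs.mono (sup_le_sup le_rfl (relAct_mono _ ?_)))
        refine iSup₂_le fun y' hy' => ?_
        rw [σ.direct_eq (hy'.trans hy.symm)]
      · refine h2 (hs.mono (sup_le_sup le_rfl (relAct_mono _ ?_)))
        exact iSup₂_le fun y' hy' => (hy ⟨y', hy'⟩).elim
  let r₀ : Submodule k (M × M) := LinearMap.ker (LinearMap.fst k M M - LinearMap.snd k M M)
  have hr₀ : ∀ a b, (a, b) ∈ r₀ ↔ a = b := fun a b => by simp [r₀, sub_eq_zero]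
  have hact : ∀ Y, relAct r₀ Y = Y := by
    intro Y
    ext a
    rw [mem_relAct]
    constructor
    · rintro ⟨b, hb, h⟩
      rwa [(hr₀ _ _).1 h]
    · exact fun h => ⟨a, h, (hr₀ _ _).2 rfl⟩
  have hr₀Z : ∀ a b, (a, b) ∈ r₀ → (R.Z ρ a, R.Z ρ b) ∈ r₀ := fun a b h => by
    rw [hr₀] at h ⊢
    rw [h]
  have hI : Inv (s, r₀) := by
    refine ⟨hr₀Z, ?_, ?_⟩
    · rw [hact]
      exact Sat.of_mem (Submodule.mem_sup_right hm)
    · rw [hact, sup_bot_eq]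
      exact hn
  suffices h : Good (s, r₀) by
    obtain ⟨w, hw, h1, h2⟩ := h
    rw [hact] at h1 h2
    exact ⟨w, hw, h1, h2⟩
  by_contra hg
  have : Nonempty (Letter V) := ⟨(hnext _ hI hg).choose⟩
  choose! F hF1 hF2 hF3 using hnext
  -- If the empty start cannot be completed, choosing letters forever produces an infinite word, and
  -- this completes it after all.
  let p : ℕ → Side V × Submodule k (M × M) := fun n =>
    Nat.rec (s, r₀) (fun _ q => (σ.dst (F q), relComp q.2 (R.lrel (F q)))) n
  have hp : ∀ n, Inv (p n) ∧ ¬ Good (p n) := by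
    intro n
    induction n with
    | zero => exact ⟨hI, hg⟩
    | succ n ih => exact ⟨hF2 _ ih.1 ih.2, hF3 _ ih.1 ih.2⟩
  have hsrc : ∀ n, σ.src (F (p n)) = (p n).1 := fun n => hF1 _ (hp n).1 (hp n).2
  have hp2 : ∀ n, (p n).2 = R.relIter r₀ (fun n => F (p n)) n := by
    intro n
    induction n with
    | zero => rfl
    | succ n ih =>
      change relComp (p n).2 _ = _
      rw [ih]
      rfl
  have hfin := hc.exists_word_of_seq σ hX hr₀Z (m := m) (l := fun n => F (p n))
    (fun i => hsrc (i + 1)) (fun n => by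
      have h1 := (hp n).1.2.1
      rw [hp2, ← hsrc n] at h1
      exact h1) (fun n => by
      have h1 := (hp n).1.2.2
      rwa [hp2] at h1)
  have e : σ.src (F (p 0)) = s := hsrc 0
  rw [e] at hfin
  exact hg hfin

end IsControlled

end QuiverOps

namespace QuiverOps

variable {k : Type u} [Field k] {V : Type v} [Quiver.{w} V] {ρ : Set (QPath V)}
  {M : Type x} [AddCommGroup M] [Module k M] {R : QuiverOps k V M} {σ : Signs ρ} {c : σ.BiWord}

/-! ### Families along two-sided words -/

theorem IsStr.apply_direct {m : ℤ → M} (hm : R.IsStr c m) {i : ℤ} {x : Quiver.Total V}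
    (h : c.letter i = some (.direct x)) : R.arrow x (m i) = m (i - 1) := by
  have := hm.rel (i - 1) (.direct x) (by rwa [sub_add_cancel])
  rw [sub_add_cancel, mem_lrel_direct] at this
  exact this.1.symm

theorem IsStr.apply_inverse {m : ℤ → M} (hm : R.IsStr c m) {i : ℤ} {x : Quiver.Total V}
    (h : c.letter (i + 1) = some (.inverse x)) : R.arrow x (m i) = m (i + 1) := by
  have := hm.rel i (.inverse x) h
  rw [mem_lrel_inverse] at this
  exact this.1.symm

theorem IsStr.apply_eq_zero_of_src (hR : ∀ r ∈ ρ, R.path r.path = 0) {m : ℤ → M}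
    (hm : R.IsStr c m) {i : ℤ} (hi : i ∈ c.I) {x : Quiver.Total V}
    (hx : c.letter (i + 1) ≠ some (.inverse x)) (hs : σ.src (.inverse x) = c.side i) :
    R.arrow x (m i) = 0 := by
  rcases hl : c.letter (i + 1) with _ | (y | y)
  · exact ((R.mem_kerSide σ).1 (hm.right_end i hi hl)).2 x hs
  · have h1 := (R.mem_lrel_direct.1 (hm.rel i _ hl)).1
    have h2 := c.src_eq _ _ hl
    rw [add_sub_cancel_right] at h2
    rw [h1, R.arrow_arrow_eq_zero hR (σ.not_foll (hs.trans h2.symm))]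
  · have h2 := c.src_eq _ _ hl
    rw [add_sub_cancel_right] at h2
    rw [σ.inverse_eq (h2.trans hs.symm)] at hl
    exact absurd hl hx

theorem IsStr.mem_E {m : ℤ → M} (hm : R.IsStr c m) {i : ℤ} (hi : i ∈ c.I) :
    m i ∈ R.E (c.side i).1 :=
  R.plus_le_E σ (c.right_isWord hi) (hm.mem_plus_right hi)

/-- An arrow that starts at the vertex of the position departs from one of its two sides; the side
facing left is treated in the inverse word. -/
theorem IsStr.apply_eq_zero (hR : ∀ r ∈ ρ, R.path r.path = 0) {m : ℤ → M} (hm : R.IsStr c m)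
    {i : ℤ} (hi : i ∈ c.I) {x : Quiver.Total V} (h : c.letter i ≠ some (.direct x))
    (h' : c.letter (i + 1) ≠ some (.inverse x)) : R.arrow x (m i) = 0 := by
  by_cases hv : x.left = (c.side i).1
  · by_cases hs : σ.src (.inverse x) = c.side i
    · exact hm.apply_eq_zero_of_src hR hi h' hs
    · have hi' : -i ∈ c.rev.I := by rwa [c.mem_rev, neg_neg]
      have := hm.rev.apply_eq_zero_of_src hR hi' (x := x) ?_ ?_
      · simpa using this
      · intro he
        obtain ⟨l, hl, hl'⟩ := Option.map_eq_some_iff.1 he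
        refine h ?_
        rw [show 1 - (-i + 1) = i by ring] at hl
        rw [hl, ← l.inv_inv, hl']
        rfl
      · change σ.src (.inverse x) = (c.side (- -i)).flip
        rw [neg_neg]
        have h1 : (σ.src (.inverse x)).1 = (c.side i).1 := hv
        refine Prod.ext h1 ?_
        change (σ.src (.inverse x)).2 = !(c.side i).2
        have h2 : (σ.src (.inverse x)).2 ≠ (c.side i).2 := fun h2 => hs (Prod.ext h1 h2)
        exact Bool.eq_not.2 h2
  · exact R.arrow_apply_of_ne hv (hm.mem_E hi)

theorem opRay_mem_of_arrow {H : Submodule k M} (hH : ∀ x, ∀ m ∈ H, R.arrow x m ∈ H)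
    (x : Quiver.Total V) (n : ℕ) {m : M} (hm : m ∈ H) : R.opRay ρ x n m ∈ H := by
  induction n generalizing x with
  | zero => exact hm
  | succ n ih => exact hH x _ (ih _)

theorem IsControlled.stable_of_arrow (hc : R.IsControlled ρ) {H : Submodule k M}
    (hH : ∀ x, ∀ m ∈ H, R.arrow x m ∈ H) : Stable (R.Z ρ) H := by
  intro m hm
  rw [hc.Z_apply]
  refine finsum_induction (· ∈ H) (zero_mem _) (fun a b ha hb => add_mem ha hb) fun x => ?_
  by_cases hx : Cyc ρ x
  · rw [R.cycOp_eq hx]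
    exact opRay_mem_of_arrow hH x _ hm
  · rw [R.cycOp_eq_zero hx]
    exact zero_mem _

/-- A stable subspace that is dense with respect to the filtrations given by pairs of words. -/
theorem IsControlled.sat_of_tplus_le (hc : R.IsControlled ρ) {H : Submodule k M}
    (hH : Stable (R.Z ρ) H) (h : ∀ t, σ.IsTriple t → R.tplus σ t ≤ H ⊔ R.tminus σ t) {v : V}
    {m : M} (hm : m ∈ R.E v) : Sat (R.Z ρ) H m := by
  by_contra hn
  obtain ⟨B, hB, ⟨f, hf, hfm⟩, h2⟩ := hc.exists_word σ hH (s := (v, true)) hm hn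
  obtain ⟨a, ha, b, hb, e⟩ := Submodule.mem_sup.1 hfm
  have hBm := hH.sup (hc.stable_minus σ (v, true) B)
  have hb' : ¬ Sat (R.Z ρ) (H ⊔ R.minus σ (v, true) B) b := by
    intro hs
    refine h2 (Sat.of_aeval hf ?_)
    rw [← e]
    exact (Sat.of_mem (Submodule.mem_sup_left ha)).add hBm hs
  -- Intersecting `H` with B⁺ keeps the component in D⁺, to be found next, inside B⁺ and hence in
  -- F⁺.
  have hX : Stable (R.Z ρ) ((H ⊓ R.plus σ (v, true) B) ⊔ R.minus σ (v, true) B) :=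
    (hH.inf (hc.stable_plus σ _ _)).sup (hc.stable_minus σ _ _)
  obtain ⟨D, hD, ⟨g, hg, hgb⟩, h3⟩ := hc.exists_word σ hX (s := (v, false))
    (R.plus_le_E σ hB hb) fun hs => hb' (hs.mono (sup_le_sup inf_le_left le_rfl))
  obtain ⟨a', ha', d, hd, e'⟩ := Submodule.mem_sup.1 hgb
  have hdB : d ∈ R.plus σ (v, true) B := by
    have h4 : d = Polynomial.aeval (R.Z ρ) g b - a' := by rw [← e', add_sub_cancel_left]
    rw [h4]
    exact sub_mem ((hc.stable_plus σ _ _).aeval g hb)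
      (sup_le inf_le_right (R.minus_le_plus σ _ _) ha')
  refine h3 ⟨g, hg, ?_⟩
  rw [← e']
  refine add_mem (Submodule.mem_sup_left ha') ?_
  -- Since F⁺ ⊆ H + F⁻, the component `d` lies in (H ∩ B⁺) + B⁻ + D⁻, against the choice of `D`.
  obtain ⟨y, hy, z, hz, rfl⟩ := Submodule.mem_sup.1 (h (v, B, D) ⟨hB, hD⟩ ⟨hdB, hd⟩)
  refine add_mem (Submodule.mem_sup_left (Submodule.mem_sup_left ⟨hy, ?_⟩)) ?_
  · have h5 := sub_mem hdB (R.tminus_le_tplus σ (v, B, D) hz).1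
    rwa [add_sub_cancel_right] at h5
  · obtain ⟨z₁, hz₁, z₂, hz₂, rfl⟩ := Submodule.mem_sup.1 hz
    exact add_mem (Submodule.mem_sup_right hz₁.2)
      (Submodule.mem_sup_left (Submodule.mem_sup_right hz₂.1))

/-! ### Lifts of bases of the subquotients -/

variable (R σ) in
/-- For each class of words, families along the word that form a basis of the subquotient at each
position. -/
structure LiftFamily where
  idx : σ.Class → Type x
  vec : ∀ p, idx p → ℤ → M
  isStr : ∀ p u, R.IsStr p.word (vec p u)
  basis : ∀ p, IsBasisMod (R.Fplus p.word 0) (R.Fminus p.word 0) fun u => vec p u 0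

namespace LiftFamily

variable (L : LiftFamily R σ)

theorem basis_at (p : σ.Class) {i : ℤ} (hi : i ∈ p.word.I) :
    IsBasisMod (R.Fplus p.word i) (R.Fminus p.word i) fun u => L.vec p u i :=
  IsBasisMod.of_isStr (L.isStr p) p.zero_mem hi (L.basis p)

theorem vec_notMem (p : σ.Class) (u : L.idx p) {i : ℤ} (hi : i ∈ p.word.I) :
    L.vec p u i ∉ R.Fminus p.word i := by
  intro h
  have := (L.basis_at p hi).indep (Finsupp.single u 1) (by simpa using h)
  simp at this

theorem vec_ne_zero (p : σ.Class) (u : L.idx p) {i : ℤ} (hi : i ∈ p.word.I) :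
    L.vec p u i ≠ 0 := fun h => L.vec_notMem p u hi (by rw [h]; exact zero_mem _)

/-- Positions are restricted to `J` because all vectors with the same triple must come from one
position. They then form part of a basis of a single subquotient. -/
theorem linearIndependent (hR : ∀ r ∈ ρ, R.path r.path = 0) : LinearIndependent k
    fun q : Σ p : σ.Class, L.idx p × p.word.J => L.vec q.1 q.2.1 q.2.2 := by
  classical
  refine R.linearIndependent_of_triples σ hR _ (fun q => q.1.word.triple q.2.2)
    (fun q => q.1.word.triple_isTriple (q.1.word.J_subset q.2.2.2))
    (fun q => (L.isStr q.1 q.2.1).mem_Fplus (q.1.word.J_subset q.2.2.2)) fun t₀ a ha hm => ?_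
  by_contra hne
  obtain ⟨⟨p, u₀, i⟩, hq⟩ := Finsupp.support_nonempty_iff.2 hne
  have ht := ha _ hq
  let e : L.idx p → Σ p : σ.Class, L.idx p × p.word.J := fun u => ⟨p, u, i⟩
  have he : Function.Injective e := by
    intro u u' h
    simpa [e] using h
  have hrange : (a.support : Set _) ⊆ Set.range e := by
    rintro ⟨p', u', i'⟩ hq'
    obtain ⟨rfl, h2⟩ := Signs.Class.eq_of_triple_eq i'.2 i.2 ((ha _ hq').trans ht.symm)
    obtain rfl : i' = i := Subtype.ext h2
    exact ⟨u', rfl⟩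
  have hmap := Finsupp.mapDomain_comapDomain e he a hrange
  rw [← hmap, Finsupp.linearCombination_mapDomain, ← ht] at hm
  have h0 := (L.basis_at p (p.word.J_subset i.2)).indep _ hm
  rw [h0, Finsupp.mapDomain_zero] at hmap
  exact hne hmap.symm

/-- The span of the family. -/
def span : Submodule k M := Submodule.span k {m | ∃ p u, ∃ i ∈ p.word.I, m = L.vec p u i}

theorem vec_mem_span (p : σ.Class) (u : L.idx p) {i : ℤ} (hi : i ∈ p.word.I) :
    L.vec p u i ∈ L.span := Submodule.subset_span ⟨p, u, i, hi, rfl⟩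

theorem arrow_mem_span (hR : ∀ r ∈ ρ, R.path r.path = 0) (x : Quiver.Total V) (m : M)
    (hm : m ∈ L.span) : R.arrow x m ∈ L.span := by
  have : L.span ≤ L.span.comap (R.arrow x) := by
    refine Submodule.span_le.2 ?_
    rintro _ ⟨p, u, i, hi, rfl⟩
    change R.arrow x (L.vec p u i) ∈ L.span
    by_cases h1 : p.word.letter i = some (.direct x)
    · rw [(L.isStr p u).apply_direct h1]
      exact L.vec_mem_span p u (p.word.mem_of_letter h1).2
    · by_cases h2 : p.word.letter (i + 1) = some (.inverse x)
      · rw [(L.isStr p u).apply_inverse h2]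
        exact L.vec_mem_span p u (p.word.mem_of_letter h2).1
      · rw [(L.isStr p u).apply_eq_zero hR hi h1 h2]
        exact zero_mem _
  exact this hm

theorem stable_span (hc : R.IsControlled ρ) : Stable (R.Z ρ) L.span :=
  hc.stable_of_arrow (L.arrow_mem_span hc.rel)

theorem tplus_le {t : Signs.Triple V} (ht : σ.IsTriple t) :
    R.tplus σ t ≤ L.span ⊔ R.tminus σ t := by
  obtain ⟨p, i, hi, rfl⟩ := Signs.Class.exists_triple_eq ht
  have hi' := p.word.J_subset hi
  refine (L.basis_at p hi').span.trans (sup_le_sup (Submodule.span_le.2 ?_) le_rfl)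
  rintro _ ⟨u, rfl⟩
  exact L.vec_mem_span p u hi'

theorem sat_span (hc : R.IsControlled ρ) {v : V} {m : M} (hm : m ∈ R.E v) :
    Sat (R.Z ρ) L.span m :=
  hc.sat_of_tplus_le (L.stable_span hc) (fun _ ht => L.tplus_le ht) hm

end LiftFamily

end QuiverOps

/-! ### Splitting off the part on which a linear relation is an isomorphism -/

section BandSplit

variable {k : Type u} [Field k] {M : Type x} [AddCommGroup M] [Module k M]

theorem sum_prod_mem {r : Submodule k (M × M)} {ι : Type*} {s : Finset ι} {f g : ι → M}
    (h : ∀ i ∈ s, (f i, g i) ∈ r) : (∑ i ∈ s, f i, ∑ i ∈ s, g i) ∈ r := by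
  have : (∑ i ∈ s, f i, ∑ i ∈ s, g i) = ∑ i ∈ s, (f i, g i) :=
    Prod.ext (by rw [Prod.fst_sum]) (by rw [Prod.snd_sum])
  rw [this]
  exact sum_mem h

/-- The relation induces an endomorphism `T₀` of P/Q in the basis `x`; it is injective by `h3`,
hence an automorphism by finite dimension. On representatives it holds only up to an error: Y = X T
+ S 0 + S' 0. By `h4` the error propagates forwards (`S`) and backwards (`S'`) through `Q` along `r`
and dies out in finitely many steps, so finite telescoping sums correct `X`. -/
theorem exists_automorphism {r : Submodule k (M × M)} {P Q : Submodule k M} {d : ℕ}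
    {x : Fin d → M} (hx : IsBasisMod P Q x) (h1 : ∀ a ∈ P, ∃ b ∈ P, (a, b) ∈ r)
    (h3 : ∀ a b, (a, b) ∈ r → a ∈ P → b ∈ P → b ∈ Q → a ∈ Q)
    (h4 : ∀ a ∈ Q, ∃ s t : ℕ → M, a = s 0 + t 0 ∧ (∀ n, s n ∈ Q) ∧ (∀ n, t n ∈ Q) ∧
      (∀ n, (s n, s (n + 1)) ∈ r) ∧ (∀ n, (t (n + 1), t n) ∈ r) ∧
      ∃ N, ∀ n ≥ N, s n = 0 ∧ t n = 0) :
    ∃ (T : (Fin d →₀ k) ≃ₗ[k] (Fin d →₀ k)) (φ : (Fin d →₀ k) →ₗ[k] M),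
      (∀ u, (φ u, φ (T u)) ∈ r) ∧ ∀ u, φ u - Finsupp.linearCombination k x u ∈ Q := by
  set X := Finsupp.linearCombination k x with hX
  have hXP : ∀ u, X u ∈ P := fun u => linearCombination_mem fun i _ => hx.mem i
  choose y hyP hxy using fun j => h1 _ (hx.mem j)
  have hy : ∀ j, ∃ a : Fin d →₀ k, y j - X a ∈ Q := by
    intro j
    obtain ⟨b, hb, e, he, hbe⟩ := Submodule.mem_sup.1 (hx.span (hyP j))
    obtain ⟨a, rfl⟩ := (Finsupp.mem_span_range_iff_exists_finsupp).1 hb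
    refine ⟨a, ?_⟩
    rw [← hbe, hX, Finsupp.linearCombination_apply, add_sub_cancel_left]
    exact he
  choose a ha using hy
  set Y := Finsupp.linearCombination k y with hY
  have hXY : ∀ u, (X u, Y u) ∈ r := linearCombination_mem_rel hxy
  have hYP : ∀ u, Y u ∈ P := fun u => linearCombination_mem fun i _ => hyP i
  let T₀ : (Fin d →₀ k) →ₗ[k] (Fin d →₀ k) := Finsupp.linearCombination k a
  have hT₀ : ∀ j, T₀ (Finsupp.single j 1) = a j := fun j => by simp [T₀]
  have hYT : ∀ u, Y u - X (T₀ u) ∈ Q := by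
    intro u
    have : Y - X ∘ₗ T₀ = Finsupp.linearCombination k fun j => y j - X (a j) := by
      ext j
      simp [hY, T₀]
    have h5 : Y u - X (T₀ u) = (Y - X ∘ₗ T₀) u := rfl
    rw [h5, this]
    exact linearCombination_mem fun j _ => ha j
  have hinj : Function.Injective T₀ := by
    rw [← LinearMap.ker_eq_bot, LinearMap.ker_eq_bot']
    intro u hu
    have h5 := hYT u
    rw [hu, map_zero, sub_zero] at h5
    exact hx.indep u (h3 _ _ (hXY u) (hXP u) (hYP u) h5)
  let T : (Fin d →₀ k) ≃ₗ[k] (Fin d →₀ k) := LinearEquiv.ofInjectiveEndo T₀ hinj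
  have hT : ∀ u, T u = T₀ u := fun u => rfl
  choose s t hst hs ht hsr htr N hN using fun j => h4 _ (ha j)
  let S : ℕ → (Fin d →₀ k) →ₗ[k] M := fun n => Finsupp.linearCombination k fun j => s j n
  let S' : ℕ → (Fin d →₀ k) →ₗ[k] M := fun n => Finsupp.linearCombination k fun j => t j n
  have hSr : ∀ n u, (S n u, S (n + 1) u) ∈ r := fun n =>
    linearCombination_mem_rel fun j => hsr j n
  have hSr' : ∀ n u, (S' (n + 1) u, S' n u) ∈ r := fun n =>
    linearCombination_mem_rel fun j => htr j n
  have hSQ : ∀ n u, S n u ∈ Q := fun n u => linearCombination_mem fun j _ => hs j n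
  have hSQ' : ∀ n u, S' n u ∈ Q := fun n u => linearCombination_mem fun j _ => ht j n
  have hYX : ∀ u, Y u = X (T u) + S 0 u + S' 0 u := by
    intro u
    have : Y = X ∘ₗ T₀ + S 0 + S' 0 := by
      ext j
      have := hst j
      rw [sub_eq_iff_eq_add] at this
      simp [hY, T₀, S, S', this]
      abel
    exact congrArg (fun F => F u) this
  obtain ⟨K, hK⟩ : ∃ K, ∀ j, N j ≤ K :=
    ⟨Finset.univ.sup N, fun j => Finset.le_sup (Finset.mem_univ j)⟩
  have hSK : ∀ u, S K u = 0 := fun u => by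
    refine (Submodule.mem_bot k).1 (linearCombination_mem fun j _ => ?_)
    exact (Submodule.mem_bot k).2 (hN j K (hK j)).1
  have hSK' : ∀ u, S' K u = 0 := fun u => by
    refine (Submodule.mem_bot k).1 (linearCombination_mem fun j _ => ?_)
    exact (Submodule.mem_bot k).2 (hN j K (hK j)).2
  -- The sums are chosen such that `r` relates `c₁ u` to `c₁ (T u) - S 0 u` and `c₂ u` to `c₂ (T u)
  -- - S' 0 u`, term by term; the last terms vanish by the choice of `K`.
  let c₁ : (Fin d →₀ k) →ₗ[k] M :=
    ∑ n ∈ Finset.range K, S n ∘ₗ ((T⁻¹ ^ (n + 1) : (Fin d →₀ k) ≃ₗ[k] (Fin d →₀ k)) : _ →ₗ[k] _)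
  let c₂ : (Fin d →₀ k) →ₗ[k] M :=
    -∑ n ∈ Finset.range K, S' (n + 1) ∘ₗ ((T ^ n : (Fin d →₀ k) ≃ₗ[k] (Fin d →₀ k)) : _ →ₗ[k] _)
  have hc₁ : ∀ u, c₁ u = ∑ n ∈ Finset.range K, S n ((T⁻¹ ^ (n + 1)) u) := fun u => by
    simp [c₁]
  have hc₂ : ∀ u, c₂ u = -∑ n ∈ Finset.range K, S' (n + 1) ((T ^ n) u) := fun u => by
    simp [c₂]
  have e₁ : ∀ u, c₁ (T u) = S 0 u + ∑ n ∈ Finset.range K, S (n + 1) ((T⁻¹ ^ (n + 1)) u) := by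
    intro u
    rw [hc₁]
    have h5 : ∀ n, (T⁻¹ ^ (n + 1)) (T u) = (T⁻¹ ^ n) u := by
      intro n
      rw [pow_succ, LinearEquiv.mul_apply]
      congr 1
      exact T.symm_apply_apply u
    simp only [h5]
    have h6 := Finset.sum_range_succ (fun n => S n ((T⁻¹ ^ n) u)) K
    rw [Finset.sum_range_succ', hSK, add_zero] at h6
    rw [← h6, add_comm]
    simp
  have e₂ : ∀ u, c₂ (T u) - S' 0 u = -∑ n ∈ Finset.range K, S' n ((T ^ n) u) := by
    intro u
    rw [hc₂]
    have h5 : ∀ n, (T ^ n) (T u) = (T ^ (n + 1)) u := by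
      intro n
      rw [pow_succ, LinearEquiv.mul_apply]
    simp only [h5]
    have h6 := Finset.sum_range_succ (fun n => S' n ((T ^ n) u)) K
    rw [Finset.sum_range_succ', hSK', add_zero] at h6
    rw [← h6]
    simp
    abel
  refine ⟨T, X + c₁ + c₂, fun u => ?_, fun u => ?_⟩
  · have m₁ : (c₁ u, c₁ (T u) - S 0 u) ∈ r := by
      rw [e₁, hc₁, add_sub_cancel_left]
      exact sum_prod_mem fun n _ => hSr n _
    have m₂ : (c₂ u, c₂ (T u) - S' 0 u) ∈ r := by
      rw [e₂, hc₂, ← Prod.neg_mk]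
      exact neg_mem (sum_prod_mem fun n _ => hSr' n _)
    have := add_mem (add_mem (hXY u) m₁) m₂
    rw [hYX] at this
    rw [Prod.mk_add_mk, Prod.mk_add_mk] at this
    convert this using 2
    · rfl
    · change X (T u) + c₁ (T u) + c₂ (T u) = X (T u) + S 0 u + S' 0 u + (c₁ (T u) - S 0 u) +
        (c₂ (T u) - S' 0 u)
      abel
  · simp only [LinearMap.add_apply]
    rw [add_assoc, add_sub_cancel_left, hc₁, hc₂]
    exact add_mem (sum_mem fun n _ => hSQ _ _) (neg_mem (sum_mem fun n _ => hSQ' _ _))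

end BandSplit

namespace QuiverOps

variable {k : Type u} [Field k] {V : Type v} [Quiver.{w} V] {ρ : Set (QPath V)}
  {M : Type x} [AddCommGroup M] [Module k M] {R : QuiverOps k V M} {σ : Signs ρ} {c : σ.BiWord}

/-! ### Periodic words -/

theorem _root_.StringAlg.Signs.BiWord.IsPer.rev (h : c.IsPer) : c.rev.IsPer := by
  refine ⟨Set.eq_univ_of_forall fun i => h.mem _, c.per, h.per_pos, fun t => ?_⟩
  change (c.letter (1 - (t + c.per))).map Letter.inv = (c.letter (1 - t)).map Letter.inv
  rw [← h.letter_add (1 - (t + c.per))]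
  congr 2
  ring

theorem IsStr.of_rel (hI : c.I = Set.univ) {m : ℤ → M}
    (h : ∀ i l, c.letter (i + 1) = some l → (m i, m (i + 1)) ∈ R.lrel l) : R.IsStr c m := by
  have h1 : ∀ i, c.letter i ≠ none := by
    intro i hi
    obtain ⟨l, hl⟩ := c.exists_letter (i := i) (by rw [hI]; trivial) (by rw [hI]; trivial)
    simp [hi] at hl
  exact ⟨h, fun i _ hi => (h1 _ hi).elim, fun i _ hi => (h1 _ hi).elim⟩

theorem IsStr.shift (hp : c.IsPer) {m : ℤ → M} (hm : R.IsStr c m) (n : ℤ) :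
    R.IsStr c fun i => m (i + n * c.per) := by
  refine IsStr.of_rel hp.1 fun i l hl => ?_
  have := hm.rel (i + n * c.per) l (by
    rw [← hl, ← hp.letter_add_mul (i + 1) n]; congr 1; ring)
  rwa [show i + n * c.per + 1 = i + 1 + n * c.per by ring] at this

/-- The relation given by the letters at positions `1, …, n`. -/
def stepsRel (R : QuiverOps k V M) (c : σ.BiWord) (n : ℕ) : Submodule k (M × M) where
  carrier := {p | ∃ f : ℤ → M, f 0 = p.1 ∧ f n = p.2 ∧
    ∀ i : ℤ, 0 ≤ i → i < n → ∀ l, c.letter (i + 1) = some l → (f i, f (i + 1)) ∈ R.lrel l}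
  add_mem' := by
    rintro p q ⟨f, h1, h2, h3⟩ ⟨g, h4, h5, h6⟩
    exact ⟨f + g, by simp [h1, h4], by simp [h2, h5], fun i hi hi' l hl =>
      add_mem (h3 i hi hi' l hl) (h6 i hi hi' l hl)⟩
  zero_mem' := ⟨0, rfl, rfl, fun _ _ _ _ _ => zero_mem _⟩
  smul_mem' := by
    rintro a p ⟨f, h1, h2, h3⟩
    exact ⟨a • f, by simp [h1], by simp [h2], fun i hi hi' l hl =>
      Submodule.smul_mem _ a (h3 i hi hi' l hl)⟩

theorem IsStr.mem_stepsRel (hp : c.IsPer) {m : ℤ → M} (hm : R.IsStr c m) (n : ℤ) :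
    (m (n * c.per), m ((n + 1) * c.per)) ∈ R.stepsRel c c.per := by
  refine ⟨fun i => m (i + n * c.per), by simp, ?_, fun i _ _ l hl => (hm.shift hp n).rel i l hl⟩
  change m (c.per + n * c.per) = m ((n + 1) * c.per)
  congr 1
  ring

/-- Three pieces are glued: a family through `a` to the left of `0`, the given chain over one
period, and a family through `b`, translated by the period, to the right. -/
theorem exists_isStr_of_stepsRel (hp : c.IsPer) {a b : M} (h : (a, b) ∈ R.stepsRel c c.per)
    (ha : a ∈ R.Fplus c 0) (hb : b ∈ R.Fplus c 0) :
    ∃ m, R.IsStr c m ∧ m 0 = a ∧ m c.per = b := by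
  obtain ⟨f, h1, h2, h3⟩ := h
  obtain ⟨m, hm, hma⟩ := R.exists_isStr c (hp.mem 0) ha
  obtain ⟨m', hm', hmb⟩ := R.exists_isStr c (hp.mem 0) hb
  have hpos := hp.per_pos
  have hm'' := hm'.shift hp (-1)
  refine ⟨fun i => if i ≤ 0 then m i else if i < c.per then f i else m' (i + (-1) * c.per),
    IsStr.of_rel hp.1 fun i l hl => ?_, by simpa using hma, ?_⟩
  · have hf : ∀ i : ℤ, 0 ≤ i → i ≤ c.per → (if i ≤ 0 then m i else if i < c.per then f i else
        m' (i + (-1) * c.per)) = f i := by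
      intro i hi hi'
      by_cases h0 : i ≤ 0
      · obtain rfl : i = 0 := le_antisymm h0 hi
        rw [if_pos le_rfl, hma, h1]
      · rw [if_neg h0]
        by_cases h4 : i < c.per
        · rw [if_pos h4]
        · obtain rfl : i = c.per := by omega
          rw [if_neg h4, h2, ← hmb]
          congr 1
          ring
    by_cases hi : i < 0
    · rw [if_pos hi.le, if_pos (by omega)]
      exact hm.rel i l hl
    · by_cases hi' : i < c.per
      · rw [hf i (by omega) (by omega), hf (i + 1) (by omega) (by omega)]
        exact h3 i (by omega) hi' l hl
      · rw [if_neg (by omega), if_neg (by omega), if_neg (by omega), if_neg (by omega)]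
        exact hm''.rel i l hl
  · have h4 : ¬ (c.per : ℤ) ≤ 0 := by omega
    simp only [h4, if_false, lt_irrefl]
    rw [← hmb]
    congr 1
    ring

theorem exists_isStr_of_minus (h0 : (0 : ℤ) ∈ c.I) {a : M}
    (ha : a ∈ R.plus σ (c.side 0).flip (c.left 0) ⊓ R.minus σ (c.side 0) (c.right 0)) :
    ∃ m, R.IsStr c m ∧ m 0 = a ∧ ∃ N : ℕ, ∀ i : ℤ, N ≤ i → m i = 0 := by
  obtain ⟨g, hg, hg0⟩ := (R.mem_plus σ).1 ha.1
  obtain ⟨f, hf, ⟨N, hN⟩, hf0⟩ := (R.mem_minus σ).1 ha.2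
  obtain ⟨m, hm, h⟩ := R.exists_isStr_of_seqs c h0 hg hf (hg0.trans hf0.symm)
  refine ⟨m, hm, (h 0).1.trans hf0, N, fun i hi => ?_⟩
  obtain ⟨n, rfl⟩ := Int.eq_ofNat_of_zero_le (show 0 ≤ i by omega)
  rw [(h n).1, hN n (by omega)]

/-- The two summands of F⁻ consist of the elements that can be continued by zero far to the right,
respectively far to the left; the second is the first for the inverse word. -/
theorem exists_isStr_of_mem_Fminus (h0 : (0 : ℤ) ∈ c.I) {a : M} (ha : a ∈ R.Fminus c 0) :
    ∃ m m', R.IsStr c m ∧ R.IsStr c m' ∧ a = m 0 + m' 0 ∧ m 0 ∈ R.Fminus c 0 ∧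
      m' 0 ∈ R.Fminus c 0 ∧ ∃ N : ℕ, ∀ i : ℤ, N ≤ i → m i = 0 ∧ m' (-i) = 0 := by
  have ha' := ha
  rw [Fminus_eq] at ha'
  obtain ⟨a₁, h1, a₂, h2, e⟩ := Submodule.mem_sup.1 ha'
  obtain ⟨m, hm, hm0, N, hN⟩ := exists_isStr_of_minus h0 h1
  have h3 : a₂ ∈ R.plus σ (c.rev.side 0).flip (c.rev.left 0) ⊓
      R.minus σ (c.rev.side 0) (c.rev.right 0) := by
    have e1 := c.rev_left 0
    have e2 := c.rev_right 0
    rw [neg_zero] at e1 e2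
    rw [e1, e2]
    simpa [Signs.BiWord.rev, and_comm] using h2
  obtain ⟨m', hm', hm0', N', hN'⟩ := exists_isStr_of_minus (by simpa [c.mem_rev] using h0) h3
  refine ⟨m, fun i => m' (-i), hm, hm'.of_rev, ?_, ?_, ?_, N + N', fun i hi => ⟨hN i ?_, ?_⟩⟩
  · simp [hm0, hm0', e]
  · rw [hm0, Fminus_eq]
    exact Submodule.mem_sup_left h1
  · simp only [neg_zero, hm0']
    rw [Fminus_eq]
    exact Submodule.mem_sup_right h2
  · push_cast at hi; omega
  · simp only [neg_neg]
    exact hN' i (by push_cast at hi; omega)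

/-- A basis of the subquotient of a periodic word can be lifted such that the shift by the period
acts by an automorphism of the coefficients. -/
theorem exists_periodic_lift (hp : c.IsPer) {d : ℕ} {x : Fin d → M}
    (hx : IsBasisMod (R.Fplus c 0) (R.Fminus c 0) x) :
    ∃ (T : (Fin d →₀ k) ≃ₗ[k] (Fin d →₀ k)) (φ : ℤ → (Fin d →₀ k) →ₗ[k] M),
      (∀ u, R.IsStr c fun i => φ i u) ∧ (∀ i u, φ (i + c.per) u = φ i (T u)) ∧
      IsBasisMod (R.Fplus c 0) (R.Fminus c 0) fun j => φ 0 (Finsupp.single j 1) := by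
  have hpos := hp.per_pos
  have hper : ∀ n : ℤ, R.Fplus c (n * c.per) = R.Fplus c 0 ∧
      R.Fminus c (n * c.per) = R.Fminus c 0 := by
    intro n
    have := hp.triple_add_mul 0 n
    rw [zero_add] at this
    exact ⟨by rw [Fplus, Fplus, this], by rw [Fminus, Fminus, this]⟩
  obtain ⟨T, φ, hφ, hφx⟩ := exists_automorphism (r := R.stepsRel c c.per) hx (fun a ha => by
      obtain ⟨m, hm, rfl⟩ := R.exists_isStr c (hp.mem 0) ha
      refine ⟨m ((0 + 1 : ℤ) * c.per), ?_, by simpa using hm.mem_stepsRel hp 0⟩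
      rw [← (hper (0 + 1)).1]
      exact hm.mem_Fplus (hp.mem _))
    (fun a b hab ha hb hb' => by
      obtain ⟨m, hm, rfl, rfl⟩ := exists_isStr_of_stepsRel hp hab ha hb
      refine hm.mem_Fminus (hp.mem (1 * c.per)) (hp.mem 0) ?_
      rw [(hper 1).2, one_mul]
      exact hb')
    (fun a ha => by
      obtain ⟨m, m', hm, hm', e, h1, h2, N, hN⟩ := exists_isStr_of_mem_Fminus (hp.mem 0) ha
      refine ⟨fun n => m ((n : ℤ) * c.per), fun n => m' ((-(n : ℤ)) * c.per), by simpa using e,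
        fun n => ?_, fun n => ?_, fun n => ?_, fun n => ?_, N, fun n hn => ⟨?_, ?_⟩⟩
      · rw [← (hper n).2]
        exact hm.mem_Fminus (hp.mem 0) (hp.mem _) h1
      · rw [← (hper (-n)).2]
        exact hm'.mem_Fminus (hp.mem 0) (hp.mem _) h2
      · have := hm.mem_stepsRel hp n
        simpa using this
      · have := hm'.mem_stepsRel hp (-(n + 1))
        simpa using this
      · refine (hN _ ?_).1
        nlinarith
      · have := (hN ((n : ℤ) * c.per) (by nlinarith)).2
        simpa using this)
  choose f hf0 hfn hf using fun j => hφ (Finsupp.single j 1)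
  let ψ : ℤ → (Fin d →₀ k) →ₗ[k] M := fun i => Finsupp.linearCombination k fun j => f j i
  have hψ0 : ψ 0 = φ := by
    ext j
    simp [ψ, hf0]
  have hψn : ψ c.per = φ ∘ₗ T := by
    ext j
    simp [ψ, hfn]
  have hψ : ∀ i : ℤ, 0 ≤ i → i < c.per → ∀ l, c.letter (i + 1) = some l → ∀ u,
      (ψ i u, ψ (i + 1) u) ∈ R.lrel l := fun i hi hi' l hl =>
    linearCombination_mem_rel fun j => hf j i hi hi' l hl
  have hpos' : (0 : ℤ) < c.per := by exact_mod_cast hpos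
  -- The maps over one period are repeated, with one more factor `T` for each period; at the
  -- boundary they fit because `ψ c.per` is `φ ∘ T`.
  refine ⟨T, fun i => ψ (i % c.per) ∘ₗ
    ((T ^ (i / c.per) : (Fin d →₀ k) ≃ₗ[k] (Fin d →₀ k)) : _ →ₗ[k] _), fun u => ?_, fun i u => ?_,
    ?_⟩
  · refine IsStr.of_rel hp.1 fun i l hl => ?_
    have hdm := Int.emod_add_mul_ediv i c.per
    have h0 := Int.emod_nonneg i hpos'.ne'
    have h1 := Int.emod_lt_of_pos i hpos'
    have hl' : c.letter (i % c.per + 1) = some l := by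
      rw [← hl, ← hp.letter_add_mul _ (i / c.per)]
      congr 1
      linarith
    have h2 := hψ _ h0 h1 l hl' ((T ^ (i / c.per)) u)
    by_cases h3 : i % c.per + 1 < c.per
    · have h4 : (i + 1) / c.per = i / c.per ∧ (i + 1) % c.per = i % c.per + 1 := by
        rw [Int.ediv_emod_unique hpos']
        exact ⟨by linarith, by omega, h3⟩
      change (ψ (i % c.per) ((T ^ (i / c.per)) u),
        ψ ((i + 1) % c.per) ((T ^ ((i + 1) / c.per)) u)) ∈ R.lrel l
      rw [h4.1, h4.2]
      exact h2
    · have h5 : i % c.per + 1 = c.per := by omega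
      have h4 : (i + 1) / c.per = i / c.per + 1 ∧ (i + 1) % c.per = 0 := by
        rw [Int.ediv_emod_unique hpos']
        exact ⟨by linear_combination (hdm - h5), le_rfl, hpos'⟩
      change (ψ (i % c.per) ((T ^ (i / c.per)) u),
        ψ ((i + 1) % c.per) ((T ^ ((i + 1) / c.per)) u)) ∈ R.lrel l
      rw [h4.1, h4.2, hψ0, add_comm, zpow_add, zpow_one]
      rw [h5, hψn] at h2
      exact h2
  · change ψ ((i + c.per) % c.per) ((T ^ ((i + c.per) / c.per)) u) = _
    rw [Int.add_emod_right, Int.add_ediv_of_dvd_right (dvd_refl _), Int.ediv_self hpos'.ne',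
      zpow_add, zpow_one]
    rfl
  · refine hx.congr (R.Fminus_le_Fplus c 0) fun j => ?_
    have := hφx (Finsupp.single j 1)
    simpa [hψ0] using this

end QuiverOps

namespace QuiverOps

variable {k : Type u} [Field k] {V : Type v} [Quiver.{w} V] {ρ : Set (QPath V)}
  {M : Type x} [AddCommGroup M] [Module k M] {R : QuiverOps k V M} {σ : Signs ρ} {c : σ.BiWord}

/-! ### Infinite powers of a primitive cycle -/

variable (R ρ) in
/-- The elements that are divisible by all powers of a primitive cycle, in a coherent way. -/
def ray (y : Quiver.Total V) : Submodule k M where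
  carrier := {m | ∃ f : ℕ → M, f 0 = m ∧
    ∀ n, (f n, f (n + 1)) ∈ R.lrel (.direct ((next ρ)^[n] y))}
  add_mem' := by
    rintro a b ⟨f, h1, h2⟩ ⟨g, h3, h4⟩
    exact ⟨f + g, by simp [h1, h3], fun n => add_mem (h2 n) (h4 n)⟩
  zero_mem' := ⟨0, rfl, fun _ => zero_mem _⟩
  smul_mem' := by
    rintro a b ⟨f, h1, h2⟩
    exact ⟨a • f, by simp [h1], fun n => Submodule.smul_mem _ a (h2 n)⟩

theorem ray_le_range (y : Quiver.Total V) : R.ray ρ y ≤ LinearMap.range (R.arrow y) := by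
  rintro _ ⟨f, rfl, h⟩
  exact ⟨f 1, (R.mem_lrel_direct.1 (h 0)).1.symm⟩

theorem opRay_apply_of_seq {y : Quiver.Total V} {f : ℕ → M}
    (h : ∀ n, (f n, f (n + 1)) ∈ R.lrel (.direct ((next ρ)^[n] y))) (n : ℕ) :
    R.opRay ρ y n (f n) = f 0 := by
  induction n with
  | zero => rfl
  | succ n ih =>
    rw [opRay_succ', Module.End.mul_apply, ← (R.mem_lrel_direct.1 (h n)).1, ih]

namespace IsControlled

theorem stable_ray (hc : R.IsControlled ρ) (y : Quiver.Total V) :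
    Stable (R.Z ρ) (R.ray ρ y) := by
  rintro _ ⟨f, rfl, h⟩
  exact ⟨fun n => R.Z ρ (f n), rfl, fun n => hc.lrel_Z _ _ _ (h n)⟩

/-- The sequence that witnesses membership, started one turn later, is again such a sequence, and
the cycle maps its first term to the original one. -/
theorem ray_divisible (hc : R.IsControlled ρ) {y : Quiver.Total V} (hy : Cyc ρ y) :
    ∀ d ∈ R.ray ρ y, ∃ d' ∈ R.ray ρ y, d = R.Z ρ d' := by
  rintro _ ⟨f, rfl, h⟩
  have h1 : ∀ n, (f (n + cycLen ρ y), f (n + cycLen ρ y + 1)) ∈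
      R.lrel (.direct ((next ρ)^[n] y)) := by
    intro n
    have := h (n + cycLen ρ y)
    rwa [Function.iterate_add_apply, hy.iterate_cycLen] at this
  have h2 : f (cycLen ρ y) ∈ R.ray ρ y :=
    ⟨fun n => f (n + cycLen ρ y), by simp, fun n => by
      have := h1 n
      rwa [show n + cycLen ρ y + 1 = n + 1 + cycLen ρ y by ring] at this⟩
  refine ⟨_, h2, ?_⟩
  rw [hc.Z_eq_cycOp (ray_le_range y h2), R.cycOp_eq hy, opRay_apply_of_seq h]

theorem exists_aeval_ray_eq_zero (hc : R.IsControlled ρ) {y : Quiver.Total V} (hy : Cyc ρ y) :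
    ∃ f : Polynomial k, f.coeff 0 = 1 ∧ ∀ d ∈ R.ray ρ y, Polynomial.aeval (R.Z ρ) f d = 0 :=
  (hc.stableFG_range y).exists_aeval_eq_zero (ray_le_range y) (hc.ray_divisible hy)
    (hc.stable_ray y)

theorem finiteDimensional_ray (hc : R.IsControlled ρ) {y : Quiver.Total V} (hy : Cyc ρ y) :
    FiniteDimensional k (R.ray ρ y) :=
  (hc.stableFG_range y).finiteDimensional_of_divisible (ray_le_range y) (hc.ray_divisible hy)
    (hc.stable_ray y)

/-- If no two consecutive letters form a relation, the word runs around a primitive cycle and F⁺ at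
`0` lies in its ray. Otherwise F⁺ vanishes just before the relation. -/
theorem exists_finiteDimensional_of_direct (hc : R.IsControlled ρ) (hp : c.IsPer)
    {y : ℤ → Quiver.Total V} (hy : ∀ i, c.letter i = some (.direct (y i))) :
    ∃ i, FiniteDimensional k (R.Fplus c i) := by
  by_cases hf : ∀ i, Foll ρ (y i) (y (i + 1))
  · have h1 : ∀ n : ℕ, (next ρ)^[n] (y 1) = y (1 + n) := by
      intro n
      induction n with
      | zero => simp
      | succ n ih =>
        rw [Function.iterate_succ_apply', ih, (hf _).next_eq hc.string]
        congr 1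
    have h2 : Cyc ρ (y 1) := by
      refine ⟨⟨c.per, hp.per_pos, ?_⟩, fun i => ?_⟩
      · change (next ρ)^[c.per] (y 1) = y 1
        have := hp.letter_add 1
        rw [hy, hy] at this
        rw [h1]
        simpa using this
      · rw [h1, h1]
        convert hf (1 + i) using 2
        push_cast
        ring
    have := hc.finiteDimensional_ray h2
    refine ⟨0, Submodule.finiteDimensional_of_le (S₂ := R.ray ρ (y 1)) ?_⟩
    rw [Fplus_eq]
    refine inf_le_right.trans fun a ha => ?_
    obtain ⟨f, hf, rfl⟩ := (R.mem_plus σ).1 ha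
    refine ⟨f, rfl, fun n => ?_⟩
    have h3 := (R.mem_seqs σ).1 hf n
    have h4 : c.right 0 n = some (.direct ((next ρ)^[n] (y 1))) := by
      rw [h1, Signs.BiWord.right, hy, zero_add]
    rwa [h4] at h3
  · push Not at hf
    obtain ⟨i, hi⟩ := hf
    refine ⟨i - 1, ?_⟩
    have : R.Fplus c (i - 1) = ⊥ := by
      rw [eq_bot_iff]
      intro a ha
      obtain ⟨b, hb, hab⟩ := R.exists_Fplus_succ c (i := i - 1) (hy _) ha
      obtain ⟨d, -, hbd⟩ := R.exists_Fplus_succ c (i := i - 1 + 1) (hy _) hb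
      rw [sub_add_cancel] at hab hbd
      rw [Submodule.mem_bot, (R.mem_lrel_direct.1 hab).1, (R.mem_lrel_direct.1 hbd).1,
        R.arrow_arrow_eq_zero hc.rel hi]
    rw [this]
    infer_instance

/-- Between an inverse letter and a following direct one, F⁺ lies in the intersection of the images
of two different arrows. If there is no such place, a single inverse letter forces, by periodicity,
all letters to be inverse; inverting the word leaves only direct words. -/
theorem exists_finiteDimensional_Fplus (hc : R.IsControlled ρ) (hp : c.IsPer) :
    ∃ i, FiniteDimensional k (R.Fplus c i) := by
  have hlet : ∀ i, ∃ l, c.letter i = some l := fun i => c.exists_letter (hp.mem _) (hp.mem _)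
  by_cases h1 : ∃ i x y, c.letter i = some (.inverse x) ∧ c.letter (i + 1) = some (.direct y)
  · obtain ⟨i, x, y, hx, hy⟩ := h1
    have hxy : x ≠ y := by
      rintro rfl
      have h2 := c.dst_eq _ _ hx
      have h3 := c.src_eq _ _ hy
      rw [add_sub_cancel_right, ← h2] at h3
      exact Side.flip_ne _ (h3.trans (σ.dst_inv (.direct x))).symm
    have := hc.finiteDimensional_range_inf hxy
    refine ⟨i, Submodule.finiteDimensional_of_le
      (S₂ := LinearMap.range (R.arrow x) ⊓ LinearMap.range (R.arrow y)) fun a ha => ⟨?_, ?_⟩⟩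
    · rw [← sub_add_cancel i 1] at hx ha
      obtain ⟨b, -, hb⟩ := R.exists_Fplus_pred c hx ha
      exact ⟨b, (R.mem_lrel_inverse.1 hb).1.symm⟩
    · obtain ⟨b, -, hb⟩ := R.exists_Fplus_succ c hy ha
      exact ⟨b, (R.mem_lrel_direct.1 hb).1.symm⟩
  · push Not at h1
    by_cases h2 : ∃ i x, c.letter i = some (.inverse x)
    · obtain ⟨i, x, hx⟩ := h2
      have h3 : ∀ n : ℕ, ∃ x, c.letter (i + n) = some (.inverse x) := by
        intro n
        induction n with
        | zero => exact ⟨x, by simpa using hx⟩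
        | succ n ih =>
          obtain ⟨x', hx'⟩ := ih
          obtain ⟨l, hl⟩ := hlet (i + (n + 1 : ℕ))
          cases l with
          | direct y => exact (h1 _ _ y hx' (by rw [← hl]; congr 1; push_cast; ring)).elim
          | inverse y => exact ⟨y, hl⟩
      have h4 : ∀ j, ∃ x, c.letter j = some (.inverse x) := by
        intro j
        have hpos := hp.per_pos
        -- Moving `j` to the right by `|j| + |i|` periods brings it beyond `i`.
        obtain ⟨x', hx'⟩ := h3 (j + (|j| + |i|) * c.per - i).toNat
        refine ⟨x', ?_⟩
        rw [← hx', ← hp.letter_add_mul j (|j| + |i|)]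
        congr 1
        have h5 : (1 : ℤ) ≤ c.per := by omega
        have h6 : |j| + |i| ≤ (|j| + |i|) * c.per :=
          le_mul_of_one_le_right (by positivity) h5
        have h7 := neg_abs_le j
        have h8 := le_abs_self i
        rw [Int.toNat_of_nonneg (by linarith)]
        ring
      choose y hy using h4
      obtain ⟨j, hj⟩ := hc.exists_finiteDimensional_of_direct hp.rev (y := fun i => y (1 - i))
        (fun i => by
          change (c.letter (1 - i)).map Letter.inv = _
          rw [hy]
          rfl)
      refine ⟨-j, ?_⟩
      rw [← Fplus_rev, neg_neg]
      exact hj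
    · push Not at h2
      have h3 : ∀ i, ∃ y, c.letter i = some (.direct y) := by
        intro i
        obtain ⟨l, hl⟩ := hlet i
        cases l with
        | direct y => exact ⟨y, hl⟩
        | inverse y => exact (h2 _ _ hl).elim
      choose y hy using h3
      exact hc.exists_finiteDimensional_of_direct hp hy

/-- The subquotients of a periodic word are finite dimensional. -/
theorem finite_of_isPer (hc : R.IsControlled ρ) (hp : c.IsPer) {β : Type*} {x : β → M}
    (hx : IsBasisMod (R.Fplus c 0) (R.Fminus c 0) x) : Finite β := by
  obtain ⟨i, hi⟩ := hc.exists_finiteDimensional_Fplus hp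
  choose m hm hm0 using fun u => R.exists_isStr c (hp.mem 0) (hx.mem u)
  have h1 : IsBasisMod (R.Fplus c i) (R.Fminus c i) fun u => m u i :=
    IsBasisMod.of_isStr hm (hp.mem 0) (hp.mem i) (by simpa only [hm0] using hx)
  have h2 : LinearIndependent k fun u => (⟨m u i, h1.mem u⟩ : R.Fplus c i) := by
    rw [linearIndependent_iff]
    intro a ha
    refine h1.indep a ?_
    have h3 := congrArg (R.Fplus c i).subtype ha
    rw [Finsupp.apply_linearCombination, map_zero] at h3
    have h4 : Finsupp.linearCombination k (fun u => m u i) a = 0 := h3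
    rw [h4]
    exact zero_mem _
  exact h2.finite

/-- A basis of the subquotient of a periodic word, lifted to families on which the shift by the
period acts by an automorphism of the coefficients. -/
theorem exists_periodic_family (hc : R.IsControlled ρ) (hp : c.IsPer) :
    ∃ (d : ℕ) (T : (Fin d →₀ k) ≃ₗ[k] (Fin d →₀ k)) (φ : ℤ → (Fin d →₀ k) →ₗ[k] M),
      (∀ u, R.IsStr c fun i => φ i u) ∧ (∀ i u, φ (i + c.per) u = φ i (T u)) ∧
      IsBasisMod (R.Fplus c 0) (R.Fminus c 0) fun j => φ 0 (Finsupp.single j 1) := by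
  obtain ⟨β, x, hx⟩ := exists_isBasisMod (R.Fplus c 0) (R.Fminus c 0)
  have := hc.finite_of_isPer hp hx
  obtain ⟨d, ⟨e⟩⟩ := Finite.exists_equiv_fin β
  have hx' : IsBasisMod (R.Fplus c 0) (R.Fminus c 0) fun j => x (e.symm j) := by
    refine ⟨fun j => hx.mem _, fun a ha => ?_, hx.span.trans (sup_le_sup ?_ le_rfl)⟩
    · have h1 : Finsupp.linearCombination k (fun j => x (e.symm j)) a =
          Finsupp.linearCombination k x (a.mapDomain e.symm) := by
        rw [Finsupp.linearCombination_mapDomain]; rfl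
      rw [h1] at ha
      have h2 := hx.indep _ ha
      rw [← Finsupp.mapDomain_zero (f := e.symm)] at h2
      exact Finsupp.mapDomain_injective e.symm.injective h2
    · refine Submodule.span_mono ?_
      rintro _ ⟨u, rfl⟩
      exact ⟨e u, by simp⟩
  obtain ⟨T, φ, h1, h2, h3⟩ := exists_periodic_lift hp hx'
  exact ⟨d, T, φ, h1, h2, h3⟩

end IsControlled

end QuiverOps

/-! ### Words that end with powers of the inverse of a primitive cycle -/

section Representatives

variable {V : Type v} [Quiver.{w} V] (ρ : Set (QPath V))

/-- An arrow of each primitive cycle. -/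
def cycRep (x : Quiver.Total V) : Quiver.Total V :=
  (Set.range_nonempty fun n : ℕ => (next ρ)^[n] x).some

theorem exists_iterate_eq_cycRep (x : Quiver.Total V) : ∃ n : ℕ, (next ρ)^[n] x = cycRep ρ x :=
  (Set.range_nonempty fun n : ℕ => (next ρ)^[n] x).some_mem

variable {ρ}

theorem Cyc.cycRep_next {x : Quiver.Total V} (h : Cyc ρ x) :
    cycRep ρ (StringAlg.next ρ x) = cycRep ρ x := by
  have key : ∀ (S S' : Set (Quiver.Total V)) (hS : S.Nonempty) (hS' : S'.Nonempty), S = S' →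
      hS.some = hS'.some := by
    rintro S _ hS hS' rfl
    rfl
  refine key _ _ _ _ (Set.Subset.antisymm ?_ ?_)
  · rintro _ ⟨n, rfl⟩
    exact ⟨n + 1, rfl⟩
  · rintro _ ⟨n, rfl⟩
    refine ⟨n + (cycLen ρ x - 1), ?_⟩
    change (StringAlg.next ρ)^[n + (cycLen ρ x - 1)] (StringAlg.next ρ x) = _
    rw [← Function.iterate_succ_apply, show (n + (cycLen ρ x - 1)).succ = n + cycLen ρ x by
      have := h.cycLen_pos; omega, Function.iterate_add_apply, h.iterate_cycLen]

theorem Cyc.cycRep_iterate {x : Quiver.Total V} (h : Cyc ρ x) (n : ℕ) :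
    cycRep ρ ((StringAlg.next ρ)^[n] x) = cycRep ρ x := by
  induction n with
  | zero => rfl
  | succ n ih => rw [Function.iterate_succ_apply', (h.iterate n).cycRep_next, ih]

theorem Cyc.cycLen_iterate {x : Quiver.Total V} (h : Cyc ρ x) (n : ℕ) :
    cycLen ρ ((StringAlg.next ρ)^[n] x) = cycLen ρ x := by
  induction n with
  | zero => rfl
  | succ n ih => rw [Function.iterate_succ_apply', (h.iterate n).cycLen_next, ih]

theorem Cyc.cycRep {x : Quiver.Total V} (h : Cyc ρ x) : Cyc ρ (StringAlg.cycRep ρ x) := by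
  obtain ⟨n, hn⟩ := exists_iterate_eq_cycRep ρ x
  rw [← hn]
  exact h.iterate n

end Representatives

namespace Signs.BiWord

variable {V : Type v} [Quiver.{w} V] {ρ : Set (QPath V)} {σ : Signs ρ}

/-- The letters of `c` after position `j` are the inverses of the arrows `x n`, which run backwards
through a primitive cycle, and the letter at position `j` is not inverse. -/
structure IsTail (c : σ.BiWord) (j : ℤ) (x : ℕ → Quiver.Total V) : Prop where
  letter : ∀ n : ℕ, c.letter (j + 1 + n) = some (.inverse (x n))
  start : ∀ y, c.letter j ≠ some (.inverse y)
  foll : ∀ n, Foll ρ (x (n + 1)) (x n)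
  cyc : Cyc ρ (x 0)

namespace IsTail

variable {c : σ.BiWord} {j : ℤ} {x : ℕ → Quiver.Total V}

theorem cyc_all (h : c.IsTail j x) (hρ : IsStringAlgebra ρ) (n : ℕ) : Cyc ρ (x n) := by
  induction n with
  | zero => exact h.cyc
  | succ n ih => exact ih.of_foll hρ (h.foll n)

theorem next_succ (h : c.IsTail j x) (hρ : IsStringAlgebra ρ) (n : ℕ) :
    next ρ (x (n + 1)) = x n := (h.foll n).next_eq hρ

theorem iterate_add (h : c.IsTail j x) (hρ : IsStringAlgebra ρ) (n a : ℕ) :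
    (next ρ)^[a] (x (n + a)) = x n := by
  induction a with
  | zero => rfl
  | succ a ih => rw [Function.iterate_succ_apply, ← add_assoc, h.next_succ hρ, ih]

theorem cycRep_eq (h : c.IsTail j x) (hρ : IsStringAlgebra ρ) (n : ℕ) :
    cycRep ρ (x n) = cycRep ρ (x 0) := by
  rw [← h.iterate_add hρ 0 n, zero_add, (h.cyc_all hρ n).cycRep_iterate]

theorem cycLen_eq (h : c.IsTail j x) (hρ : IsStringAlgebra ρ) (n : ℕ) :
    cycLen ρ (x n) = cycLen ρ (x 0) := by
  rw [← h.iterate_add hρ 0 n, zero_add, (h.cyc_all hρ n).cycLen_iterate]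

theorem add_cycLen (h : c.IsTail j x) (hρ : IsStringAlgebra ρ) (n : ℕ) :
    x (n + cycLen ρ (x 0)) = x n := by
  have h1 := (h.cyc_all hρ (n + cycLen ρ (x 0))).iterate_cycLen
  rw [h.cycLen_eq hρ, h.iterate_add hρ] at h1
  exact h1.symm

theorem start_mem (h : c.IsTail j x) : j ∈ c.I := by
  have := (c.mem_of_letter (h.letter 0)).2
  simpa using this

theorem mem (h : c.IsTail j x) (n : ℕ) : j + n ∈ c.I := by
  have := (c.mem_of_letter (h.letter n)).2
  convert this using 1
  ring

theorem side_eq (h : c.IsTail j x) : σ.src (.inverse (x 0)) = c.side j := by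
  have := c.src_eq _ _ (h.letter 0)
  simpa using this

/-- The start is the last position whose letter is not inverse. -/
theorem unique (h : c.IsTail j x) {j' : ℤ} {x' : ℕ → Quiver.Total V} (h' : c.IsTail j' x') :
    j = j' ∧ x = x' := by
  have key : ∀ {j j' : ℤ} {x x' : ℕ → Quiver.Total V}, c.IsTail j x → c.IsTail j' x' →
      ¬ j < j' := by
    intro j j' x x' h h' hlt
    refine h'.start (x (j' - j - 1).toNat) ?_
    rw [← h.letter]
    congr 1
    omega
  obtain rfl : j = j' := le_antisymm (not_lt.1 (key h' h)) (not_lt.1 (key h h'))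
  refine ⟨rfl, funext fun n => ?_⟩
  have := (h.letter n).symm.trans (h'.letter n)
  simpa using this

theorem exists_entry (h : c.IsTail j x) (hρ : IsStringAlgebra ρ) :
    ∃ i : ℕ, x i = cycRep ρ (x 0) ∧ i < cycLen ρ (x 0) ∧
      ∀ i', x i' = cycRep ρ (x 0) → ∃ a, i' = i + cycLen ρ (x 0) * a := by
  classical
  have hex : ∃ i, x i = cycRep ρ (x 0) := by
    obtain ⟨n, hn⟩ := exists_iterate_eq_cycRep ρ (x (cycLen ρ (x 0)))
    -- Applying `next` goes back in the tail. From a full number of turns large enough to absorb `n`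
    -- steps, going back `n` steps reaches the representative.
    refine ⟨cycLen ρ (x 0) * (n + 1) - n, ?_⟩
    have hpos := h.cyc.cycLen_pos
    have h1 : ∀ q, x (cycLen ρ (x 0) * q) = x 0 := by
      intro q
      induction q with
      | zero => rfl
      | succ q ih => rw [mul_add, mul_one, h.add_cycLen hρ, ih]
    have h2 : n ≤ cycLen ρ (x 0) * (n + 1) := by nlinarith
    rw [← h.iterate_add hρ _ n, Nat.sub_add_cancel h2, h1, ← h.cycRep_eq hρ (cycLen ρ (x 0)),
      ← hn]
    congr 1
    have := h1 1
    rw [mul_one] at this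
    exact this.symm
  refine ⟨Nat.find hex, Nat.find_spec hex, ?_, fun i' hi' => ?_⟩
  · by_contra hge
    have hpos := h.cyc.cycLen_pos
    refine Nat.find_min hex (m := Nat.find hex - cycLen ρ (x 0)) (by omega) ?_
    rw [← h.add_cycLen hρ, Nat.sub_add_cancel (by omega)]
    exact Nat.find_spec hex
  · have h1 : Nat.find hex ≤ i' := Nat.find_min' hex hi'
    obtain ⟨b, rfl⟩ := Nat.exists_eq_add_of_le h1
    have h2 := h.iterate_add hρ (Nat.find hex) b
    rw [hi', Nat.find_spec hex] at h2
    have h3 : cycLen ρ (cycRep ρ (x 0)) ∣ b :=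
      Function.IsPeriodicPt.minimalPeriod_dvd (f := next ρ) h2
    rw [← Nat.find_spec hex, h.cycLen_eq hρ] at h3
    obtain ⟨a, rfl⟩ := h3
    exact ⟨a, rfl⟩

end IsTail

end Signs.BiWord

namespace QuiverOps

variable {k : Type u} [Field k] {V : Type v} [Quiver.{w} V] {ρ : Set (QPath V)}
  {M : Type x} [AddCommGroup M] [Module k M] {R : QuiverOps k V M} {σ : Signs ρ} {c : σ.BiWord}
  {j : ℤ} {x : ℕ → Quiver.Total V}

theorem IsStr.tail_apply (hρ : IsStringAlgebra ρ) (h : c.IsTail j x) {m : ℤ → M}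
    (hm : R.IsStr c m) (n l : ℕ) :
    m (j + n + (l + 1 : ℕ)) = R.opRay ρ (x (n + l)) (l + 1) (m (j + n)) := by
  have key : ∀ n : ℕ, R.arrow (x n) (m (j + n)) = m (j + n + 1) := fun n =>
    hm.apply_inverse (by rw [← h.letter n]; congr 1; ring)
  induction l with
  | zero =>
    rw [opRay_one, add_zero, key]
    simp
  | succ l ih =>
    rw [← add_assoc, opRay_succ, Module.End.mul_apply, h.next_succ hρ, ← ih]
    have := key (n + l + 1)
    push_cast at this ⊢
    rw [show j + n + (l + 1) = j + (n + l + 1) by ring, this]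
    congr 1
    ring

/-- Families supported on a tail. -/
theorem IsControlled.exists_tail_family (hc : R.IsControlled ρ) (h : c.IsTail j x) {d : M}
    (hd : d ∈ LinearMap.range (R.arrow (next ρ (x 0)))) :
    ∃ m, R.IsStr c m ∧ m j = d ∧ (∀ i < j, m i = 0) ∧ m j ∈ R.Fminus c j := by
  have hf := h.cyc.foll_next
  have hdE : d ∈ R.E (x 0).left := by
    rw [← hf.right_eq_left]
    exact R.range_arrow_le _ hd
  have hside := h.side_eq
  -- As `d` lies in the image of the arrow that `x 0` follows, no other arrow acts on it. This is
  -- why the family can be zero to the left of `j`.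
  have hkill : ∀ y, y ≠ x 0 → R.arrow y d = 0 := by
    intro y hy
    obtain ⟨d', rfl⟩ := hd
    exact R.arrow_arrow_eq_zero hc.rel (fun hy' => hy (hy'.left_unique hc.string hf)) d'
  let g : ℕ → M := fun n => Nat.rec d (fun n a => R.arrow (x n) a) n
  have hg : ∀ n, g n ∈ R.E (x n).left := by
    intro n
    cases n with
    | zero => exact hdE
    | succ n =>
      rw [← (h.foll n).right_eq_left]
      exact R.arrow_mem_E _ _
  let m : ℤ → M := fun i => if i < j then 0 else g (i - j).toNat
  have hm0 : ∀ i < j, m i = 0 := fun i hi => if_pos hi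
  have hmg : ∀ n : ℕ, m (j + n) = g n := fun n => by
    simp only [m]
    rw [if_neg (by omega)]
    congr 1
    omega
  have hmj : m j = d := (congrArg m (by simp)).trans (hmg 0)
  have hker : d ∈ R.kerSide σ (c.side j).flip := by
    refine (R.mem_kerSide σ).2 ⟨?_, fun y hy => hkill y ?_⟩
    · rw [← hside]
      exact hdE
    · rintro rfl
      rw [hside] at hy
      exact Side.flip_ne _ hy.symm
  have hm : R.IsStr c m := by
    refine ⟨fun i l hl => ?_, fun i hi hl => ?_, fun i hi hl => ?_⟩
    · rcases lt_trichotomy (i + 1) j with hi | hi | hi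
      · rw [hm0 i (by omega), hm0 _ hi]
        exact zero_mem _
      · rw [hm0 i (by omega), hi, hmj]
        rw [hi] at hl
        cases l with
        | inverse y => exact (h.start y hl).elim
        | direct y =>
          have hdst := c.dst_eq _ _ hl
          refine R.mem_lrel_direct.2 ⟨(hkill y ?_).symm, ?_⟩
          · rintro rfl
            rw [← hside] at hdst
            have := σ.src_inv (.direct (x 0))
            rw [hdst] at this
            exact Side.flip_ne _ this.symm
          · have h1 : y.left = (c.side j).1 := congrArg Prod.fst hdst
            rw [h1, ← hside]
            exact hdE
      · obtain ⟨n, hn⟩ := Int.eq_ofNat_of_zero_le (show 0 ≤ i - j by omega)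
        obtain rfl : i = j + n := by omega
        have h1 := h.letter n
        rw [show j + 1 + (n : ℤ) = j + n + 1 by ring, hl] at h1
        obtain rfl : l = .inverse (x n) := by simpa using h1
        have h2 := hmg (n + 1)
        push_cast at h2
        rw [hmg, show j + (n : ℤ) + 1 = j + (n + 1) by ring, h2]
        exact R.mem_lrel_inverse.2 ⟨rfl, hg n⟩
    · rcases lt_or_ge i j with hi' | hi'
      · rw [hm0 i hi']
        exact zero_mem _
      · have h1 := h.letter (i - j).toNat
        rw [show j + 1 + ((i - j).toNat : ℤ) = i + 1 by omega, hl] at h1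
        simp at h1
    · rcases lt_trichotomy i j with hi' | rfl | hi'
      · rw [hm0 i hi']
        exact zero_mem _
      · rw [hmj]
        exact hker
      · have h1 := h.letter (i - j - 1).toNat
        rw [show j + 1 + ((i - j - 1).toNat : ℤ) = i by omega, hl] at h1
        simp at h1
  -- The vector at `j` is continued by zero to the left: if the word ends there, because `d` lies in
  -- `imSide`; otherwise, because the letter at `j` relates it to zero.
  refine ⟨m, hm, hmj, hm0, ?_⟩
  rw [Fminus_eq]
  refine Submodule.mem_sup_right ⟨?_, hm.mem_plus_right h.start_mem⟩
  refine R.mem_minus_of_truncate σ (f := fun _ => m j) (n := 0) (fun i hi => by omega) ?_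
  rw [c.left_zero]
  change (m j, 0) ∈ R.step σ (c.side j).flip _
  rcases hl : c.letter j with _ | l
  · refine (R.mem_step_none σ).2 ⟨?_, zero_mem _, ?_⟩
    · rw [hmj]; exact hker
    · rw [sub_zero, hmj]
      refine R.range_le_imSide σ ?_ hd
      rw [σ.src_of_foll hf, hside]
  · have h1 := hm.rel (j - 1) l (by rwa [sub_add_cancel])
    rw [sub_add_cancel, hm0 (j - 1) (by omega)] at h1
    exact R.mem_lrel_inv.2 h1

end QuiverOps

/-! ### Adjusting families on the tails at both ends of a word -/

namespace Signs.BiWord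

variable {V : Type v} [Quiver.{w} V] {ρ : Set (QPath V)} {σ : Signs ρ}

/-- A word or its inverse. -/
def ori (c : σ.BiWord) : Bool → σ.BiWord
  | true => c
  | false => c.rev

/-- Letters on a right tail are inverse and letters on a left tail are direct, so the tails do not
overlap. Corrections on one tail therefore leave the other untouched. -/
theorem IsTail.le_of_rev {c : σ.BiWord} {j j' : ℤ} {x x' : ℕ → Quiver.Total V}
    (h : c.IsTail j x) (h' : c.rev.IsTail j' x') {q : ℤ} (hq : j' ≤ -q) : q ≤ j := by
  by_contra hj
  have h1 := h.letter (q - j - 1).toNat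
  have h2 := h'.letter (-q - j').toNat
  rw [show j + 1 + ((q - j - 1).toNat : ℤ) = q by omega] at h1
  rw [show j' + 1 + ((-q - j').toNat : ℤ) = 1 - q by omega] at h2
  obtain ⟨l, hl, hl'⟩ := Option.map_eq_some_iff.1 h2
  rw [show 1 - (1 - q) = q by ring, h1] at hl
  obtain rfl : Letter.inverse _ = l := by simpa using hl
  simp [Letter.inv] at hl'

end Signs.BiWord

/-- A family along a word or along its inverse. -/
def oriFam {M : Type x} (m : ℤ → M) : Bool → ℤ → M
  | true => m
  | false => fun i => m (-i)

theorem oriFam_oriFam {M : Type x} (m : ℤ → M) (o : Bool) : oriFam (oriFam m o) o = m := by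
  cases o
  · funext i
    simp [oriFam]
  · rfl

theorem oriFam_not {M : Type x} (m : ℤ → M) (o : Bool) (i : ℤ) :
    oriFam m (!o) (-i) = oriFam m o i := by
  cases o <;> simp [oriFam]

namespace QuiverOps

variable {k : Type u} [Field k] {V : Type v} [Quiver.{w} V] {ρ : Set (QPath V)}
  {M : Type x} [AddCommGroup M] [Module k M] {R : QuiverOps k V M} {σ : Signs ρ} {c : σ.BiWord}

theorem IsStr.ori {m : ℤ → M} (h : R.IsStr c m) (o : Bool) : R.IsStr (c.ori o) (oriFam m o) := by
  cases o
  · exact h.rev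
  · exact h

theorem IsStr.of_ori {m : ℤ → M} {o : Bool} (h : R.IsStr (c.ori o) m) :
    R.IsStr c (oriFam m o) := by
  cases o
  · exact IsStr.of_rev h
  · exact h

theorem mem_Fminus_of_ori {m : ℤ → M} {o : Bool} (h : R.IsStr (c.ori o) m) {i : ℤ}
    (hi : i ∈ (c.ori o).I) (hm : m i ∈ R.Fminus (c.ori o) i) (h0 : (0 : ℤ) ∈ c.I) :
    oriFam m o 0 ∈ R.Fminus c 0 := by
  cases o
  · have := h.mem_Fminus hi (j := -0) (by simpa [Signs.BiWord.ori, c.mem_rev] using h0) hm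
    rw [show R.Fminus c 0 = R.Fminus c.rev (-0) from (R.Fminus_rev c 0).symm]
    exact this
  · exact h.mem_Fminus hi h0 hm

namespace IsControlled

/-- The family starts at `j` with `m₁` transported along the part of the cycle that is missing. The
`i + 1` letters up to the entry position complete the turn and give `Z m₁`. When the entry is at the
end of a full turn the missing part is empty, which is the case treated separately. -/
theorem exists_tail_correction (hc : R.IsControlled ρ) {j : ℤ} {x : ℕ → Quiver.Total V}
    (h : c.IsTail j x) {i : ℕ} (hi : x i = cycRep ρ (x 0)) (hiL : i < cycLen ρ (x 0)) {m₁ : M}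
    (hm₁ : m₁ ∈ LinearMap.range (R.arrow (cycRep ρ (x 0)))) :
    ∃ m, R.IsStr c m ∧ m (j + (i + 1 : ℕ)) = R.Z ρ m₁ ∧ (∀ i < j, m i = 0) ∧
      m j ∈ R.Fminus c j := by
  set w₀ := cycRep ρ (x 0) with hw₀
  have hcyc : Cyc ρ w₀ := h.cyc.cycRep
  have hL : cycLen ρ w₀ = cycLen ρ (x 0) := by rw [← hi, h.cycLen_eq hc.string]
  have hx0 : (next ρ)^[i + 1] w₀ = next ρ (x 0) := by
    have h1 := h.iterate_add hc.string 0 i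
    rw [zero_add, hi] at h1
    rw [Function.iterate_succ_apply', h1]
  have hd : R.opRay ρ (next ρ (x 0)) (cycLen ρ (x 0) - (i + 1)) m₁ ∈
      LinearMap.range (R.arrow (next ρ (x 0))) := by
    by_cases h1 : i + 1 = cycLen ρ (x 0)
    · have h2 : next ρ (x 0) = w₀ := by
        rw [← hx0, h1, ← hL, hcyc.iterate_cycLen]
      rw [h2, h1, Nat.sub_self]
      exact hm₁
    · exact R.opRay_mem_range (by omega) _
  obtain ⟨m, hm, hmj, hm0, hmF⟩ := hc.exists_tail_family h hd
  refine ⟨m, hm, ?_, hm0, hmF⟩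
  have h1 := hm.tail_apply hc.string h 0 i
  simp only [Nat.cast_zero, add_zero, zero_add] at h1
  rw [h1, hmj, hi, ← hx0, ← Module.End.mul_apply, ← opRay_add,
    show i + 1 + (cycLen ρ (x 0) - (i + 1)) = cycLen ρ w₀ by omega, ← R.cycOp_eq hcyc,
    hc.Z_eq_cycOp hm₁]

/-- The families along nonperiodic words can be chosen such that on their tails they generate
subspaces that are saturated up to torsion. -/
theorem exists_adjusted (hc : R.IsControlled ρ) (L : LiftFamily R σ) :
    ∃ L' : LiftFamily R σ, ∃ e : ∀ p, L'.idx p = L.idx p,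
      (∀ p, p.word.IsPer → ∀ u, L'.vec p u = L.vec p (cast (e p) u)) ∧
      ∀ w₀, ∃ S : Submodule k M, Stable (R.Z ρ) S ∧ S ≤ LinearMap.range (R.arrow w₀) ∧
        S ≤ L'.span ∧
        (∀ y ∈ LinearMap.range (R.arrow w₀), Sat (R.Z ρ) S y → ∃ z ∈ S, Sat (R.Z ρ) ⊥ (y - z)) ∧
        (∀ p u o j x, ¬ p.word.IsPer → (p.word.ori o).IsTail j x → cycRep ρ (x 0) = w₀ →
          ∀ n, x n = w₀ → oriFam (L'.vec p u) o (j + (n + 1 : ℕ)) ∈ S) := by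
  classical
  -- For a representative `w₀`: all tails, at either end of a nonperiodic word, that run around the
  -- cycle of `w₀`, one for every basis vector of the word.
  let T : Quiver.Total V → Type _ := fun w₀ => {t : Σ p : σ.Class, L.idx p × Bool //
    ¬ t.1.word.IsPer ∧ ∃ j x, (t.1.word.ori t.2.2).IsTail j x ∧ cycRep ρ (x 0) = w₀}
  choose j x hx hxw using fun (w₀ : Quiver.Total V) (t : T w₀) => t.2.2
  choose i hi hiL hia using fun (w₀ : Quiver.Total V) (t : T w₀) =>
    (hx w₀ t).exists_entry hc.string
  -- The vector at which the tail first enters the image of `w₀`; the later entries are obtained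
  -- from it by powers of `Z`.
  let w : ∀ w₀, T w₀ → M := fun w₀ t =>
    oriFam (L.vec t.1.1 t.1.2.1) t.1.2.2 (j w₀ t + (i w₀ t + 1 : ℕ))
  have hw : ∀ w₀ t, w w₀ t ∈ LinearMap.range (R.arrow w₀) := by
    intro w₀ t
    have h1 := ((L.isStr t.1.1 t.1.2.1).ori t.1.2.2).tail_apply hc.string (hx w₀ t) 0 (i w₀ t)
    simp only [Nat.cast_zero, add_zero, zero_add, hi, hxw] at h1
    change oriFam _ _ _ ∈ _
    rw [h1]
    exact R.opRay_mem_range (Nat.succ_pos _) _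
  -- Saturation changes these vectors only by multiples `Z m₁`, which is what the corrections of
  -- tails can realize.
  choose w' hw'1 hw'2 using fun w₀ =>
    (hc.stableFG_range w₀).exists_saturated (w w₀) (hw w₀)
  have hΔ : ∀ (p : σ.Class) (u : L.idx p) (o : Bool), ∃ Δ : ℤ → M, R.IsStr p.word Δ ∧
      Δ 0 ∈ R.Fminus p.word 0 ∧ (p.word.IsPer → Δ = 0) ∧
      (∀ q, oriFam Δ o q ≠ 0 → ∃ j x, (p.word.ori o).IsTail j x ∧ j ≤ q) ∧
      ∀ (w₀ : Quiver.Total V) (t : T w₀), t.1 = ⟨p, u, o⟩ →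
        oriFam (L.vec p u) o (j w₀ t + (i w₀ t + 1 : ℕ)) +
          oriFam Δ o (j w₀ t + (i w₀ t + 1 : ℕ)) = w' w₀ t := by
    intro p u o
    by_cases h : ¬ p.word.IsPer ∧ ∃ j x, (p.word.ori o).IsTail j x
    · obtain ⟨hp, j₀, x₀, h₀⟩ := h
      let t₀ : T (cycRep ρ (x₀ 0)) := ⟨⟨p, u, o⟩, hp, j₀, x₀, h₀, rfl⟩
      obtain ⟨m₁, hm₁, e₁⟩ := hw'1 _ t₀
      have h₁ : (p.word.ori o).IsTail (j _ t₀) (x _ t₀) := hx _ t₀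
      obtain ⟨Δ, hΔ, hΔ1, hΔ2, hΔ3⟩ := hc.exists_tail_correction h₁ (hi _ t₀) (hiL _ t₀)
        (m₁ := m₁) (by rw [hxw]; exact hm₁)
      refine ⟨oriFam Δ o, hΔ.of_ori, mem_Fminus_of_ori hΔ h₁.start_mem hΔ3 p.zero_mem,
        fun h => (hp h).elim, fun q hq => ⟨_, _, h₁, ?_⟩, ?_⟩
      · by_contra hlt
        rw [oriFam_oriFam] at hq
        exact hq (hΔ2 q (by omega))
      · rintro w₀ ⟨t, ht⟩ rfl
        obtain rfl : cycRep ρ (x₀ 0) = w₀ := by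
          obtain ⟨-, j', x', h', rfl⟩ := ht
          rw [(h'.unique h₀).2]
        rw [oriFam_oriFam, hΔ1, ← e₁, add_comm, sub_add_cancel]
    · refine ⟨0, ⟨fun _ _ _ => zero_mem _, fun _ _ _ => zero_mem _, fun _ _ _ => zero_mem _⟩,
        zero_mem _, fun _ => rfl, fun q hq => (hq ?_).elim, ?_⟩
      · cases o <;> rfl
      · rintro w₀ ⟨t, ht⟩ rfl
        obtain ⟨hp, j', x', h', -⟩ := ht
        exact (h ⟨hp, j', x', h'⟩).elim
  choose Δ hΔ1 hΔ2 hΔ3 hΔ4 hΔ5 using hΔ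
  -- Both ends are corrected independently. The corrections lie in F⁻, so the bases persist, and
  -- they are zero for periodic words.
  let L' : LiftFamily R σ :=
    { idx := L.idx
      vec := fun p u i => L.vec p u i + (Δ p u true i + Δ p u false i)
      isStr := fun p u => (L.isStr p u).add ((hΔ1 p u true).add (hΔ1 p u false))
      basis := fun p => (L.basis p).congr (R.Fminus_le_Fplus _ _) fun u => by
        rw [add_sub_cancel_left]
        exact add_mem (hΔ2 p u true) (hΔ2 p u false) }
  have hvec : ∀ p u o q, oriFam (L'.vec p u) o q =
      oriFam (L.vec p u) o q + (oriFam (Δ p u o) o q + oriFam (Δ p u (!o)) o q) := by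
    intro p u o q
    cases o
    · change L.vec p u (-q) + (_ + _) = _
      rw [add_comm (Δ p u true (-q))]
      rfl
    · rfl
  have hvec' : ∀ (w₀ : Quiver.Total V) (t : T w₀),
      oriFam (L'.vec t.1.1 t.1.2.1) t.1.2.2 (j w₀ t + (i w₀ t + 1 : ℕ)) = w' w₀ t := by
    rintro w₀ t
    obtain ⟨⟨p, u, o⟩, ht⟩ := t
    rw [hvec, ← add_assoc, hΔ5 p u o w₀ ⟨⟨p, u, o⟩, ht⟩ rfl]
    -- The correction belonging to the opposite end vanishes at this position, since the two tails
    -- do not overlap.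
    convert add_zero _ using 2
    by_contra hne
    rw [← oriFam_not] at hne
    obtain ⟨j', x', h', hj'⟩ := hΔ4 p u (!o) _ hne
    have h1 : (p.word.ori o).IsTail (j w₀ ⟨⟨p, u, o⟩, ht⟩) (x w₀ ⟨⟨p, u, o⟩, ht⟩) :=
      hx w₀ ⟨⟨p, u, o⟩, ht⟩
    have h2 : (p.word.ori o).rev.IsTail j' x' := by
      cases o
      · change p.word.rev.rev.IsTail j' x'
        rw [rev_rev]
        exact h'
      · exact h'
    have h3 := h1.le_of_rev h2 hj'
    push_cast at h3
    omega
  have hmem : ∀ p u o q, q ∈ (p.word.ori o).I → oriFam (L'.vec p u) o q ∈ L'.span := by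
    intro p u o q hq
    cases o
    · exact L'.vec_mem_span p u hq
    · exact L'.vec_mem_span p u hq
  refine ⟨L', fun _ => rfl, fun p hp u => ?_, fun w₀ => ?_⟩
  · funext q
    change L.vec p u q + (Δ p u true q + Δ p u false q) = L.vec p u q
    rw [hΔ3 p u true hp, hΔ3 p u false hp]
    simp
  · set S := Submodule.span k {m | ∃ (a : ℕ) (t : T w₀), m = (R.Z ρ ^ a) (w' w₀ t)} with hS
    have hwr : ∀ t, w' w₀ t ∈ LinearMap.range (R.arrow w₀) := by
      intro t
      obtain ⟨m₁, hm₁, e⟩ := hw'1 w₀ t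
      have := add_mem (hc.Z_mem_range hm₁) (hw w₀ t)
      rwa [← e, sub_add_cancel] at this
    refine ⟨S, Stable.span ?_, Submodule.span_le.2 ?_, Submodule.span_le.2 ?_, hw'2 w₀, ?_⟩
    · rintro _ ⟨a, t, rfl⟩
      refine Submodule.subset_span ⟨a + 1, t, ?_⟩
      rw [pow_succ', Module.End.mul_apply]
    · rintro _ ⟨a, t, rfl⟩
      exact (hc.stable_range w₀).pow a (hwr t)
    · rintro _ ⟨a, t, rfl⟩
      refine (L'.stable_span hc).pow a ?_
      rw [← hvec' w₀ t]
      exact hmem _ _ _ _ ((hx w₀ t).mem _)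
    · intro p u o j₀ x₀ hp h₀ hw₀ n hn
      let t : T w₀ := ⟨⟨p, u, o⟩, hp, j₀, x₀, h₀, hw₀⟩
      have h₁ : (p.word.ori o).IsTail (j w₀ t) (x w₀ t) := hx w₀ t
      obtain ⟨ej, ex⟩ := h₁.unique h₀
      obtain ⟨a, ha⟩ := hia w₀ t n (by rw [hxw, ex, hn])
      have hst := (L'.isStr p u).ori o
      have hwt : oriFam (L'.vec p u) o (j w₀ t + (i w₀ t + 1 : ℕ)) = w' w₀ t := hvec' w₀ t
      have hL : cycLen ρ w₀ = cycLen ρ (x w₀ t 0) := by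
        have h2 := h₀.cycLen_eq hc.string n
        rw [hn] at h2
        rw [ex]
        exact h2
      have hcyc : Cyc ρ w₀ := by rw [← hn]; exact h₀.cyc_all hc.string n
      -- Every further turn along the tail applies the cycle, that is `Z`, to the entry vector.
      have key : ∀ a : ℕ, oriFam (L'.vec p u) o
          (j w₀ t + (i w₀ t + cycLen ρ (x w₀ t 0) * a + 1 : ℕ)) = (R.Z ρ ^ a) (w' w₀ t) := by
        intro a
        induction a with
        | zero => exact hwt
        | succ a ih =>
          have h2 := hst.tail_apply hc.string h₁ (i w₀ t + cycLen ρ (x w₀ t 0) * a + 1)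
            (cycLen ρ (x w₀ t 0) - 1)
          have hpos := h₁.cyc.cycLen_pos
          have h3 : i w₀ t + cycLen ρ (x w₀ t 0) * a + 1 + (cycLen ρ (x w₀ t 0) - 1) =
              i w₀ t + cycLen ρ (x w₀ t 0) * (a + 1) := by
            rw [mul_add, mul_one]; omega
          have h4 : x w₀ t (i w₀ t + cycLen ρ (x w₀ t 0) * (a + 1)) = w₀ := by
            have h5 : ∀ b, x w₀ t (i w₀ t + cycLen ρ (x w₀ t 0) * b) = w₀ := by
              intro b
              induction b with
              | zero => rw [mul_zero, add_zero, hi, hxw]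
              | succ b ih => rw [mul_add, mul_one, ← add_assoc, h₁.add_cycLen hc.string, ih]
            exact h5 _
          rw [h3, h4, Nat.sub_add_cancel hpos, ih, ← hL, ← R.cycOp_eq hcyc,
            ← hc.Z_eq_cycOp ((hc.stable_range w₀).pow a (hwr t))] at h2
          rw [pow_succ', Module.End.mul_apply, ← h2]
          congr 1
          rw [hL]
          push_cast
          ring
      rw [ha, ← ej, key a]
      exact Submodule.subset_span ⟨a, t, rfl⟩

end IsControlled

end QuiverOps

/-- A Bézout relation between `f` and `X ^ n` expresses `m` through f(φ) m and φ^n m. -/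
theorem Stable.mem_of_sat {k : Type u} [Field k] {M : Type x} [AddCommGroup M] [Module k M]
    {φ : Module.End k M} {S : Submodule k M} (hS : Stable φ S) {m : M} (h : Sat φ S m) {n : ℕ}
    (hn : (φ ^ n) m ∈ S) : m ∈ S := by
  obtain ⟨f, hf, hm⟩ := h
  obtain ⟨a, b, hab⟩ := isCoprime_X_pow hf n
  have h1 : m = Polynomial.aeval φ a (Polynomial.aeval φ f m) +
      Polynomial.aeval φ b ((φ ^ n) m) := by
    have h2 := congrArg (fun g : Polynomial k => Polynomial.aeval φ g m) hab
    simp only [map_add, map_mul, map_pow, Polynomial.aeval_X, map_one] at h2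
    exact h2.symm
  rw [h1]
  exact add_mem (hS.aeval a hm) (hS.aeval b hn)

namespace Signs.BiWord

variable {V : Type v} [Quiver.{w} V] {ρ : Set (QPath V)} {σ : Signs ρ} {c : σ.BiWord}

/-- The position in a word or its inverse. -/
def oriPos (o : Bool) (i : ℤ) : ℤ := cond o i (-i)

theorem not_direct_inverse {i : ℤ} {z : Quiver.Total V} (h : c.letter i = some (.direct z))
    (h' : c.letter (i + 1) = some (.inverse z)) : False := by
  have h1 := c.dst_eq _ _ h
  have h2 := c.src_eq _ _ h'
  rw [add_sub_cancel_right, ← h1] at h2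
  have h3 := σ.src_inv (.direct z)
  exact Side.flip_ne _ (h3.symm.trans h2)

theorem IsPer.of_rev (h : c.rev.IsPer) : c.IsPer := by
  have := h.rev
  rwa [QuiverOps.rev_rev] at this

theorem isPer_ori {o : Bool} : (c.ori o).IsPer ↔ c.IsPer := by
  cases o
  · exact ⟨IsPer.of_rev, IsPer.rev⟩
  · exact Iff.rfl

end Signs.BiWord

open Signs.BiWord (oriPos)

namespace QuiverOps

variable {k : Type u} [Field k] {V : Type v} [Quiver.{w} V] {ρ : Set (QPath V)}
  {M : Type x} [AddCommGroup M] [Module k M] {R : QuiverOps k V M} {σ : Signs ρ} {c : σ.BiWord}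

/-- A path that does not kill an element of a family along a word moves it along the word. -/
theorem IsStr.opRay_ne_zero (hR : ∀ r ∈ ρ, R.path r.path = 0) {m : ℤ → M} (hm : R.IsStr c m)
    {i : ℤ} (hi : i ∈ c.I) (y : Quiver.Total V) (n : ℕ) (h : R.opRay ρ y (n + 1) (m i) ≠ 0) :
    ∃ o, (∀ s : ℕ, s ≤ n →
        (c.ori o).letter (oriPos o i + 1 + s) = some (.inverse ((next ρ)^[n - s] y))) ∧
      R.opRay ρ y (n + 1) (m i) = oriFam m o (oriPos o i + (n + 1 : ℕ)) := by
  induction n generalizing y with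
  | zero =>
    rw [opRay_one] at h ⊢
    by_cases h1 : c.letter (i + 1) = some (.inverse y)
    · refine ⟨true, fun s hs => ?_, ?_⟩
      · obtain rfl : s = 0 := by omega
        change c.letter (i + 1 + ((0 : ℕ) : ℤ)) = some (.inverse y)
        rw [Nat.cast_zero, add_zero, h1]
      · rw [hm.apply_inverse h1]
        rfl
    · by_cases h2 : c.letter i = some (.direct y)
      · refine ⟨false, fun s hs => ?_, ?_⟩
        · obtain rfl : s = 0 := by omega
          change (c.letter (1 - (-i + 1 + (0 : ℕ)))).map Letter.inv = _
          rw [show 1 - (-i + 1 + ((0 : ℕ) : ℤ)) = i by push_cast; ring, h2]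
          rfl
        · rw [hm.apply_direct h2]
          change _ = m (-(-i + (0 + 1 : ℕ)))
          congr 1
          push_cast
          ring
      · exact (h (hm.apply_eq_zero hR hi h2 h1)).elim
  | succ n ih =>
    rw [opRay_succ, Module.End.mul_apply] at h ⊢
    obtain ⟨o, h1, h2⟩ := ih (next ρ y) (fun h0 => h (by rw [h0, map_zero]))
    have h3 := h1 n le_rfl
    rw [Nat.sub_self, Function.iterate_zero, id] at h3
    have h4 : (c.ori o).letter (oriPos o i + (n + 1 : ℕ)) = some (.inverse (next ρ y)) := by
      rw [← h3]; congr 1; push_cast; ring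
    have h5 : (c.ori o).letter (oriPos o i + (n + 1 : ℕ) + 1) = some (.inverse y) := by
      by_contra hne
      refine h ?_
      rw [h2]
      refine (hm.ori o).apply_eq_zero hR ((c.ori o).mem_of_letter h4).1 ?_ hne
      rw [h4]
      simp
    refine ⟨o, fun s hs => ?_, ?_⟩
    · rcases Nat.lt_or_eq_of_le hs with hs | rfl
      · rw [h1 s (by omega), show n + 1 - s = (n - s) + 1 by omega, Function.iterate_succ_apply]
      · rw [Nat.sub_self, Function.iterate_zero, id, ← h5]
        congr 1
        push_cast
        ring
    · rw [h2, (hm.ori o).apply_inverse h5]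
      congr 1
      push_cast
      ring

/-- A nonperiodic word that ends with inverses of arrows of a primitive cycle has a tail. -/
theorem exists_isTail (hc : R.IsControlled ρ) {m : ℤ → M} (hm : R.IsStr c m)
    (hnz : ∀ i ∈ c.I, m i ≠ 0) (hp : ¬ c.IsPer) {i : ℤ}
    (h : ∀ s : ℕ, ∃ z, c.letter (i + 1 + s) = some (.inverse z) ∧ Cyc ρ z) :
    ∃ j x, c.IsTail j x ∧ j ≤ i := by
  have hfoll : ∀ q z z', c.letter q = some (.inverse z) → c.letter (q + 1) = some (.inverse z') →
      Foll ρ z' z := by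
    intro q z z' h1 h2
    by_contra hf
    refine hnz (q + 1) (c.mem_of_letter h2).1 ?_
    rw [← hm.apply_inverse h2]
    have h3 := hm.apply_inverse (i := q - 1) (by rwa [sub_add_cancel])
    rw [sub_add_cancel] at h3
    rw [← h3, R.arrow_arrow_eq_zero hc.rel hf]
  by_cases hall : ∃ q, q ≤ i ∧ ∀ z, c.letter q ≠ some (.inverse z)
  · obtain ⟨j, ⟨hji, hj⟩, hmax⟩ := Int.exists_greatest_of_bdd (P := fun q => q ≤ i ∧
      ∀ z, c.letter q ≠ some (.inverse z)) ⟨i, fun q hq => hq.1⟩ hall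
    have h1 : ∀ n : ℕ, ∃ z, c.letter (j + 1 + n) = some (.inverse z) := by
      intro n
      by_cases hn : j + 1 + n ≤ i
      · by_contra hne
        push Not at hne
        have := hmax (j + 1 + n) ⟨hn, hne⟩
        omega
      · obtain ⟨z, hz, -⟩ := h (j + 1 + n - (i + 1)).toNat
        refine ⟨z, ?_⟩
        rw [← hz]
        congr 1
        omega
    choose x hx using h1
    have hf : ∀ n, Foll ρ (x (n + 1)) (x n) := fun n => by
      refine hfoll _ _ _ (hx n) ?_
      rw [← hx (n + 1)]
      congr 1
      push_cast
      ring
    refine ⟨j, x, ⟨hx, hj, hf, ?_⟩, hji⟩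
    obtain ⟨z, hz, hzc⟩ := h 0
    have h2 := hx (i - j).toNat
    rw [show j + 1 + ((i - j).toNat : ℤ) = i + 1 + (0 : ℕ) by push_cast; omega, hz] at h2
    have h3 : Cyc ρ (x (i - j).toNat) := by
      have : z = x (i - j).toNat := by simpa using h2
      rwa [← this]
    have h4 : ∀ n, Cyc ρ (x n) → Cyc ρ (x 0) := by
      intro n
      induction n with
      | zero => exact id
      | succ n ih =>
        intro hn
        refine ih ?_
        rw [← (hf n).next_eq hc.string]
        exact hn.next
    exact h4 _ h3
  -- Without a letter that is not inverse, the word runs around the cycle in both directions and is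
  -- periodic, with the length of the cycle as a period.
  · push Not at hall
    have h1 : ∀ q, ∃ z, c.letter q = some (.inverse z) := by
      intro q
      by_cases hq : q ≤ i
      · exact hall q hq
      · obtain ⟨z, hz, -⟩ := h (q - (i + 1)).toNat
        refine ⟨z, ?_⟩
        rw [← hz]
        congr 1
        omega
    choose x hx using h1
    have hf : ∀ q, Foll ρ (x (q + 1)) (x q) := fun q => hfoll _ _ _ (hx q) (hx _)
    have hn : ∀ q, next ρ (x (q + 1)) = x q := fun q => (hf q).next_eq hc.string
    obtain ⟨z, hz, hzc⟩ := h 0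
    have hz' : Cyc ρ (x (i + 1)) := by
      rw [Nat.cast_zero, add_zero, hx] at hz
      have : x (i + 1) = z := by simpa using hz
      rwa [this]
    have hcyc : ∀ q, Cyc ρ (x q) ∧ cycLen ρ (x q) = cycLen ρ (x (i + 1)) := by
      intro q
      induction q using Int.inductionOn' (b := i + 1) with
      | zero => exact ⟨hz', rfl⟩
      | succ q _ ih =>
        have h2 := ih.1.of_foll hc.string (hf q)
        refine ⟨h2, ?_⟩
        rw [← ih.2, ← hn q, h2.cycLen_next]
      | pred q _ ih =>
        have h2 := hn (q - 1)
        rw [sub_add_cancel] at h2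
        rw [← h2]
        exact ⟨ih.1.next, by rw [ih.1.cycLen_next, ih.2]⟩
    have hit : ∀ (n : ℕ) q, (next ρ)^[n] (x (q + n)) = x q := by
      intro n
      induction n with
      | zero => simp
      | succ n ih =>
        intro q
        rw [Function.iterate_succ_apply]
        push_cast
        rw [← add_assoc, hn, ih]
    refine (hp ⟨Set.eq_univ_of_forall fun q => (c.mem_of_letter (hx q)).1,
      cycLen ρ (x (i + 1)), hz'.cycLen_pos, fun t => ?_⟩).elim
    rw [hx, hx]
    have h3 := hit (cycLen ρ (x (i + 1))) t
    have h4 := (hcyc (t + cycLen ρ (x (i + 1)))).1.iterate_cycLen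
    rw [(hcyc _).2, h3] at h4
    rw [h4]

theorem mem_ray {y : Quiver.Total V} (hy : Cyc ρ y) {f : ℕ → M}
    (h : ∀ n, f n = R.arrow ((next ρ)^[n] y) (f (n + 1))) : f 0 ∈ R.ray ρ y := by
  refine ⟨f, rfl, fun n => R.mem_lrel_direct.2 ⟨h n, ?_⟩⟩
  rw [h (n + 1), ← (hy.foll n).right_eq_left]
  exact R.arrow_mem_E _ _

namespace IsControlled

/-- If g(Z) m = 0 with g(0) = 1, then `q`, the value of -divX g at `Z`, inverts `Z` on the powers
applied to `m`. So `m` can be divided by the cycle indefinitely and coherently. -/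
theorem mem_ray_of_sat_bot (hc : R.IsControlled ρ) {y : Quiver.Total V} (hy : Cyc ρ y) {m : M}
    (hm : m ∈ LinearMap.range (R.arrow y)) (h : Sat (R.Z ρ) ⊥ m) : m ∈ R.ray ρ y := by
  obtain ⟨g, hg, hgm⟩ := h
  let q : Module.End k M := Polynomial.aeval (R.Z ρ) (-g.divX)
  have hqm : ∀ n : ℕ, R.Z ρ ((q ^ (n + 1)) m) = (q ^ n) m := by
    intro n
    have e1 : g = g.divX * Polynomial.X + 1 := by
      conv_lhs => rw [← g.divX_mul_X_add, hg, Polynomial.C_1]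
    have e2 : R.Z ρ * q ^ (n + 1) = q ^ n - q ^ n * Polynomial.aeval (R.Z ρ) g := by
      have e3 : R.Z ρ * q = 1 - Polynomial.aeval (R.Z ρ) g := by
        have : Polynomial.aeval (R.Z ρ) (Polynomial.X * -g.divX) =
            Polynomial.aeval (R.Z ρ) (1 - g) := by
          congr 1
          linear_combination e1
        simpa [q] using this
      have e4 : Commute (R.Z ρ) q := by
        have := Polynomial.X_mul (p := -g.divX)
        have := congrArg (Polynomial.aeval (R.Z ρ)) this
        rwa [map_mul, map_mul, Polynomial.aeval_X] at this
      rw [pow_succ, ← mul_assoc, (e4.pow_right n).eq, mul_assoc, e3, mul_sub, mul_one]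
    have := congrArg (fun F : Module.End k M => F m) e2
    simp only [LinearMap.sub_apply, Module.End.mul_apply] at this
    rw [this, (Submodule.mem_bot k).1 hgm, map_zero, sub_zero]
  have hqr : ∀ n : ℕ, (q ^ n) m ∈ LinearMap.range (R.arrow y) := by
    intro n
    induction n with
    | zero => exact hm
    | succ n ih =>
      rw [pow_succ', Module.End.mul_apply]
      exact (hc.stable_range y).aeval _ ih
  have hit : ∀ n : ℕ, (next ρ)^[cycLen ρ y * n] y = y := fun n => by
    rw [Function.iterate_mul]
    exact Function.iterate_fixed hy.iterate_cycLen n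
  have hle : ∀ n : ℕ, n ≤ cycLen ρ y * n := fun n => Nat.le_mul_of_pos_left n hy.cycLen_pos
  -- The `n`-th term is `m` divided by `n` turns and then moved along all but the final `n` arrows
  -- of them.
  refine mem_ray hy (f := fun n => R.opRay ρ ((next ρ)^[n] y) (cycLen ρ y * n - n) ((q ^ n) m))
    fun n => ?_
  have h1 := hle n
  have h2 := hle (n + 1)
  rw [Function.iterate_succ_apply']
  have h3 : ∀ (a : Quiver.Total V) (t : ℕ) (v : M),
      R.arrow a (R.opRay ρ (next ρ a) t v) = R.opRay ρ a (t + 1) v := fun a t v => by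
    rw [opRay_succ, Module.End.mul_apply]
  rw [h3,
    show cycLen ρ y * (n + 1) - (n + 1) + 1 = (cycLen ρ y * n - n) + cycLen ρ y by
      rw [mul_add, mul_one] at h2 ⊢; omega, opRay_add, ← Function.iterate_add_apply,
    Nat.sub_add_cancel h1, hit, Module.End.mul_apply, ← R.cycOp_eq hy,
    ← hc.Z_eq_cycOp (hqr _), hqm]

end IsControlled

end QuiverOps

/-! ### The periodic word of a primitive cycle -/

section CycleWord

variable {V : Type v} [Quiver.{w} V] {ρ : Set (QPath V)}

variable (ρ) in
/-- The arrows of a primitive cycle, numbered by the integers, starting with `y` at `1`. -/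
def cycArrow (y : Quiver.Total V) (i : ℤ) : Quiver.Total V :=
  (next ρ)^[((i - 1) % cycLen ρ y).toNat] y

theorem cycArrow_eq {y : Quiver.Total V} {i : ℤ} {n : ℕ} (h : (cycLen ρ y : ℤ) ∣ i - 1 - n) :
    cycArrow ρ y i = (next ρ)^[n] y := by
  have h1 : (i - 1) % cycLen ρ y = (n : ℤ) % cycLen ρ y :=
    (Int.emod_emod_of_dvd _ dvd_rfl).symm.trans
      (by rw [Int.emod_emod_of_dvd _ dvd_rfl]; exact Int.emod_eq_emod_iff_emod_sub_eq_zero.2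
            (Int.emod_eq_zero_of_dvd h))
  rw [cycArrow, h1, ← Int.natCast_mod, Int.toNat_natCast]
  exact Function.iterate_mod_minimalPeriod_eq

theorem Cyc.exists_cycArrow {y : Quiver.Total V} (hy : Cyc ρ y) (i : ℤ) :
    ∃ n : ℕ, cycArrow ρ y i = (StringAlg.next ρ)^[n] y ∧
      cycArrow ρ y (i + 1) = (StringAlg.next ρ)^[n + 1] y := by
  have hL : (cycLen ρ y : ℤ) ≠ 0 := by have := hy.cycLen_pos; omega
  refine ⟨((i - 1) % cycLen ρ y).toNat, rfl, cycArrow_eq ?_⟩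
  push_cast
  rw [Int.toNat_of_nonneg (Int.emod_nonneg _ hL)]
  have := Int.dvd_self_sub_emod (x := i - 1) (m := (cycLen ρ y : ℤ))
  convert this using 1
  ring

theorem Cyc.next_cycArrow {y : Quiver.Total V} (hy : Cyc ρ y) (i : ℤ) :
    StringAlg.next ρ (cycArrow ρ y i) = cycArrow ρ y (i + 1) := by
  obtain ⟨n, h1, h2⟩ := hy.exists_cycArrow i
  rw [h1, h2, Function.iterate_succ_apply']

theorem Cyc.foll_cycArrow {y : Quiver.Total V} (hy : Cyc ρ y) (i : ℤ) :
    Foll ρ (cycArrow ρ y i) (cycArrow ρ y (i + 1)) := by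
  obtain ⟨n, h1, h2⟩ := hy.exists_cycArrow i
  rw [h1, h2]
  exact hy.foll n

/-- The periodic word that runs through a primitive cycle. -/
def cycWord (σ : Signs ρ) {y : Quiver.Total V} (hy : Cyc ρ y) : σ.BiWord where
  letter i := some (.direct (cycArrow ρ y i))
  side i := σ.dst (.direct (cycArrow ρ y i))
  I := Set.univ
  conv _ _ _ _ _ _ _ := trivial
  isSome _ := by simp
  src_eq i l h := by
    obtain rfl := Option.some.inj h
    have h1 := hy.foll_cycArrow (i - 1)
    rw [sub_add_cancel] at h1
    rw [σ.src_of_foll h1]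
    have h2 := σ.src_inv (.direct (cycArrow ρ y (i - 1)))
    rw [show (Letter.direct (cycArrow ρ y (i - 1))).inv =
      .inverse (cycArrow ρ y (i - 1)) from rfl] at h2
    rw [h2]
    simp [Side.flip]
  dst_eq i l h := by
    obtain rfl := Option.some.inj h
    rfl

end CycleWord

namespace QuiverOps

open Signs.BiWord (oriPos)

variable {k : Type u} [Field k] {V : Type v} [Quiver.{w} V] {ρ : Set (QPath V)}
  {M : Type x} [AddCommGroup M] [Module k M] {R : QuiverOps k V M} {σ : Signs ρ} {c : σ.BiWord}

theorem right_cycWord {y : Quiver.Total V} (hy : Cyc ρ y) (n : ℕ) :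
    (cycWord σ hy).right 0 n = some (.direct ((next ρ)^[n] y)) := by
  change some (Letter.direct (cycArrow ρ y (0 + 1 + n))) = _
  rw [cycArrow_eq (n := n) (by simp)]

theorem left_cycWord {y : Quiver.Total V} (hy : Cyc ρ y) (n : ℕ) :
    (cycWord σ hy).left 0 n = some (.inverse (cycArrow ρ y (-n))) := by
  change some (Letter.inverse (cycArrow ρ y (0 - n))) = _
  rw [zero_sub]

namespace IsControlled

theorem plus_cycWord {y : Quiver.Total V} (hy : Cyc ρ y) (s : Side V) :
    R.plus σ s ((cycWord σ hy).right 0) = R.ray ρ y := by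
  refine le_antisymm (fun a ha => ?_) ?_
  · obtain ⟨f, hf, rfl⟩ := (R.mem_plus σ).1 ha
    refine ⟨f, rfl, fun n => ?_⟩
    have h3 := (R.mem_seqs σ).1 hf n
    rwa [right_cycWord] at h3
  · rintro _ ⟨f, rfl, hf⟩
    refine (R.mem_plus σ).2 ⟨f, (R.mem_seqs σ).2 fun n => ?_, rfl⟩
    rw [right_cycWord]
    exact hf n

/-- To the left the word consists of inverse letters, which can be followed by applying arrows
without any condition. -/
theorem ray_le_Fplus {y : Quiver.Total V} (hy : Cyc ρ y) :
    R.ray ρ y ≤ R.Fplus (cycWord σ hy) 0 := by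
  rw [Fplus_eq, plus_cycWord]
  refine le_inf (fun a ha => ?_) le_rfl
  let g : ℕ → M := fun n => n.rec a fun n b => R.arrow (cycArrow ρ y (-n)) b
  have hgE : ∀ n : ℕ, g n ∈ R.E (cycArrow ρ y (-n)).left := by
    intro n
    cases n with
    | zero =>
      have h1 := (hy.foll_cycArrow 0).right_eq_left
      rw [Nat.cast_zero, neg_zero, ← h1, zero_add, cycArrow_eq (n := 0) (by simp)]
      exact R.range_arrow_le y (ray_le_range y ha)
    | succ n =>
      have h1 := (hy.foll_cycArrow (-(n + 1 : ℕ))).right_eq_left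
      rw [← h1]
      convert R.arrow_mem_E (cycArrow ρ y (-n)) (g n) using 4
      push_cast
      ring
  refine (R.mem_plus σ).2 ⟨g, (R.mem_seqs σ).2 fun n => ?_, rfl⟩
  rw [left_cycWord]
  exact R.mem_lrel_inverse.2 ⟨rfl, hgE n⟩

/-- To the right, a sequence of direct letters that is eventually zero starts with zero. To the
left, it means that a power of `Z` kills the element, but `Z` is injective on the ray, which is
killed by a polynomial with constant term one. -/
theorem Fminus_cycWord (hc : R.IsControlled ρ) {y : Quiver.Total V} (hy : Cyc ρ y) :
    R.Fminus (cycWord σ hy) 0 = ⊥ := by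
  rw [Fminus_eq, plus_cycWord, eq_bot_iff]
  refine sup_le (inf_le_right.trans fun a ha => ?_) ?_
  · obtain ⟨f, hf, ⟨N, hN⟩, rfl⟩ := (R.mem_minus σ).1 ha
    have h1 : ∀ n, (f n, f (n + 1)) ∈ R.lrel (.direct ((next ρ)^[n] y)) := fun n => by
      have h3 := (R.mem_seqs σ).1 hf n
      rwa [right_cycWord] at h3
    rw [Submodule.mem_bot, ← opRay_apply_of_seq h1 N, hN N le_rfl, map_zero]
  · rintro a ⟨ha, hr⟩
    obtain ⟨g, hg, ⟨N, hN⟩, rfl⟩ := (R.mem_minus σ).1 ha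
    have h1 : ∀ n : ℕ, g (n + 1) = R.arrow (cycArrow ρ y (-n)) (g n) := fun n => by
      have h3 := (R.mem_seqs σ).1 hg n
      rw [left_cycWord] at h3
      exact (R.mem_lrel_inverse.1 h3).1
    have h2 : ∀ n : ℕ, g n = R.opRay ρ (cycArrow ρ y (1 - n)) n (g 0) := by
      intro n
      induction n with
      | zero => rfl
      | succ n ih =>
        rw [opRay_succ, Module.End.mul_apply, hy.next_cycArrow, h1, ih,
          show (1 : ℤ) - (n + 1 : ℕ) = -n by push_cast; ring,
          show (-n : ℤ) + 1 = 1 - n by ring]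
    have h3 := h2 (cycLen ρ y * N)
    rw [hN _ (Nat.le_mul_of_pos_left N hy.cycLen_pos),
      cycArrow_eq (n := 0) ⟨-N, by push_cast; ring⟩, Function.iterate_zero, id] at h3
    have h4 := R.opRay_cycLen_mul hy N 0
    rw [add_zero] at h4
    rw [h4, show R.opRay ρ y 0 = 1 from rfl, mul_one,
      ← (hc.Z_pow_eq_cycOp_pow (ray_le_range y hr) N).1] at h3
    obtain ⟨f, hf, hf0⟩ := hc.exists_aeval_ray_eq_zero hy
    exact Stable.bot.mem_of_sat ⟨f, hf, (Submodule.mem_bot k).2 (hf0 _ hr)⟩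
      ((Submodule.mem_bot k).2 h3.symm)

/-- The ray lies in the F⁺ of a periodic word whose F⁻ is zero, so lifts of a basis of the
subquotient span it exactly, without denominators. -/
theorem ray_le_span (hc : R.IsControlled ρ) (L : LiftFamily R σ) {y : Quiver.Total V}
    (hy : Cyc ρ y) : R.ray ρ y ≤ L.span := by
  have h1 : R.Fplus (cycWord σ hy) 0 ≤ L.span ⊔ R.Fminus (cycWord σ hy) 0 :=
    L.tplus_le ((cycWord σ hy).triple_isTriple trivial)
  rw [hc.Fminus_cycWord hy, sup_bot_eq] at h1
  exact (ray_le_Fplus hy).trans h1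

end IsControlled

theorem _root_.StringAlg.Signs.BiWord.IsPer.ori (h : c.IsPer) (o : Bool) : (c.ori o).IsPer :=
  Signs.BiWord.isPer_ori.2 h

/-- If no power of a primitive cycle kills an element of a family along a word, then the word
runs around the inverse of the cycle forever. -/
theorem IsStr.exists_ori (hc : R.IsControlled ρ) {m : ℤ → M} (hm : R.IsStr c m) {i : ℤ}
    (hi : i ∈ c.I) {y : Quiver.Total V} (hy : Cyc ρ y) (h : ∀ K, (R.cycOp ρ y ^ K) (m i) ≠ 0) :
    ∃ o, (∀ K s : ℕ, s < cycLen ρ y * K → (c.ori o).letter (oriPos o i + 1 + s) =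
        some (.inverse ((next ρ)^[cycLen ρ y * K - 1 - s] y))) ∧
      R.cycOp ρ y (m i) = oriFam m o (oriPos o i + cycLen ρ y) := by
  have hL := hy.cycLen_pos
  have h1 : ∀ K : ℕ, 0 < K → ∃ o, (∀ s : ℕ, s < cycLen ρ y * K →
      (c.ori o).letter (oriPos o i + 1 + s) =
        some (.inverse ((next ρ)^[cycLen ρ y * K - 1 - s] y))) ∧
      (R.cycOp ρ y ^ K) (m i) = oriFam m o (oriPos o i + (cycLen ρ y * K : ℕ)) := by
    intro K hK
    have hpos : 0 < cycLen ρ y * K := Nat.mul_pos hL hK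
    have h2 := R.opRay_cycLen_mul hy K 0
    rw [add_zero, show R.opRay ρ y 0 = 1 from rfl, mul_one] at h2
    have h3 : cycLen ρ y * K - 1 + 1 = cycLen ρ y * K := Nat.sub_add_cancel hpos
    obtain ⟨o, ho, ho'⟩ := hm.opRay_ne_zero hc.rel hi y (cycLen ρ y * K - 1)
      (by rw [h3, h2]; exact h K)
    rw [h3, h2] at ho'
    exact ⟨o, fun s hs => ho s (by omega), ho'⟩
  have hlast : ∀ K : ℕ, 0 < K →
      (next ρ)^[cycLen ρ y * K - 1] y = (next ρ)^[cycLen ρ y - 1] y := by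
    intro K hK
    obtain ⟨K, rfl⟩ : ∃ K', K = K' + 1 := ⟨K - 1, by omega⟩
    rw [show cycLen ρ y * (K + 1) - 1 = (cycLen ρ y - 1) + cycLen ρ y * K by
      rw [mul_add, mul_one]; omega, Function.iterate_add_apply, Function.iterate_mul,
      Function.iterate_fixed hy.iterate_cycLen K]
  -- The direction does not depend on the number of turns: running both ways from position `i` would
  -- place an arrow next to its own inverse.
  have huniq : ∀ o o' : Bool, (c.ori o).letter (oriPos o i + 1) =
      some (.inverse ((next ρ)^[cycLen ρ y - 1] y)) → (c.ori o').letter (oriPos o' i + 1) =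
      some (.inverse ((next ρ)^[cycLen ρ y - 1] y)) → o = o' := by
    have key : c.letter (i + 1) = some (.inverse ((next ρ)^[cycLen ρ y - 1] y)) →
        c.rev.letter (-i + 1) = some (.inverse ((next ρ)^[cycLen ρ y - 1] y)) → False := by
      intro ha hb
      change (c.letter (1 - (-i + 1))).map Letter.inv = _ at hb
      rw [show (1 : ℤ) - (-i + 1) = i by ring] at hb
      obtain ⟨l, hl, hl'⟩ := Option.map_eq_some_iff.1 hb
      cases l with
      | direct z =>
        obtain rfl : z = _ := by simpa [Letter.inv] using hl'
        exact Signs.BiWord.not_direct_inverse hl ha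
      | inverse z => simp [Letter.inv] at hl'
    intro o o' ha hb
    cases o <;> cases o'
    · rfl
    · exact (key hb ha).elim
    · exact (key ha hb).elim
    · rfl
  obtain ⟨o, ho, ho'⟩ := h1 1 one_pos
  rw [pow_one, mul_one] at ho'
  refine ⟨o, fun K s hs => ?_, ho'⟩
  have hK : 0 < K := Nat.pos_of_ne_zero fun h0 => by rw [h0, mul_zero] at hs; omega
  obtain ⟨o', h2, -⟩ := h1 K hK
  have e1 := ho 0 (by rwa [mul_one])
  have e2 := h2 0 (Nat.mul_pos hL hK)
  rw [Nat.cast_zero, add_zero, Nat.sub_zero, hlast _ one_pos] at e1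
  rw [Nat.cast_zero, add_zero, Nat.sub_zero, hlast _ hK] at e2
  rw [huniq o o' e1 e2]
  exact h2 s hs

/-- By periodicity the letters known to the right of `i` recur to the left, so the vector is the end
of arbitrarily long rays formed by vectors of the family itself. -/
theorem IsStr.mem_ray_of_isPer {m : ℤ → M} (hm : R.IsStr c m) (hp : c.IsPer) {i : ℤ}
    {y : Quiver.Total V} (hy : Cyc ρ y)
    (h : ∀ K s : ℕ, s < cycLen ρ y * K →
      c.letter (i + 1 + s) = some (.inverse ((next ρ)^[cycLen ρ y * K - 1 - s] y))) :
    m (i + cycLen ρ y) ∈ R.ray ρ y := by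
  have hL := hy.cycLen_pos
  have h0 := mem_ray (R := R) (f := fun n => m (i + cycLen ρ y - n)) hy fun n => ?_
  · simpa using h0
  -- A translation by a multiple of both the period and the length of the cycle moves the position
  -- `n` steps back into the part where the letters are known.
  have h1 := hp.letter_add_mul (i + cycLen ρ y - n) (n * cycLen ρ y)
  have hle : n ≤ cycLen ρ y * (n * c.per) := by
    calc n = 1 * (n * 1) := by ring
      _ ≤ cycLen ρ y * (n * c.per) :=
        Nat.mul_le_mul hL (Nat.mul_le_mul_left n hp.per_pos)
  have h2 := h (1 + n * c.per) (cycLen ρ y - 1 + cycLen ρ y * (n * c.per) - n)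
    (by rw [mul_add, mul_one]; omega)
  have h3 : i + 1 + ((cycLen ρ y - 1 + cycLen ρ y * (n * c.per) - n : ℕ) : ℤ) =
      i + cycLen ρ y - n + n * cycLen ρ y * c.per := by
    rw [Nat.cast_sub (by omega), Nat.cast_add, Nat.cast_sub hL]
    push_cast
    ring
  rw [h3, h1] at h2
  have h4 : cycLen ρ y * (1 + n * c.per) - 1 -
      (cycLen ρ y - 1 + cycLen ρ y * (n * c.per) - n) = n := by
    rw [mul_add, mul_one]; omega
  rw [h4] at h2
  have h5 := hm.apply_inverse (i := i + cycLen ρ y - n - 1) (by rwa [sub_add_cancel])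
  rw [sub_add_cancel] at h5
  rw [← h5]
  congr 2
  push_cast
  ring

namespace LiftFamily

variable {L : LiftFamily R σ} {S : Submodule k M} {y : Quiver.Total V}

/-- A vector that survives all powers of the cycle is moved around it forever along its word. In a
periodic word one turn leads into the ray; in a nonperiodic word it leads to an entry of the tail
into the image of `y`, and these entries lie in `S`. -/
theorem exists_cycOp_vec_mem (hc : R.IsControlled ρ) (hy : Cyc ρ y) (hrep : cycRep ρ y = y)
    (hS : ∀ p u o j x, ¬ p.word.IsPer → (p.word.ori o).IsTail j x → cycRep ρ (x 0) = y →
      ∀ n, x n = y → oriFam (L.vec p u) o (j + (n + 1 : ℕ)) ∈ S)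
    (p : σ.Class) (u : L.idx p) {i : ℤ} (hi : i ∈ p.word.I) :
    ∃ K, (R.cycOp ρ y ^ K) (L.vec p u i) ∈ S ⊔ R.ray ρ y := by
  by_cases h : ∃ K, (R.cycOp ρ y ^ K) (L.vec p u i) = 0
  · obtain ⟨K, hK⟩ := h
    exact ⟨K, by rw [hK]; exact zero_mem _⟩
  push Not at h
  have hL := hy.cycLen_pos
  obtain ⟨o, h1, h2⟩ := (L.isStr p u).exists_ori hc hi hy h
  refine ⟨1, ?_⟩
  rw [pow_one, h2]
  by_cases hp : p.word.IsPer
  · exact Submodule.mem_sup_right (((L.isStr p u).ori o).mem_ray_of_isPer (hp.ori o) hy h1)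
  · have hnz : ∀ q ∈ (p.word.ori o).I, oriFam (L.vec p u) o q ≠ 0 := by
      intro q hq
      cases o
      · exact L.vec_ne_zero p u hq
      · exact L.vec_ne_zero p u hq
    obtain ⟨j, x, hx, hj⟩ := exists_isTail hc ((L.isStr p u).ori o) hnz
      (fun h => hp (Signs.BiWord.isPer_ori.1 h)) (i := oriPos o i)
      fun s => ⟨_, h1 (s + 1) s ((Nat.lt_succ_self s).trans_le (Nat.le_mul_of_pos_left _ hL)),
        hy.iterate _⟩
    have hn : (((oriPos o i - j).toNat + (cycLen ρ y - 1) : ℕ) : ℤ) =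
        oriPos o i - j + cycLen ρ y - 1 := by
      push_cast [hL]
      omega
    have hxn : x ((oriPos o i - j).toNat + (cycLen ρ y - 1)) = y := by
      have e1 := hx.letter ((oriPos o i - j).toNat + (cycLen ρ y - 1))
      have e2 := h1 1 (cycLen ρ y - 1) (by omega)
      rw [show j + 1 + (((oriPos o i - j).toNat + (cycLen ρ y - 1) : ℕ) : ℤ) =
        oriPos o i + 1 + ((cycLen ρ y - 1 : ℕ) : ℤ) by rw [hn]; omega, e2, mul_one,
        Nat.sub_self, Function.iterate_zero, id] at e1
      exact (Letter.inverse.inj (Option.some.inj e1)).symm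
    have := hS p u o j x hp hx (by rw [← hx.cycRep_eq hc.string, hxn, hrep]) _ hxn
    refine Submodule.mem_sup_left ?_
    convert this using 1
    congr 1
    rw [Nat.cast_add, hn]
    push_cast
    ring

theorem exists_cycOp_mem (hc : R.IsControlled ρ) (hy : Cyc ρ y) (hrep : cycRep ρ y = y)
    (hst : Stable (R.Z ρ) S) (hSy : S ≤ LinearMap.range (R.arrow y))
    (hS : ∀ p u o j x, ¬ p.word.IsPer → (p.word.ori o).IsTail j x → cycRep ρ (x 0) = y →
      ∀ n, x n = y → oriFam (L.vec p u) o (j + (n + 1 : ℕ)) ∈ S) {h : M} (hh : h ∈ L.span) :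
    ∃ K, (R.cycOp ρ y ^ K) h ∈ S ⊔ R.ray ρ y := by
  have hle : S ⊔ R.ray ρ y ≤ LinearMap.range (R.arrow y) := sup_le hSy (ray_le_range y)
  have hpow : ∀ (K : ℕ) (m : M), m ∈ S ⊔ R.ray ρ y → (R.cycOp ρ y ^ K) m ∈ S ⊔ R.ray ρ y := by
    intro K m hm
    rw [← (hc.Z_pow_eq_cycOp_pow (hle hm) K).1]
    exact (hst.sup (hc.stable_ray y)).pow K hm
  induction hh using Submodule.span_induction with
  | mem m hm =>
    obtain ⟨p, u, i, hi, rfl⟩ := hm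
    exact exists_cycOp_vec_mem hc hy hrep hS p u hi
  | zero => exact ⟨0, by rw [map_zero]; exact zero_mem _⟩
  | add a b _ _ ha hb =>
    obtain ⟨K, ha⟩ := ha
    obtain ⟨K', hb⟩ := hb
    refine ⟨K + K', ?_⟩
    rw [map_add]
    refine add_mem ?_ ?_
    · rw [add_comm, pow_add, Module.End.mul_apply]
      exact hpow _ _ ha
    · rw [pow_add, Module.End.mul_apply]
      exact hpow _ _ hb
  | smul t a _ ha =>
    obtain ⟨K, ha⟩ := ha
    exact ⟨K, by rw [map_smul]; exact Submodule.smul_mem _ t ha⟩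

/-- For a denominator `f` with f(Z) m in the span, some `Z ^ K` moves f(Z) m into `S` plus the ray.
As the ray is torsion, `Z ^ K` applied to `m` lies in `S` up to denominators, hence by saturation in
`S` up to torsion. That torsion lies in the ray, which every lift spans. So `Z ^ K` applied to `m`
is in the span, and coprimality gives `m`. -/
theorem mem_span_of_range (hc : R.IsControlled ρ) (hy : Cyc ρ y) (hrep : cycRep ρ y = y)
    (hst : Stable (R.Z ρ) S) (hSy : S ≤ LinearMap.range (R.arrow y)) (hSL : S ≤ L.span)
    (hsat : ∀ m ∈ LinearMap.range (R.arrow y), Sat (R.Z ρ) S m → ∃ z ∈ S, Sat (R.Z ρ) ⊥ (m - z))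
    (hS : ∀ p u o j x, ¬ p.word.IsPer → (p.word.ori o).IsTail j x → cycRep ρ (x 0) = y →
      ∀ n, x n = y → oriFam (L.vec p u) o (j + (n + 1 : ℕ)) ∈ S) {m : M}
    (hm : m ∈ LinearMap.range (R.arrow y)) (h : Sat (R.Z ρ) L.span m) : m ∈ L.span := by
  obtain ⟨f, hf, hfm⟩ := id h
  obtain ⟨K, hK⟩ := exists_cycOp_mem hc hy hrep hst hSy hS hfm
  have hfr : Polynomial.aeval (R.Z ρ) f m ∈ LinearMap.range (R.arrow y) :=
    (hc.stable_range y).aeval f hm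
  rw [← (hc.Z_pow_eq_cycOp_pow hfr K).1] at hK
  obtain ⟨s, hs, r, hr, hsr⟩ := Submodule.mem_sup.1 hK
  obtain ⟨g, hg, hg0⟩ := hc.exists_aeval_ray_eq_zero hy
  have hcomm : Polynomial.aeval (R.Z ρ) f ((R.Z ρ ^ K) m) =
      (R.Z ρ ^ K) (Polynomial.aeval (R.Z ρ) f m) := by
    have := congrArg (fun F => Polynomial.aeval (R.Z ρ) F m)
      (mul_comm f (Polynomial.X ^ K))
    simpa using this
  have h1 : Sat (R.Z ρ) S ((R.Z ρ ^ K) m) := by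
    refine Sat.of_aeval hf ⟨g, hg, ?_⟩
    rw [hcomm, ← hsr, map_add, hg0 r hr, add_zero]
    exact hst.aeval g hs
  have h2 : (R.Z ρ ^ K) m ∈ LinearMap.range (R.arrow y) := (hc.stable_range y).pow K hm
  obtain ⟨z, hz, hz'⟩ := hsat _ h2 h1
  have h3 := hc.ray_le_span L hy (hc.mem_ray_of_sat_bot hy (sub_mem h2 (hSy hz)) hz')
  refine (L.stable_span hc).mem_of_sat h (n := K) ?_
  have := add_mem h3 (hSL hz)
  rwa [sub_add_cancel] at this

end LiftFamily

end QuiverOps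

/-! ### Spanning from the representatives of primitive cycles -/

namespace QuiverOps

variable {k : Type u} [Field k] {V : Type v} [Quiver.{w} V] {ρ : Set (QPath V)}
  {M : Type x} [AddCommGroup M] [Module k M] {R : QuiverOps k V M} {σ : Signs ρ}

theorem IsControlled.sat_opRay (hc : R.IsControlled ρ) {H : Submodule k M}
    (hH : ∀ x, ∀ m ∈ H, R.arrow x m ∈ H) (x : Quiver.Total V) (n : ℕ) {m : M}
    (hm : Sat (R.Z ρ) H m) : Sat (R.Z ρ) H (R.opRay ρ x n m) := by
  obtain ⟨f, hf, h⟩ := hm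
  refine ⟨f, hf, ?_⟩
  have h1 : Commute (R.opRay ρ x n) (R.Z ρ) := LinearMap.ext fun m => hc.opRay_Z x n m
  have h2 : Polynomial.aeval (R.Z ρ) f (R.opRay ρ x n m) =
      R.opRay ρ x n (Polynomial.aeval (R.Z ρ) f m) := by
    have h3 : Commute (R.opRay ρ x n) (Polynomial.aeval (R.Z ρ) f) := by
      rw [Polynomial.aeval_eq_sum_range]
      exact Commute.sum_right _ _ _ fun i _ => (h1.pow_right i).smul_right _
    exact congrArg (fun F : Module.End k M => F m) h3.eq.symm
  rw [h2]
  exact opRay_mem_of_arrow hH x n h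

namespace LiftFamily

/-- If saturated elements of the image of the representative of each primitive cycle lie in the
span of a family, then so do saturated elements of the image of any arrow of a primitive cycle. -/
theorem mem_span_of_cyc (hc : R.IsControlled ρ) {L : LiftFamily R σ}
    (hL : ∀ y, Cyc ρ y → cycRep ρ y = y → ∀ m ∈ LinearMap.range (R.arrow y),
      Sat (R.Z ρ) L.span m → m ∈ L.span) {y : Quiver.Total V} (hy : Cyc ρ y) {m : M}
    (hm : m ∈ LinearMap.range (R.arrow y)) (h : Sat (R.Z ρ) L.span m) : m ∈ L.span := by
  have hA := L.arrow_mem_span hc.rel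
  obtain ⟨a, ha, haL⟩ : ∃ a, (next ρ)^[a] y = cycRep ρ y ∧ a < cycLen ρ y := by
    obtain ⟨n, hn⟩ := exists_iterate_eq_cycRep ρ y
    refine ⟨n % cycLen ρ y, ?_, Nat.mod_lt _ hy.cycLen_pos⟩
    rw [← hn]
    exact Function.iterate_mod_minimalPeriod_eq
  -- It suffices to treat `Z m`; along its turn it passes through the image of the representative,
  -- and applying the remaining arrows stays in the span.
  refine (L.stable_span hc).mem_of_sat h (n := 1) ?_
  rw [pow_one, hc.Z_eq_cycOp hm, R.cycOp_eq hy,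
    show cycLen ρ y = a + (cycLen ρ y - a) by omega, opRay_add, Module.End.mul_apply, ha]
  refine opRay_mem_of_arrow hA y a ?_
  refine hL _ hy.cycRep ?_ _ (opRay_mem_range _ (by omega) _) (hc.sat_opRay hA _ _ h)
  rw [← ha, hy.cycRep_iterate, ha]

/-- `Z m` is a sum of elements in images of arrows on cycles, each again in the span up to
denominators because rays commute with `Z`. So `Z m` lies in the span, and then so does `m` by
coprimality. -/
theorem span_eq_top_of_cyc (hc : R.IsControlled ρ) {L : LiftFamily R σ}
    (hL : ∀ y, Cyc ρ y → cycRep ρ y = y → ∀ m ∈ LinearMap.range (R.arrow y),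
      Sat (R.Z ρ) L.span m → m ∈ L.span) : L.span = ⊤ := by
  have hA := L.arrow_mem_span hc.rel
  rw [eq_top_iff, ← hc.iSup_E]
  refine iSup_le fun v m hm => ?_
  have h := L.sat_span hc hm
  have hZ : R.Z ρ m ∈ L.span := by
    rw [hc.Z_apply]
    refine finsum_induction (· ∈ L.span) (zero_mem _) (fun _ _ => add_mem) fun y => ?_
    by_cases hy : Cyc ρ y
    · refine mem_span_of_cyc hc hL hy (R.cycOp_mem_range y m) ?_
      rw [R.cycOp_eq hy]
      exact hc.sat_opRay hA _ _ h
    · rw [R.cycOp_eq_zero hy]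
      exact zero_mem _
  exact (L.stable_span hc).mem_of_sat h (n := 1) (by rwa [pow_one])

end LiftFamily

end QuiverOps

/-! ### Bases adapted to a decomposition into indecomposables -/

section Decomposition

variable {k : Type u} [Field k] {A : Type u} [Ring A] [Algebra k A] {W : Type u} [AddCommGroup W]
  [Module k W] [Module A W] [IsScalarTower k A W]

/-- A finite-dimensional submodule has a basis that is adapted to a decomposition into
indecomposable submodules. -/
theorem exists_adapted_family [FiniteDimensional k W] (n : ℕ) (U : Submodule A W)
    (hn : Module.finrank k (U.restrictScalars k) ≤ n) :
    ∃ (G ι : Type) (P : G → Submodule A W) (β : ι → W) (π : ι → G),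
      (∀ g, IsIndecomposable A (P g)) ∧ LinearIndependent k β ∧
      Submodule.span k (Set.range β) = U.restrictScalars k ∧ (∀ t, β t ∈ P (π t)) ∧
      ∀ g, (P g).restrictScalars k ≤ Submodule.span k {w | ∃ t, π t = g ∧ β t = w} := by
  induction n using Nat.strong_induction_on generalizing U with
  | _ n ih =>
  by_cases hU : U = ⊥
  · subst hU
    exact ⟨Empty, Empty, Empty.elim, Empty.elim, Empty.elim, fun g => g.elim,
      linearIndependent_empty_type, by simp, fun t => t.elim, fun g => g.elim⟩
  by_cases hind : IsIndecomposable A U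
  · let b := Module.finBasis k (U.restrictScalars k)
    have hspan : Submodule.span k (Set.range fun t => (b t : W)) = U.restrictScalars k := by
      have := congrArg (Submodule.map (U.restrictScalars k).subtype) b.span_eq
      rwa [Submodule.map_span, ← Set.range_comp, Submodule.map_top, Submodule.range_subtype] at this
    refine ⟨Unit, Fin _, fun _ => U, fun t => b t, fun _ => (), fun _ => hind, ?_, hspan,
      fun t => (b t).2, fun g => ?_⟩
    · exact b.linearIndependent.map' (U.restrictScalars k).subtype (Submodule.ker_subtype _)
    · refine hspan.ge.trans (Submodule.span_mono ?_)
      rintro _ ⟨t, rfl⟩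
      exact ⟨t, rfl, rfl⟩
  · have hnt : Nontrivial U := (Submodule.nontrivial_iff_ne_bot).2 hU
    obtain ⟨p, q, hpq, hp, hq⟩ : ∃ p q : Submodule A U, IsCompl p q ∧ p ≠ ⊥ ∧ q ≠ ⊥ := by
      by_contra! h
      exact hind ⟨hnt, fun p q hpq => or_iff_not_imp_left.2 fun hp => h p q hpq hp⟩
    have hlt : ∀ p q : Submodule A U, IsCompl p q → q ≠ ⊥ →
        Module.finrank k ((p.map U.subtype).restrictScalars k) < n := by
      intro p q hpq hq
      refine (Submodule.finrank_lt_finrank_of_lt (t := U.restrictScalars k) ?_).trans_le hn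
      refine lt_of_le_of_ne (fun w hw => ?_) fun h => hq ?_
      · obtain ⟨w, -, rfl⟩ := hw
        exact w.2
      · have h1 : p = ⊤ := by
          refine eq_top_iff.2 fun w _ => ?_
          have h2 : (w : W) ∈ (p.map U.subtype).restrictScalars k := by rw [h]; exact w.2
          obtain ⟨w', hw', h3⟩ := h2
          rwa [Subtype.ext h3] at hw'
        rw [h1] at hpq
        exact eq_bot_iff.2 (le_trans (le_inf le_top le_rfl) hpq.disjoint.le_bot)
    obtain ⟨G₁, ι₁, P₁, β₁, π₁, a1, a2, a3, a4, a5⟩ := ih _ (hlt p q hpq hq) (p.map U.subtype) le_rfl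
    obtain ⟨G₂, ι₂, P₂, β₂, π₂, b1, b2, b3, b4, b5⟩ :=
      ih _ (hlt q p hpq.symm hp) (q.map U.subtype) le_rfl
    refine ⟨G₁ ⊕ G₂, ι₁ ⊕ ι₂, Sum.elim P₁ P₂, Sum.elim β₁ β₂, Sum.map π₁ π₂,
      Sum.rec a1 b1, ?_, ?_, Sum.rec a4 b4, Sum.rec (fun g => ?_) fun g => ?_⟩
    · refine LinearIndependent.sum_type a2 b2 ?_
      rw [a3, b3, Submodule.disjoint_def]
      rintro w ⟨w₁, h1, rfl⟩ ⟨w₂, h2, h3⟩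
      obtain rfl : w₂ = w₁ := Subtype.ext h3
      have h4 := Submodule.disjoint_def.1 hpq.disjoint _ h1 h2
      rw [h4]
      rfl
    · rw [Set.Sum.elim_range, Submodule.span_union, a3, b3]
      refine le_antisymm (sup_le ?_ ?_) fun w hw => ?_
      · rintro _ ⟨w, -, rfl⟩
        exact w.2
      · rintro _ ⟨w, -, rfl⟩
        exact w.2
      · obtain ⟨w₁, h1, w₂, h2, h3⟩ := Submodule.mem_sup.1
          (show (⟨w, hw⟩ : U) ∈ p ⊔ q by rw [hpq.sup_eq_top]; trivial)
        exact Submodule.mem_sup.2 ⟨w₁, ⟨w₁, h1, rfl⟩, w₂, ⟨w₂, h2, rfl⟩, congrArg Subtype.val h3⟩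
    · refine (a5 g).trans (Submodule.span_mono ?_)
      rintro _ ⟨t, ht, rfl⟩
      exact ⟨.inl t, congrArg Sum.inl ht, rfl⟩
    · refine (b5 g).trans (Submodule.span_mono ?_)
      rintro _ ⟨t, ht, rfl⟩
      exact ⟨.inr t, congrArg Sum.inr ht, rfl⟩

end Decomposition

/-! ### Automorphisms as modules over Laurent polynomials -/

section Laurent

variable {k : Type u} [Field k] {W : Type u} [AddCommGroup W] [Module k W]

/-- A vector space with an automorphism, as a module over Laurent polynomials in which the
variable acts as the inverse of the automorphism. -/
def LaurentSpace (_ : W ≃ₗ[k] W) : Type u := W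

namespace LaurentSpace

variable (τ : W ≃ₗ[k] W)

instance : AddCommGroup (LaurentSpace τ) := inferInstanceAs (AddCommGroup W)
instance : Module k (LaurentSpace τ) := inferInstanceAs (Module k W)

instance [FiniteDimensional k W] : FiniteDimensional k (LaurentSpace τ) :=
  inferInstanceAs (FiniteDimensional k W)

/-- The action of Laurent polynomials. -/
def laurentHom : k[T;T⁻¹] →ₐ[k] Module.End k W :=
  AddMonoidAlgebra.lift k (Module.End k W) ℤ
    ((Units.coeHom _).comp (zpowersHom _ ((LinearMap.GeneralLinearGroup.generalLinearEquiv k W).symm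
      τ.symm)))

instance : Module k[T;T⁻¹] (LaurentSpace τ) := Module.compHom W (laurentHom τ).toRingHom

theorem smul_def (g : k[T;T⁻¹]) (w : LaurentSpace τ) :
    g • w = (laurentHom τ g : Module.End k W) w := rfl

instance : IsScalarTower k k[T;T⁻¹] (LaurentSpace τ) :=
  ⟨fun c g m => by rw [smul_def, map_smul]; rfl⟩

theorem T_one_smul (w : LaurentSpace τ) :
    (LaurentPolynomial.T 1 : k[T;T⁻¹]) • w = τ.symm w := by
  rw [smul_def, laurentHom, LaurentPolynomial.T, AddMonoidAlgebra.lift_single, one_smul]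
  rfl

end LaurentSpace

end Laurent

/-! ### Band data and the final choice of lifts -/

namespace QuiverOps

variable {k : Type u} [Field k] {V : Type v} [Quiver.{w} V] {ρ : Set (QPath V)}
  {M : Type x} [AddCommGroup M] [Module k M] {R : QuiverOps k V M} {σ : Signs ρ}

variable (R) in
/-- Families of vectors along a periodic word, made from a decomposition of a module over
Laurent polynomials into indecomposable ones. -/
structure BandData (c : σ.BiWord) {ι : Type x} (vec : ι → ℤ → M) where
  d : ℕ
  τ : (Fin d →₀ k) ≃ₗ[k] (Fin d →₀ k)
  φ : ℤ → LaurentSpace τ →ₗ[k] M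
  isStr : ∀ u, R.IsStr c fun i => φ i u
  φ_add : ∀ i u, φ (i + c.per) u = φ i (τ u)
  G : Type
  P : G → Submodule k[T;T⁻¹] (LaurentSpace τ)
  indecomposable : ∀ g, IsIndecomposable k[T;T⁻¹] (P g)
  β : ι → LaurentSpace τ
  π : ι → G
  mem : ∀ u, β u ∈ P (π u)
  le_span : ∀ g, (P g).restrictScalars k ≤ Submodule.span k {w | ∃ u, π u = g ∧ β u = w}
  vec_eq : ∀ u i, vec u i = φ i (β u)

theorem IsControlled.exists_bandData (hc : R.IsControlled ρ) {c : σ.BiWord} (hp : c.IsPer) :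
    ∃ (ι : Type x) (vec : ι → ℤ → M), (∀ u, R.IsStr c (vec u)) ∧
      (IsBasisMod (R.Fplus c 0) (R.Fminus c 0) fun u => vec u 0) ∧
      Nonempty (R.BandData c vec) := by
  obtain ⟨d, τ, φ, h1, h2, h3⟩ := hc.exists_periodic_family hp
  obtain ⟨G, ι, P, β, π, a1, a2, a3, a4, a5⟩ := exists_adapted_family (k := k) (A := k[T;T⁻¹])
    (W := LaurentSpace τ) _ ⊤ le_rfl
  let ψ : ℤ → LaurentSpace τ →ₗ[k] M := φ
  have hlc : ∀ w : Fin d →₀ k,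
      Finsupp.linearCombination k (fun j => φ 0 (Finsupp.single j 1)) w = φ 0 w := by
    intro w
    conv_rhs => rw [← Finsupp.sum_single w]
    rw [Finsupp.linearCombination_apply, map_finsuppSum]
    refine Finsupp.sum_congr fun j _ => ?_
    rw [← map_smul, Finsupp.smul_single_one]
  refine ⟨ULift ι, fun u i => φ i (β u.down), fun u => h1 _, ⟨fun u => ?_, fun a ha => ?_, ?_⟩, ⟨?_⟩⟩
  · exact (h1 _).mem_Fplus (hp.mem 0)
  · have h4 : Finsupp.linearCombination k (fun u : ULift ι => φ 0 (β u.down)) a =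
        ψ 0 (Finsupp.linearCombination k (fun u : ULift ι => β u.down) a) :=
      (Finsupp.apply_linearCombination k (ψ 0) (fun u : ULift ι => β u.down) a).symm
    have h5 := h3.indep _ ((hlc _).symm ▸ h4 ▸ ha)
    have h6 : LinearIndependent k fun u : ULift ι => β u.down :=
      a2.comp _ ULift.down_injective
    exact (linearIndependent_iff.1 h6) a h5
  · refine h3.span.trans (sup_le_sup_right ?_ _)
    rw [Submodule.span_le]
    rintro _ ⟨j, rfl⟩
    have h4 : (Finsupp.single j 1 : Fin d →₀ k) ∈ Submodule.span k (Set.range β) := by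
      rw [a3]
      trivial
    have h5 := Submodule.mem_map_of_mem (f := ψ 0) h4
    rw [Submodule.map_span] at h5
    refine Submodule.span_mono ?_ h5
    rintro _ ⟨_, ⟨t, rfl⟩, rfl⟩
    exact ⟨⟨t⟩, rfl⟩
  · exact
      { d := d
        τ := τ
        φ := φ
        isStr := h1
        φ_add := h2
        G := G
        P := P
        indecomposable := a1
        β := fun u => β u.down
        π := fun u => π u.down
        mem := fun u => a4 _
        le_span := fun g => (a5 g).trans (Submodule.span_mono (by
          rintro _ ⟨t, ht, rfl⟩
          exact ⟨⟨t⟩, ht, rfl⟩))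
        vec_eq := fun _ _ => rfl }

/-- A family that lifts bases of the functors of all words, spans the module and comes from
modules over Laurent polynomials for periodic words. -/
theorem IsControlled.exists_liftFamily (hc : R.IsControlled ρ) :
    ∃ L : LiftFamily R σ, L.span = ⊤ ∧ ∀ p : σ.Class, p.word.IsPer →
      Nonempty (R.BandData p.word (L.vec p)) := by
  have key : ∀ p : σ.Class, ∃ (ι : Type x) (vec : ι → ℤ → M), (∀ u, R.IsStr p.word (vec u)) ∧
      (IsBasisMod (R.Fplus p.word 0) (R.Fminus p.word 0) fun u => vec u 0) ∧
      (p.word.IsPer → Nonempty (R.BandData p.word vec)) := by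
    intro p
    by_cases hp : p.word.IsPer
    · obtain ⟨ι, vec, h1, h2, h3⟩ := hc.exists_bandData hp
      exact ⟨ι, vec, h1, h2, fun _ => h3⟩
    · obtain ⟨ι, y, hy⟩ := exists_isBasisMod (R.Fplus p.word 0) (R.Fminus p.word 0)
      choose m hm hm0 using fun u => R.exists_isStr p.word p.zero_mem (hy.mem u)
      refine ⟨ι, m, hm, ?_, fun h => (hp h).elim⟩
      simpa only [hm0] using hy
  choose ι vec h1 h2 h3 using key
  let L₀ : LiftFamily R σ := ⟨ι, vec, h1, h2⟩
  obtain ⟨L, e, he, hS⟩ := hc.exists_adjusted L₀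
  refine ⟨L, LiftFamily.span_eq_top_of_cyc hc fun y hy hrep m hm hsat => ?_, fun p hp => ?_⟩
  · obtain ⟨S, hst, hSy, hSL, hsat', hS⟩ := hS y
    exact LiftFamily.mem_span_of_range hc hy hrep hst hSy hSL hsat' hS hm hsat
  · obtain ⟨D⟩ := h3 p hp
    have h4 : L.vec p = fun u => vec p (cast (e p) u) := funext (he p hp)
    rw [h4]
    exact ⟨{ D with
      β := fun u => D.β (cast (e p) u)
      π := fun u => D.π (cast (e p) u)
      mem := fun u => D.mem _
      le_span := fun g => (D.le_span g).trans (Submodule.span_mono (by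
        rintro _ ⟨t, ht, rfl⟩
        exact ⟨cast (e p).symm t, by simpa using ht, by simp⟩))
      vec_eq := fun u i => D.vec_eq _ i }⟩

end QuiverOps

/-! ### Modules over the quotient algebra as representations of the quiver -/

section PathAction

variable {k : Type u} [Field k] {V : Type v} [Quiver.{w} V] {ρ : Set (QPath V)}
  {M : Type x} [AddCommGroup M] [Module k M]

theorem PathAlgebra.apply_mem (F : PathAlgebra k V →ₗ[k] Module.End k M) {N : Submodule k M} {m : M}
    (h : ∀ p, F (ofPath k p) m ∈ N) (f : PathAlgebra k V) : F f m ∈ N := by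
  have h1 : N.mkQ ∘ₗ LinearMap.applyₗ m ∘ₗ F = 0 := PathAlgebra.hom_ext fun p => by
    simpa using h p
  have h2 := congrArg (fun G => G f) h1
  simpa using h2

theorem QuiverOps.map_pathAlgLin {N : Type y} [AddCommGroup N] [Module k N]
    {R : QuiverOps k V N} {R' : QuiverOps k V M} {f : N →ₗ[k] M}
    (hv : ∀ v n, f (R.vert v n) = R'.vert v (f n)) (ha : ∀ x n, f (R.arrow x n) = R'.arrow x (f n))
    (a : PathAlgebra k V) (n : N) : f (R.pathAlgLin a n) = R'.pathAlgLin a (f n) := by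
  have hp : ∀ {b c : V} (p : Quiver.Path b c) (n : N), f (R.path p n) = R'.path p (f n) := by
    intro b c p
    induction p with
    | nil => exact hv b
    | cons p x ih =>
      intro n
      rw [QuiverOps.path, QuiverOps.path, Module.End.mul_apply, Module.End.mul_apply, ha, ih]
  have h1 : f ∘ₗ LinearMap.applyₗ n ∘ₗ R.pathAlgLin = LinearMap.applyₗ (f n) ∘ₗ R'.pathAlgLin :=
    PathAlgebra.hom_ext fun p => by simpa [QuiverOps.pathAlgLin] using hp p.path n
  exact congrArg (fun G => G a) h1

end PathAction

namespace AlgModule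

variable {k : Type u} [Field k] {V : Type v} [Quiver.{w} V] {ρ : Set (QPath V)}
  (M : AlgModule.{u, max u v w, x} k (QuotAlgebra k ρ))

/-- The operators of vertices and arrows on a module over `kQ/(ρ)`. -/
def ops : QuiverOps k V M.carrier where
  vert v := M.act (proj k ρ (ofPath k ⟨v, v, .nil⟩))
  arrow x := M.act (proj k ρ (ofPath k ⟨x.left, x.right, x.hom.toPath⟩))
  vert_idem v := by
    rw [← map_mul, ← proj_mul, ofPath_mul_ofPath, pathMul_comp, Quiver.Path.comp_nil]
  vert_orth v w h := by
    rw [← map_mul, ← proj_mul, ofPath_mul_ofPath, pathMul_ne k (Ne.symm h), map_zero, map_zero]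
  head_arrow x := by
    rw [← map_mul, ← proj_mul, ofPath_mul_ofPath, pathMul_comp, Quiver.Path.comp_nil]
  arrow_tail x := by
    rw [← map_mul, ← proj_mul, ofPath_mul_ofPath, pathMul_comp, Quiver.Path.nil_comp]

theorem ops_path {a b : V} (p : Quiver.Path a b) :
    M.ops.path p = M.act (proj k ρ (ofPath k ⟨a, b, p⟩)) := by
  induction p with
  | nil => rfl
  | cons p x ih =>
    rw [QuiverOps.path, ih]
    change M.act _ * _ = _
    rw [← map_mul, ← proj_mul, ofPath_mul_ofPath, pathMul_comp]
    rfl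

theorem act_proj (f : PathAlgebra k V) : M.act (proj k ρ f) = M.ops.pathAlgLin f := by
  let F : QuotAlgebra k ρ →ₗ[k] Module.End k M.carrier :=
    { toFun := M.act, map_add' := map_add M.act, map_smul' := map_smul M.act }
  have h : F ∘ₗ proj k ρ = M.ops.pathAlgLin := PathAlgebra.hom_ext fun p => by
    simpa [QuiverOps.pathAlgLin, F] using (M.ops_path p.path).symm
  exact congrArg (fun G => G f) h

theorem act_mem {N : Submodule k M.carrier} {m : M.carrier}
    (h : ∀ p : QPath V, M.ops.path p.path m ∈ N) (a : QuotAlgebra k ρ) : M.act a m ∈ N := by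
  obtain ⟨f, rfl⟩ := proj_surjective k ρ a
  rw [act_proj]
  refine PathAlgebra.apply_mem _ (fun p => ?_) f
  rw [QuiverOps.pathAlgLin, PathAlgebra.extend_ofPath]
  exact h p

/-- Finite control is used only for the trivial paths: it bounds the space at each vertex by a
finitely generated submodule. -/
theorem isControlled (hρ : IsStringAlgebra ρ) (hM : M.IsUnital) (hfc : M.IsFinitelyControlled) :
    M.ops.IsControlled ρ where
  string := hρ
  rel r hr := by
    rw [ops_path]
    have h1 : ofPath k r ∈ relIdeal k ρ := by
      rw [relIdeal, Submodule.mem_sInf]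
      exact fun I hI => hI.2 r hr
    have h2 : proj k ρ (ofPath k r) = 0 := (Submodule.Quotient.mk_eq_zero _).2 h1
    exact (congrArg M.act h2).trans (map_zero M.act)
  iSup_E := by
    rw [eq_top_iff, ← show _ = _ from hM, Submodule.span_le]
    rintro _ ⟨a, m, rfl⟩
    refine M.act_mem (fun p => ?_) a
    have h1 : M.ops.path p.path m ∈ M.ops.E p.head :=
      ⟨M.ops.path p.path m, congrArg (fun F : Module.End k M.carrier => F m)
        (M.ops.head_path p.path)⟩
    exact Submodule.mem_iSup_of_mem p.head h1
  fg v := by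
    obtain ⟨N, ⟨s, -, hN⟩, h⟩ := hfc (proj k ρ (ofPath k ⟨v, v, .nil⟩))
    refine ⟨s, ?_⟩
    rintro _ ⟨m, rfl⟩
    have h1 := h m
    rw [hN] at h1
    refine Submodule.span_le.2 ?_ h1
    rintro _ ⟨a, m', hm', rfl⟩
    refine M.act_mem (fun p => ?_) a
    exact Submodule.subset_span ⟨p, m', hm', rfl⟩

end AlgModule

/-- A nonempty interval of integers is a translate of one of the standard index sets. -/
theorem exists_shape {I : Set ℤ} (hne : I.Nonempty)
    (hI : ∀ i j t, i ∈ I → j ∈ I → i ≤ t → t ≤ j → t ∈ I) :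
    ∃ (s : Shape) (t : ℤ), (∀ i, i ∈ s.idx ↔ i + t ∈ I) ∧ (I = Set.univ → s = .int ∧ t = 0) := by
  by_cases ha : ∃ a ∈ I, ∀ i ∈ I, a ≤ i
  · obtain ⟨a, ha, ha'⟩ := ha
    have hnu : I ≠ Set.univ := fun h => by
      have := ha' (a - 1) (by rw [h]; trivial)
      omega
    by_cases hb : ∃ b ∈ I, ∀ i ∈ I, i ≤ b
    · obtain ⟨b, hb, hb'⟩ := hb
      have hab := ha' b hb
      refine ⟨.fin (b - a).toNat, a, fun i => ⟨fun h => ?_, fun h => ?_⟩, fun h => (hnu h).elim⟩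
      · obtain ⟨h1, h2⟩ := h
        exact hI a b _ ha hb (by omega) (by omega)
      · have h1 := ha' _ h
        have h2 := hb' _ h
        exact ⟨by omega, by omega⟩
    · push Not at hb
      have hub : ∀ n : ℕ, ∃ b ∈ I, a + n ≤ b := by
        intro n
        induction n with
        | zero => exact ⟨a, ha, by simp⟩
        | succ n ih =>
          obtain ⟨b, hb1, hb2⟩ := ih
          obtain ⟨b', hb', h⟩ := hb b hb1
          exact ⟨b', hb', by push_cast; omega⟩
      refine ⟨.nat, a, fun i => ⟨fun h => ?_, fun h => ?_⟩, fun h => (hnu h).elim⟩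
      · have h : 0 ≤ i := h
        obtain ⟨b, hb1, hb2⟩ := hub i.toNat
        exact hI a b _ ha hb1 (by omega) (by omega)
      · have h1 := ha' _ h
        change 0 ≤ i
        omega
  · push Not at ha
    obtain ⟨i₀, hi₀⟩ := hne
    have hlb : ∀ n : ℕ, ∃ a ∈ I, a ≤ i₀ - n := by
      intro n
      induction n with
      | zero => exact ⟨i₀, hi₀, by simp⟩
      | succ n ih =>
        obtain ⟨b, hb1, hb2⟩ := ih
        obtain ⟨b', hb', h⟩ := ha b hb1
        exact ⟨b', hb', by push_cast; omega⟩
    by_cases hb : ∃ b ∈ I, ∀ i ∈ I, i ≤ b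
    · obtain ⟨b, hb, hb'⟩ := hb
      refine ⟨.negNat, b, fun i => ⟨fun h => ?_, fun h => ?_⟩, fun h => ?_⟩
      · have h : i ≤ 0 := h
        obtain ⟨a, ha1, ha2⟩ := hlb (i₀ - (i + b)).toNat
        exact hI a b _ ha1 hb (by omega) (by omega)
      · have h1 := hb' _ h
        change i ≤ 0
        omega
      · have := hb' (b + 1) (by rw [h]; trivial)
        omega
    · push Not at hb
      have hub : ∀ n : ℕ, ∃ b ∈ I, i₀ + n ≤ b := by
        intro n
        induction n with
        | zero => exact ⟨i₀, hi₀, by simp⟩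
        | succ n ih =>
          obtain ⟨b, hb1, hb2⟩ := ih
          obtain ⟨b', hb', h⟩ := hb b hb1
          exact ⟨b', hb', by push_cast; omega⟩
      refine ⟨.int, 0, fun i => ⟨fun _ => ?_, fun _ => trivial⟩, fun _ => ⟨rfl, rfl⟩⟩
      obtain ⟨a, ha1, ha2⟩ := hlb (i₀ - i).toNat
      obtain ⟨b, hb1, hb2⟩ := hub (i - i₀).toNat
      exact hI a b _ ha1 hb1 (by omega) (by omega)

/-! ### From two-sided words to words in the sense of the statement -/

namespace QuiverOps

variable {k : Type u} [Field k] {V : Type v} [Quiver.{w} V] {ρ : Set (QPath V)}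
  {M : Type x} [AddCommGroup M] [Module k M] {R : QuiverOps k V M} {σ : Signs ρ} {c : σ.BiWord}

theorem IsStr.path_apply {m : ℤ → M} (hm : R.IsStr c m) {a b : V} (p : Quiver.Path a b)
    (hp : 0 < p.length) (j : ℤ) (h : ∀ (t : ℕ) (ht : t < (arrowList p).length),
      c.letter (j + t) = some (.direct (arrowList p)[t])) :
    R.path p (m (j + p.length - 1)) = m (j - 1) := by
  induction p generalizing j with
  | nil => simp at hp
  | @cons d e p x ih =>
    have h0 : c.letter j = some (.direct ⟨d, e, x⟩) := by
      have := h 0 (by simp [arrowList])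
      simpa [arrowList] using this
    rw [QuiverOps.path, Module.End.mul_apply]
    rcases Nat.eq_zero_or_pos p.length with hl | hl
    · have hd : a = d := Quiver.Path.eq_of_length_zero p hl
      subst hd
      have hp : p = .nil := Quiver.Path.eq_nil_of_length_zero p hl
      subst hp
      have h1 := R.arrow_vert ⟨a, e, x⟩ (m (j + ((Quiver.Path.nil.cons x).length : ℕ) - 1))
      refine h1.trans ?_
      rw [← hm.apply_direct h0]
      congr 2
      simp
    · rw [← hm.apply_direct h0]
      congr 1
      have h1 := ih hl (j + 1) fun t ht => by
        have := h (t + 1) (by simpa [arrowList] using ht)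
        simp only [arrowList, List.getElem_cons_succ] at this
        rw [← this]
        congr 1
        push_cast
        ring
      rw [add_sub_cancel_right] at h1
      rw [← h1, Quiver.Path.length_cons]
      congr 2
      push_cast
      ring

/-- The sides of a two-sided word do not exclude relations, but a relation in `ρ` that occurs acts
between two positions and forces the vector at its end to be zero. -/
theorem IsStr.not_occurs (hc : R.IsControlled ρ) {m : ℤ → M} (hm : R.IsStr c m)
    (hnz : ∀ i ∈ c.I, m i ≠ 0) {r : QPath V} (hr : r ∈ ρ) :
    ¬ Occurs c.letter ((arrowList r.path).map .direct) := by
  rintro ⟨j, hj⟩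
  have hlen := hc.string.two_le_length r hr
  have hl := Word.length_arrowList r.path
  have h1 := hm.path_apply r.path (by omega) j fun t ht => by
    rw [hj t (by simpa using ht), List.getElem_map]
  have h2 := hj 0 (by rw [List.length_map]; omega)
  rw [Nat.cast_zero, add_zero] at h2
  rw [hc.rel r hr, LinearMap.zero_apply] at h1
  exact hnz _ (c.mem_of_letter h2).2 h1.symm

theorem IsStr.not_occurs_inv (hc : R.IsControlled ρ) {m : ℤ → M} (hm : R.IsStr c m)
    (hnz : ∀ i ∈ c.I, m i ≠ 0) {r : QPath V} (hr : r ∈ ρ) :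
    ¬ Occurs c.letter ((arrowList r.path).reverse.map .inverse) := by
  rintro ⟨j, hj⟩
  refine hm.rev.not_occurs hc (fun i hi => hnz _ (c.mem_rev.1 hi)) hr
    ⟨2 - j - (arrowList r.path).length, fun t ht => ?_⟩
  rw [List.length_map] at ht
  change (c.letter (1 - (2 - j - (arrowList r.path).length + t))).map Letter.inv = _
  have h1 := hj ((arrowList r.path).length - 1 - t) (by simp; omega)
  rw [show 1 - (2 - j - ((arrowList r.path).length : ℤ) + t) =
    j + ((arrowList r.path).length - 1 - t : ℕ) by omega, h1]
  simp only [List.getElem_map, List.getElem_reverse, Option.map_some, Letter.inv]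
  congr 3
  omega

/-- `C` is the word `c` translated by `t`. -/
structure _root_.StringAlg.Word.Models (C : Word ρ) (c : σ.BiWord) (t : ℤ) : Prop where
  mem_iff : ∀ i, i ∈ C.shape.idx ↔ i + t ∈ c.I
  letter_eq : ∀ i, C.letter i = c.letter (i + t)
  vertex_eq : ∀ i ∈ C.shape.idx, C.vertex i = some (c.side (i + t)).1

/-- A word in which no vector of a family vanishes is, up to a translation, a word in the
standard sense. -/
theorem IsStr.exists_word (hc : R.IsControlled ρ) {m : ℤ → M} (hm : R.IsStr c m)
    (hnz : ∀ i ∈ c.I, m i ≠ 0) (hne : c.I.Nonempty) :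
    ∃ (C : Word ρ) (t : ℤ), C.Models c t ∧ (c.I = Set.univ → C.shape = .int ∧ t = 0) := by
  classical
  obtain ⟨s, t, hs, hu⟩ := exists_shape hne c.conv
  have htr : ∀ L, Occurs (fun i => c.letter (i + t)) L → Occurs c.letter L := by
    rintro L ⟨j, hj⟩
    refine ⟨j + t, fun n hn => ?_⟩
    rw [← hj n hn]
    congr 1
    ring
  have hmem : ∀ i l, c.letter (i + t) = some l → i ∈ s.idx ∧ i - 1 ∈ s.idx := by
    intro i l h
    obtain ⟨h1, h2⟩ := c.mem_of_letter h
    exact ⟨(hs i).2 h1, (hs _).2 (by rwa [sub_add_eq_add_sub])⟩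
  refine ⟨⟨s, fun i => c.letter (i + t), fun i => if i ∈ s.idx then some (c.side (i + t)).1 else none,
    fun i => ?_, fun i => ?_, fun i l h => ?_, fun i l h => ?_, fun i l l' h h' he => ?_,
    fun r hr h => hm.not_occurs hc hnz hr (htr _ h),
    fun r hr h => hm.not_occurs_inv hc hnz hr (htr _ h)⟩, t, ⟨hs, fun i => rfl,
    fun i hi => if_pos hi⟩, hu⟩
  · rw [c.isSome, hs, hs, sub_add_eq_add_sub]
  · split_ifs with h <;> simp [h]
  · rw [if_pos (hmem i l h).2, sub_add_eq_add_sub, ← c.src_eq _ _ h]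
    rfl
  · rw [if_pos (hmem i l h).1, ← c.dst_eq _ _ h]
    rfl
  · have h1 := c.dst_eq _ _ h
    have h2 := c.src_eq _ _ h'
    rw [show i + 1 + t - 1 = i + t by ring, ← h1, ← he, σ.src_inv] at h2
    exact Side.flip_ne _ h2

end QuiverOps

/-! ### Recognising a direct sum by bases -/

namespace AlgModule

variable {k : Type u} [Field k] {A : Type v} [NonUnitalRing A] [Module k A]

/-- A module is the direct sum of modules that map to it in such a way that the images of bases
form a basis. -/
theorem isomorphic_directSum (M : AlgModule.{u, v, x} k A) {J : Type y}
    (N : J → AlgModule.{u, v, w} k A) (f : ∀ j, (N j).carrier →ₗ[k] M.carrier)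
    (hf : ∀ j a m, f j ((N j).act a m) = M.act a (f j m)) {Q : J → Type*}
    (n : ∀ j, Q j → (N j).carrier) (hn : ∀ j, ⊤ ≤ Submodule.span k (Set.range (n j)))
    (hli : LinearIndependent k fun q : Σ j, Q j => f q.1 (n q.1 q.2))
    (hsp : ⊤ ≤ Submodule.span k (Set.range fun q : Σ j, Q j => f q.1 (n q.1 q.2))) :
    M.Isomorphic (directSum N) := by
  classical
  let B := Module.Basis.mk hli hsp
  have hB : ∀ q, B q = f q.1 (n q.1 q.2) := fun q => Module.Basis.mk_apply hli hsp q
  let b : ∀ j, Module.Basis (Q j) k (N j).carrier := fun j =>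
    Module.Basis.mk (LinearIndependent.of_comp (f j) (hli.comp (Sigma.mk j) sigma_mk_injective))
      (hn j)
  have hb : ∀ j q, b j q = n j q := fun j q => Module.Basis.mk_apply _ (hn j) q
  let F : (⨁ j, (N j).carrier) →ₗ[k] M.carrier := DirectSum.toModule k J M.carrier f
  let G : M.carrier →ₗ[k] ⨁ j, (N j).carrier :=
    B.constr k fun q => DirectSum.lof k J (fun j => (N j).carrier) q.1 (n q.1 q.2)
  have h1 : F ∘ₗ G = LinearMap.id := B.ext fun q => by
    rw [LinearMap.comp_apply, Module.Basis.constr_basis, DirectSum.toModule_lof,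
      LinearMap.id_apply, hB]
  have h2 : G ∘ₗ F = LinearMap.id := DirectSum.linearMap_ext k fun j => (b j).ext fun q => by
    simp only [LinearMap.comp_apply, LinearMap.id_apply, F, DirectSum.toModule_lof, hb]
    have := B.constr_basis k
      (fun q => DirectSum.lof k J (fun j => (N j).carrier) q.1 (n q.1 q.2)) ⟨j, q⟩
    rwa [hB] at this
  let E : M.carrier ≃ₗ[k] ⨁ j, (N j).carrier :=
    { G with
      invFun := F
      left_inv := fun m => congrArg (fun H : M.carrier →ₗ[k] M.carrier => H m) h1
      right_inv := fun z =>
        congrArg (fun H : (⨁ j, (N j).carrier) →ₗ[k] ⨁ j, (N j).carrier => H z) h2 }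
  refine ⟨E, fun a m => ?_⟩
  have h3 : F ∘ₗ ((directSum N).act a : Module.End k (⨁ j, (N j).carrier)) = M.act a ∘ₗ F := by
    refine DirectSum.linearMap_ext k fun j => LinearMap.ext fun m => ?_
    change F (DirectSum.lmap (fun j => (N j).act a) (DirectSum.lof k J _ j m)) =
      M.act a (F (DirectSum.lof k J _ j m))
    rw [DirectSum.lmap_lof]
    simp only [F, DirectSum.toModule_lof, hf]
  have h4 := congrArg (fun H : (⨁ j, (N j).carrier) →ₗ[k] M.carrier => H (E m)) h3
  have h5 : F (E m) = m := congrArg (fun H : M.carrier →ₗ[k] M.carrier => H m) h1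
  have h6 : F ((directSum N).act a (E m)) = M.act a m := h4.trans (congrArg (M.act a) h5)
  rw [← h6]
  exact congrArg (fun H : (⨁ j, (N j).carrier) →ₗ[k] ⨁ j, (N j).carrier =>
    H ((directSum N).act a (E m))) h2

/-- As `isomorphic_directSum`, with summands indexed by a type in the universe of the module. -/
theorem exists_isomorphic_directSum (M : AlgModule.{u, v, x} k A) {J : Type y}
    (N : J → AlgModule.{u, v, w} k A) (f : ∀ j, (N j).carrier →ₗ[k] M.carrier)
    (hf : ∀ j a m, f j ((N j).act a m) = M.act a (f j m)) {Q : J → Type*} (hQ : ∀ j, Nonempty (Q j))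
    (n : ∀ j, Q j → (N j).carrier) (hn : ∀ j, ⊤ ≤ Submodule.span k (Set.range (n j)))
    (hli : LinearIndependent k fun q : Σ j, Q j => f q.1 (n q.1 q.2))
    (hsp : ⊤ ≤ Submodule.span k (Set.range fun q : Σ j, Q j => f q.1 (n q.1 q.2))) :
    ∃ (J' : Type x) (e : J' → J), M.Isomorphic (directSum fun j => N (e j)) := by
  -- One basis vector from each summand embeds the index set into `M`, which lowers its universe.
  let q := fun j => (hQ j).some
  have hinj : Function.Injective fun j => f j (n j (q j)) := fun j j' h =>
    congrArg Sigma.fst (hli.injective (a₁ := ⟨j, q j⟩) (a₂ := ⟨j', q j'⟩) h)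
  let e : Set.range (fun j => f j (n j (q j))) ≃ J := (Equiv.ofInjective _ hinj).symm
  refine ⟨_, e, M.isomorphic_directSum _ (fun j => f (e j)) (fun j => hf (e j))
    (Q := fun j => Q (e j)) (fun j => n (e j)) (fun j => hn (e j)) ?_ ?_⟩
  · refine hli.comp (fun q : Σ j, Q (e j) => (⟨e q.1, q.2⟩ : Σ j, Q j)) ?_
    exact (Equiv.sigmaCongrLeft (β := Q) e).injective
  · refine hsp.trans (Submodule.span_mono ?_)
    rintro _ ⟨q, rfl⟩
    obtain ⟨q', rfl⟩ := (Equiv.sigmaCongrLeft (β := Q) e).surjective q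
    exact ⟨q', rfl⟩

end AlgModule

/-! ### Homomorphisms from string and band modules -/

section Homs

variable {k : Type u} [Field k] {V : Type v} [Quiver.{w} V] {ρ : Set (QPath V)} {σ : Signs ρ}
  {M : AlgModule.{u, max u v w, x} k (QuotAlgebra k ρ)} {c : σ.BiWord} {C : Word ρ}

/-- A family along a word defines a homomorphism from the string module. -/
theorem Word.Models.extend_act {t : ℤ} (hC : C.Models c t)
    (hR : ∀ r ∈ ρ, M.ops.path r.path = 0) {m : ℤ → M.carrier} (hm : M.ops.IsStr c m)
    (a : QuotAlgebra k ρ) (z : C.Space k) :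
    C.extend k (fun i => m (i + t)) ((C.stringModule k).act a z) =
      M.act a (C.extend k (fun i => m (i + t)) z) := by
  obtain ⟨f, rfl⟩ := proj_surjective k ρ a
  rw [M.act_proj]
  refine QuiverOps.map_pathAlgLin (R := C.ops k) (R' := M.ops) (fun v z => ?_) (fun y z => ?_) f z
  · have : C.extend k (fun i => m (i + t)) ∘ₗ C.vertOp k v =
        M.ops.vert v ∘ₗ C.extend k (fun i => m (i + t)) := C.hom_ext fun i hi => by
      have h1 := hm.mem_E ((hC.mem_iff i).1 hi)
      simp only [LinearMap.comp_apply]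
      rw [C.vertOp_b, C.extend_b k _ hi, hC.vertex_eq i hi]
      split_ifs with h
      · rw [C.extend_b k _ hi]
        rw [Option.some.inj h] at h1
        exact (M.ops.mem_E.1 h1).symm
      · rw [map_zero, M.ops.vert_apply_of_ne (fun h' => h (by rw [h'])) h1]
    exact congrArg (fun F => F z) this
  · have : C.extend k (fun i => m (i + t)) ∘ₗ C.arrowOp k y =
        M.ops.arrow y ∘ₗ C.extend k (fun i => m (i + t)) := C.hom_ext fun i hi => by
      simp only [LinearMap.comp_apply]
      rw [C.arrowOp_b, C.extend_b k _ hi]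
      split_ifs with h h'
      · rw [C.extend_b k _ (Word.mem_of_letter h).2]
        rw [hC.letter_eq] at h
        rw [hm.apply_direct h]
        congr 1
        ring
      · rw [C.extend_b k _ (Word.mem_of_letter h').1]
        rw [hC.letter_eq, add_right_comm] at h'
        rw [hm.apply_inverse h', add_right_comm]
      · rw [hC.letter_eq] at h
        rw [hC.letter_eq, add_right_comm] at h'
        rw [map_zero, hm.apply_eq_zero hR ((hC.mem_iff i).1 hi) h h']
    exact congrArg (fun F => F z) this

theorem Word.mem_of_b_mem {N : Submodule k (C.Space k)} (h : ∀ i ∈ C.shape.idx, C.b k i ∈ N)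
    (z : C.Space k) : z ∈ N := by
  have h1 : N.mkQ = 0 := C.hom_ext fun i hi => by simpa using h i hi
  rw [← N.ker_mkQ, h1]
  trivial

theorem Word.Models.isPeriodic (hC : C.Models c 0) (hs : C.shape = .int) (hp : c.IsPer) :
    C.IsPeriodic c.per where
  shape_eq := hs
  isLeast := by
    have h : ∀ i, C.letter i = c.letter i := fun i => by rw [hC.letter_eq, add_zero]
    refine ⟨⟨hp.per_pos, fun i => ?_⟩, fun n hn => hp.per_le hn.1 fun i => ?_⟩
    · rw [h, h, hp.letter_add]
    · rw [← h, ← h, hn.2]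

end Homs

namespace Word.IsPeriodic

variable {k : Type u} [Field k] {V : Type v} [Quiver.{w} V] {ρ : Set (QPath V)}
  {C : Word ρ} {n : ℕ} (hC : C.IsPeriodic n) {W : Type u} [AddCommGroup W] [Module k W]
  {τ : W ≃ₗ[k] W} {M : Type x} [AddCommGroup M] [Module k M]

theorem T_one_smul (z : hC.Bimodule k) :
    (LaurentPolynomial.T 1 : k[T;T⁻¹]) • z = hC.shift k z := by
  rw [laurent_smul_def, laurentHom_T, zpow_one]
  rfl

theorem T_neg_one_smul (z : hC.Bimodule k) :
    (LaurentPolynomial.T (-1) : k[T;T⁻¹]) • z = (hC.shift k).symm z := by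
  rw [laurent_smul_def, laurentHom_T, zpow_neg_one]
  rfl

variable (C) in
/-- The bilinear map with `(b i, w) ↦ φ i w`. -/
def pairing (φ : ℤ → LaurentSpace τ →ₗ[k] M) :
    C.Space k →ₗ[k] LaurentSpace τ →ₗ[k] M := C.extend k φ

theorem pairing_b (hC : C.IsPeriodic n) (φ : ℤ → LaurentSpace τ →ₗ[k] M) (i : ℤ) (w : LaurentSpace τ) :
    pairing C φ (C.b k i) w = φ i w := by
  rw [pairing, C.extend_b k _ (hC.mem_idx i)]

/-- The generator T sends `b i` to `b (i - n)`, and φ (i - n) w = φ i (τ⁻¹ w). This is why T acts on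
`LaurentSpace τ` by the inverse of `τ`. The relation then passes to T⁻¹ and to all Laurent
polynomials. -/
theorem pairing_smul {φ : ℤ → LaurentSpace τ →ₗ[k] M}
    (hφ : ∀ i w, φ (i + n) w = φ i (τ w)) (g : k[T;T⁻¹]) (z : hC.Bimodule k) (w : LaurentSpace τ) :
    pairing C φ (g • z : hC.Bimodule k) w = pairing C φ z (g • w) := by
  have h1 : ∀ (z : C.Space k) (w : LaurentSpace τ),
      pairing C φ (hC.shift k z) w = pairing C φ z (τ.symm w : W) := by
    intro z w
    have : (LinearMap.applyₗ w ∘ₗ pairing C φ) ∘ₗ (hC.shift k : C.Space k →ₗ[k] C.Space k) =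
        LinearMap.applyₗ (R := k) (M := LaurentSpace τ) (M₂ := M) (τ.symm w : W) ∘ₗ
          pairing C φ := C.hom_ext fun i _ => by
      change pairing C φ (hC.shift k (C.b k i)) w = pairing C φ (C.b k i) (τ.symm w : W)
      have h2 := hφ (i - n) (τ.symm w)
      have h3 : τ (τ.symm w) = w := τ.apply_symm_apply w
      rw [sub_add_cancel, h3] at h2
      rw [hC.shift_b, pairing_b hC]
      exact h2.symm.trans (pairing_b hC φ i _).symm
    exact congrArg (fun F => F z) this
  have hT : ∀ (z : hC.Bimodule k) (w : LaurentSpace τ),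
      pairing C φ ((LaurentPolynomial.T 1 : k[T;T⁻¹]) • z : hC.Bimodule k) w =
        pairing C φ z ((LaurentPolynomial.T 1 : k[T;T⁻¹]) • w) := by
    intro z w
    rw [LaurentSpace.T_one_smul, T_one_smul]
    exact h1 z w
  have hT' : ∀ (z : hC.Bimodule k) (w : LaurentSpace τ),
      pairing C φ ((LaurentPolynomial.T (-1) : k[T;T⁻¹]) • z : hC.Bimodule k) w =
        pairing C φ z ((LaurentPolynomial.T (-1) : k[T;T⁻¹]) • w) := by
    intro z w
    have h2 := hT ((LaurentPolynomial.T (-1) : k[T;T⁻¹]) • z)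
      ((LaurentPolynomial.T (-1) : k[T;T⁻¹]) • w)
    rw [smul_smul, smul_smul, ← LaurentPolynomial.T_add] at h2
    simpa using h2.symm
  have hmul : ∀ g g' : k[T;T⁻¹],
      (∀ (z : hC.Bimodule k) (w : LaurentSpace τ),
        pairing C φ (g • z : hC.Bimodule k) w = pairing C φ z (g • w)) →
      (∀ (z : hC.Bimodule k) (w : LaurentSpace τ),
        pairing C φ (g' • z : hC.Bimodule k) w = pairing C φ z (g' • w)) →
      ∀ (z : hC.Bimodule k) (w : LaurentSpace τ),
        pairing C φ ((g * g') • z : hC.Bimodule k) w = pairing C φ z ((g * g') • w) := by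
    intro g g' h h' z w
    rw [mul_smul, h, h', smul_smul, mul_comm]
  induction g using LaurentPolynomial.induction_on generalizing z w with
  | h_C a =>
    rw [show LaurentPolynomial.C a = a • (1 : k[T;T⁻¹]) by
      rw [LaurentPolynomial.smul_eq_C_mul, mul_one], smul_assoc, smul_assoc, one_smul, one_smul]
    rw [map_smul]
    exact congrArg (fun F : LaurentSpace τ →ₗ[k] M => F w) ((pairing C φ).map_smul a z)
  | h_add hp hq =>
    rw [add_smul, add_smul, map_add, ← hp, ← hq]
    exact congrArg (fun F : LaurentSpace τ →ₗ[k] M => F w) ((pairing C φ).map_add _ _)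
  | h_C_mul_T m a ih =>
    rw [LaurentPolynomial.T_add, ← mul_assoc]
    exact hmul _ _ ih hT z w
  | h_C_mul_T_Z m a ih =>
    rw [sub_eq_add_neg, LaurentPolynomial.T_add, ← mul_assoc]
    exact hmul _ _ ih hT' z w

/-- The linear map with `b i ⊗ w ↦ φ i w`. -/
def tensorHom (φ : ℤ → LaurentSpace τ →ₗ[k] M) (hφ : ∀ i w, φ (i + n) w = φ i (τ w))
    (P : Submodule k[T;T⁻¹] (LaurentSpace τ)) :
    hC.Bimodule k ⊗[k[T;T⁻¹]] P →ₗ[k] M where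
  toFun := TensorProduct.liftAddHom
    { toFun := fun z : hC.Bimodule k => ((pairing C φ z).comp (P.subtype.restrictScalars k)).toAddMonoidHom
      map_zero' := by
        ext w
        exact congrArg (fun F : LaurentSpace τ →ₗ[k] M => F w) (pairing C φ).map_zero
      map_add' := fun z z' => by
        ext w
        exact congrArg (fun F : LaurentSpace τ →ₗ[k] M => F w) ((pairing C φ).map_add z z') }
    fun g z w => pairing_smul hC hφ g z w
  map_add' := map_add _
  map_smul' a z := by
    induction z with
    | zero => simp only [smul_zero, map_zero]
    | add z z' h h' => rw [smul_add, map_add, h, h', map_add, smul_add]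
    | tmul z w =>
      rw [TensorProduct.smul_tmul']
      exact congrArg (fun F : LaurentSpace τ →ₗ[k] M => F w) ((pairing C φ).map_smul a z)

end Word.IsPeriodic

variable {k : Type u} [Field k] {V : Type v} [Quiver.{w} V] {ρ : Set (QPath V)} {σ : Signs ρ}
  {M : AlgModule.{u, max u v w, x} k (QuotAlgebra k ρ)}

/-- String and band modules that map to `M`, with spanning sets that map to given families of
vectors along a word. -/
structure Summands (M : AlgModule.{u, max u v w, x} k (QuotAlgebra k ρ)) (c : σ.BiWord)
    {ι : Type x} (vec : ι → ℤ → M.carrier) where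
  G : Type x
  π : ι → G
  surjective : Function.Surjective π
  N : G → AlgModule.{u, max u v w, u} k (QuotAlgebra k ρ)
  isStringOrBand : ∀ g, IsStringOrBand (N g)
  f : ∀ g, (N g).carrier →ₗ[k] M.carrier
  f_act : ∀ g a z, f g ((N g).act a z) = M.act a (f g z)
  n : ∀ g, {t // π t = g} → ℤ → (N g).carrier
  f_n : ∀ g t, ∀ i ∈ c.I, f g (n g t i) = vec t i
  span : ∀ g, ⊤ ≤ Submodule.span k {z | ∃ t, ∃ i ∈ c.J, n g t i = z}

/-- The summands of a nonperiodic word are string modules. -/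
theorem nonempty_summands_string (hc : M.ops.IsControlled ρ) {c : σ.BiWord} (hp : ¬ c.IsPer)
    (hne : c.I.Nonempty) {ι : Type x} {vec : ι → ℤ → M.carrier}
    (hvec : ∀ t, M.ops.IsStr c (vec t)) (hnz : ∀ t, ∀ i ∈ c.I, vec t i ≠ 0) :
    Nonempty (Summands M c vec) := by
  choose C s hC _ using fun t => (hvec t).exists_word hc (hnz t) hne
  have hJ : c.J = c.I := if_neg hp
  exact ⟨{
    G := ι
    π := id
    surjective := Function.surjective_id
    N := fun t => (C t).stringModule k
    isStringOrBand := fun t => .string (C t)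
    f := fun t => (C t).extend k fun i => vec t (i + s t)
    f_act := fun t a z => (hC t).extend_act hc.rel (hvec t) a z
    n := fun t _ i => (C t).b k (i - s t)
    f_n := by
      rintro _ ⟨t, rfl⟩ i hi
      have h1 : i - s t ∈ (C t).shape.idx := by rwa [(hC t).mem_iff, sub_add_cancel]
      refine ((C t).extend_b k (fun i => vec t (i + s t)) h1).trans ?_
      simp only [sub_add_cancel]
    span := by
      intro t z _
      refine Word.mem_of_b_mem (C := C t) (fun i hi => Submodule.subset_span ?_) z
      refine ⟨⟨t, rfl⟩, i + s t, ?_, ?_⟩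
      · rw [hJ]
        exact ((hC t).mem_iff i).1 hi
      · rw [add_sub_cancel_right] }⟩

namespace Word.IsPeriodic

variable {C : Word ρ} {n : ℕ} (hC : C.IsPeriodic n) {W : Type u} [AddCommGroup W] [Module k W]
  {τ : W ≃ₗ[k] W} {P : Submodule k[T;T⁻¹] (LaurentSpace τ)}

variable (k) in
/-- The basis vector `b i` as an element of the bimodule. -/
def basisVec (i : ℤ) : hC.Bimodule k := C.b k i

theorem T_neg_one_smul_basisVec (i : ℤ) :
    (LaurentPolynomial.T (-1) : k[T;T⁻¹]) • hC.basisVec k (i - n) = hC.basisVec k i := by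
  rw [hC.T_neg_one_smul]
  exact (LinearEquiv.symm_apply_eq _).2 (hC.shift_b k i).symm

theorem smul_tmul_right (a : k) (z : hC.Bimodule k) (w : P) :
    z ⊗ₜ[k[T;T⁻¹]] (a • w) = a • (z ⊗ₜ[k[T;T⁻¹]] w) := by
  rw [← one_smul k[T;T⁻¹] w, ← smul_assoc, ← TensorProduct.smul_tmul, smul_assoc, one_smul,
    one_smul, TensorProduct.smul_tmul']

theorem basisVec_tmul (i : ℤ) (w : P) : hC.basisVec k i ⊗ₜ[k[T;T⁻¹]] w =
    hC.basisVec k (i - n) ⊗ₜ[k[T;T⁻¹]] ((LaurentPolynomial.T (-1) : k[T;T⁻¹]) • w) := by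
  rw [← TensorProduct.smul_tmul, T_neg_one_smul_basisVec]

/-- Powers of T pass through the tensor sign and move any position into a single period. -/
theorem mem_of_tmul_mem (hn : 0 < n) {S : Submodule k (hC.Bimodule k ⊗[k[T;T⁻¹]] P)}
    (h : ∀ i : ℤ, 0 ≤ i → i < n → ∀ w : P, hC.basisVec k i ⊗ₜ w ∈ S)
    (z : hC.Bimodule k ⊗[k[T;T⁻¹]] P) : z ∈ S := by
  have h0 : (n : ℤ) ≠ 0 := by omega
  have hnat : ∀ (q : ℕ) (i : ℤ), 0 ≤ i → i < n → ∀ w : P,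
      hC.basisVec k (i + q * n) ⊗ₜ w ∈ S ∧ hC.basisVec k (i - q * n) ⊗ₜ w ∈ S := by
    intro q i hi hi'
    induction q with
    | zero => intro w; simpa using h i hi hi' w
    | succ q ih =>
      intro w
      refine ⟨?_, ?_⟩
      · have h1 := (ih ((LaurentPolynomial.T (-1) : k[T;T⁻¹]) • w)).1
        rw [basisVec_tmul, show i + ((q + 1 : ℕ) : ℤ) * n - n = i + q * n by push_cast; ring]
        exact h1
      · have h1 := hC.basisVec_tmul (k := k) (i - q * n)
          ((LaurentPolynomial.T 1 : k[T;T⁻¹]) • w)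
        rw [smul_smul, ← LaurentPolynomial.T_add, neg_add_cancel, LaurentPolynomial.T_zero,
          one_smul] at h1
        rw [show i - ((q + 1 : ℕ) : ℤ) * n = i - q * n - n by push_cast; ring, ← h1]
        exact (ih _).2
  have hb : ∀ (i : ℤ) (w : P), hC.basisVec k i ⊗ₜ w ∈ S := by
    intro i w
    have h1 := Int.emod_nonneg i h0
    have h2 := Int.emod_lt_of_pos i (show (0 : ℤ) < n by omega)
    have h3 := Int.emod_add_mul_ediv i n
    rcases Int.eq_nat_or_neg (i / n) with ⟨q, hq | hq⟩
    · have := (hnat q _ h1 h2 w).1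
      rwa [← hq, mul_comm, h3] at this
    · have := (hnat q _ h1 h2 w).2
      rw [hq] at h3
      rwa [show i % n - q * n = i by linear_combination h3] at this
  induction z with
  | zero => exact zero_mem _
  | add z z' hz hz' => exact add_mem hz hz'
  | tmul z w =>
    let F : C.Space k →ₗ[k] hC.Bimodule k ⊗[k[T;T⁻¹]] P :=
      { toFun := fun z : hC.Bimodule k => z ⊗ₜ w
        map_add' := fun z z' : hC.Bimodule k => TensorProduct.add_tmul z z' w
        map_smul' := fun a (z : hC.Bimodule k) => rfl }
    exact Word.mem_of_b_mem (N := S.comap F) (fun i _ => hb i w) z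

theorem tmul_mem_of_span {B : Set (LaurentSpace τ)} (hB : P.restrictScalars k ≤ Submodule.span k B)
    {S : Submodule k (hC.Bimodule k ⊗[k[T;T⁻¹]] P)} {z : hC.Bimodule k}
    (h : ∀ w ∈ B, ∃ hw : w ∈ P, z ⊗ₜ (⟨w, hw⟩ : P) ∈ S) (w : P) : z ⊗ₜ w ∈ S := by
  let F : P →ₗ[k] hC.Bimodule k ⊗[k[T;T⁻¹]] P :=
    { toFun := fun w => z ⊗ₜ w
      map_add' := fun w w' => TensorProduct.tmul_add _ _ _
      map_smul' := fun a w => hC.smul_tmul_right a _ _ }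
  have h1 : Submodule.span k B ≤ (S.comap F).map (P.restrictScalars k).subtype := by
    rw [Submodule.span_le]
    intro w hw
    obtain ⟨hw, h2⟩ := h w hw
    exact ⟨⟨w, hw⟩, h2, rfl⟩
  obtain ⟨w', hw', h2⟩ := h1 (hB w.2)
  rwa [Subtype.ext h2] at hw'

theorem tensorHom_act {φ : ℤ → LaurentSpace τ →ₗ[k] M.carrier}
    (hφ : ∀ i w, φ (i + n) w = φ i (τ w))
    (h : ∀ w a (z : C.Space k), pairing C φ ((C.stringModule k).act a z) w =
      M.act a (pairing C φ z w))
    (a : QuotAlgebra k ρ) (z : hC.Bimodule k ⊗[k[T;T⁻¹]] P) :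
    hC.tensorHom φ hφ P (((hC.actLaurent k a).rTensor P) z) =
      M.act a (hC.tensorHom φ hφ P z) := by
  induction z with
  | zero => simp only [map_zero]
  | add z z' h h' => simp only [map_add, h, h']
  | tmul z w => exact h w a z

end Word.IsPeriodic

/-- The summands of a periodic word are band modules. -/
theorem nonempty_summands_band (hc : M.ops.IsControlled ρ) {c : σ.BiWord} (hp : c.IsPer)
    {ι : Type x} {vec : ι → ℤ → M.carrier} (hvec : ∀ t, M.ops.IsStr c (vec t))
    (hnz : ∀ t, ∀ i ∈ c.I, vec t i ≠ 0) (D : M.ops.BandData c vec) :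
    Nonempty (Summands M c vec) := by
  -- An indecomposable summand is nonzero and spanned by its adapted vectors, so there is at least
  -- one.
  have hsurj : Function.Surjective D.π := by
    intro g
    by_contra! h
    have h1 := D.le_span g
    have h2 : {w | ∃ t, D.π t = g ∧ D.β t = w} = ∅ := by
      ext w
      simpa using fun t ht => (h t ht).elim
    rw [h2, Submodule.span_empty, le_bot_iff] at h1
    have h3 := (D.indecomposable g).1
    obtain ⟨⟨w, hw⟩, hw0⟩ := exists_ne (0 : D.P g)
    have h4 : w ∈ (D.P g).restrictScalars k := hw
    rw [h1, Submodule.mem_bot] at h4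
    exact hw0 (Subtype.ext h4)
  -- The nonvanishing of some vector family is what shows that no relation occurs in the word. The
  -- translation is zero, so the numbering needed for the period is kept.
  have hC : ∀ g : D.G, ∃ C : Word ρ, C.Models c 0 ∧ C.shape = .int := by
    intro g
    obtain ⟨t, -⟩ := hsurj g
    obtain ⟨C, s, h1, h2⟩ := (hvec t).exists_word hc (hnz t) ⟨0, hp.mem 0⟩
    obtain ⟨h3, rfl⟩ := h2 hp.1
    exact ⟨C, h1, h3⟩
  choose C hC hs using hC
  have hper : ∀ g, (C g).IsPeriodic c.per := fun g => (hC g).isPeriodic (hs g) hp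
  have hJ : c.J = Set.Ico 0 (c.per : ℤ) := if_pos hp
  have hpair : ∀ g w a (z : (C g).Space k),
      Word.IsPeriodic.pairing (C g) D.φ (((C g).stringModule k).act a z) w =
        M.act a (Word.IsPeriodic.pairing (C g) D.φ z w) := by
    intro g w a z
    have h2 : ∀ z : (C g).Space k, Word.IsPeriodic.pairing (C g) D.φ z w =
        (C g).extend k (fun i => D.φ (i + 0) w) z := by
      intro z
      have : LinearMap.applyₗ w ∘ₗ Word.IsPeriodic.pairing (C g) D.φ =
          (C g).extend k (fun i => D.φ (i + 0) w) := (C g).hom_ext fun i hi => by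
        rw [(C g).extend_b k _ hi, add_zero]
        exact (hper g).pairing_b D.φ i w
      exact congrArg (fun F => F z) this
    exact (h2 _).trans (((hC g).extend_act hc.rel (D.isStr w) a z).trans
      (congrArg (M.act a) (h2 z).symm))
  exact ⟨{
    G := ULift D.G
    π := fun t => ⟨D.π t⟩
    surjective := fun g => by
      obtain ⟨t, ht⟩ := hsurj g.down
      exact ⟨t, congrArg ULift.up ht⟩
    N := fun g => (hper g.down).tensorModule k (D.P g.down)
    isStringOrBand := fun g => by
      have : FiniteDimensional k (D.P g.down) :=
        inferInstanceAs (FiniteDimensional k ((D.P g.down).restrictScalars k))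
      exact .band (C g.down) c.per (hper g.down) (D.P g.down) (D.indecomposable g.down)
    f := fun g => (hper g.down).tensorHom D.φ D.φ_add (D.P g.down)
    f_act := fun g a z => (hper g.down).tensorHom_act D.φ_add (hpair g.down) a z
    n := fun g t i => (hper g.down).basisVec k i ⊗ₜ[k[T;T⁻¹]]
      (⟨D.β t.1, congrArg ULift.down t.2 ▸ D.mem t.1⟩ : D.P g.down)
    f_n := fun g t i _ => by
      rw [D.vec_eq]
      exact (hper g.down).pairing_b D.φ i _
    span := fun g z _ => by
      refine (hper g.down).mem_of_tmul_mem hp.per_pos (fun i hi hi' w => ?_) z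
      refine (hper g.down).tmul_mem_of_span (D.le_span g.down) ?_ w
      rintro _ ⟨t, ht, rfl⟩
      exact ⟨ht ▸ D.mem t, Submodule.subset_span
        (M := ((hper g.down).tensorModule k (D.P g.down)).carrier) ⟨⟨t, congrArg ULift.up ht⟩, i, by rw [hJ]; exact ⟨hi, hi'⟩, rfl⟩⟩ }⟩

theorem exists_decomposition (hρ : IsStringAlgebra ρ) (hM : M.IsUnital)
    (hfc : M.IsFinitelyControlled) :
    ∃ (J : Type x) (N : J → AlgModule.{u, max u v w, u} k (QuotAlgebra k ρ)),
      (∀ j, IsStringOrBand (N j)) ∧ M.Isomorphic (AlgModule.directSum N) := by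
  obtain ⟨σ⟩ := exists_signs hρ
  have hc := M.isControlled hρ hM hfc
  obtain ⟨L, hL, hband⟩ := hc.exists_liftFamily (σ := σ)
  have hsum : ∀ p : σ.Class, Nonempty (Summands M p.word (L.vec p)) := by
    intro p
    have hnz : ∀ t, ∀ i ∈ p.word.I, L.vec p t i ≠ 0 := fun t i hi => L.vec_ne_zero p t hi
    by_cases hp : p.word.IsPer
    · obtain ⟨D⟩ := hband p hp
      exact nonempty_summands_band hc hp (L.isStr p) hnz D
    · exact nonempty_summands_string hc hp ⟨0, p.zero_mem⟩ (L.isStr p) hnz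
  let S := fun p => (hsum p).some
  let Q : (Σ p, (S p).G) → Type x := fun j => {t // (S j.1).π t = j.2} × ULift j.1.word.J
  let n : ∀ j : Σ p, (S p).G, Q j → ((S j.1).N j.2).carrier := fun j q => (S j.1).n j.2 q.1 q.2.down
  have hQ : ∀ j, Nonempty (Q j) := by
    rintro ⟨p, g⟩
    obtain ⟨t, ht⟩ := (S p).surjective g
    obtain ⟨i, hi, -⟩ := p.word.exists_mem_J p.zero_mem
    exact ⟨⟨⟨t, ht⟩, ⟨i, hi⟩⟩⟩
  have hn : ∀ j, ⊤ ≤ Submodule.span k (Set.range (n j)) := by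
    rintro ⟨p, g⟩
    refine ((S p).span g).trans (Submodule.span_mono ?_)
    rintro _ ⟨t, i, hi, rfl⟩
    exact ⟨⟨t, ⟨i, hi⟩⟩, rfl⟩
  -- Grouping the vectors by summands only renames the index set of the lift: the summand is
  -- determined by the basis vector.
  have hli : LinearIndependent k fun q : Σ j, Q j => (S q.1.1).f q.1.2 (n q.1 q.2) := by
    have h1 := (L.linearIndependent hc.rel).comp (fun q : Σ j, Q j =>
      (⟨q.1.1, (q.2.1.1, q.2.2.down)⟩ : Σ p : σ.Class, L.idx p × p.word.J)) ?_
    · convert h1 using 1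
      exact funext fun q => (S q.1.1).f_n q.1.2 q.2.1 _ (q.1.1.word.J_subset q.2.2.down.2)
    · rintro ⟨⟨p, g⟩, ⟨t, ht⟩, ⟨i⟩⟩ ⟨⟨p', g'⟩, ⟨t', ht'⟩, ⟨i'⟩⟩ h
      obtain rfl : p = p' := congrArg Sigma.fst h
      obtain ⟨h1, h2⟩ := Prod.ext_iff.1 (eq_of_heq (Sigma.mk.inj h).2)
      obtain rfl : t = t' := h1
      obtain rfl : i = i' := h2
      obtain rfl : g = g' := ht.symm.trans ht'
      rfl
  have hsp : ⊤ ≤ Submodule.span k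
      (Set.range fun q : Σ j, Q j => (S q.1.1).f q.1.2 (n q.1 q.2)) := by
    rw [← hL, QuiverOps.LiftFamily.span, Submodule.span_le]
    rintro _ ⟨p, t, i, hi, rfl⟩
    have h1 : (S p).n ((S p).π t) ⟨t, rfl⟩ i ∈ Submodule.span k _ :=
      (S p).span ((S p).π t) trivial
    have h2 := Submodule.mem_map_of_mem (f := (S p).f ((S p).π t)) h1
    rw [(S p).f_n _ _ i hi, Submodule.map_span] at h2
    refine Submodule.span_mono ?_ h2
    rintro _ ⟨_, ⟨t', i', hi', rfl⟩, rfl⟩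
    exact ⟨⟨⟨p, (S p).π t⟩, t', ⟨i', hi'⟩⟩, rfl⟩
  obtain ⟨J, e, h⟩ := M.exists_isomorphic_directSum (fun j : Σ p, (S p).G => (S j.1).N j.2)
    (fun j => (S j.1).f j.2) (fun j => (S j.1).f_act j.2) hQ n hn hli hsp
  exact ⟨J, fun j => (S (e j).1).N (e j).2, fun j => (S (e j).1).isStringOrBand (e j).2, h⟩

end StringAlg

end

theorem theoremt {k : Type u} [Field k] {V : Type v} [Quiver.{w} V]
    (ρ : Set (StringAlg.QPath V)) (hρ : StringAlg.IsStringAlgebra ρ)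
    (M : StringAlg.AlgModule.{u, max u v w, x} k (StringAlg.QuotAlgebra k ρ))
    (hM : M.IsUnital) (hfc : M.IsFinitelyControlled) :
    ∃ (J : Type x) (N : J → StringAlg.AlgModule.{u, max u v w, u} k (StringAlg.QuotAlgebra k ρ)),
      (∀ j, StringAlg.IsStringOrBand (N j)) ∧ M.Isomorphic (StringAlg.AlgModule.directSum N) := by
  exact StringAlg.exists_decomposition hρ hM hfc
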